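/- **Setting.** Let $r\ge1$, $d=d_0\ge d_1\ge\dots\ge d_r\ge1$, $N=\sum_i d_i$, and write $z=(z_0,\dots,z_r)\in\mathbb R^N=\mathbb R^{d_0}\times\dots\times\mathbb R^{d_r}$, $v=z_0$. Let $B$ be a real $N\times N$ matrix whose blocks $B_{ij}\in\mathbb R^{d_i\times d_j}$ satisfy: $B_{ij}=0$ if $i>j+1$, and $B_{j,j-1}$ has rank $d_j$ for $j=1,\dots,r$ (so that $\mathcal K=\tfrac12\Delta_v+\langle Bz,\nabla_z\rangle+\partial_t$ is hypoelliptic). Put $|z|_B=\sum_i|z_i|^{1/(2i+1)}$ and $a.z=(a z_0,a^3z_1,\dots,a^{2r+1}z_r)$. Fix a smooth $\rho_{-1}\ge0$ on $\mathbb R^N$ equal to $1$ where $|\xi|_B\le\frac12$ and supported in $\{|\xi|_B\le\frac23\}$, and set $\rho_j(\xi)=\rho_{-1}(2^{-(j+1)}.\xi)-\rho_{-1}(2^{-j}.\xi)$ for $j\ge0$ and $\Delta_jf=\mathcal F^{-1}(\rho_j\mathcal Ff)$. For $\gamma\in\mathbb R$, $\mathcal C_B^\gamma$ is the space of tempered distributions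 with $\|f\|_\gamma=\sup_{j\ge-1}2^{j\gamma}\|\Delta_jf\|_{L^\infty}<\infty$. For $T>0$, $L^\infty_T\mathcal C^\gamma_B$ is the space of weakly measurable $f:[0,T]\to\mathcal C^\gamma_B$ (that is, $t\mapsto\langle f_t|\varphi\rangle$ is Lebesgue measurable for every Schwartz function $\varphi$) with $\|f\|_{T,\gamma}=\operatorname{ess\,sup}_{t\in[0,T]}\|f_t\|_\gamma<\infty$; for $\mathbb R^d$-valued $f$ the norm is that of the largest component. Products are Bony products, $fg=\sum_{i,j}\Delta_if\,\Delta_jg$. Let $P_0=\mathrm{Id}$ and, for $t>0$, let $P_t$ act on tempered distributions by $\langle P_tf|\varphi\rangle=\langle f|\int\Gamma_t(\cdot-e^{tB}y)\varphi(y)\,dy\rangle$, where $\Gamma_t$ is the centred Gaussian density with covariance $\int_0^te^{\tau B}A(e^{\tau B})^{\top}d\tau$, $A=\mathrm{diag}(I_d,0)$. Let $T>0$, $\beta\in(0,\frac12)$, $\varepsilon\in(0,1-2\beta)$, $\lambda\ge0$. For $\mathscr B\in L^\infty_T\mathcal C_B^{-\beta}$ ($\mathbb R^d$-valued), $g\in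 L^\infty_T\mathcal C_B^{-\beta}$ and $\ell\in\mathcal C_B^{1+\beta+\varepsilon}$, a *mild solution* of $$\mathcal Ku+\langle\mathscr B,\nabla_v\rangle u=\lambda u+g\ \text{ on }(0,T),\qquad u_T=\ell,$$ is a $u\in L^\infty_T\mathcal C_B^{1+\beta+\varepsilon}$ which is bounded and continuous on $[0,T]\times\mathbb R^N$ and satisfies, for all $t\in[0,T]$, $$u_t=P_{T-t}\ell-\int_t^TP_{s-t}\big(\lambda u_s+g_s-\langle\mathscr B_s,\nabla_v\rangle u_s\big)\,ds .$$ **Theorem.** Let $\mathscr B,\mathscr B^{(n)},g,g^{(n)}\in L_T^\infty\mathcal C_B^{-\beta}$ and $\ell,\ell^{(n)}\in\mathcal C_B^{1+\beta+\varepsilon}$ be such that, as $n\to\infty$, for every $\eta>0$, $$\|\mathscr B-\mathscr B^{(n)}\|_{T,-\beta-\eta}\to0,\qquad \|g-g^{(n)}\|_{T,-\beta-\eta}\to0,\qquad \|\ell-\ell^{(n)}\|_{1+\beta+\varepsilon-\eta}\to0 .$$ (a) For every $\lambda\ge0$ the problem with data $(\mathscr B,g,\ell)$ and the problems with data $(\mathscr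 B^{(n)},g^{(n)},\ell^{(n)})$ have unique mild solutions $u$ and $u^{(n)}$, and for every $\eta>0$ $$\|u^{(n)}-u\|_{T,1+\beta+\varepsilon-\eta}\to0\qquad(n\to\infty).$$ (b) Let $\ell=\ell^{(n)}=0$ for all $n$. There is $\bar\lambda>0$ such that for all $\lambda>\bar\lambda$ $$\|u^{(n)}\|_{T,1+\beta+\varepsilon}\le\tfrac12\qquad\text{for all }n .$$ Moreover, for every $M\ge0$ there is $\bar\lambda>0$, depending only on $T,\beta,\varepsilon,M$ (and on $B$ and $\rho_{-1}$), such that whenever $\|\mathscr B\|_{T,-\beta}\le M$ and $\|g\|_{T,-\beta}\le M$, the bound $\|u^{(n)}\|_{T,1+\beta+\varepsilon}\le\frac12$ holds for all $\lambda>\bar\lambda$ and all $n\ge n_0$, where $n_0$ depends on the approximating sequences but not on $\lambda$; and it holds for all $\lambda>\bar\lambda$ and all $n$ if also $\|\mathscr B^{(n)}\|_{T,-\beta}\le M$ and $\|g^{(n)}\|_{T,-\beta}\le M$ for all $n$ (for instance for mollifications of $\mathscr B$ and $g$ with a mollifier $\Phi\ge0$, $\int\Phi=1$). -/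

import Mathlib

open MeasureTheory Filter Topology Set
open scoped ENNReal NNReal ContDiff SchwartzMap FourierTransform LineDeriv Matrix

noncomputable section

namespace Kolmogorov

/-! ### Coordinates, anisotropic size, structure of the drift matrix -/

/-- Coordinates of `ℝ^N = ℝ^{δ 0} × ⋯ × ℝ^{δ r}`: a block index together with an index inside the
block. The `v`-variables are those of block `0`, so that `d = δ 0` and `N = ∑ i, δ i`. -/
abbrev Coord {r : ℕ} (δ : Fin (r + 1) → ℕ) : Type := (i : Fin (r + 1)) × Fin (δ i)

/-- The Euclidean space `ℝ^N`. -/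
abbrev Space {r : ℕ} (δ : Fin (r + 1) → ℕ) : Type := EuclideanSpace ℝ (Coord δ)

/-- `B` is an `N × N` matrix of the form
`(* * ⋯ * * ; B₁ * ⋯ * * ; 0 B₂ ⋯ * * ; ⋯ ; 0 0 ⋯ B_r *)`,
the blocks `*` being arbitrary and `B_j` having `δ j` rows, `δ (j-1)` columns and rank `δ j`, where
`δ 0 ≥ δ 1 ≥ ⋯ ≥ δ r ≥ 1` and `r ≥ 1`. -/
structure IsKolmogorovMatrix {r : ℕ} {δ : Fin (r + 1) → ℕ} (B : Matrix (Coord δ) (Coord δ) ℝ) :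
    Prop where
  one_le : 1 ≤ r
  dim_anti : Antitone δ
  dim_pos : ∀ i, 1 ≤ δ i
  rank_block : ∀ j : Fin r,
    (Matrix.of fun (k : Fin (δ j.succ)) (l : Fin (δ j.castSucc)) =>
      B ⟨j.succ, k⟩ ⟨j.castSucc, l⟩).rank = δ j.succ
  zero_block : ∀ i j : Fin (r + 1), (j : ℕ) + 1 < (i : ℕ) →
    ∀ (k : Fin (δ i)) (l : Fin (δ j)), B ⟨i, k⟩ ⟨j, l⟩ = 0

variable {r : ℕ} {δ : Fin (r + 1) → ℕ}

/-- `|z|_B = ∑ i, |z_i|^{1/(2i+1)}`, with `|z_i|` the Euclidean norm of the `i`-th block. -/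
def anisoNorm (z : Space δ) : ℝ :=
  ∑ i : Fin (r + 1), (Real.sqrt (∑ k : Fin (δ i), z ⟨i, k⟩ ^ 2)) ^ (1 / (2 * (i : ℝ) + 1))

/-- The dilation `D_a z = (a z_0, a^3 z_1, …, a^{2r+1} z_r)`. -/
def dilation (a : ℝ) (z : Space δ) : Space δ :=
  WithLp.toLp 2 fun k => a ^ (2 * (k.1 : ℕ) + 1) * z k

/-! ### Littlewood-Paley blocks and anisotropic Besov norms -/

/-- The function generating an anisotropic Paley-Littlewood partition: smooth, non-negative, equal
to `1` on the anisotropic ball of radius `1/2` and supported in the one of radius `2/3`. -/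
structure IsGenerator (ρ : Space δ → ℝ) : Prop where
  smooth : ContDiff ℝ ∞ ρ
  nonneg : ∀ ξ, 0 ≤ ρ ξ
  eq_one : ∀ ξ, anisoNorm ξ ≤ 1 / 2 → ρ ξ = 1
  support : ∀ ξ, ρ ξ ≠ 0 → anisoNorm ξ ≤ 2 / 3

/-- A bundled generator of an anisotropic Paley-Littlewood partition. -/
def Generator {r : ℕ} (δ : Fin (r + 1) → ℕ) : Type := {ρ : Space δ → ℝ // IsGenerator ρ}

/-- The Paley-Littlewood partition, with the index shifted by one: `partition ρ n` is `ρ_{n-1}`. -/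
def partition (ρ : Generator δ) : ℕ → Space δ → ℝ
  | 0, ξ => ρ.1 ξ
  | n + 1, ξ => ρ.1 (dilation ((2 : ℝ)⁻¹ ^ (n + 1)) ξ) - ρ.1 (dilation ((2 : ℝ)⁻¹ ^ n) ξ)

/-- The Fourier multiplier of the block `Δ_{n-1}` for the normalization
`∫ e^{-2 π i ⟨z, ζ⟩} f(z) dz` of the Fourier transform, i.e. `ρ_{n-1}(2 π ζ)`. -/
def symbolFun (ρ : Generator δ) (n : ℕ) (ζ : Space δ) : ℂ :=
  ((partition ρ n ((2 * Real.pi) • ζ) : ℝ) : ℂ)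

lemma contDiff_dilation (a : ℝ) : ContDiff ℝ ∞ (dilation a : Space δ → Space δ) := by
  rw [contDiff_euclidean]
  intro k
  simp only [dilation]
  fun_prop

lemma contDiff_partition (ρ : Generator δ) (n : ℕ) : ContDiff ℝ ∞ (partition ρ n) := by
  cases n with
  | zero => exact ρ.2.smooth
  | succ n =>
    exact (ρ.2.smooth.comp (contDiff_dilation _)).sub (ρ.2.smooth.comp (contDiff_dilation _))

lemma contDiff_symbolFun (ρ : Generator δ) (n : ℕ) : ContDiff ℝ ∞ (symbolFun ρ n) :=
  Complex.ofRealCLM.contDiff.comp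
    ((contDiff_partition ρ n).comp (contDiff_const_smul (2 * Real.pi)))

lemma norm_coord_le_one (ρ : Generator δ) {ξ : Space δ} (h : ρ.1 ξ ≠ 0) (k : Coord δ) :
    |ξ k| ≤ 1 := by
  have h1 := ρ.2.support ξ h
  set s : ℝ := Real.sqrt (∑ l : Fin (δ k.1), ξ ⟨k.1, l⟩ ^ 2) with hs
  have hs0 : 0 ≤ s := Real.sqrt_nonneg _
  have h2 : s ^ (1 / (2 * ((k.1 : ℕ) : ℝ) + 1)) ≤ 2 / 3 := by
    refine le_trans ?_ h1
    unfold anisoNorm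
    exact Finset.single_le_sum
      (f := fun i : Fin (r + 1) =>
        (Real.sqrt (∑ l : Fin (δ i), ξ ⟨i, l⟩ ^ 2)) ^ (1 / (2 * (i : ℝ) + 1)))
      (fun i _ => Real.rpow_nonneg (Real.sqrt_nonneg _) _) (Finset.mem_univ k.1)
  have h3 : s ≤ 1 := by
    by_contra hlt
    have h4 : (1 : ℝ) < s ^ (1 / (2 * ((k.1 : ℕ) : ℝ) + 1)) :=
      Real.one_lt_rpow (not_le.1 hlt) (by positivity)
    linarith
  refine le_trans ?_ h3
  rw [hs]
  refine Real.abs_le_sqrt ?_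
  exact Finset.single_le_sum (f := fun l : Fin (δ k.1) => ξ ⟨k.1, l⟩ ^ 2)
    (fun l _ => sq_nonneg _) (Finset.mem_univ k.2)

lemma exists_bound_partition (ρ : Generator δ) (n : ℕ) :
    ∃ R : ℝ, ∀ ξ, partition ρ n ξ ≠ 0 → ∀ k, |ξ k| ≤ R := by
  have key : ∀ a : ℝ, 0 < a → ∃ R : ℝ, ∀ ξ : Space δ, ρ.1 (dilation a ξ) ≠ 0 →
      ∀ k, |ξ k| ≤ R := by
    intro a ha
    refine ⟨∑ i : Fin (r + 1), (a ^ (2 * (i : ℕ) + 1))⁻¹, fun ξ hξ k => ?_⟩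
    have h1 := norm_coord_le_one ρ hξ k
    have hp : 0 < a ^ (2 * (k.1 : ℕ) + 1) := pow_pos ha _
    have h2 : |ξ k| ≤ (a ^ (2 * (k.1 : ℕ) + 1))⁻¹ := by
      simp only [dilation, abs_mul, abs_of_pos hp] at h1
      rw [inv_eq_one_div, le_div_iff₀ hp, mul_comm]
      exact h1
    refine h2.trans (Finset.single_le_sum (f := fun i : Fin (r + 1) => (a ^ (2 * (i : ℕ) + 1))⁻¹)
      (fun i _ => by positivity) (Finset.mem_univ k.1))
  cases n with
  | zero => exact ⟨1, fun ξ h k => norm_coord_le_one ρ h k⟩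
  | succ n =>
    obtain ⟨R₁, h₁⟩ := key ((2 : ℝ)⁻¹ ^ (n + 1)) (by positivity)
    obtain ⟨R₂, h₂⟩ := key ((2 : ℝ)⁻¹ ^ n) (by positivity)
    refine ⟨max R₁ R₂, fun ξ h k => ?_⟩
    by_cases h0 : ρ.1 (dilation ((2 : ℝ)⁻¹ ^ (n + 1)) ξ) = 0
    · refine (h₂ ξ (fun h0' => h ?_) k).trans (le_max_right _ _)
      simp only [partition]
      rw [h0, h0', sub_zero]
    · exact (h₁ ξ h0 k).trans (le_max_left _ _)

lemma hasCompactSupport_symbolFun (ρ : Generator δ) (n : ℕ) :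
    HasCompactSupport (symbolFun ρ n) := by
  obtain ⟨R, hR⟩ := exists_bound_partition ρ n
  refine HasCompactSupport.of_support_subset_isCompact
    (isCompact_closedBall (0 : Space δ) (Real.sqrt (∑ _k : Coord δ, R ^ 2))) ?_
  intro ζ hζ
  have h1 : partition ρ n ((2 * Real.pi) • ζ) ≠ 0 := by
    intro h0
    exact hζ (by simp [symbolFun, h0])
  have h2 := hR _ h1
  rw [mem_closedBall_zero_iff, EuclideanSpace.norm_eq]
  refine Real.sqrt_le_sqrt (Finset.sum_le_sum fun k _ => ?_)
  have h3 := h2 k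
  rw [Real.norm_eq_abs]
  refine pow_le_pow_left₀ (abs_nonneg _) (le_trans ?_ h3) 2
  have hpi : (1 : ℝ) ≤ 2 * Real.pi := by linarith [Real.pi_gt_three]
  rw [PiLp.smul_apply, smul_eq_mul, abs_mul, abs_of_pos (by linarith : (0 : ℝ) < 2 * Real.pi)]
  nlinarith [abs_nonneg (ζ k)]

/-- The multiplier of `Δ_{n-1}` as a Schwartz function. -/
def symbol (ρ : Generator δ) (n : ℕ) : 𝓢(Space δ, ℂ) :=
  (hasCompactSupport_symbolFun ρ n).toSchwartzMap (contDiff_symbolFun ρ n)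

/-- The Schwartz function `y ↦ K(x - y)`, where `K` is the convolution kernel of `Δ_{n-1}`, that is,
the inverse Fourier transform of the multiplier. -/
def blockKernel (ρ : Generator δ) (n : ℕ) (x : Space δ) : 𝓢(Space δ, ℂ) :=
  SchwartzMap.compSubConstCLM ℂ x (𝓕 (symbol ρ n))

lemma blockKernel_apply (ρ : Generator δ) (n : ℕ) (x y : Space δ) :
    blockKernel ρ n x y = (𝓕⁻ (symbol ρ n)) (x - y) := by
  rw [SchwartzMap.fourierInv_apply_eq]
  simp [blockKernel]

/-- The Paley-Littlewood block `Δ_{n-1} f = K * f` of a tempered distribution, as a function. -/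
def block (ρ : Generator δ) (n : ℕ) (f : 𝓢'(Space δ, ℂ)) (x : Space δ) : ℂ :=
  f (blockKernel ρ n x)

/-- The anisotropic Besov norm `‖f‖_γ = sup_{j ≥ -1} 2^{jγ} ‖Δ_j f‖_{L^∞}` (with `j = n - 1`), with
values in `[0, ∞]`. The space `C_B^γ` consists of the tempered distributions for which it is
finite. -/
def besovNorm (ρ : Generator δ) (γ : ℝ) (f : 𝓢'(Space δ, ℂ)) : ℝ≥0∞ :=
  ⨆ n : ℕ, ENNReal.ofReal ((2 : ℝ) ^ (((n : ℝ) - 1) * γ)) * ⨆ x : Space δ, ‖block ρ n f x‖ₑ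

/-- `h` is the product of `f` and `g`: `h = ∑_{i,j} Δ_i f Δ_j g`, as the limit in the sense of
tempered distributions of the partial sums over `i, j < n - 1`. -/
def IsBonyProduct (ρ : Generator δ) (f g h : 𝓢'(Space δ, ℂ)) : Prop :=
  ∀ φ : 𝓢(Space δ, ℂ), Tendsto
    (fun n : ℕ => ∑ i ∈ Finset.range n, ∑ j ∈ Finset.range n,
      ∫ x, block ρ i f x * block ρ j g x * φ x)
    atTop (𝓝 (h φ))

open Classical in
/-- Bony's product `f g` (equal to zero if the defining series does not converge). -/
def bonyProduct (ρ : Generator δ) (f g : 𝓢'(Space δ, ℂ)) : 𝓢'(Space δ, ℂ) :=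
  if h : ∃ p, IsBonyProduct ρ f g p then h.choose else 0

/-- The product is determined by its defining property. -/
lemma bonyProduct_eq {ρ : Generator δ} {f g h : 𝓢'(Space δ, ℂ)} (H : IsBonyProduct ρ f g h) :
    bonyProduct ρ f g = h := by
  have hex : ∃ p, IsBonyProduct ρ f g p := ⟨h, H⟩
  have h1 : IsBonyProduct ρ f g (bonyProduct ρ f g) := by
    unfold bonyProduct
    rw [dif_pos hex]
    exact hex.choose_spec
  ext φ
  exact tendsto_nhds_unique (h1 φ) (H φ)

/-! ### The semigroup of the Kolmogorov operator -/

/-- The projection `A` on the variables of block `0`. -/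
def projMatrix {r : ℕ} (δ : Fin (r + 1) → ℕ) : Matrix (Coord δ) (Coord δ) ℝ :=
  Matrix.diagonal fun k => if k.1 = 0 then 1 else 0

/-- `C(s) = ∫_0^s e^{τB} A (e^{τB})ᵀ dτ`. -/
def covMatrix (B : Matrix (Coord δ) (Coord δ) ℝ) (s : ℝ) : Matrix (Coord δ) (Coord δ) ℝ :=
  Matrix.of fun k l => ∫ τ in (0 : ℝ)..s,
    (NormedSpace.exp (τ • B) * projMatrix δ * (NormedSpace.exp (τ • B))ᵀ) k l

/-- The Gaussian density `Γ_s` with covariance matrix `C(s)`. -/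
def gaussianKernel (B : Matrix (Coord δ) (Coord δ) ℝ) (s : ℝ) (z : Coord δ → ℝ) : ℝ :=
  (2 * Real.pi) ^ (-(Fintype.card (Coord δ) : ℝ) / 2) / Real.sqrt (covMatrix B s).det *
    Real.exp (-(1 / 2) * (((covMatrix B s)⁻¹ *ᵥ z) ⬝ᵥ z))

/-- The fundamental solution `Γ(s; y, z) = Γ_s(z - e^{sB} y)` of `½ Δ_v + ⟨Bz, ∇_z⟩ + ∂_t`. -/
def fundSol (B : Matrix (Coord δ) (Coord δ) ℝ) (s : ℝ) (y z : Space δ) : ℝ :=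
  gaussianKernel B s (z.ofLp - NormedSpace.exp (s • B) *ᵥ y.ofLp)

open Classical in
/-- The adjoint semigroup on Schwartz functions: `P'_0 φ = φ` and, for `t > 0`, `P'_t φ` is the
Schwartz function `z ↦ ∫ Γ(t; y, z) φ(y) dy`. -/
def adjointSemigroup (B : Matrix (Coord δ) (Coord δ) ℝ) (t : ℝ) (φ : 𝓢(Space δ, ℂ)) :
    𝓢(Space δ, ℂ) :=
  if t = 0 then φ
  else if h : ∃ ψ : 𝓢(Space δ, ℂ), ∀ z, ψ z = ∫ y, (fundSol B t y z : ℂ) * φ y then h.choose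
  else 0

/-- The pairing `⟨P_t f | φ⟩ = ⟨f | P'_t φ⟩` for a tempered distribution `f`. -/
def semigroupPairing (B : Matrix (Coord δ) (Coord δ) ℝ) (t : ℝ) (f : 𝓢'(Space δ, ℂ))
    (φ : 𝓢(Space δ, ℂ)) : ℂ :=
  f (adjointSemigroup B t φ)

/-! ### Functions of time -/

/-- `‖f‖_{T,γ} = ess sup_{t ∈ [0,T]} ‖f_t‖_γ`. -/
def timeNorm (ρ : Generator δ) (T γ : ℝ) (f : ℝ → 𝓢'(Space δ, ℂ)) : ℝ≥0∞ :=
  essSup (fun t => besovNorm ρ γ (f t)) (volume.restrict (Icc 0 T))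

/-- `f ∈ L^∞_T C_B^γ`. Values outside `[0,T]` are irrelevant. -/
structure MemLinf (ρ : Generator δ) (T γ : ℝ) (f : ℝ → 𝓢'(Space δ, ℂ)) : Prop where
  mem : ∀ t ∈ Icc 0 T, besovNorm ρ γ (f t) < ⊤
  meas : ∀ φ : 𝓢(Space δ, ℂ), AEMeasurable (fun t => f t φ) (volume.restrict (Icc 0 T))
  bdd : timeNorm ρ T γ f < ⊤

/-- The same norm for an `ℝ^d`-valued (in the `v`-directions) distribution: largest component. -/
def vecTimeNorm (ρ : Generator δ) (T γ : ℝ) (b : ℝ → Fin (δ 0) → 𝓢'(Space δ, ℂ)) : ℝ≥0∞ :=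
  ⨆ i, timeNorm ρ T γ fun t => b t i

/-- `b ∈ L^∞_T C_B^γ` for an `ℝ^d`-valued distribution. -/
def VecMemLinf (ρ : Generator δ) (T γ : ℝ) (b : ℝ → Fin (δ 0) → 𝓢'(Space δ, ℂ)) : Prop :=
  ∀ i, MemLinf ρ T γ fun t => b t i

/-- `f` is (given by) a bounded continuous function on `[0,T] × ℝ^N`. -/
def IsBoundedContinuous (T : ℝ) (f : ℝ → 𝓢'(Space δ, ℂ)) : Prop :=
  ∃ U : ℝ × Space δ → ℂ, ContinuousOn U (Icc 0 T ×ˢ univ) ∧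
    (∃ C : ℝ, ∀ t ∈ Icc 0 T, ∀ x, ‖U (t, x)‖ ≤ C) ∧
    ∀ t ∈ Icc 0 T, ∀ φ : 𝓢(Space δ, ℂ), f t φ = ∫ x, U (t, x) * φ x

/-! ### Mild solutions of the backward Kolmogorov problem -/

/-- `∂_{v_i} f`, the `i`-th derivative in the `v`-variables. -/
def vDeriv (i : Fin (δ 0)) (f : 𝓢'(Space δ, ℂ)) : 𝓢'(Space δ, ℂ) :=
  ∂_{(EuclideanSpace.single (⟨0, i⟩ : Coord δ) (1 : ℝ) : Space δ)} f

/-- `λ u + g - ⟨b, ∇_v⟩ u` at a fixed time. -/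
def source (ρ : Generator δ) (lam : ℝ) (b : Fin (δ 0) → 𝓢'(Space δ, ℂ)) (g u : 𝓢'(Space δ, ℂ)) :
    𝓢'(Space δ, ℂ) :=
  (lam : ℂ) • u + g - ∑ i, bonyProduct ρ (b i) (vDeriv i u)

/-- `u` is a mild solution of regularity `γ` on `[0,T]` of
`½ Δ_v u + ⟨Bz, ∇_z u⟩ + ∂_t u + ⟨b, ∇_v⟩ u = λ u + g`, `u_T = ℓ`, that is, `u` is bounded and
continuous on `[0,T] × ℝ^N`, belongs to `L^∞_T C_B^γ` and
`u_t = P_{T-t} ℓ - ∫_t^T P_{s-t}(λ u_s + g_s - ⟨b_s, ∇_v⟩ u_s) ds` for all `t ∈ [0,T]`, as an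
identity of tempered distributions. -/
structure IsMildSolution (ρ : Generator δ) (B : Matrix (Coord δ) (Coord δ) ℝ) (T γ lam : ℝ)
    (b : ℝ → Fin (δ 0) → 𝓢'(Space δ, ℂ)) (g : ℝ → 𝓢'(Space δ, ℂ)) (ℓ : 𝓢'(Space δ, ℂ))
    (u : ℝ → 𝓢'(Space δ, ℂ)) : Prop where
  continuous : IsBoundedContinuous T u
  mem : MemLinf ρ T γ u
  integrable : ∀ t ∈ Icc 0 T, ∀ φ : 𝓢(Space δ, ℂ), IntervalIntegrable
    (fun s => semigroupPairing B (s - t) (source ρ lam (b s) (g s) (u s)) φ) volume t T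
  eq : ∀ t ∈ Icc 0 T, ∀ φ : 𝓢(Space δ, ℂ), u t φ = semigroupPairing B (T - t) ℓ φ -
    ∫ s in t..T, semigroupPairing B (s - t) (source ρ lam (b s) (g s) (u s)) φ

/-- `u` is the unique mild solution (as a function on `[0,T]`). -/
def IsUniqueMildSolution (ρ : Generator δ) (B : Matrix (Coord δ) (Coord δ) ℝ) (T γ lam : ℝ)
    (b : ℝ → Fin (δ 0) → 𝓢'(Space δ, ℂ)) (g : ℝ → 𝓢'(Space δ, ℂ)) (ℓ : 𝓢'(Space δ, ℂ))
    (u : ℝ → 𝓢'(Space δ, ℂ)) : Prop :=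
  IsMildSolution ρ B T γ lam b g ℓ u ∧
    ∀ w, IsMildSolution ρ B T γ lam b g ℓ w → EqOn w u (Icc 0 T)

/-- The drifts `bₙ` and the forcings `gₙ` belong to `L^∞_T C_B^{-β}` and approximate `b` and `g`,
in the norms of regularity `-β-η` for all `η > 0`. -/
structure Approximates (ρ : Generator δ) (T β : ℝ)
    (b : ℝ → Fin (δ 0) → 𝓢'(Space δ, ℂ)) (g : ℝ → 𝓢'(Space δ, ℂ))
    (bₙ : ℕ → ℝ → Fin (δ 0) → 𝓢'(Space δ, ℂ)) (gₙ : ℕ → ℝ → 𝓢'(Space δ, ℂ)) : Prop where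
  drift_mem : VecMemLinf ρ T (-β) b
  forcing_mem : MemLinf ρ T (-β) g
  drift_mem_n : ∀ n, VecMemLinf ρ T (-β) (bₙ n)
  forcing_mem_n : ∀ n, MemLinf ρ T (-β) (gₙ n)
  drift_tendsto : ∀ η > 0,
    Tendsto (fun n => vecTimeNorm ρ T (-β - η) (b - bₙ n)) atTop (𝓝 0)
  forcing_tendsto : ∀ η > 0, Tendsto (fun n => timeNorm ρ T (-β - η) (g - gₙ n)) atTop (𝓝 0)

end Kolmogorov

end

set_option linter.unusedSectionVars false

noncomputable section

namespace Kolmogorov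

section

/-! ### Fourier multipliers on Schwartz functions and the `L¹` norm -/

section Multiplier

variable {E : Type*} [NormedAddCommGroup E] [InnerProductSpace ℝ E] [FiniteDimensional ℝ E]
  [MeasurableSpace E] [BorelSpace E]

/-! Everything is transposed to test functions. Up to constants, having regularity γ is the same as
being bounded by the dual norm `dnorm ρ (-γ)`, a weighted sum of the L¹ norms of the blocks of the
test function (`norm_apply_le_dnorm`, `besovBound_of_dnorm`). Operators on distributions are thus
estimated through L¹ bounds on frequency-localized Schwartz functions, where Young's inequality and
the scale invariance of the kernels do the work. The bridge is `apply_integral_translate`: a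
tempered distribution commutes with an integral of translates of a Schwartz function.

Three analytic facts carry the proof.

Products (`exists_isBonyProduct`): the product of regularities -β and α ≥ β+κ exists and has
regularity -(β+κ). The small loss κ makes the increments of the products of low-frequency parts
decay like 2^{-nκ}; it is affordable because the hypotheses on β and ε are open conditions.

Schauder estimate (`exists_dnorm_evol_le`): on the Fourier side the adjoint semigroup composes with
the flow of the transposed drift and multiplies by exp(-2π²⟨C(t)ξ,ξ⟩). The rank condition gives C(t)
≥ c diag(t^{2i+1}) (`exists_pos_le_covForm`), so on block m the Gaussian beats every power of √t
2^m. The flow moves a block only to frequencies whose ratio to 2^m is polynomial in max(1, √t 2^m)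
(`exists_dblock_evol_dblock_eq_zero`), and the Gaussian absorbs this. The outcome is a gain of a
derivatives at the price t^{-a/2}.

Time: as γ+β+σ < 2, the singularity t^{-a/2} with a = γ+β+σ is integrable, and its integral against
e^{-ντ} tends to 0 as ν → ∞ (`tendsto_volterraConst`).

Together they show that one step of the mild formulation halves differences in a norm weighted by
e^{κ(T-t)}, for κ large (`exists_besovBound_step`). Picard iteration gives existence on all of
[0,T]. The difference of two solutions solves the same linear equation with forcing g - g' - (b -
b')·∇u', so the a priori bound `exists_besovBound_of_mild` yields both uniqueness and stability. The
data converge only at exponents -β-η, so stability is run with β+η in place of β and γ-η in place of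
γ, in the room left by 0 < ε < 1-2β.

For (b), a vanishing terminal datum allows λ to be traded for the damping factor e^{-λ(s-t)} inside
the time integral (`MildMap.damped`). Large λ then plays the role of the time weight: the constant
in front of the data tends to 0 and depends only on bounds for the data at an exponent slightly
below -β, which the approximations eventually inherit from the limit. -/

/-- The `L¹` norm as a seminorm on Schwartz functions. -/
def l1 : Seminorm ℂ 𝓢(E, ℂ) :=
  (normSeminorm ℂ (Lp ℂ 1 (volume : Measure E))).comp (SchwartzMap.toLpCLM ℂ ℂ 1 volume).toLinearMap

lemma l1_eq (φ : 𝓢(E, ℂ)) : l1 φ = ∫ x, ‖φ x‖ := by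
  simp only [l1, Seminorm.comp_apply, coe_normSeminorm]
  exact SchwartzMap.norm_toLp_one

lemma l1_nonneg (φ : 𝓢(E, ℂ)) : 0 ≤ l1 φ := apply_nonneg _ _

lemma continuous_l1 : Continuous (l1 : 𝓢(E, ℂ) → ℝ) := by
  have : (l1 : 𝓢(E, ℂ) → ℝ) = fun φ => ‖SchwartzMap.toLpCLM ℂ ℂ 1 volume φ‖ := rfl
  rw [this]
  fun_prop

/-- The operator `φ ↦ 𝓕 (m · 𝓕⁻ φ)`. -/
def mult (m : E → ℂ) : 𝓢(E, ℂ) →L[ℂ] 𝓢(E, ℂ) :=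
  FourierTransform.fourierCLM ℂ 𝓢(E, ℂ) ∘L SchwartzMap.smulLeftCLM ℂ m ∘L
    FourierTransform.fourierInvCLM ℂ 𝓢(E, ℂ)

lemma mult_apply (m : E → ℂ) (φ : 𝓢(E, ℂ)) :
    mult m φ = 𝓕 (SchwartzMap.smulLeftCLM ℂ m (𝓕⁻ φ)) := rfl

lemma fourierInv_mult {m : E → ℂ} (hm : m.HasTemperateGrowth) (φ : 𝓢(E, ℂ)) (ξ : E) :
    (𝓕⁻ (mult m φ)) ξ = m ξ * (𝓕⁻ φ) ξ := by
  rw [mult_apply, FourierTransform.fourierInv_fourier_eq, SchwartzMap.smulLeftCLM_apply_apply hm,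
    smul_eq_mul]

/-- Injectivity of the inverse Fourier transform. Operator identities on test functions are checked
with it by comparing symbols pointwise. -/
lemma eq_of_fourierInv {φ ψ : 𝓢(E, ℂ)} (h : ∀ ξ, (𝓕⁻ φ) ξ = (𝓕⁻ ψ) ξ) : φ = ψ := by
  have h1 : 𝓕⁻ φ = 𝓕⁻ ψ := SchwartzMap.ext h
  have h2 := congrArg (fun f : 𝓢(E, ℂ) => 𝓕 f) h1
  simpa using h2

lemma mult_comm {m n : E → ℂ} (hm : m.HasTemperateGrowth) (hn : n.HasTemperateGrowth)
    (φ : 𝓢(E, ℂ)) : mult m (mult n φ) = mult n (mult m φ) := by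
  refine eq_of_fourierInv fun ξ => ?_
  rw [fourierInv_mult hm, fourierInv_mult hn, fourierInv_mult hn, fourierInv_mult hm]
  ring

lemma mult_mult {m n : E → ℂ} (hm : m.HasTemperateGrowth) (hn : n.HasTemperateGrowth)
    (φ : 𝓢(E, ℂ)) : mult m (mult n φ) = mult (fun ξ => m ξ * n ξ) φ := by
  refine eq_of_fourierInv fun ξ => ?_
  rw [fourierInv_mult hm, fourierInv_mult hn, fourierInv_mult (m := fun ξ => m ξ * n ξ) (hm.mul hn)]
  ring

open Convolution in
lemma mult_eq_convolution (m φ : 𝓢(E, ℂ)) :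
    mult m φ = SchwartzMap.convolution (ContinuousLinearMap.mul ℂ ℂ) (𝓕 m) φ := by
  refine eq_of_fourierInv fun ξ => ?_
  rw [fourierInv_mult m.hasTemperateGrowth]
  have h (f : 𝓢(E, ℂ)) (x : E) : (𝓕⁻ f) x = (𝓕 f) (-x) := by
    rw [SchwartzMap.fourierInv_coe, SchwartzMap.fourier_coe, Real.fourierInv_eq_fourier_neg]
  rw [h _ ξ, h _ ξ, SchwartzMap.fourier_convolution, SchwartzMap.pairing_apply_apply,
    ← h (𝓕 m), FourierTransform.fourierInv_fourier_eq]
  simp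

open Convolution in
lemma mult_apply_eq_integral (m φ : 𝓢(E, ℂ)) (x : E) :
    mult m φ x = ∫ y, (𝓕 m) (x - y) * φ y := by
  rw [mult_eq_convolution, SchwartzMap.convolution_apply, ← MeasureTheory.convolution_flip]
  rfl

lemma integral_norm_sub_mul {f g : E → ℝ} (hf : Integrable f) (hg : Integrable g) :
    ∫ x, ∫ y, f (x - y) * g y = (∫ x, f x) * ∫ y, g y := by
  have h := hg.convolution_integrand (ContinuousLinearMap.mul ℝ ℝ) hf
  have h2 : Integrable (Function.uncurry fun x y => f (x - y) * g y) (volume.prod volume) := by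
    refine h.congr (Eventually.of_forall fun p => ?_)
    simp [Function.uncurry, mul_comm]
  rw [integral_integral_swap h2]
  have h3 : ∀ y, ∫ x, f (x - y) * g y = (∫ x, f x) * g y := fun y => by
    rw [integral_mul_const, integral_sub_right_eq_self f y]
  simp_rw [h3]
  rw [integral_const_mul]

/-- Young's inequality: `mult m` is convolution with `𝓕 m`. The operator bounds on test functions
come down to the L¹ norm of a kernel. -/
lemma l1_mult_le (m φ : 𝓢(E, ℂ)) : l1 (mult m φ) ≤ l1 (𝓕 m) * l1 φ := by
  rw [l1_eq, l1_eq, l1_eq, ← integral_norm_sub_mul (𝓕 m).integrable.norm φ.integrable.norm]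
  have h := (φ.integrable (μ := volume)).norm.convolution_integrand (ContinuousLinearMap.mul ℝ ℝ)
    ((𝓕 m).integrable (μ := volume)).norm
  refine integral_mono ((mult m φ).integrable (μ := volume)).norm ?_ fun x => ?_
  · simpa [mul_comm] using h.integral_prod_left
  · change ‖mult m φ x‖ ≤ _
    rw [mult_apply_eq_integral]
    refine (norm_integral_le_integral_norm _).trans (le_of_eq ?_)
    simp_rw [norm_mul]

lemma integral_comp_equiv (L : E ≃L[ℝ] E) {F : Type*} [NormedAddCommGroup F] [NormedSpace ℝ F]
    (f : E → F) :
    ∫ x, f (L x) = |(LinearMap.det (L : E →ₗ[ℝ] E))⁻¹| • ∫ x, f x := by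
  have hdet : LinearMap.det (L : E →ₗ[ℝ] E) ≠ 0 := (LinearEquiv.isUnit_det' L.toLinearEquiv).ne_zero
  have h := Measure.map_linearMap_addHaar_eq_smul_addHaar (volume : Measure E) hdet
  have h2 : ∫ x, f (L x) = ∫ y, f y ∂(Measure.map (L : E →ₗ[ℝ] E) volume) := by
    have := (L.toHomeomorph.measurableEmbedding).integral_map (μ := (volume : Measure E)) f
    exact this.symm
  rw [h2, h, integral_smul_measure, ENNReal.toReal_ofReal (abs_nonneg _)]

/-- The transpose of a linear equivalence. -/
def adjEquiv (L : E ≃L[ℝ] E) : E ≃L[ℝ] E :=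
  ContinuousLinearEquiv.equivOfInverse (ContinuousLinearMap.adjoint (L : E →L[ℝ] E))
    (ContinuousLinearMap.adjoint (L.symm : E →L[ℝ] E))
    (fun x => by
      rw [← ContinuousLinearMap.comp_apply, ← ContinuousLinearMap.adjoint_comp]
      exact ext_inner_left ℝ fun y => by simp [ContinuousLinearMap.adjoint_inner_right])
    (fun x => by
      rw [← ContinuousLinearMap.comp_apply, ← ContinuousLinearMap.adjoint_comp]
      exact ext_inner_left ℝ fun y => by simp [ContinuousLinearMap.adjoint_inner_right])

lemma inner_adjEquiv_symm (L : E ≃L[ℝ] E) (x z : E) :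
    inner ℝ (L x) ((adjEquiv L).symm z) = inner ℝ x z := by
  have : (adjEquiv L).symm z = ContinuousLinearMap.adjoint (L.symm : E →L[ℝ] E) z := rfl
  rw [this, ContinuousLinearMap.adjoint_inner_right]
  simp

/-- Composition with a linear equivalence. -/
abbrev compL (L : E ≃L[ℝ] E) : 𝓢(E, ℂ) →L[ℂ] 𝓢(E, ℂ) :=
  SchwartzMap.compCLMOfContinuousLinearEquiv ℂ L

lemma fourier_compL (L : E ≃L[ℝ] E) (φ : 𝓢(E, ℂ)) (z : E) :
    (𝓕 (compL L φ)) z =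
      |(LinearMap.det (L : E →ₗ[ℝ] E))⁻¹| • (𝓕 φ) ((adjEquiv L).symm z) := by
  rw [SchwartzMap.fourier_coe, SchwartzMap.fourier_coe, Real.fourier_eq, Real.fourier_eq,
    ← integral_comp_equiv L]
  refine integral_congr_ae (Eventually.of_forall fun x => ?_)
  simp only [inner_adjEquiv_symm]
  rfl

lemma l1_comp_equiv (L : E ≃L[ℝ] E) (φ : 𝓢(E, ℂ)) :
    l1 (compL L φ) = |(LinearMap.det (L : E →ₗ[ℝ] E))⁻¹| * l1 φ := by
  rw [l1_eq, l1_eq, ← smul_eq_mul, ← integral_comp_equiv L]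
  rfl

lemma det_adjEquiv (L : E ≃L[ℝ] E) :
    LinearMap.det ((adjEquiv L : E ≃L[ℝ] E) : E →ₗ[ℝ] E) = LinearMap.det (L : E →ₗ[ℝ] E) := by
  have : ((adjEquiv L : E ≃L[ℝ] E) : E →ₗ[ℝ] E) = LinearMap.adjoint (L : E →ₗ[ℝ] E) := rfl
  rw [this, ← LinearMap.det_toMatrix (stdOrthonormalBasis ℝ E).toBasis,
    LinearMap.toMatrix_adjoint, Matrix.det_conjTranspose, LinearMap.det_toMatrix]
  simp

/-- A linear change of variable in the symbol acts on the kernel by the inverse transpose together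
with the Jacobian that preserves L¹ norms. Hence the bounds are uniform over dyadic scales and over
Gaussian shapes. -/
lemma l1_fourier_compL (L : E ≃L[ℝ] E) (φ : 𝓢(E, ℂ)) : l1 (𝓕 (compL L φ)) = l1 (𝓕 φ) := by
  have hdet : LinearMap.det (L : E →ₗ[ℝ] E) ≠ 0 := (LinearEquiv.isUnit_det' L.toLinearEquiv).ne_zero
  have h : 𝓕 (compL L φ) =
      ((|(LinearMap.det (L : E →ₗ[ℝ] E))⁻¹| : ℝ) : ℂ) • compL (adjEquiv L).symm (𝓕 φ) := by
    ext z
    rw [fourier_compL]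
    simp
  have h2 : LinearMap.det ((adjEquiv L).symm : E →ₗ[ℝ] E) = (LinearMap.det (L : E →ₗ[ℝ] E))⁻¹ := by
    rw [← det_adjEquiv L]
    exact LinearEquiv.det_coe_symm (adjEquiv L).toLinearEquiv
  rw [h, map_smul_eq_mul, l1_comp_equiv, h2, inv_inv, Complex.norm_real, Real.norm_eq_abs, abs_abs,
    ← mul_assoc, ← abs_mul, inv_mul_cancel₀ hdet, abs_one, one_mul]

end Multiplier

end

section

/-! ### Integrals of translates of a Schwartz function against a tempered distribution -/

section Exchange

variable {E : Type*} [NormedAddCommGroup E] [InnerProductSpace ℝ E] [FiniteDimensional ℝ E]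
  [MeasurableSpace E] [BorelSpace E]

/-- The translate `y ↦ K (y - x)`. -/
abbrev translate (x : E) : 𝓢(E, ℂ) →L[ℂ] 𝓢(E, ℂ) := SchwartzMap.compSubConstCLM ℂ x

lemma iteratedFDeriv_translate (K : 𝓢(E, ℂ)) (x : E) (l : ℕ) (y : E) :
    iteratedFDeriv ℝ l (translate x K) y = iteratedFDeriv ℝ l K (y - x) := by
  have : (translate x K : E → ℂ) = fun y => K (y - x) := by
    ext y; exact SchwartzMap.compSubConstCLM_apply K x y
  rw [this, iteratedFDeriv_comp_sub]

lemma pow_norm_mul_le (φ : 𝓢(E, ℂ)) (k l : ℕ) (x y : E) :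
    ‖y‖ ^ k * ‖iteratedFDeriv ℝ l φ (y - x)‖ ≤
      2 ^ k * (SchwartzMap.seminorm ℝ k l φ + SchwartzMap.seminorm ℝ 0 l φ) * (1 + ‖x‖) ^ k := by
  have h1 : ‖y‖ ^ k ≤ 2 ^ k * (‖y - x‖ ^ k + ‖x‖ ^ k) := by
    have h2 : ‖y‖ ≤ ‖y - x‖ + ‖x‖ := by simpa using norm_add_le (y - x) x
    refine (pow_le_pow_left₀ (norm_nonneg _) h2 k).trans ?_
    refine (add_pow_le (norm_nonneg _) (norm_nonneg _) k).trans ?_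
    gcongr
    · norm_num
    · omega
  have hx : ‖x‖ ^ k ≤ (1 + ‖x‖) ^ k := by gcongr; linarith
  have h1x : 1 ≤ (1 + ‖x‖) ^ k := one_le_pow₀ (by linarith [norm_nonneg x])
  have ha := SchwartzMap.le_seminorm ℝ k l φ (y - x)
  have hb := SchwartzMap.le_seminorm ℝ 0 l φ (y - x)
  rw [pow_zero, one_mul] at hb
  have hA : 0 ≤ SchwartzMap.seminorm ℝ k l φ := apply_nonneg _ _
  have hB : 0 ≤ SchwartzMap.seminorm ℝ 0 l φ := apply_nonneg _ _
  calc ‖y‖ ^ k * ‖iteratedFDeriv ℝ l φ (y - x)‖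
      ≤ 2 ^ k * (‖y - x‖ ^ k + ‖x‖ ^ k) * ‖iteratedFDeriv ℝ l φ (y - x)‖ := by gcongr
    _ = 2 ^ k * (‖y - x‖ ^ k * ‖iteratedFDeriv ℝ l φ (y - x)‖ +
          ‖x‖ ^ k * ‖iteratedFDeriv ℝ l φ (y - x)‖) := by ring
    _ ≤ 2 ^ k * (SchwartzMap.seminorm ℝ k l φ * (1 + ‖x‖) ^ k +
          (1 + ‖x‖) ^ k * SchwartzMap.seminorm ℝ 0 l φ) := by
        refine mul_le_mul_of_nonneg_left (add_le_add ?_ ?_) (by positivity)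
        · exact ha.trans (le_mul_of_one_le_right hA h1x)
        · exact mul_le_mul hx hb (norm_nonneg _) (by positivity)
    _ = _ := by ring

lemma hasFDerivAt_iteratedFDeriv (φ : 𝓢(E, ℂ)) (l : ℕ) (y : E) :
    HasFDerivAt (iteratedFDeriv ℝ l φ) (fderiv ℝ (iteratedFDeriv ℝ l φ) y) y :=
  (((φ.smooth (l + 1)).differentiable_iteratedFDeriv
    (by exact_mod_cast Nat.lt_succ_self l)) y).hasFDerivAt

lemma norm_translate_sub_le (K : 𝓢(E, ℂ)) (k l : ℕ) (x x' y : E) :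
    ‖y‖ ^ k * ‖iteratedFDeriv ℝ l K (y - x) - iteratedFDeriv ℝ l K (y - x')‖ ≤
      2 ^ k * (SchwartzMap.seminorm ℝ k (l + 1) K + SchwartzMap.seminorm ℝ 0 (l + 1) K) *
        (1 + (‖x‖ + ‖x'‖)) ^ k * ‖x - x'‖ := by
  set M := 2 ^ k * (SchwartzMap.seminorm ℝ k (l + 1) K + SchwartzMap.seminorm ℝ 0 (l + 1) K) *
        (1 + (‖x‖ + ‖x'‖)) ^ k with hM
  have hA : 0 ≤ SchwartzMap.seminorm ℝ k (l + 1) K := apply_nonneg _ _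
  have hB : 0 ≤ SchwartzMap.seminorm ℝ 0 (l + 1) K := apply_nonneg _ _
  have hM0 : 0 ≤ M := by positivity
  -- The mean value inequality is applied with the derivative bound divided by ‖y‖^k, so the case of
  -- a vanishing weight is separated.
  rcases eq_or_lt_of_le (by positivity : 0 ≤ ‖y‖ ^ k) with hy | hy
  · rw [← hy, zero_mul]
    positivity
  have hbound : ∀ z ∈ segment ℝ (y - x) (y - x'), ‖fderiv ℝ (iteratedFDeriv ℝ l K) z‖ ≤
      M / ‖y‖ ^ k := by
    intro z hz
    rw [le_div_iff₀' hy, norm_fderiv_iteratedFDeriv]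
    obtain ⟨a, b, ha, hb, hab, rfl⟩ := hz
    have hz' : ‖a • x + b • x'‖ ≤ ‖x‖ + ‖x'‖ := by
      refine (norm_add_le _ _).trans ?_
      rw [norm_smul, norm_smul, Real.norm_of_nonneg ha, Real.norm_of_nonneg hb]
      exact add_le_add (mul_le_of_le_one_left (norm_nonneg _) (by linarith))
        (mul_le_of_le_one_left (norm_nonneg _) (by linarith))
    have he : a • (y - x) + b • (y - x') = y - (a • x + b • x') := by
      rw [smul_sub, smul_sub, sub_add_sub_comm, ← add_smul, hab, one_smul]
    rw [he]
    refine (pow_norm_mul_le K k (l + 1) _ y).trans ?_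
    rw [hM]
    gcongr
  have := (convex_segment (y - x) (y - x')).norm_image_sub_le_of_norm_hasFDerivWithin_le
    (fun z _ => (hasFDerivAt_iteratedFDeriv K l z).hasFDerivWithinAt) hbound
    (right_mem_segment ℝ _ _) (left_mem_segment ℝ _ _)
  have h2 : y - x - (y - x') = -(x - x') := by abel
  rw [h2, norm_neg, div_mul_eq_mul_div, le_div_iff₀' hy] at this
  exact this

lemma continuous_translate (K : 𝓢(E, ℂ)) : Continuous fun x => translate x K := by
  rw [continuous_iff_continuousAt]
  intro x'
  rw [ContinuousAt, (schwartz_withSeminorms ℝ E ℂ).tendsto_nhds]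
  intro ⟨k, l⟩ ε hε
  set M := 2 ^ k * (SchwartzMap.seminorm ℝ k (l + 1) K + SchwartzMap.seminorm ℝ 0 (l + 1) K)
  have hlim : Tendsto (fun x => M * (1 + (‖x‖ + ‖x'‖)) ^ k * ‖x - x'‖) (𝓝 x') (𝓝 0) := by
    have : Continuous fun x => M * (1 + (‖x‖ + ‖x'‖)) ^ k * ‖x - x'‖ := by fun_prop
    simpa using this.tendsto x'
  filter_upwards [hlim.eventually_lt_const hε] with x hx
  refine lt_of_le_of_lt ?_ hx
  rw [SchwartzMap.schwartzSeminormFamily_apply]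
  refine SchwartzMap.seminorm_le_bound ℝ k l _ ?_ fun y => ?_
  · have hA : 0 ≤ SchwartzMap.seminorm ℝ k (l + 1) K := apply_nonneg _ _
    have hB : 0 ≤ SchwartzMap.seminorm ℝ 0 (l + 1) K := apply_nonneg _ _
    positivity
  · have h1 : iteratedFDeriv ℝ l (translate x K - translate x' K : 𝓢(E, ℂ)) y =
        iteratedFDeriv ℝ l K (y - x) - iteratedFDeriv ℝ l K (y - x') := by
      rw [← iteratedFDeriv_translate, ← iteratedFDeriv_translate]
      exact iteratedFDeriv_sub_apply ((translate x K).smooth l).contDiffAt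
        ((translate x' K).smooth l).contDiffAt
    rw [h1]
    exact norm_translate_sub_le K k l x x' y

/-- A measurable function all of whose moments are finite. -/
structure HasMoments (θ : E → ℂ) : Prop where
  meas : AEStronglyMeasurable θ volume
  int : ∀ k : ℕ, Integrable (fun x => (1 + ‖x‖) ^ k * ‖θ x‖)

lemma HasMoments.integrable {θ : E → ℂ} (h : HasMoments θ) : Integrable θ := by
  have := h.int 0
  simp only [pow_zero, one_mul] at this
  exact (integrable_norm_iff h.meas).1 this

lemma SchwartzMap_hasMoments (φ : 𝓢(E, ℂ)) : HasMoments (φ : E → ℂ) := by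
  refine ⟨φ.continuous.aestronglyMeasurable, fun k => ?_⟩
  have h1 := φ.integrable_pow_mul (μ := volume) k
  have h0 := φ.integrable_pow_mul (μ := volume) 0
  refine ((h1.add h0).const_mul (2 ^ k)).mono' ?_ (Eventually.of_forall fun x => ?_)
  · exact (by fun_prop : Continuous fun x => (1 + ‖x‖) ^ k * ‖φ x‖).aestronglyMeasurable
  · rw [Real.norm_of_nonneg (by positivity)]
    simp only [Pi.add_apply, pow_zero, one_mul]
    have h2 : (1 + ‖x‖) ^ k ≤ 2 ^ k * (1 ^ k + ‖x‖ ^ k) := by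
      refine (add_pow_le zero_le_one (norm_nonneg _) k).trans ?_
      gcongr
      · norm_num
      · omega
    calc (1 + ‖x‖) ^ k * ‖φ x‖ ≤ 2 ^ k * (1 ^ k + ‖x‖ ^ k) * ‖φ x‖ := by gcongr
      _ = _ := by ring

lemma HasMoments.bdd_mul {θ F : E → ℂ} (h : HasMoments θ) (hF : AEStronglyMeasurable F volume)
    {C : ℝ} (hC : ∀ x, ‖F x‖ ≤ C) : HasMoments fun x => F x * θ x := by
  refine ⟨hF.mul h.meas, fun k => ?_⟩
  refine ((h.int k).const_mul C).mono' ?_ (Eventually.of_forall fun x => ?_)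
  · exact ((by fun_prop : Continuous fun x : E => (1 + ‖x‖) ^ k).aestronglyMeasurable).mul
      (hF.mul h.meas).norm
  · rw [Real.norm_of_nonneg (by positivity), norm_mul]
    have := hC x
    calc (1 + ‖x‖) ^ k * (‖F x‖ * ‖θ x‖) = ‖F x‖ * ((1 + ‖x‖) ^ k * ‖θ x‖) := by ring
      _ ≤ _ := by gcongr

lemma lineDeriv_integral_translate {θ : E → ℂ} (hθ : Integrable θ) (K ψ : 𝓢(E, ℂ))
    (hψ : ∀ y, ψ y = ∫ x, θ x * K (y - x)) (v y : E) :
    (∂_{v} ψ) y = ∫ x, θ x * (∂_{v} K) (y - x) := by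
  have hd : HasFDerivAt (fun y => ∫ x, θ x * K (y - x))
      (∫ x, θ x • fderiv ℝ K (y - x)) y := by
    have hc : Continuous (fderiv ℝ (K : E → ℂ)) := (K.smooth 1).continuous_fderiv (by norm_num)
    have hb0 : ∀ z, ‖K z‖ ≤ SchwartzMap.seminorm ℝ 0 0 K := SchwartzMap.norm_le_seminorm ℝ K
    have hb1 : ∀ z, ‖fderiv ℝ K z‖ ≤ SchwartzMap.seminorm ℝ 0 1 K := fun z => by
      rw [← norm_iteratedFDeriv_one]
      exact SchwartzMap.norm_iteratedFDeriv_le_seminorm ℝ K 1 z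
    have hm : ∀ z, AEStronglyMeasurable (fun x => θ x * K (z - x)) volume := fun z =>
      hθ.aestronglyMeasurable.mul (by fun_prop : Continuous fun x => K (z - x)).aestronglyMeasurable
    refine hasFDerivAt_integral_of_dominated_of_fderiv_le (𝕜 := ℝ) (s := univ)
      (F' := fun y x => θ x • fderiv ℝ K (y - x))
      (bound := fun x => ‖θ x‖ * SchwartzMap.seminorm ℝ 0 1 K) univ_mem
      (Eventually.of_forall hm) ?_ ?_ ?_ (hθ.norm.mul_const _) ?_
    · refine (hθ.norm.mul_const (SchwartzMap.seminorm ℝ 0 0 K)).mono' (hm y)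
        (Eventually.of_forall fun x => ?_)
      rw [norm_mul]
      gcongr
      exact hb0 _
    · exact hθ.aestronglyMeasurable.smul
        (hc.comp (continuous_const.sub continuous_id)).aestronglyMeasurable
    · refine Eventually.of_forall fun x z _ => ?_
      rw [norm_smul]
      gcongr
      exact hb1 _
    · refine Eventually.of_forall fun x z _ => ?_
      have := (K.hasFDerivAt (z - x)).comp z ((hasFDerivAt_id z).sub_const x)
      exact this.const_mul (θ x)
  have hψ' : (ψ : E → ℂ) = fun y => ∫ x, θ x * K (y - x) := funext hψ
  have hint : Integrable fun x => θ x • fderiv ℝ K (y - x) := by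
    refine (hθ.norm.mul_const (SchwartzMap.seminorm ℝ 0 1 K)).mono' ?_
      (Eventually.of_forall fun x => ?_)
    · exact hθ.aestronglyMeasurable.smul
        (((K.smooth 1).continuous_fderiv (by norm_num)).comp
          (continuous_const.sub continuous_id)).aestronglyMeasurable
    · rw [norm_smul, ← norm_iteratedFDeriv_one]
      gcongr
      exact SchwartzMap.norm_iteratedFDeriv_le_seminorm ℝ K 1 _
  rw [SchwartzMap.lineDerivOp_apply_eq_fderiv, hψ', hd.fderiv,
    ContinuousLinearMap.integral_apply hint]
  refine integral_congr_ae (Eventually.of_forall fun x => ?_)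
  simp [SchwartzMap.lineDerivOp_apply_eq_fderiv]

/-- Written with iterated line derivatives, the claim follows by induction, because a line
derivative of a Schwartz function is again Schwartz and the one-derivative case applies to it. -/
lemma iteratedFDeriv_integral_translate {θ : E → ℂ} (hθ : Integrable θ) (K ψ : 𝓢(E, ℂ))
    (hψ : ∀ y, ψ y = ∫ x, θ x * K (y - x)) (l : ℕ) (m : Fin l → E) (y : E) :
    iteratedFDeriv ℝ l ψ y m = ∫ x, θ x * iteratedFDeriv ℝ l K (y - x) m := by
  simp_rw [← SchwartzMap.iteratedLineDerivOp_eq_iteratedFDeriv]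
  induction l generalizing y with
  | zero => simpa using hψ y
  | succ l ih =>
    simp_rw [LineDeriv.iteratedLineDerivOp_succ_left]
    exact lineDeriv_integral_translate hθ _ _ (ih (Fin.tail m)) (m 0) y

/-- A multilinear map is controlled by its values on an orthonormal basis. -/
lemma norm_multilinear_le {ι : Type*} [Fintype ι] (b : OrthonormalBasis ι ℝ E) {l : ℕ}
    (M : E [×l]→L[ℝ] ℂ) : ‖M‖ ≤ ∑ J : Fin l → ι, ‖M fun i => b (J i)‖ := by
  classical
  refine ContinuousMultilinearMap.opNorm_le_bound (Finset.sum_nonneg fun _ _ => norm_nonneg _)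
    fun v => ?_
  have h1 : M v = ∑ J : Fin l → ι, (∏ i, b.repr (v i) (J i)) • M fun i => b (J i) := by
    conv_lhs => rw [show v = fun i => ∑ j, b.repr (v i) j • b j from
      funext fun i => (b.sum_repr (v i)).symm]
    rw [M.map_sum]
    refine Finset.sum_congr rfl fun J _ => ?_
    exact M.map_smul_univ _ _
  rw [h1, Finset.sum_mul]
  refine (norm_sum_le _ _).trans (Finset.sum_le_sum fun J _ => ?_)
  rw [norm_smul, mul_comm, norm_prod]
  gcongr with i
  have := PiLp.norm_apply_le (b.repr (v i)) (J i)
  rwa [LinearIsometryEquiv.norm_map] at this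

/-- The weighted derivatives of a Schwartz function in given directions, as bounded continuous
functions. -/
def weightedDeriv (i : ℕ × ℕ) (m : Fin i.2 → E) :
    𝓢(E, ℂ) →ₗ[ℂ] (BoundedContinuousFunction E ℂ) where
  toFun φ := BoundedContinuousFunction.ofNormedAddCommGroup
    (fun y => ((‖y‖ ^ i.1 : ℝ) : ℂ) * iteratedFDeriv ℝ i.2 φ y m)
    (by
      have h := (φ.smooth i.2).continuous_iteratedFDeriv le_rfl
      have h2 : Continuous fun y => iteratedFDeriv ℝ i.2 φ y m :=
        (ContinuousMultilinearMap.apply ℝ (fun _ : Fin i.2 => E) ℂ m).continuous.comp h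
      fun_prop)
    (SchwartzMap.seminorm ℝ i.1 i.2 φ * ∏ j, ‖m j‖)
    (fun y => by
      rw [norm_mul, Complex.norm_real, norm_pow, norm_norm]
      refine (mul_le_mul_of_nonneg_left (ContinuousMultilinearMap.le_opNorm _ m)
        (by positivity)).trans ?_
      rw [← mul_assoc]
      gcongr
      exact SchwartzMap.le_seminorm ℝ i.1 i.2 φ y)
  map_add' φ ψ := by
    ext1 y
    have : iteratedFDeriv ℝ i.2 (φ + ψ : 𝓢(E, ℂ)) y =
        iteratedFDeriv ℝ i.2 φ y + iteratedFDeriv ℝ i.2 ψ y :=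
      iteratedFDeriv_add_apply (φ.smooth _).contDiffAt (ψ.smooth _).contDiffAt
    change ((‖y‖ ^ i.1 : ℝ) : ℂ) * iteratedFDeriv ℝ i.2 (φ + ψ : 𝓢(E, ℂ)) y m = _
    rw [this, add_apply, mul_add]
    rfl
  map_smul' c φ := by
    ext1 y
    have : iteratedFDeriv ℝ i.2 (c • φ : 𝓢(E, ℂ)) y = c • iteratedFDeriv ℝ i.2 φ y :=
      iteratedFDeriv_const_smul_apply (φ.smooth _).contDiffAt
    change ((‖y‖ ^ i.1 : ℝ) : ℂ) * iteratedFDeriv ℝ i.2 (c • φ : 𝓢(E, ℂ)) y m = _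
    rw [this, smul_apply, mul_smul_comm]
    rfl

lemma weightedDeriv_apply (i : ℕ × ℕ) (m : Fin i.2 → E) (φ : 𝓢(E, ℂ)) (y : E) :
    weightedDeriv i m φ y = ((‖y‖ ^ i.1 : ℝ) : ℂ) * iteratedFDeriv ℝ i.2 φ y m := rfl

lemma norm_weightedDeriv_apply (i : ℕ × ℕ) (m : Fin i.2 → E) (φ : 𝓢(E, ℂ)) (y : E) :
    ‖weightedDeriv i m φ y‖ = ‖y‖ ^ i.1 * ‖iteratedFDeriv ℝ i.2 φ y m‖ := by
  rw [weightedDeriv_apply, norm_mul, Complex.norm_real, norm_pow, norm_norm]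

lemma seminorm_le_weightedDeriv {ι : Type*} [Fintype ι] (b : OrthonormalBasis ι ℝ E) (i : ℕ × ℕ)
    (φ : 𝓢(E, ℂ)) : SchwartzMap.seminorm ℂ i.1 i.2 φ ≤
      ∑ J : Fin i.2 → ι, ‖weightedDeriv i (fun j => b (J j)) φ‖ := by
  refine SchwartzMap.seminorm_le_bound ℂ _ _ φ
    (Finset.sum_nonneg fun J _ => norm_nonneg (weightedDeriv i (fun j => b (J j)) φ)) fun y => ?_
  refine (mul_le_mul_of_nonneg_left (norm_multilinear_le b _) (by positivity)).trans ?_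
  rw [Finset.mul_sum]
  refine Finset.sum_le_sum fun J _ => ?_
  rw [← norm_weightedDeriv_apply i (fun j => b (J j))]
  exact (weightedDeriv i (fun j => b (J j)) φ).norm_coe_le_norm y

lemma norm_weightedDeriv_le (i : ℕ × ℕ) (m : Fin i.2 → E) (φ : 𝓢(E, ℂ)) {C : ℝ} (hC : 0 ≤ C)
    (h : ∀ y, ‖y‖ ^ i.1 * ‖iteratedFDeriv ℝ i.2 φ y‖ ≤ C) :
    ‖weightedDeriv i m φ‖ ≤ C * ∏ j, ‖m j‖ := by
  rw [BoundedContinuousFunction.norm_le (by positivity)]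
  intro y
  rw [norm_weightedDeriv_apply]
  refine (mul_le_mul_of_nonneg_left (ContinuousMultilinearMap.le_opNorm _ m)
    (by positivity)).trans ?_
  rw [← mul_assoc]
  gcongr
  exact h y

lemma exists_seminorm_bound (f : 𝓢'(E, ℂ)) :
    ∃ (s : Finset (ℕ × ℕ)) (C : ℝ≥0), ∀ φ : 𝓢(E, ℂ),
      ‖f φ‖ ≤ C * s.sup (schwartzSeminormFamily ℂ E ℂ) φ := by
  have hf : Continuous ((normSeminorm ℂ ℂ).comp f.toLinearMap) := by
    have : Continuous fun φ => ‖f φ‖ := (f.continuous).norm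
    exact this
  obtain ⟨s, C, -, h⟩ := Seminorm.bound_of_continuous (schwartz_withSeminorms ℂ E ℂ) _ hf
  exact ⟨s, C, fun φ => h φ⟩

/-- A linear functional bounded by the norm of a linear image extends continuously. -/
lemma exists_dual_extension {V Y : Type*} [AddCommGroup V] [Module ℂ V] [NormedAddCommGroup Y]
    [NormedSpace ℂ Y] (f : V →ₗ[ℂ] ℂ) (I : V →ₗ[ℂ] Y) (C : ℝ) (hI : ∀ φ, ‖f φ‖ ≤ C * ‖I φ‖) :
    ∃ g : StrongDual ℂ Y, ∀ φ, g (I φ) = f φ := by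
  have hker : LinearMap.ker I ≤ LinearMap.ker f := by
    intro φ hφ
    rw [LinearMap.mem_ker] at hφ ⊢
    have := hI φ
    rw [hφ, norm_zero, mul_zero] at this
    exact norm_le_zero_iff.1 this
  -- The functional descends to the range of `I`, since it vanishes on the kernel; Hahn–Banach then
  -- extends it to all of `Y`.
  let g0 : LinearMap.range I →ₗ[ℂ] ℂ :=
    ((LinearMap.ker I).liftQ f hker).comp I.quotKerEquivRange.symm.toLinearMap
  have hg0 : ∀ φ, g0 ⟨I φ, LinearMap.mem_range_self I φ⟩ = f φ := by
    intro φ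
    have : I.quotKerEquivRange.symm ⟨I φ, LinearMap.mem_range_self I φ⟩ =
        (LinearMap.ker I).mkQ φ := by
      rw [LinearEquiv.symm_apply_eq]
      rfl
    simp only [g0, LinearMap.comp_apply, LinearEquiv.coe_coe, this]
    rfl
  let g1 : StrongDual ℂ (LinearMap.range I) := g0.mkContinuous C (by
    rintro ⟨_, φ, rfl⟩
    rw [hg0]
    exact hI φ)
  obtain ⟨g, hg, -⟩ := exists_extension_norm_eq (LinearMap.range I) g1
  exact ⟨g, fun φ => (hg ⟨I φ, LinearMap.mem_range_self I φ⟩).trans (hg0 φ)⟩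

/-- The Bochner integral is taken in a Banach space through which `f` factors, where it commutes
with a continuous functional; no integral with values in the Schwartz space is needed. -/
lemma apply_eq_integral {V Y : Type*} [AddCommGroup V] [Module ℂ V] [NormedAddCommGroup Y]
    [NormedSpace ℂ Y] [CompleteSpace Y] (f : V →ₗ[ℂ] ℂ) (I : V →ₗ[ℂ] Y) (C : ℝ)
    (hI : ∀ φ, ‖f φ‖ ≤ C * ‖I φ‖) (ψ : V) (τ : E → V) (θ : E → ℂ)
    (hint : Integrable fun x => θ x • I (τ x)) (hkey : ∫ x, θ x • I (τ x) = I ψ) :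
    f ψ = ∫ x, θ x * f (τ x) := by
  obtain ⟨g, hg⟩ := exists_dual_extension f I C hI
  rw [← hg ψ, ← hkey, ← g.integral_comp_comm hint]
  refine integral_congr_ae (Eventually.of_forall fun x => ?_)
  change g (θ x • I (τ x)) = θ x * f (τ x)
  rw [map_smul, hg, smul_eq_mul]

lemma continuous_weightedDeriv (i : ℕ × ℕ) (m : Fin i.2 → E) : Continuous (weightedDeriv i m) := by
  refine WithSeminorms.continuous_normedSpace_rng _ (schwartz_withSeminorms ℂ E ℂ) _
    ⟨{i}, ∏ j, ‖m j‖₊, fun φ => ?_⟩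
  simp only [Seminorm.comp_apply, coe_normSeminorm, Finset.sup_singleton]
  refine (norm_weightedDeriv_le i m φ (apply_nonneg (SchwartzMap.seminorm ℂ i.1 i.2) φ) fun y =>
    SchwartzMap.le_seminorm ℂ _ _ φ y).trans (le_of_eq ?_)
  rw [mul_comm, smul_apply, NNReal.smul_def, NNReal.coe_prod]
  rfl

lemma norm_weightedDeriv_translate_le (i : ℕ × ℕ) (m : Fin i.2 → E) (K : 𝓢(E, ℂ)) (x : E) :
    ‖weightedDeriv i m (translate x K)‖ ≤
      2 ^ i.1 * (SchwartzMap.seminorm ℝ i.1 i.2 K + SchwartzMap.seminorm ℝ 0 i.2 K) *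
        (1 + ‖x‖) ^ i.1 * ∏ j, ‖m j‖ := by
  have hA : 0 ≤ SchwartzMap.seminorm ℝ i.1 i.2 K := apply_nonneg _ _
  have hB : 0 ≤ SchwartzMap.seminorm ℝ 0 i.2 K := apply_nonneg _ _
  refine norm_weightedDeriv_le _ _ _ (by positivity) fun y => ?_
  rw [iteratedFDeriv_translate]
  exact pow_norm_mul_le K _ _ x y

lemma integrable_weightedDeriv_translate {θ : E → ℂ} (hθ : HasMoments θ) (i : ℕ × ℕ)
    (m : Fin i.2 → E) (K : 𝓢(E, ℂ)) :
    Integrable fun x => θ x • weightedDeriv i m (translate x K) := by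
  refine ((hθ.int i.1).const_mul
    (2 ^ i.1 * (SchwartzMap.seminorm ℝ i.1 i.2 K + SchwartzMap.seminorm ℝ 0 i.2 K) *
      ∏ j, ‖m j‖)).mono'
    (hθ.meas.smul
      ((continuous_weightedDeriv i m).comp (continuous_translate K)).aestronglyMeasurable)
    (Eventually.of_forall fun x => ?_)
  rw [norm_smul]
  refine (mul_le_mul_of_nonneg_left (norm_weightedDeriv_translate_le i m K x)
    (norm_nonneg _)).trans (le_of_eq ?_)
  ring

lemma integral_weightedDeriv_translate {θ : E → ℂ} (hθ : HasMoments θ) (i : ℕ × ℕ)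
    (m : Fin i.2 → E) (K ψ : 𝓢(E, ℂ)) (hψ : ∀ y, ψ y = ∫ x, θ x * K (y - x)) :
    ∫ x, θ x • weightedDeriv i m (translate x K) = weightedDeriv i m ψ := by
  ext1 y
  let ev : BoundedContinuousFunction E ℂ →L[ℝ] ℂ := BoundedContinuousFunction.evalCLM ℝ y
  have h1 := ev.integral_comp_comm (integrable_weightedDeriv_translate hθ i m K)
  refine h1.symm.trans ?_
  rw [weightedDeriv_apply, iteratedFDeriv_integral_translate hθ.integrable K ψ hψ,
    ← integral_const_mul]
  refine integral_congr_ae (Eventually.of_forall fun x => ?_)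
  have h4 : ev (θ x • weightedDeriv i m (translate x K)) =
    θ x * (((‖y‖ ^ i.1 : ℝ) : ℂ) * iteratedFDeriv ℝ i.2 (translate x K) y m) := rfl
  change ev (θ x • weightedDeriv i m (translate x K)) = _
  rw [h4, iteratedFDeriv_translate]
  ring

/-- All weighted derivatives of type `i ∈ s` in the directions of an orthonormal basis. -/
def weightedDerivs {ι : Type*} (b : ι → E) (s : Finset (ℕ × ℕ)) :
    𝓢(E, ℂ) →ₗ[ℂ] (((i : s) × (Fin i.1.2 → ι)) → BoundedContinuousFunction E ℂ) :=
  LinearMap.pi fun p => weightedDeriv p.1.1 (fun j => b (p.2 j))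

lemma sup_seminorm_le_weightedDerivs {ι : Type*} [Fintype ι] (b : OrthonormalBasis ι ℝ E)
    (s : Finset (ℕ × ℕ)) (φ : 𝓢(E, ℂ)) :
    s.sup (schwartzSeminormFamily ℂ E ℂ) φ ≤
      Fintype.card ((i : s) × (Fin i.1.2 → ι)) * ‖weightedDerivs b s φ‖ := by
  refine Seminorm.finset_sup_apply_le (by positivity) fun i hi => ?_
  refine (seminorm_le_weightedDeriv b i φ).trans ?_
  have h1 : ∀ J : Fin i.2 → ι, ‖weightedDeriv i (fun j => b (J j)) φ‖ ≤
      ‖weightedDerivs b s φ‖ := fun J =>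
    norm_le_pi_norm (weightedDerivs b s φ) ⟨⟨i, hi⟩, J⟩
  refine (Finset.sum_le_card_nsmul _ _ _ fun J _ => h1 J).trans ?_
  rw [nsmul_eq_mul]
  gcongr
  exact Fintype.card_le_of_injective
    (fun J => (⟨⟨i, hi⟩, J⟩ : (i : s) × (Fin i.1.2 → ι))) fun J J' h =>
      eq_of_heq (Sigma.mk.inj h).2

/-- A tempered distribution may be exchanged with an integral of translates. -/
theorem apply_integral_translate (f : 𝓢'(E, ℂ)) (K : 𝓢(E, ℂ)) {θ : E → ℂ} (hθ : HasMoments θ)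
    (ψ : 𝓢(E, ℂ)) (hψ : ∀ y, ψ y = ∫ x, θ x * K (y - x)) :
    f ψ = ∫ x, θ x * f (translate x K) := by
  -- A tempered distribution sees only finitely many Schwartz seminorms, so it factors through a
  -- finite product of spaces of bounded continuous functions. There the integral of translates is
  -- computed coordinate by coordinate.
  obtain ⟨s, C, hC⟩ := exists_seminorm_bound f
  have hI : ∀ φ, ‖f.toLinearMap φ‖ ≤
      C * (Fintype.card ((i : s) × (Fin i.1.2 → Fin (Module.finrank ℝ E)))) *
        ‖weightedDerivs (stdOrthonormalBasis ℝ E) s φ‖ := by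
    intro φ
    refine (hC φ).trans ?_
    rw [mul_assoc]
    exact mul_le_mul_of_nonneg_left (sup_seminorm_le_weightedDerivs _ s φ) C.2
  have h1 : ∀ p, Integrable fun x =>
      (θ x • weightedDerivs (stdOrthonormalBasis ℝ E) s (translate x K)) p := fun p =>
    integrable_weightedDeriv_translate hθ p.1.1 _ K
  refine apply_eq_integral f.toLinearMap (weightedDerivs (stdOrthonormalBasis ℝ E) s) _ hI ψ
    (fun x => translate x K) θ (Integrable.of_eval h1) ?_
  funext p
  rw [eval_integral h1]
  exact integral_weightedDeriv_translate hθ p.1.1 _ K ψ hψ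

lemma continuous_apply_translate (f : 𝓢'(E, ℂ)) (K : 𝓢(E, ℂ)) :
    Continuous fun x => f (translate x K) :=
  f.continuous.comp (continuous_translate K)

end Exchange

end

section

/-! ### Dilations and the Paley-Littlewood partition -/

variable {r : ℕ} {δ : Fin (r + 1) → ℕ}

lemma dilation_apply (a : ℝ) (z : Space δ) (k : Coord δ) :
    dilation a z k = a ^ (2 * (k.1 : ℕ) + 1) * z k := rfl

lemma dilation_dilation (a b : ℝ) (z : Space δ) : dilation a (dilation b z) = dilation (a * b) z := by
  ext k
  simp only [dilation_apply, mul_pow]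
  ring

lemma dilation_one (z : Space δ) : dilation 1 z = z := by
  ext k
  simp [dilation_apply]

/-- The dilation as a linear equivalence. -/
def dilEquiv (a : ℝ) (ha : a ≠ 0) : Space δ ≃L[ℝ] Space δ :=
  LinearEquiv.toContinuousLinearEquiv
    { toFun := dilation a
      invFun := dilation a⁻¹
      map_add' := fun x y => by ext k; simp [dilation_apply, mul_add]
      map_smul' := fun c x => by ext k; simp [dilation_apply]; ring
      left_inv := fun x => by rw [dilation_dilation, inv_mul_cancel₀ ha, dilation_one]
      right_inv := fun x => by rw [dilation_dilation, mul_inv_cancel₀ ha, dilation_one] }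

lemma dilation_smul (a c : ℝ) (z : Space δ) : dilation a (c • z) = c • dilation a z := by
  ext k; simp [dilation_apply]; ring

/-- The dilation by `2 ^ k`. -/
def dil (k : ℤ) : Space δ ≃L[ℝ] Space δ := dilEquiv ((2 : ℝ) ^ k) (by positivity)

lemma dil_apply (k : ℤ) (z : Space δ) : dil k z = dilation ((2 : ℝ) ^ k) z := rfl

lemma dil_dil (j k : ℤ) (z : Space δ) : dil j (dil k z) = dil (j + k) z := by
  rw [dil_apply, dil_apply, dil_apply, dilation_dilation, zpow_add₀ (by norm_num)]

lemma dil_zero (z : Space δ) : dil 0 z = z := by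
  rw [dil_apply, zpow_zero, dilation_one]

lemma compL_dil_dil (j k : ℤ) (φ : 𝓢(Space δ, ℂ)) : compL (dil j) (compL (dil k) φ) =
    compL (dil (j + k)) φ := by
  ext x
  change φ (dil k (dil j x)) = φ (dil (j + k) x)
  rw [dil_dil, _root_.add_comm k j]

lemma anisoNorm_dilation {a : ℝ} (ha : 0 ≤ a) (z : Space δ) :
    anisoNorm (dilation a z) = a * anisoNorm z := by
  unfold anisoNorm
  rw [Finset.mul_sum]
  refine Finset.sum_congr rfl fun i _ => ?_
  have h1 : ∑ k : Fin (δ i), dilation a z ⟨i, k⟩ ^ 2 =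
      (a ^ (2 * (i : ℕ) + 1)) ^ 2 * ∑ k : Fin (δ i), z ⟨i, k⟩ ^ 2 := by
    rw [Finset.mul_sum]
    refine Finset.sum_congr rfl fun k _ => ?_
    rw [dilation_apply]
    ring
  rw [h1, Real.sqrt_mul (by positivity), Real.sqrt_sq (by positivity),
    Real.mul_rpow (by positivity) (Real.sqrt_nonneg _)]
  congr 1
  rw [← Real.rpow_natCast, ← Real.rpow_mul ha]
  have : ((2 * (i : ℕ) + 1 : ℕ) : ℝ) * (1 / (2 * (i : ℝ) + 1)) = 1 := by
    push_cast
    field_simp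
  rw [this, Real.rpow_one]

lemma continuous_anisoNorm : Continuous (anisoNorm : Space δ → ℝ) := by
  unfold anisoNorm
  refine continuous_finsetSum _ fun i _ => ?_
  refine Continuous.rpow_const (by fun_prop) fun z => Or.inr (by positivity)

/-- Each exponent 1/(2i+1) is at most one, so each term is subadditive. -/
lemma anisoNorm_add_le (x y : Space δ) : anisoNorm (x + y) ≤ anisoNorm x + anisoNorm y := by
  unfold anisoNorm
  rw [← Finset.sum_add_distrib]
  refine Finset.sum_le_sum fun i _ => ?_
  have h1 : Real.sqrt (∑ k : Fin (δ i), (x + y) ⟨i, k⟩ ^ 2) ≤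
      Real.sqrt (∑ k : Fin (δ i), x ⟨i, k⟩ ^ 2) + Real.sqrt (∑ k : Fin (δ i), y ⟨i, k⟩ ^ 2) := by
    have h := norm_add_le (WithLp.toLp 2 fun k => x ⟨i, k⟩ : EuclideanSpace ℝ (Fin (δ i)))
      (WithLp.toLp 2 fun k => y ⟨i, k⟩)
    simpa [EuclideanSpace.norm_eq] using h
  refine (Real.rpow_le_rpow (Real.sqrt_nonneg _) h1 (by positivity)).trans ?_
  refine Real.rpow_add_le_add_rpow (Real.sqrt_nonneg _) (Real.sqrt_nonneg _) (by positivity) ?_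
  rw [div_le_one (by positivity)]
  have : (0 : ℝ) ≤ (i : ℕ) := Nat.cast_nonneg _
  linarith

/-- The anisotropic size of a frequency. -/
def fsize (ζ : Space δ) : ℝ := anisoNorm ((2 * Real.pi) • ζ)

lemma fsize_dilation {a : ℝ} (ha : 0 ≤ a) (ζ : Space δ) : fsize (dilation a ζ) = a * fsize ζ := by
  rw [fsize, ← dilation_smul, anisoNorm_dilation ha, fsize]

lemma fsize_add_le (x y : Space δ) : fsize (x + y) ≤ fsize x + fsize y := by
  unfold fsize
  rw [smul_add]
  exact anisoNorm_add_le _ _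

lemma continuous_fsize : Continuous (fsize : Space δ → ℝ) :=
  continuous_anisoNorm.comp (continuous_const_smul _)

/-! ### Dyadic cut-offs and blocks as operators on test functions -/

variable (ρ : Generator δ)

/-- The multiplier of the low-frequency cut-off at scale `2 ^ k`. -/
def cut (k : ℤ) : 𝓢(Space δ, ℂ) := compL (dil (-k)) (symbol ρ 0)

lemma cut_apply (k : ℤ) (ζ : Space δ) :
    cut ρ k ζ = ((ρ.1 (dilation ((2 : ℝ) ^ (-k)) ((2 * Real.pi) • ζ)) : ℝ) : ℂ) := by
  rw [dilation_smul]
  rfl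

lemma anisoNorm_scaled (k : ℤ) (ζ : Space δ) :
    anisoNorm (dilation ((2 : ℝ) ^ (-k)) ((2 * Real.pi) • ζ)) = fsize ζ / 2 ^ k := by
  rw [anisoNorm_dilation (by positivity), fsize, zpow_neg, inv_mul_eq_div]

lemma cut_eq_one {k : ℤ} {ζ : Space δ} (h : fsize ζ ≤ 2 ^ k / 2) : cut ρ k ζ = 1 := by
  rw [cut_apply, ρ.2.eq_one, Complex.ofReal_one]
  rw [anisoNorm_scaled, div_le_iff₀ (by positivity)]
  linarith

lemma cut_eq_zero {k : ℤ} {ζ : Space δ} (h : 2 ^ k * (2 / 3) < fsize ζ) : cut ρ k ζ = 0 := by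
  rw [cut_apply, Complex.ofReal_eq_zero]
  by_contra h0
  have := ρ.2.support _ h0
  rw [anisoNorm_scaled, div_le_iff₀ (by positivity)] at this
  linarith

lemma fsize_le_of_cut_ne_zero {k : ℤ} {ζ : Space δ} (h : cut ρ k ζ ≠ 0) :
    fsize ζ ≤ 2 ^ k * (2 / 3) := by
  by_contra h0
  exact h (cut_eq_zero ρ (not_le.1 h0))

/-- The smaller cut-off lives where the size is at most (2/3)2^j, and the larger one equals 1 up to
2^k/2 ≥ 2^j. -/
lemma cut_mul_cut {j k : ℤ} (h : j < k) (ζ : Space δ) : cut ρ j ζ * cut ρ k ζ = cut ρ j ζ := by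
  by_cases h0 : cut ρ j ζ = 0
  · rw [h0, zero_mul]
  · have h1 := fsize_le_of_cut_ne_zero ρ h0
    have h2 : (2 : ℝ) ^ (j + 1) ≤ 2 ^ k := zpow_le_zpow_right₀ (by norm_num) h
    rw [zpow_add_one₀ (by norm_num)] at h2
    have h3 : (0 : ℝ) < 2 ^ j := by positivity
    rw [cut_eq_one ρ (k := k) (by linarith), mul_one]

lemma symbol_zero : symbol ρ 0 = cut ρ 0 := by
  ext ζ
  change symbol ρ 0 ζ = symbol ρ 0 (dil (-0) ζ)
  rw [neg_zero, dil_zero]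

/-- With the index shift, block n+1 is the difference of the cut-offs at scales 2^{n+1} and 2^n, so
sums of blocks telescope. -/
lemma symbol_succ (n : ℕ) : symbol ρ (n + 1) = cut ρ (n + 1) - cut ρ n := by
  ext ζ
  rw [sub_apply, cut_apply, cut_apply]
  change symbolFun ρ (n + 1) ζ = _
  simp only [symbolFun, partition]
  push_cast
  congr 4
  · rw [zpow_neg, inv_pow]; norm_cast
  · rw [zpow_neg, inv_pow]; norm_cast

lemma hasCompactSupport_cut (k : ℤ) : HasCompactSupport (cut ρ k) :=
  (hasCompactSupport_symbolFun ρ 0).comp_homeomorph (dil (-k)).toHomeomorph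

lemma compL_dil_cut (j k : ℤ) : compL (dil (-j)) (cut ρ k) = cut ρ (k + j) := by
  unfold cut
  rw [compL_dil_dil]
  congr 2
  ring_nf

/-- The `L¹` norm of the kernel of the cut-offs. -/
def cutConst : ℝ := l1 (𝓕 (symbol ρ 0))

lemma cutConst_nonneg : 0 ≤ cutConst ρ := l1_nonneg _

lemma l1_fourier_cut (k : ℤ) : l1 (𝓕 (cut ρ k)) = cutConst ρ := l1_fourier_compL _ _

/-- The low-frequency cut-off acting on Schwartz functions. -/
def lowPass (k : ℤ) : 𝓢(Space δ, ℂ) →L[ℂ] 𝓢(Space δ, ℂ) := mult (cut ρ k)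

/-- The adjoint of the Paley-Littlewood block. -/
def dblock (n : ℕ) : 𝓢(Space δ, ℂ) →L[ℂ] 𝓢(Space δ, ℂ) := mult (symbol ρ n)

lemma l1_lowPass_le (k : ℤ) (φ : 𝓢(Space δ, ℂ)) : l1 (lowPass ρ k φ) ≤ cutConst ρ * l1 φ := by
  have := l1_mult_le (cut ρ k) φ
  rwa [l1_fourier_cut] at this

lemma mult_add (m n φ : 𝓢(Space δ, ℂ)) : mult (m + n : 𝓢(Space δ, ℂ)) φ = mult m φ + mult n φ := by
  refine eq_of_fourierInv fun ξ => ?_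
  rw [FourierTransform.fourierInv_add, fourierInv_mult (m + n).hasTemperateGrowth, add_apply,
    add_apply, fourierInv_mult m.hasTemperateGrowth, fourierInv_mult n.hasTemperateGrowth]
  ring

lemma mult_sub (m n φ : 𝓢(Space δ, ℂ)) : mult (m - n : 𝓢(Space δ, ℂ)) φ = mult m φ - mult n φ := by
  rw [eq_sub_iff_add_eq, ← mult_add, sub_add_cancel]

lemma dblock_zero (φ : 𝓢(Space δ, ℂ)) : dblock ρ 0 φ = lowPass ρ 0 φ := by
  rw [dblock, symbol_zero]; rfl

lemma dblock_succ (n : ℕ) (φ : 𝓢(Space δ, ℂ)) :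
    dblock ρ (n + 1) φ = lowPass ρ (n + 1) φ - lowPass ρ n φ := by
  rw [dblock, symbol_succ]
  exact mult_sub _ _ _

lemma sum_dblock (n : ℕ) (φ : 𝓢(Space δ, ℂ)) :
    ∑ i ∈ Finset.range (n + 1), dblock ρ i φ = lowPass ρ n φ := by
  induction n with
  | zero => simp [dblock_zero]
  | succ n ih =>
    rw [Finset.sum_range_succ, ih, dblock_succ]
    push_cast
    abel

lemma l1_dblock_le (n : ℕ) (φ : 𝓢(Space δ, ℂ)) : l1 (dblock ρ n φ) ≤ 2 * cutConst ρ * l1 φ := by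
  have h0 := mul_nonneg (cutConst_nonneg ρ) (l1_nonneg φ)
  cases n with
  | zero =>
    rw [dblock_zero]
    exact (l1_lowPass_le ρ 0 φ).trans (by linarith)
  | succ n =>
    rw [dblock_succ]
    refine (map_sub_le_add l1 _ _).trans ?_
    have h1 := l1_lowPass_le ρ (n + 1) φ
    have h2 := l1_lowPass_le ρ n φ
    linarith

lemma lowPass_comm (j k : ℤ) (φ : 𝓢(Space δ, ℂ)) :
    lowPass ρ j (lowPass ρ k φ) = lowPass ρ k (lowPass ρ j φ) :=
  mult_comm (cut ρ j).hasTemperateGrowth (cut ρ k).hasTemperateGrowth φ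

lemma lowPass_lowPass {j k : ℤ} (h : j < k) (φ : 𝓢(Space δ, ℂ)) :
    lowPass ρ j (lowPass ρ k φ) = lowPass ρ j φ := by
  rw [lowPass, lowPass, mult_mult (cut ρ j).hasTemperateGrowth (cut ρ k).hasTemperateGrowth]
  congr 2
  exact funext fun ξ => cut_mul_cut ρ h ξ

lemma lowPass_dblock {n : ℕ} {k : ℤ} (h : (n : ℤ) < k) (φ : 𝓢(Space δ, ℂ)) :
    lowPass ρ k (dblock ρ n φ) = dblock ρ n φ := by
  cases n with
  | zero =>
    rw [dblock_zero, lowPass_comm, lowPass_lowPass ρ (by exact_mod_cast h)]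
  | succ n =>
    rw [dblock_succ, map_sub, lowPass_comm ρ k, lowPass_comm ρ k,
      lowPass_lowPass ρ (by push_cast at h; omega), lowPass_lowPass ρ (by push_cast at h; omega)]

/-- Block 0 is excluded: it is itself a cut-off, and a cut-off at a smaller scale does not
annihilate it. -/
lemma lowPass_dblock_eq_zero {n : ℕ} {k : ℤ} (h : k + 1 < (n : ℤ)) (hn : n ≠ 0)
    (φ : 𝓢(Space δ, ℂ)) : lowPass ρ k (dblock ρ n φ) = 0 := by
  obtain ⟨n, rfl⟩ := Nat.exists_eq_succ_of_ne_zero hn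
  rw [dblock_succ, map_sub, lowPass_lowPass ρ (by push_cast at h; omega),
      lowPass_lowPass ρ (by push_cast at h; omega), sub_self]

lemma dblock_dblock_eq_zero {m n : ℕ} (h : m + 1 < n) (φ : 𝓢(Space δ, ℂ)) :
    dblock ρ m (dblock ρ n φ) = 0 := by
  cases m with
  | zero => rw [dblock_zero, lowPass_dblock_eq_zero ρ (by omega) (by omega)]
  | succ m =>
    rw [dblock_succ, lowPass_dblock_eq_zero ρ (by omega) (by omega),
      lowPass_dblock_eq_zero ρ (by omega) (by omega), sub_self]

end

section

variable {r : ℕ} {δ : Fin (r + 1) → ℕ}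

/-! ### Decay of the blocks of a Schwartz function -/

/-- A test function whose support is compact and does not contain the origin. -/
structure IsAnnular {E : Type*} [NormedAddCommGroup E] [NormedSpace ℝ E] (χ : 𝓢(E, ℂ)) : Prop where
  compact : HasCompactSupport χ
  vanish : ∃ c > 0, ∀ ξ, ‖ξ‖ < c → χ ξ = 0

/-- Division by ‖ξ‖² is harmless because `χ` vanishes near the origin. Each division is later worth
one factor 4^{-n} on a block, or one power of a Gaussian parameter. -/
lemma IsAnnular.exists_div {E : Type*} [NormedAddCommGroup E] [InnerProductSpace ℝ E]
    {χ : 𝓢(E, ℂ)} (h : IsAnnular χ) :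
    ∃ χ' : 𝓢(E, ℂ), IsAnnular χ' ∧ ∀ ξ, χ ξ = ((‖ξ‖ ^ 2 : ℝ) : ℂ) * χ' ξ := by
  obtain ⟨c, hc, hv⟩ := h.vanish
  have hsm : ContDiff ℝ ∞ fun ξ => (((‖ξ‖ ^ 2)⁻¹ : ℝ) : ℂ) * χ ξ := by
    rw [contDiff_iff_contDiffAt]
    intro ξ
    by_cases hξ : ξ = 0
    · have : (fun ξ => (((‖ξ‖ ^ 2)⁻¹ : ℝ) : ℂ) * χ ξ) =ᶠ[𝓝 ξ] fun _ => 0 := by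
        filter_upwards [Metric.ball_mem_nhds ξ hc] with z hz
        rw [hξ, mem_ball_zero_iff] at hz
        rw [hv z hz, mul_zero]
      exact contDiffAt_const.congr_of_eventuallyEq this
    · have h1 : ContDiffAt ℝ ∞ (fun ξ : E => (‖ξ‖ ^ 2)⁻¹) ξ :=
        ContDiffAt.inv ((contDiff_norm_sq ℝ).contDiffAt) (by simpa using hξ)
      exact (Complex.ofRealCLM.contDiff.contDiffAt.comp ξ h1).mul χ.smooth'.contDiffAt
  have hcs : HasCompactSupport fun ξ => (((‖ξ‖ ^ 2)⁻¹ : ℝ) : ℂ) * χ ξ := h.compact.mul_left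
  refine ⟨hcs.toSchwartzMap hsm, ⟨hcs, c, hc, fun ξ hξ => ?_⟩, fun ξ => ?_⟩
  · change (((‖ξ‖ ^ 2)⁻¹ : ℝ) : ℂ) * χ ξ = 0
    rw [hv ξ hξ, mul_zero]
  · change χ ξ = ((‖ξ‖ ^ 2 : ℝ) : ℂ) * ((((‖ξ‖ ^ 2)⁻¹ : ℝ) : ℂ) * χ ξ)
    by_cases h0 : ‖ξ‖ < c
    · rw [hv ξ h0]; simp
    · have : ‖ξ‖ ^ 2 ≠ 0 := by
        have : 0 < ‖ξ‖ := hc.trans_le (not_lt.1 h0)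
        positivity
      rw [← mul_assoc, ← Complex.ofReal_mul, mul_inv_cancel₀ this, Complex.ofReal_one, one_mul]

/-- The square of a coordinate, as a multiplier. -/
def coordSq (k : Coord δ) (ξ : Space δ) : ℂ := ((ξ k ^ 2 : ℝ) : ℂ)

lemma hasTemperateGrowth_coord (k : Coord δ) :
    Function.HasTemperateGrowth fun ξ : Space δ => ξ k :=
  (EuclideanSpace.proj (𝕜 := ℝ) k : Space δ →L[ℝ] ℝ).hasTemperateGrowth

lemma hasTemperateGrowth_coordSq (k : Coord δ) : (coordSq k : Space δ → ℂ).HasTemperateGrowth := by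
  have h := hasTemperateGrowth_coord (δ := δ) k
  exact Function.HasTemperateGrowth.comp
    (g := (Complex.ofReal : ℝ → ℂ)) Function.Complex.hasTemperateGrowth_ofReal (h.pow 2)

lemma norm_sq_dil_neg (n : ℕ) (ξ : Space δ) :
    ‖dil (-(n : ℤ)) ξ‖ ^ 2 = ∑ k : Coord δ, ((4 : ℝ) ^ n)⁻¹ ^ (2 * (k.1 : ℕ) + 1) * ξ k ^ 2 := by
  rw [EuclideanSpace.norm_sq_eq]
  refine Finset.sum_congr rfl fun k _ => ?_
  rw [dil_apply, dilation_apply, Real.norm_eq_abs, sq_abs, mul_pow, ← pow_mul, mul_comm _ 2,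
    pow_mul, zpow_neg, zpow_natCast, inv_pow, ← pow_mul, mul_comm n 2, pow_mul]
  norm_num

lemma exists_seminorm_mul {E : Type*} [NormedAddCommGroup E] [NormedSpace ℝ E]
    {q : Seminorm ℂ 𝓢(E, ℂ)} (hq : Continuous q) {c : ℝ} (hc : 0 ≤ c) :
    ∃ q' : Seminorm ℂ 𝓢(E, ℂ), Continuous q' ∧ ∀ φ, q' φ = c * q φ := by
  refine ⟨c.toNNReal • q, hq.const_smul c.toNNReal, fun φ => ?_⟩
  rw [smul_apply, NNReal.smul_def, Real.coe_toNNReal c hc, smul_eq_mul]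

lemma seminorm_sum_apply {V ι : Type*} [AddCommGroup V] [Module ℂ V] (q : ι → Seminorm ℂ V)
    (s : Finset ι) (φ : V) : (∑ k ∈ s, q k) φ = ∑ k ∈ s, q k φ :=
  sum_apply s q φ

lemma seminorm_map_sum_le {V ι : Type*} [AddCommGroup V] [Module ℂ V] (q : Seminorm ℂ V)
    (s : Finset ι) (v : ι → V) : q (∑ k ∈ s, v k) ≤ ∑ k ∈ s, q (v k) :=
  Finset.le_sum_of_subadditive q (map_zero q).le (map_add_le_add q) s v

/-- Induction on `j`. Writing χ = ‖ξ‖²χ' and dilating, ‖ξ‖² becomes the sum of 4^{-n(2i+1)}ξ_k².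
Each ξ_k² is moved onto `φ` as a multiplier, hence into the seminorm, and each coefficient is at
most 4^{-n}. -/
theorem exists_seminorm_decay (j : ℕ) : ∀ χ : 𝓢(Space δ, ℂ), IsAnnular χ →
    ∃ q : Seminorm ℂ 𝓢(Space δ, ℂ), Continuous q ∧ ∀ (n : ℕ) (φ : 𝓢(Space δ, ℂ)),
      l1 (mult (compL (dil (-(n : ℤ))) χ) φ) ≤ (((4 : ℝ) ^ n)⁻¹) ^ j * q φ := by
  induction j with
  | zero =>
    intro χ _
    obtain ⟨q, hq, hq'⟩ := exists_seminorm_mul (E := Space δ) continuous_l1 (l1_nonneg (𝓕 χ))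
    refine ⟨q, hq, fun n φ => ?_⟩
    rw [pow_zero, one_mul, hq']
    have := l1_mult_le (compL (dil (-(n : ℤ))) χ) φ
    rwa [l1_fourier_compL] at this
  | succ j ih =>
    intro χ hχ
    obtain ⟨χ', hχ', heq⟩ := hχ.exists_div
    obtain ⟨q, hq, hqb⟩ := ih χ' hχ'
    refine ⟨∑ k : Coord δ, q.comp (mult (coordSq k)).toLinearMap, ?_, fun n φ => ?_⟩
    · have : (⇑(∑ k : Coord δ, q.comp (mult (coordSq k)).toLinearMap) : 𝓢(Space δ, ℂ) → ℝ) =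
          fun φ => ∑ k : Coord δ, q (mult (coordSq k) φ) := by
        ext φ
        rw [seminorm_sum_apply]
        rfl
      rw [this]
      exact continuous_finsetSum _ fun k _ => hq.comp (mult (coordSq k)).continuous
    · have h1 : mult (compL (dil (-(n : ℤ))) χ) φ = ∑ k : Coord δ,
          ((((4 : ℝ) ^ n)⁻¹ ^ (2 * (k.1 : ℕ) + 1) : ℝ) : ℂ) •
            mult (compL (dil (-(n : ℤ))) χ') (mult (coordSq k) φ) := by
        refine eq_of_fourierInv fun ξ => ?_
        have h2 : 𝓕⁻ (∑ k : Coord δ, ((((4 : ℝ) ^ n)⁻¹ ^ (2 * (k.1 : ℕ) + 1) : ℝ) : ℂ) •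
            mult (compL (dil (-(n : ℤ))) χ') (mult (coordSq k) φ)) =
          ∑ k : Coord δ, ((((4 : ℝ) ^ n)⁻¹ ^ (2 * (k.1 : ℕ) + 1) : ℝ) : ℂ) •
            𝓕⁻ (mult (compL (dil (-(n : ℤ))) χ') (mult (coordSq k) φ)) := by
          have := map_sum (FourierTransform.fourierInvCLM ℂ 𝓢(Space δ, ℂ)) (fun k : Coord δ =>
            ((((4 : ℝ) ^ n)⁻¹ ^ (2 * (k.1 : ℕ) + 1) : ℝ) : ℂ) •
              mult (compL (dil (-(n : ℤ))) χ') (mult (coordSq k) φ)) Finset.univ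
          exact this.trans (Finset.sum_congr rfl fun k _ => map_smul _ _ _)
        rw [h2, fourierInv_mult (SchwartzMap.hasTemperateGrowth _), sum_apply]
        have h3 : ∀ k : Coord δ, (((((4 : ℝ) ^ n)⁻¹ ^ (2 * (k.1 : ℕ) + 1) : ℝ) : ℂ) •
            𝓕⁻ (mult (compL (dil (-(n : ℤ))) χ') (mult (coordSq k) φ))) ξ =
            ((((4 : ℝ) ^ n)⁻¹ ^ (2 * (k.1 : ℕ) + 1) * ξ k ^ 2 : ℝ) : ℂ) *
              (χ' (dil (-(n : ℤ)) ξ) * (𝓕⁻ φ) ξ) := by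
          intro k
          rw [smul_apply, fourierInv_mult (SchwartzMap.hasTemperateGrowth _),
            fourierInv_mult (hasTemperateGrowth_coordSq k), smul_eq_mul]
          change _ * (χ' (dil (-(n : ℤ)) ξ) * _) = _
          rw [coordSq]
          push_cast
          ring
        rw [Finset.sum_congr rfl fun k _ => h3 k, ← Finset.sum_mul, ← Complex.ofReal_sum,
          ← norm_sq_dil_neg]
        change χ (dil (-(n : ℤ)) ξ) * _ = _
        rw [heq (dil (-(n : ℤ)) ξ)]
        ring
      rw [h1]
      refine (seminorm_map_sum_le l1 _ _).trans ?_
      rw [seminorm_sum_apply, Finset.mul_sum]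
      refine Finset.sum_le_sum fun k _ => ?_
      rw [map_smul_eq_mul, Complex.norm_real, Real.norm_of_nonneg (by positivity)]
      have h4 := hqb n (mult (coordSq k) φ)
      have h5 : ((4 : ℝ) ^ n)⁻¹ ^ (2 * (k.1 : ℕ) + 1) ≤ ((4 : ℝ) ^ n)⁻¹ :=
        pow_le_of_le_one (by positivity) (inv_le_one_of_one_le₀ (one_le_pow₀ (by norm_num)))
          (by omega)
      calc _ ≤ ((4 : ℝ) ^ n)⁻¹ * ((((4 : ℝ) ^ n)⁻¹) ^ j * q (mult (coordSq k) φ)) := by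
            gcongr
        _ = (((4 : ℝ) ^ n)⁻¹) ^ (j + 1) * q.comp (mult (coordSq k)).toLinearMap φ := by
            change _ = _ * q (mult (coordSq k) φ)
            ring

variable (ρ : Generator δ)

lemma fsize_zero : fsize (0 : Space δ) = 0 := by
  have := fsize_dilation (le_refl (0 : ℝ)) (0 : Space δ)
  rw [zero_mul] at this
  rw [← this]
  congr 1
  ext k
  simp [dilation_apply]

lemma exists_fsize_lt {c : ℝ} (hc : 0 < c) : ∃ s > 0, ∀ ξ : Space δ, ‖ξ‖ < s → fsize ξ < c := by
  have h := (continuous_fsize (δ := δ)).tendsto 0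
  rw [fsize_zero] at h
  obtain ⟨s, hs, h2⟩ := Metric.eventually_nhds_iff_ball.1 (h.eventually_lt_const hc)
  exact ⟨s, hs, fun ξ hξ => h2 ξ (by simpa using hξ)⟩

/-- The annular multiplier `ρ - ρ(2 ·)`. -/
def annulus : 𝓢(Space δ, ℂ) := cut ρ 0 - cut ρ (-1)

lemma isAnnular_annulus : IsAnnular (annulus ρ) := by
  refine ⟨?_, ?_⟩
  · have : (annulus ρ : Space δ → ℂ) = (cut ρ 0 : Space δ → ℂ) - cut ρ (-1) := rfl
    rw [this, sub_eq_add_neg]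
    exact (hasCompactSupport_cut ρ 0).add (hasCompactSupport_cut ρ (-1)).neg
  · obtain ⟨s, hs, h⟩ := exists_fsize_lt (δ := δ) (c := 1 / 4) (by norm_num)
    refine ⟨s, hs, fun ξ hξ => ?_⟩
    have := h ξ hξ
    rw [annulus, sub_apply, cut_eq_one ρ (by norm_num; linarith),
      cut_eq_one ρ (by norm_num; linarith), sub_self]

lemma symbol_succ_eq (n : ℕ) :
    symbol ρ (n + 1) = compL (dil (-((n + 1 : ℕ) : ℤ))) (annulus ρ) := by
  rw [annulus, map_sub, compL_dil_cut, compL_dil_cut, symbol_succ]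
  congr 2
  · push_cast; ring
  · push_cast; ring

lemma exists_seminorm_dblock (j : ℕ) : ∃ q : Seminorm ℂ 𝓢(Space δ, ℂ), Continuous q ∧
    ∀ (n : ℕ) (φ : 𝓢(Space δ, ℂ)), l1 (dblock ρ n φ) ≤ (((4 : ℝ) ^ n)⁻¹) ^ j * q φ := by
  obtain ⟨q, hq, hqb⟩ := exists_seminorm_decay j (annulus ρ) (isAnnular_annulus ρ)
  have hc : 0 ≤ 2 * cutConst ρ := mul_nonneg zero_le_two (cutConst_nonneg ρ)
  obtain ⟨q2, hq2, hq2'⟩ := exists_seminorm_mul (E := Space δ) continuous_l1 hc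
  -- The second seminorm only serves block 0, which is not annular and for which the decay factor is
  -- 1.
  refine ⟨q + q2, hq.add hq2, fun n φ => ?_⟩
  · have h0 : (q + q2) φ = q φ + 2 * cutConst ρ * l1 φ := by rw [add_apply, hq2']
    rw [h0]
    have h1 : 0 ≤ q φ := apply_nonneg _ _
    have h2 := mul_nonneg hc (l1_nonneg φ)
    cases n with
    | zero =>
      have := l1_dblock_le ρ 0 φ
      simp only [pow_zero, inv_one, one_pow, one_mul]
      linarith
    | succ n =>
      rw [dblock, symbol_succ_eq]
      refine (hqb (n + 1) φ).trans ?_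
      gcongr
      linarith

/-- The dual Besov norm `N_θ(φ) = ∑ n, 2^{nθ} ‖Δ'_n φ‖_{L¹}` on Schwartz functions. -/
def dnorm (θ : ℝ) (φ : 𝓢(Space δ, ℂ)) : ℝ :=
  ∑' n : ℕ, (2 : ℝ) ^ ((n : ℝ) * θ) * l1 (dblock ρ n φ)

/-- Taking j ≥ θ+1 in the decay 4^{-nj} absorbs the weight 2^{nθ} and leaves the summable factor
2^{-n}. -/
lemma exists_seminorm_dnorm (θ : ℝ) : ∃ q : Seminorm ℂ 𝓢(Space δ, ℂ), Continuous q ∧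
    ∀ (n : ℕ) (φ : 𝓢(Space δ, ℂ)),
      (2 : ℝ) ^ ((n : ℝ) * θ) * l1 (dblock ρ n φ) ≤ (1 / 2) ^ n * q φ := by
  obtain ⟨j, hj⟩ := exists_nat_ge (θ + 1)
  obtain ⟨q, hq, hqb⟩ := exists_seminorm_dblock ρ j
  refine ⟨q, hq, fun n φ => ?_⟩
  have h2 : (2 : ℝ) ^ ((n : ℝ) * θ) * (((4 : ℝ) ^ n)⁻¹) ^ j ≤ (1 / 2) ^ n := by
    have h4 : (((4 : ℝ) ^ n)⁻¹) ^ j = (2 : ℝ) ^ (-(2 * n * j : ℝ)) := by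
      rw [Real.rpow_neg (by norm_num), inv_pow, ← pow_mul]
      congr 1
      rw [show (4 : ℝ) = 2 ^ 2 by norm_num, ← pow_mul]
      norm_cast
      rw [mul_assoc]
    have h5 : (1 / 2 : ℝ) ^ n = (2 : ℝ) ^ (-(n : ℝ)) := by
      rw [Real.rpow_neg (by norm_num), one_div, inv_pow, Real.rpow_natCast]
    rw [h4, h5, ← Real.rpow_add (by norm_num)]
    refine Real.rpow_le_rpow_of_exponent_le (by norm_num) ?_
    have hn : (0 : ℝ) ≤ n := Nat.cast_nonneg n
    have hj0 : (0 : ℝ) ≤ j := Nat.cast_nonneg j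
    nlinarith [mul_nonneg hn hj0, mul_le_mul_of_nonneg_left hj hn]
  calc _ ≤ (2 : ℝ) ^ ((n : ℝ) * θ) * ((((4 : ℝ) ^ n)⁻¹) ^ j * q φ) := by gcongr; exact hqb n φ
    _ = ((2 : ℝ) ^ ((n : ℝ) * θ) * (((4 : ℝ) ^ n)⁻¹) ^ j) * q φ := by ring
    _ ≤ _ := by
      have := apply_nonneg q φ
      gcongr

lemma dnorm_term_nonneg (θ : ℝ) (φ : 𝓢(Space δ, ℂ)) (n : ℕ) :
    0 ≤ (2 : ℝ) ^ ((n : ℝ) * θ) * l1 (dblock ρ n φ) :=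
  mul_nonneg (by positivity) (l1_nonneg _)

lemma summable_dnorm (θ : ℝ) (φ : 𝓢(Space δ, ℂ)) :
    Summable fun n : ℕ => (2 : ℝ) ^ ((n : ℝ) * θ) * l1 (dblock ρ n φ) := by
  obtain ⟨q, -, hqb⟩ := exists_seminorm_dnorm ρ θ
  refine Summable.of_nonneg_of_le (dnorm_term_nonneg ρ θ φ) (fun n => hqb n φ) ?_
  exact summable_geometric_two.mul_right _

/-- This makes every functional bounded by a dual norm continuous for the Schwartz topology, hence a
tempered distribution. -/
lemma exists_dnorm_le_seminorm (θ : ℝ) : ∃ q : Seminorm ℂ 𝓢(Space δ, ℂ), Continuous q ∧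
    ∀ φ : 𝓢(Space δ, ℂ), dnorm ρ θ φ ≤ 2 * q φ := by
  obtain ⟨q, hq, hqb⟩ := exists_seminorm_dnorm ρ θ
  refine ⟨q, hq, fun φ => ?_⟩
  refine ((summable_dnorm ρ θ φ).tsum_le_tsum (fun n => hqb n φ)
    (summable_geometric_two.mul_right _)).trans ?_
  rw [tsum_mul_right, tsum_geometric_two]

lemma dnorm_nonneg (θ : ℝ) (φ : 𝓢(Space δ, ℂ)) : 0 ≤ dnorm ρ θ φ :=
  tsum_nonneg (dnorm_term_nonneg ρ θ φ)

lemma dnorm_add_le (θ : ℝ) (φ ψ : 𝓢(Space δ, ℂ)) :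
    dnorm ρ θ (φ + ψ) ≤ dnorm ρ θ φ + dnorm ρ θ ψ := by
  unfold dnorm
  rw [← (summable_dnorm ρ θ φ).tsum_add (summable_dnorm ρ θ ψ)]
  refine (summable_dnorm ρ θ _).tsum_le_tsum (fun n => ?_)
    ((summable_dnorm ρ θ φ).add (summable_dnorm ρ θ ψ))
  rw [map_add, ← mul_add]
  gcongr
  exact map_add_le_add _ _ _

lemma dnorm_mono {θ θ' : ℝ} (h : θ ≤ θ') (φ : 𝓢(Space δ, ℂ)) : dnorm ρ θ φ ≤ dnorm ρ θ' φ := by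
  refine (summable_dnorm ρ θ φ).tsum_le_tsum (fun n => ?_) (summable_dnorm ρ θ' φ)
  refine mul_le_mul_of_nonneg_right ?_ (l1_nonneg _)
  exact Real.rpow_le_rpow_of_exponent_le (by norm_num) (by gcongr)

lemma le_dnorm (θ : ℝ) (φ : 𝓢(Space δ, ℂ)) (n : ℕ) :
    (2 : ℝ) ^ ((n : ℝ) * θ) * l1 (dblock ρ n φ) ≤ dnorm ρ θ φ :=
  (summable_dnorm ρ θ φ).le_tsum n fun m _ => dnorm_term_nonneg ρ θ φ m

end

section

variable {r : ℕ} {δ : Fin (r + 1) → ℕ} (ρ : Generator δ)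

/-! ### Convergence of the Paley-Littlewood decomposition and duality -/

lemma norm_dil_neg_le (n : ℕ) (ξ : Space δ) : ‖dil (-(n : ℤ)) ξ‖ ≤ ‖ξ‖ := by
  refine le_of_sq_le_sq ?_ (norm_nonneg _)
  rw [norm_sq_dil_neg, EuclideanSpace.norm_sq_eq]
  refine Finset.sum_le_sum fun k _ => ?_
  rw [Real.norm_eq_abs, sq_abs]
  refine mul_le_of_le_one_left (sq_nonneg _) (pow_le_one₀ (by positivity) ?_)
  exact inv_le_one_of_one_le₀ (one_le_pow₀ (by norm_num))

/-- The bound is uniform in `n` because the dilation by 2^{-n} is a contraction. -/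
lemma norm_iteratedFDeriv_cut_sub_one_le (n i : ℕ) (ξ : Space δ) :
    ‖iteratedFDeriv ℝ i (fun ξ => cut ρ n ξ - 1) ξ‖ ≤
      SchwartzMap.seminorm ℝ 0 i (symbol ρ 0) + 1 := by
  have h1 : iteratedFDeriv ℝ i (fun ξ => cut ρ n ξ - 1) ξ =
      iteratedFDeriv ℝ i (cut ρ n) ξ - iteratedFDeriv ℝ i (fun _ : Space δ => (1 : ℂ)) ξ :=
    iteratedFDeriv_sub_apply ((cut ρ n).smooth i).contDiffAt contDiffAt_const
  rw [h1]
  refine (norm_sub_le _ _).trans (add_le_add ?_ ?_)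
  · have h2 : (cut ρ n : Space δ → ℂ) =
        symbol ρ 0 ∘ ⇑((dil (-(n : ℤ)) : Space δ ≃L[ℝ] Space δ) : Space δ →L[ℝ] Space δ) := rfl
    rw [h2, ContinuousLinearMap.iteratedFDeriv_comp_right _ ((symbol ρ 0).smooth i) _ le_rfl]
    refine (ContinuousMultilinearMap.norm_compContinuousLinearMap_le _ _).trans ?_
    have h3 : ‖((dil (-(n : ℤ)) : Space δ ≃L[ℝ] Space δ) : Space δ →L[ℝ] Space δ)‖ ≤ 1 :=
      ContinuousLinearMap.opNorm_le_bound _ zero_le_one fun ξ => by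
        rw [one_mul]; exact norm_dil_neg_le n ξ
    refine (mul_le_of_le_one_right (norm_nonneg _)
      (Finset.prod_le_one (fun _ _ => norm_nonneg _) fun _ _ => h3)).trans ?_
    exact SchwartzMap.norm_iteratedFDeriv_le_seminorm ℝ _ i _
  · cases i with
    | zero => simp
    | succ i => rw [iteratedFDeriv_const_of_ne (by omega)]; simp

lemma iteratedFDeriv_cut_sub_one_eq_zero {n : ℕ} (i : ℕ) {ξ : Space δ}
    (h : fsize ξ < 2 ^ n / 2) : iteratedFDeriv ℝ i (fun ξ => cut ρ n ξ - 1) ξ = 0 := by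
  have h1 : (fun ξ => cut ρ n ξ - 1) =ᶠ[𝓝 ξ] fun _ => (0 : ℂ) := by
    filter_upwards [(continuous_fsize (δ := δ)).continuousAt.eventually_lt_const h] with z hz
    rw [cut_eq_one ρ (by rw [zpow_natCast]; exact hz.le), sub_self]
  rw [(h1.iteratedFDeriv ℝ i).eq_of_nhds]
  have : (fun _ : Space δ => (0 : ℂ)) = 0 := rfl
  rw [this, iteratedFDeriv_zero]
  rfl

lemma exists_fsize_lt_pow (R : ℝ) : ∃ K : ℕ, ∀ n ≥ K, ∀ ξ : Space δ, ‖ξ‖ ≤ R →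
    fsize ξ < 2 ^ n / 2 := by
  obtain ⟨M, hM⟩ := (isCompact_closedBall (0 : Space δ) R).bddAbove_image
    (continuous_fsize (δ := δ)).continuousOn
  obtain ⟨K, hK⟩ := pow_unbounded_of_one_lt (2 * M) (by norm_num : (1 : ℝ) < 2)
  refine ⟨K, fun n hn ξ hξ => ?_⟩
  have h1 : fsize ξ ≤ M := hM ⟨ξ, by simpa using hξ, rfl⟩
  have h2 : (2 : ℝ) ^ K ≤ 2 ^ n := pow_le_pow_right₀ (by norm_num) hn
  linarith

/-- On a fixed ball the cut-off is eventually identically 1, so all derivatives of the error vanish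
there. Outside the ball, one extra power of ‖ξ‖ taken from the decay of `ψ` gives a factor 1/R. -/
lemma tendsto_smulLeft_cut (ψ : 𝓢(Space δ, ℂ)) :
    Tendsto (fun n : ℕ => SchwartzMap.smulLeftCLM ℂ (cut ρ n) ψ) atTop (𝓝 ψ) := by
  rw [(schwartz_withSeminorms ℝ (Space δ) ℂ).tendsto_nhds]
  intro ⟨p, l⟩ ε hε
  set G : ℕ → ℝ := fun i => SchwartzMap.seminorm ℝ 0 i (symbol ρ 0) + 1
  have hG : ∀ i, 0 ≤ G i := fun i => add_nonneg (apply_nonneg _ _) zero_le_one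
  set D : ℝ := ∑ i ∈ Finset.range (l + 1), (l.choose i : ℝ) * G i *
    SchwartzMap.seminorm ℝ (p + 1) (l - i) ψ with hD
  have hD0 : 0 ≤ D := Finset.sum_nonneg fun i _ =>
    mul_nonneg (mul_nonneg (Nat.cast_nonneg _) (hG i)) (apply_nonneg _ _)
  -- Outside the ball the weighted error X satisfies R X ≤ D, and this radius turns the inequality
  -- into X ≤ ε/2.
  set R : ℝ := (D + 1) / (ε / 2) with hR
  have hR0 : 0 < R := by positivity
  obtain ⟨K, hK⟩ := exists_fsize_lt_pow (δ := δ) R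
  filter_upwards [eventually_ge_atTop K] with n hn
  refine lt_of_le_of_lt ?_ (half_lt_self hε)
  rw [SchwartzMap.schwartzSeminormFamily_apply]
  refine SchwartzMap.seminorm_le_bound ℝ p l _ (by positivity) fun ξ => ?_
  have h0 : ((SchwartzMap.smulLeftCLM ℂ (cut ρ n) ψ - ψ : 𝓢(Space δ, ℂ)) : Space δ → ℂ) =
      fun ξ => (cut ρ n ξ - 1) * ψ ξ := by
    ext ξ
    rw [sub_apply, SchwartzMap.smulLeftCLM_apply_apply (cut ρ n).hasTemperateGrowth, smul_eq_mul]
    ring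
  have hsm : ContDiff ℝ l (fun ξ => cut ρ n ξ - 1) := ((cut ρ n).smooth l).sub contDiff_const
  have h1 := norm_iteratedFDeriv_mul_le hsm (ψ.smooth l) ξ (n := l) le_rfl
  rw [h0]
  refine (mul_le_mul_of_nonneg_left h1 (by positivity)).trans ?_
  by_cases hξ : ‖ξ‖ ≤ R
  · have h2 : ∀ i, iteratedFDeriv ℝ i (fun ξ => cut ρ n ξ - 1) ξ = 0 := fun i =>
      iteratedFDeriv_cut_sub_one_eq_zero ρ i (hK n hn ξ hξ)
    simp only [h2, norm_zero, mul_zero, zero_mul, Finset.sum_const_zero]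
    positivity
  · rw [not_le] at hξ
    have hξ0 : 0 < ‖ξ‖ := hR0.trans hξ
    have h3 : ‖ξ‖ ^ (p + 1) * ∑ i ∈ Finset.range (l + 1), (l.choose i : ℝ) *
        ‖iteratedFDeriv ℝ i (fun ξ => cut ρ n ξ - 1) ξ‖ * ‖iteratedFDeriv ℝ (l - i) ψ ξ‖ ≤ D := by
      rw [hD, Finset.mul_sum]
      refine Finset.sum_le_sum fun i _ => ?_
      have ha := norm_iteratedFDeriv_cut_sub_one_le ρ n i ξ
      have hb := SchwartzMap.le_seminorm ℝ (p + 1) (l - i) ψ ξ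
      calc _ = (l.choose i : ℝ) * ‖iteratedFDeriv ℝ i (fun ξ => cut ρ n ξ - 1) ξ‖ *
            (‖ξ‖ ^ (p + 1) * ‖iteratedFDeriv ℝ (l - i) ψ ξ‖) := by ring
        _ ≤ _ := by
          gcongr
    rw [pow_succ, mul_comm _ ‖ξ‖, mul_assoc] at h3
    set X := ‖ξ‖ ^ p * ∑ i ∈ Finset.range (l + 1), (l.choose i : ℝ) *
        ‖iteratedFDeriv ℝ i (fun ξ => cut ρ n ξ - 1) ξ‖ * ‖iteratedFDeriv ℝ (l - i) ψ ξ‖ with hX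
    have hX0 : 0 ≤ X := by positivity
    have h4 : R * X ≤ D := (mul_le_mul_of_nonneg_right hξ.le hX0).trans h3
    rw [hR, div_mul_eq_mul_div, div_le_iff₀ (by positivity)] at h4
    nlinarith

lemma tendsto_lowPass (φ : 𝓢(Space δ, ℂ)) :
    Tendsto (fun n : ℕ => lowPass ρ n φ) atTop (𝓝 φ) := by
  have h := ((FourierTransform.fourierCLM ℂ 𝓢(Space δ, ℂ)).continuous.tendsto _).comp
    (tendsto_smulLeft_cut ρ (𝓕⁻ φ))
  have h2 : FourierTransform.fourierCLM ℂ 𝓢(Space δ, ℂ) (𝓕⁻ φ) = φ := by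
    change 𝓕 (𝓕⁻ φ) = φ
    simp
  rw [h2] at h
  exact h

/-- The low-frequency part of a distribution, as a function. -/
def lowPassFun (k : ℤ) (f : 𝓢'(Space δ, ℂ)) (x : Space δ) : ℂ := f (translate x (𝓕 (cut ρ k)))

lemma apply_mult (f : 𝓢'(Space δ, ℂ)) (m φ : 𝓢(Space δ, ℂ)) :
    f (mult m φ) = ∫ x, φ x * f (translate x (𝓕 m)) :=
  apply_integral_translate f (𝓕 m) (SchwartzMap_hasMoments φ) (mult m φ) fun y => by
    rw [mult_apply_eq_integral]
    simp_rw [mul_comm]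

lemma block_eq (n : ℕ) (f : 𝓢'(Space δ, ℂ)) (x : Space δ) :
    block ρ n f x = f (translate x (𝓕 (symbol ρ n))) := rfl

lemma apply_dblock (f : 𝓢'(Space δ, ℂ)) (n : ℕ) (φ : 𝓢(Space δ, ℂ)) :
    f (dblock ρ n φ) = ∫ x, block ρ n f x * φ x := by
  rw [dblock, apply_mult]
  simp_rw [block_eq, mul_comm]

lemma continuous_block (n : ℕ) (f : 𝓢'(Space δ, ℂ)) : Continuous (block ρ n f) :=
  continuous_apply_translate f (𝓕 (symbol ρ n))

lemma continuous_lowPassFun (k : ℤ) (f : 𝓢'(Space δ, ℂ)) : Continuous (lowPassFun ρ k f) :=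
  continuous_apply_translate f (𝓕 (cut ρ k))

lemma translate_mult (m φ : 𝓢(Space δ, ℂ)) (x : Space δ) :
    mult m (translate x φ) = translate x (mult m φ) := by
  ext z
  rw [SchwartzMap.compSubConstCLM_apply, mult_apply_eq_integral, mult_apply_eq_integral,
    ← integral_add_right_eq_self _ x]
  refine integral_congr_ae (Eventually.of_forall fun y => ?_)
  simp only [SchwartzMap.compSubConstCLM_apply]
  congr 2
  · abel
  · abel

lemma l1_translate (φ : 𝓢(Space δ, ℂ)) (x : Space δ) : l1 (translate x φ) = l1 φ := by
  rw [l1_eq, l1_eq]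
  exact integral_sub_right_eq_self (fun y => ‖φ y‖) x

lemma fourier_cut_sub (j k : ℤ) : 𝓕 (cut ρ j - cut ρ k) = 𝓕 (cut ρ j) - 𝓕 (cut ρ k) :=
  map_sub (FourierTransform.fourierCLM ℂ 𝓢(Space δ, ℂ)) _ _

lemma lowPassFun_succ_sub (n : ℕ) (f : 𝓢'(Space δ, ℂ)) (x : Space δ) :
    lowPassFun ρ ((n : ℤ) + 1) f x - lowPassFun ρ n f x = block ρ (n + 1) f x := by
  rw [block_eq, symbol_succ, fourier_cut_sub, map_sub, map_sub]
  rfl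

lemma sum_block (n : ℕ) (f : 𝓢'(Space δ, ℂ)) (x : Space δ) :
    ∑ i ∈ Finset.range (n + 1), block ρ i f x = lowPassFun ρ n f x := by
  induction n with
  | zero => simp [block_eq, symbol_zero, lowPassFun]
  | succ n ih =>
    rw [Finset.sum_range_succ, ih, ← lowPassFun_succ_sub]
    push_cast
    ring

/-- `f` belongs to the Besov space of regularity `γ`, with norm at most `C` (up to the index shift
of the Paley-Littlewood blocks). -/
def BesovBound (γ : ℝ) (f : 𝓢'(Space δ, ℂ)) (C : ℝ) : Prop :=
  ∀ (n : ℕ) (x : Space δ), ‖block ρ n f x‖ ≤ C * (2 : ℝ) ^ (-(n : ℝ) * γ)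

variable {ρ}

lemma norm_apply_dblock_le {γ C : ℝ} {f : 𝓢'(Space δ, ℂ)} (hf : BesovBound ρ γ f C) (n : ℕ)
    (φ : 𝓢(Space δ, ℂ)) : ‖f (dblock ρ n φ)‖ ≤ C * (2 : ℝ) ^ (-(n : ℝ) * γ) * l1 φ := by
  rw [apply_dblock, l1_eq, ← integral_const_mul]
  refine norm_integral_le_of_norm_le (φ.integrable.norm.const_mul _)
    (Eventually.of_forall fun x => ?_)
  rw [norm_mul]
  gcongr
  exact hf n x

lemma BesovBound.nonneg {γ C : ℝ} {f : 𝓢'(Space δ, ℂ)} (hf : BesovBound ρ γ f C) : 0 ≤ C := by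
  have := (norm_nonneg _).trans (hf 0 0)
  simpa using this

lemma apply_dblock_eq_sum (f : 𝓢'(Space δ, ℂ)) (n : ℕ) (φ : 𝓢(Space δ, ℂ)) :
    f (dblock ρ n φ) = ∑ m ∈ Finset.range (n + 2), f (dblock ρ m (dblock ρ n φ)) := by
  have := sum_dblock ρ (n + 1) (dblock ρ n φ)
  rw [lowPass_dblock ρ (by push_cast; omega)] at this
  rw [← map_sum, this]

/-- Block n is the sum of its compositions with the at most three blocks m with |m-n| ≤ 1. Applying
the bound on the mth block of `f` to the test function `dblock ρ n φ` brings in the L¹ norm of the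
block of `φ` rather than of `φ`; the factor 2^|γ| is the change of weight between neighbouring
scales. -/
lemma norm_apply_dblock_le' {γ C : ℝ} {f : 𝓢'(Space δ, ℂ)} (hf : BesovBound ρ γ f C) (n : ℕ)
    (φ : 𝓢(Space δ, ℂ)) :
    ‖f (dblock ρ n φ)‖ ≤ 3 * (2 : ℝ) ^ |γ| * C * ((2 : ℝ) ^ ((n : ℝ) * (-γ)) * l1 (dblock ρ n φ)) := by
  set X := (2 : ℝ) ^ |γ| * C * ((2 : ℝ) ^ ((n : ℝ) * (-γ)) * l1 (dblock ρ n φ)) with hX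
  have hC := hf.nonneg
  have hX0 : 0 ≤ X := by have := l1_nonneg (dblock ρ n φ); positivity
  have h1 : ∀ m ∈ Finset.Ico (n - 1) (n + 2), ‖f (dblock ρ m (dblock ρ n φ))‖ ≤ X := by
    intro m hm
    rw [Finset.mem_Ico] at hm
    refine (norm_apply_dblock_le hf m _).trans ?_
    have h2 : (2 : ℝ) ^ (-(m : ℝ) * γ) ≤ 2 ^ |γ| * 2 ^ ((n : ℝ) * (-γ)) := by
      rw [← Real.rpow_add (by norm_num)]
      refine Real.rpow_le_rpow_of_exponent_le (by norm_num) ?_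
      have h3 : |(n : ℝ) - m| ≤ 1 := by
        rw [abs_le]
        have ha : (n : ℝ) ≤ m + 1 := by exact_mod_cast (by omega : n ≤ m + 1)
        have hb : (m : ℝ) ≤ n + 1 := by exact_mod_cast (by omega : m ≤ n + 1)
        constructor <;> linarith
      have h4 : ((n : ℝ) - m) * γ ≤ |γ| := by
        refine (le_abs_self _).trans ?_
        rw [abs_mul]
        exact mul_le_of_le_one_left (abs_nonneg _) h3
      linarith
    calc _ ≤ C * (2 ^ |γ| * 2 ^ ((n : ℝ) * (-γ))) * l1 (dblock ρ n φ) := by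
          have := l1_nonneg (dblock ρ n φ)
          gcongr
      _ = X := by rw [hX]; ring
  rw [apply_dblock_eq_sum]
  have h5 : ∑ m ∈ Finset.range (n + 2), f (dblock ρ m (dblock ρ n φ)) =
      ∑ m ∈ Finset.Ico (n - 1) (n + 2), f (dblock ρ m (dblock ρ n φ)) := by
    symm
    refine Finset.sum_subset (fun m hm => ?_) fun m hm hm' => ?_
    · rw [Finset.mem_Ico] at hm; rw [Finset.mem_range]; omega
    · rw [Finset.mem_range] at hm
      rw [Finset.mem_Ico] at hm'
      rw [dblock_dblock_eq_zero ρ (by omega), map_zero]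
  rw [h5]
  refine (norm_sum_le _ _).trans ((Finset.sum_le_card_nsmul _ _ _ h1).trans ?_)
  rw [nsmul_eq_mul, Nat.card_Ico]
  have : ((n + 2 - (n - 1) : ℕ) : ℝ) ≤ 3 := by exact_mod_cast (by omega : n + 2 - (n - 1) ≤ 3)
  calc _ ≤ 3 * X := by gcongr
    _ = _ := by rw [hX]; ring

lemma hasSum_dblock (f : 𝓢'(Space δ, ℂ)) (φ : 𝓢(Space δ, ℂ))
    (h : Summable fun n => f (dblock ρ n φ)) : ∑' n, f (dblock ρ n φ) = f φ := by
  have h1 := h.hasSum.tendsto_sum_nat.comp (tendsto_add_atTop_nat 1)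
  have h2 : Tendsto (fun n : ℕ => f (lowPass ρ n φ)) atTop (𝓝 (f φ)) :=
    (f.continuous.tendsto φ).comp (tendsto_lowPass ρ φ)
  refine tendsto_nhds_unique h1 (h2.congr fun n => ?_)
  rw [← sum_dblock, map_sum]
  rfl

/-- A distribution of regularity `γ` is bounded for the dual norm of exponent `-γ`. -/
theorem norm_apply_le_dnorm {γ C : ℝ} {f : 𝓢'(Space δ, ℂ)} (hf : BesovBound ρ γ f C)
    (φ : 𝓢(Space δ, ℂ)) : ‖f φ‖ ≤ 3 * (2 : ℝ) ^ |γ| * C * dnorm ρ (-γ) φ := by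
  have hs := (summable_dnorm ρ (-γ) φ).mul_left (3 * (2 : ℝ) ^ |γ| * C)
  have h1 : Summable fun n => ‖f (dblock ρ n φ)‖ :=
    Summable.of_nonneg_of_le (fun _ => norm_nonneg _) (fun n => norm_apply_dblock_le' hf n φ) hs
  rw [← hasSum_dblock f φ h1.of_norm]
  refine (norm_tsum_le_tsum_norm h1).trans ?_
  refine (h1.tsum_le_tsum (fun n => norm_apply_dblock_le' hf n φ) hs).trans ?_
  rw [tsum_mul_left]
  rfl

lemma dblock_fourier_symbol_eq_zero {m n : ℕ} (h : m + 1 < n ∨ n + 1 < m) :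
    dblock ρ m (𝓕 (symbol ρ n)) = 0 := by
  have key : ∀ {m n : ℕ}, m + 1 < n → ∀ ξ, symbol ρ m ξ * symbol ρ n ξ = 0 := by
    intro m n h ξ
    have h1 := fun φ => dblock_dblock_eq_zero ρ h φ
    have h2 := congrArg (fun f : 𝓢(Space δ, ℂ) => (𝓕⁻ f) ξ) (h1 (𝓕 (symbol ρ n)))
    obtain ⟨n, rfl⟩ := Nat.exists_eq_succ_of_ne_zero (by omega : n ≠ 0)
    have hz : ∀ j : ℤ, j < n → cut ρ j ξ * symbol ρ (n + 1) ξ = 0 := by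
      intro j hj
      rw [symbol_succ, sub_apply, mul_sub, cut_mul_cut ρ (by omega), cut_mul_cut ρ hj, sub_self]
    cases m with
    | zero => rw [symbol_zero]; exact hz 0 (by omega)
    | succ m =>
      rw [symbol_succ, sub_apply, sub_mul, hz _ (by omega), hz _ (by omega), sub_self]
  refine eq_of_fourierInv fun ξ => ?_
  rw [dblock, fourierInv_mult (symbol ρ m).hasTemperateGrowth,
    FourierTransform.fourierInv_fourier_eq]
  have h0 : (𝓕⁻ (0 : 𝓢(Space δ, ℂ))) ξ = 0 := by
    have : 𝓕⁻ (0 : 𝓢(Space δ, ℂ)) = 0 := map_zero (FourierTransform.fourierInvCLM ℂ 𝓢(Space δ, ℂ))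
    rw [this]; rfl
  rw [h0]
  rcases h with h | h
  · exact key h ξ
  · rw [mul_comm]; exact key h ξ

lemma l1_fourier_symbol_le (n : ℕ) : l1 (𝓕 (symbol ρ n)) ≤ 2 * cutConst ρ := by
  cases n with
  | zero =>
    rw [symbol_zero, l1_fourier_cut]
    linarith [cutConst_nonneg ρ]
  | succ n =>
    rw [symbol_succ, fourier_cut_sub]
    refine (map_sub_le_add l1 _ _).trans ?_
    rw [l1_fourier_cut, l1_fourier_cut]
    linarith

/-- The kernel of block n has frequencies of size 2^n only, so at most three terms of its dual norm
survive, each of order 2^{nθ}. Testing a dual bound on these kernels recovers the Besov bound. -/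
lemma dnorm_kernel_le (θ : ℝ) (n : ℕ) (x : Space δ) :
    dnorm ρ θ (translate x (𝓕 (symbol ρ n))) ≤
      3 * (2 : ℝ) ^ |θ| * (2 * cutConst ρ) ^ 2 * (2 : ℝ) ^ ((n : ℝ) * θ) := by
  set X := (2 : ℝ) ^ |θ| * (2 * cutConst ρ) ^ 2 * (2 : ℝ) ^ ((n : ℝ) * θ) with hX
  have hc := cutConst_nonneg ρ
  have h0 : ∀ m ∉ Finset.Ico (n - 1) (n + 2), (2 : ℝ) ^ ((m : ℝ) * θ) *
      l1 (dblock ρ m (translate x (𝓕 (symbol ρ n)))) = 0 := by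
    intro m hm
    rw [Finset.mem_Ico] at hm
    have : dblock ρ m (translate x (𝓕 (symbol ρ n))) = 0 := by
      rw [dblock, translate_mult]
      change translate x (dblock ρ m (𝓕 (symbol ρ n))) = 0
      rw [dblock_fourier_symbol_eq_zero (by omega), map_zero]
    rw [this, map_zero, mul_zero]
  have h1 : ∀ m ∈ Finset.Ico (n - 1) (n + 2), (2 : ℝ) ^ ((m : ℝ) * θ) *
      l1 (dblock ρ m (translate x (𝓕 (symbol ρ n)))) ≤ X := by
    intro m hm
    rw [Finset.mem_Ico] at hm
    have h2 : (2 : ℝ) ^ ((m : ℝ) * θ) ≤ 2 ^ |θ| * 2 ^ ((n : ℝ) * θ) := by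
      rw [← Real.rpow_add (by norm_num)]
      refine Real.rpow_le_rpow_of_exponent_le (by norm_num) ?_
      have h3 : |(m : ℝ) - n| ≤ 1 := by
        rw [abs_le]
        have ha : (n : ℝ) ≤ m + 1 := by exact_mod_cast (by omega : n ≤ m + 1)
        have hb : (m : ℝ) ≤ n + 1 := by exact_mod_cast (by omega : m ≤ n + 1)
        constructor <;> linarith
      have h4 : ((m : ℝ) - n) * θ ≤ |θ| := by
        refine (le_abs_self _).trans ?_
        rw [abs_mul]
        exact mul_le_of_le_one_left (abs_nonneg _) h3
      linarith
    have h5 : l1 (dblock ρ m (translate x (𝓕 (symbol ρ n)))) ≤ (2 * cutConst ρ) ^ 2 := by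
      refine (l1_dblock_le ρ m _).trans ?_
      rw [l1_translate, sq]
      gcongr
      exact l1_fourier_symbol_le n
    calc _ ≤ (2 ^ |θ| * 2 ^ ((n : ℝ) * θ)) * (2 * cutConst ρ) ^ 2 :=
          mul_le_mul h2 h5 (l1_nonneg _) (by positivity)
      _ = X := by rw [hX]; ring
  unfold dnorm
  rw [tsum_eq_sum h0]
  refine (Finset.sum_le_card_nsmul _ _ _ h1).trans ?_
  rw [nsmul_eq_mul, Nat.card_Ico]
  have : ((n + 2 - (n - 1) : ℕ) : ℝ) ≤ 3 := by exact_mod_cast (by omega : n + 2 - (n - 1) ≤ 3)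
  have hX0 : 0 ≤ X := by positivity
  calc _ ≤ 3 * X := by gcongr
    _ = _ := by rw [hX]; ring

variable (ρ) in
/-- The constant in the converse duality estimate. -/
def dualConst (γ : ℝ) : ℝ := 3 * (2 : ℝ) ^ |γ| * (2 * cutConst ρ) ^ 2

lemma dualConst_nonneg (γ : ℝ) : 0 ≤ dualConst ρ γ := by
  have := cutConst_nonneg ρ
  unfold dualConst
  positivity

/-- A distribution which is bounded for the dual norm of exponent `-γ` has regularity `γ`. -/
theorem besovBound_of_dnorm {γ C : ℝ} (hC : 0 ≤ C) {f : 𝓢'(Space δ, ℂ)}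
    (hf : ∀ φ, ‖f φ‖ ≤ C * dnorm ρ (-γ) φ) : BesovBound ρ γ f (dualConst ρ γ * C) := by
  intro n x
  rw [block_eq]
  refine (hf _).trans ?_
  refine (mul_le_mul_of_nonneg_left (dnorm_kernel_le (-γ) n x) hC).trans (le_of_eq ?_)
  rw [dualConst, abs_neg, neg_mul, mul_neg]
  ring

lemma BesovBound.mono {γ C C' : ℝ} {f : 𝓢'(Space δ, ℂ)} (hf : BesovBound ρ γ f C) (h : C ≤ C') :
    BesovBound ρ γ f C' := fun n x => (hf n x).trans (by gcongr)

lemma BesovBound.mono_exponent {γ γ' C : ℝ} {f : 𝓢'(Space δ, ℂ)} (hf : BesovBound ρ γ f C)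
    (h : γ' ≤ γ) : BesovBound ρ γ' f C := by
  intro n x
  refine (hf n x).trans ?_
  have hC := hf.nonneg
  refine mul_le_mul_of_nonneg_left
    (Real.rpow_le_rpow_of_exponent_le (by norm_num) ?_) hC
  have := mul_le_mul_of_nonneg_left h (Nat.cast_nonneg (α := ℝ) n)
  linarith

lemma block_add (n : ℕ) (f g : 𝓢'(Space δ, ℂ)) (x : Space δ) :
    block ρ n (f + g) x = block ρ n f x + block ρ n g x := rfl

lemma block_sub (n : ℕ) (f g : 𝓢'(Space δ, ℂ)) (x : Space δ) :
    block ρ n (f - g) x = block ρ n f x - block ρ n g x := rfl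

lemma block_smul (n : ℕ) (c : ℂ) (f : 𝓢'(Space δ, ℂ)) (x : Space δ) :
    block ρ n (c • f) x = c * block ρ n f x := rfl

lemma BesovBound.add {γ C C' : ℝ} {f g : 𝓢'(Space δ, ℂ)} (hf : BesovBound ρ γ f C)
    (hg : BesovBound ρ γ g C') : BesovBound ρ γ (f + g) (C + C') := by
  intro n x
  rw [block_add, add_mul]
  exact (norm_add_le _ _).trans (add_le_add (hf n x) (hg n x))

lemma BesovBound.sub {γ C C' : ℝ} {f g : 𝓢'(Space δ, ℂ)} (hf : BesovBound ρ γ f C)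
    (hg : BesovBound ρ γ g C') : BesovBound ρ γ (f - g) (C + C') := by
  intro n x
  rw [block_sub, add_mul]
  exact (norm_sub_le _ _).trans (add_le_add (hf n x) (hg n x))

lemma BesovBound.smul {γ C : ℝ} {f : 𝓢'(Space δ, ℂ)} (hf : BesovBound ρ γ f C) (c : ℂ) :
    BesovBound ρ γ (c • f) (‖c‖ * C) := by
  intro n x
  rw [block_smul, norm_mul, mul_assoc]
  gcongr
  exact hf n x

lemma besovBound_zero (γ : ℝ) : BesovBound ρ γ (0 : 𝓢'(Space δ, ℂ)) 0 := by
  intro n x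
  have : block ρ n (0 : 𝓢'(Space δ, ℂ)) x = 0 := rfl
  rw [this, norm_zero, zero_mul]

/-- A linear functional which is bounded for a dual norm is a tempered distribution. -/
def ofDual {θ C : ℝ} (f : 𝓢(Space δ, ℂ) →ₗ[ℂ] ℂ) (hC : 0 ≤ C)
    (h : ∀ φ, ‖f φ‖ ≤ C * dnorm ρ θ φ) : 𝓢'(Space δ, ℂ) :=
  ContinuousLinearMap.toPointwiseConvergenceCLM _ _ _ _
    { f with
      cont := by
        obtain ⟨q, hq, hqb⟩ := exists_dnorm_le_seminorm ρ θ
        obtain ⟨q', hq', hq''⟩ := exists_seminorm_mul hq (by positivity : 0 ≤ C * 2)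
        have hb : ∀ φ, ‖f φ‖ ≤ q' φ := fun φ => by
          rw [hq'']
          refine (h φ).trans ?_
          rw [mul_assoc]
          exact mul_le_mul_of_nonneg_left (hqb φ) hC
        refine continuous_of_continuousAt_zero f.toAddMonoidHom ?_
        rw [ContinuousAt]
        have : f.toAddMonoidHom (0 : 𝓢(Space δ, ℂ)) = 0 := map_zero _
        rw [this]
        refine squeeze_zero_norm hb ?_
        have := hq'.tendsto 0
        rwa [map_zero] at this }

end

section

variable {r : ℕ} {δ : Fin (r + 1) → ℕ} {ρ : Generator δ}

/-! ### Besov norms and derivatives in the `v`-directions -/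

/-- The factor 2^γ comes from the shift j = n-1 between the blocks of the norm and those of
`BesovBound`. -/
lemma besovBound_of_besovNorm_le {γ C : ℝ} (hC : 0 ≤ C) {f : 𝓢'(Space δ, ℂ)}
    (h : besovNorm ρ γ f ≤ ENNReal.ofReal C) : BesovBound ρ γ f (2 ^ γ * C) := by
  intro n x
  have h1 : ENNReal.ofReal ((2 : ℝ) ^ (((n : ℝ) - 1) * γ)) * ‖block ρ n f x‖ₑ ≤
      ENNReal.ofReal C :=
    (mul_le_mul_right (le_iSup (fun x => ‖block ρ n f x‖ₑ) x) _).trans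
      ((le_iSup (fun n : ℕ => ENNReal.ofReal ((2 : ℝ) ^ (((n : ℝ) - 1) * γ)) *
        ⨆ x : Space δ, ‖block ρ n f x‖ₑ) n).trans h)
  rw [← ofReal_norm, ← ENNReal.ofReal_mul (by positivity),
    ENNReal.ofReal_le_ofReal_iff hC] at h1
  have h2 : (2 : ℝ) ^ γ * C * 2 ^ (-(n : ℝ) * γ) = C * 2 ^ (-(((n : ℝ) - 1) * γ)) := by
    rw [show -(((n : ℝ) - 1) * γ) = γ + -(n : ℝ) * γ by ring, Real.rpow_add (by norm_num)]
    ring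
  rw [h2, Real.rpow_neg (by norm_num), ← div_eq_mul_inv, le_div_iff₀ (by positivity), mul_comm]
  exact h1

lemma besovBound_toReal {γ : ℝ} {f : 𝓢'(Space δ, ℂ)} (h : besovNorm ρ γ f < ⊤) :
    BesovBound ρ γ f (2 ^ γ * (besovNorm ρ γ f).toReal) :=
  besovBound_of_besovNorm_le ENNReal.toReal_nonneg (ENNReal.ofReal_toReal h.ne).ge

lemma BesovBound.besovNorm_le {γ C : ℝ} {f : 𝓢'(Space δ, ℂ)} (h : BesovBound ρ γ f C) :
    besovNorm ρ γ f ≤ ENNReal.ofReal (2 ^ (-γ) * C) := by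
  have hC := h.nonneg
  refine iSup_le fun n => ?_
  rw [ENNReal.mul_iSup]
  refine iSup_le fun x => ?_
  rw [← ofReal_norm, ← ENNReal.ofReal_mul (by positivity)]
  refine ENNReal.ofReal_le_ofReal ?_
  calc _ ≤ (2 : ℝ) ^ (((n : ℝ) - 1) * γ) * (C * 2 ^ (-(n : ℝ) * γ)) := by gcongr; exact h n x
    _ = (2 : ℝ) ^ (((n : ℝ) - 1) * γ) * 2 ^ (-(n : ℝ) * γ) * C := by ring
    _ = _ := by rw [← Real.rpow_add (by norm_num)]; ring_nf

lemma BesovBound.besovNorm_lt_top {γ C : ℝ} {f : 𝓢'(Space δ, ℂ)} (h : BesovBound ρ γ f C) :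
    besovNorm ρ γ f < ⊤ := h.besovNorm_le.trans_lt ENNReal.ofReal_lt_top

/-- The unit vector of a `v`-variable. -/
abbrev vUnit (i : Fin (δ 0)) : Space δ := EuclideanSpace.single (⟨0, i⟩ : Coord δ) (1 : ℝ)

lemma inner_vUnit (i : Fin (δ 0)) (ξ : Space δ) : inner ℝ ξ (vUnit i) = ξ ⟨0, i⟩ := by
  rw [EuclideanSpace.inner_single_right]
  simp

lemma dblock_lineDeriv (n : ℕ) (v : Space δ) (φ : 𝓢(Space δ, ℂ)) :
    dblock ρ n (∂_{v} φ) = ∂_{v} (dblock ρ n φ) := by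
  refine eq_of_fourierInv fun ξ => ?_
  have hv : Function.HasTemperateGrowth fun ξ : Space δ => inner ℝ ξ v := by fun_prop
  rw [dblock, fourierInv_mult (symbol ρ n).hasTemperateGrowth, SchwartzMap.fourierInv_lineDerivOp_eq,
    SchwartzMap.fourierInv_lineDerivOp_eq, smul_apply, smul_apply,
    SchwartzMap.smulLeftCLM_apply_apply hv, SchwartzMap.smulLeftCLM_apply_apply hv,
    fourierInv_mult (symbol ρ n).hasTemperateGrowth]
  simp only [smul_eq_mul, Complex.real_smul]
  ring

variable (ρ) in
/-- The multiplier of a derivative of the low-frequency cut-off. -/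
def derivCut (v : Space δ) (k : ℤ) : 𝓢(Space δ, ℂ) :=
  (-(2 * Real.pi * Complex.I)) • SchwartzMap.smulLeftCLM ℂ (fun ξ : Space δ => inner ℝ ξ v) (cut ρ k)

lemma derivCut_apply (v : Space δ) (k : ℤ) (ξ : Space δ) : derivCut ρ v k ξ =
    (-(2 * Real.pi * Complex.I)) * ((inner ℝ ξ v : ℝ) * cut ρ k ξ) := by
  have hv : Function.HasTemperateGrowth fun ξ : Space δ => inner ℝ ξ v := by fun_prop
  rw [derivCut, smul_apply, SchwartzMap.smulLeftCLM_apply_apply hv]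
  rfl

lemma mult_derivCut (v : Space δ) (k : ℤ) (φ : 𝓢(Space δ, ℂ)) :
    mult (derivCut ρ v k) φ = ∂_{v} (lowPass ρ k φ) := by
  refine eq_of_fourierInv fun ξ => ?_
  have hv : Function.HasTemperateGrowth fun ξ : Space δ => inner ℝ ξ v := by fun_prop
  rw [fourierInv_mult (SchwartzMap.hasTemperateGrowth _), SchwartzMap.fourierInv_lineDerivOp_eq,
    smul_apply, SchwartzMap.smulLeftCLM_apply_apply hv, lowPass,
    fourierInv_mult (cut ρ k).hasTemperateGrowth, derivCut_apply]
  simp only [smul_eq_mul, Complex.real_smul]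
  ring

/-- The v-coordinates have weight exactly one under the anisotropic dilation, so a v-derivative at
scale 2^k costs one factor 2^k. -/
lemma l1_fourier_derivCut (i : Fin (δ 0)) (k : ℤ) :
    l1 (𝓕 (derivCut ρ (vUnit i) k)) = 2 ^ k * l1 (𝓕 (derivCut ρ (vUnit i) 0)) := by
  have h1 : derivCut ρ (vUnit i) k = ((2 ^ k : ℝ) : ℂ) • compL (dil (-k)) (derivCut ρ (vUnit i) 0) := by
    ext ξ
    rw [smul_apply]
    change _ = _ • derivCut ρ (vUnit i) 0 (dil (-k) ξ)
    have h2 : cut ρ 0 (dil (-k) ξ) = cut ρ k ξ := by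
      have := compL_dil_cut ρ k 0
      rw [zero_add] at this
      rw [← this]; rfl
    rw [derivCut_apply, derivCut_apply, inner_vUnit, inner_vUnit, h2, dil_apply, dilation_apply]
    have h3 : (2 : ℝ) ^ k * (2 : ℝ) ^ (-k) = 1 := by
      rw [← zpow_add₀ (by norm_num)]; simp
    have h4 : (((2 : ℝ) ^ k : ℝ) : ℂ) * (((2 : ℝ) ^ (-k) : ℝ) : ℂ) = 1 := by exact_mod_cast h3
    simp only [Fin.val_zero, mul_zero, zero_add, pow_one, smul_eq_mul, Complex.ofReal_mul]
    linear_combination (-(2 * Real.pi * Complex.I) * (ξ ⟨0, i⟩) * cut ρ k ξ) * (-h4)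
  have h5 : 𝓕 (((2 ^ k : ℝ) : ℂ) • compL (dil (-k)) (derivCut ρ (vUnit i) 0)) =
      ((2 ^ k : ℝ) : ℂ) • 𝓕 (compL (dil (-k)) (derivCut ρ (vUnit i) 0)) :=
    map_smul (FourierTransform.fourierCLM ℂ 𝓢(Space δ, ℂ)) _ _
  rw [h1, h5, map_smul_eq_mul, l1_fourier_compL, Complex.norm_real,
    Real.norm_of_nonneg (by positivity)]

variable (ρ) in
/-- The constant in the Bernstein inequality for `∂_{v_i}`. -/
def bernsteinConst : ℝ := ∑ i : Fin (δ 0), 2 * l1 (𝓕 (derivCut ρ (vUnit i) 0))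

lemma bernsteinConst_nonneg : 0 ≤ bernsteinConst ρ :=
  Finset.sum_nonneg fun _ _ => mul_nonneg (by norm_num) (l1_nonneg _)

lemma le_bernsteinConst (i : Fin (δ 0)) :
    2 * l1 (𝓕 (derivCut ρ (vUnit i) 0)) ≤ bernsteinConst ρ :=
  Finset.single_le_sum (f := fun i : Fin (δ 0) => 2 * l1 (𝓕 (derivCut ρ (vUnit i) 0)))
    (fun _ _ => mul_nonneg (by norm_num) (l1_nonneg _)) (Finset.mem_univ i)

lemma l1_dblock_lineDeriv_le (i : Fin (δ 0)) (n : ℕ) (φ : 𝓢(Space δ, ℂ)) :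
    l1 (dblock ρ n (∂_{vUnit i} φ)) ≤ bernsteinConst ρ * 2 ^ n * l1 (dblock ρ n φ) := by
  -- The cut-off at scale n+1 acts as the identity on block n, so the derivative of the block is a
  -- multiplier with integrable kernel.
  have h1 : dblock ρ n (∂_{vUnit i} φ) =
      mult (derivCut ρ (vUnit i) ((n : ℤ) + 1)) (dblock ρ n φ) := by
    rw [mult_derivCut, lowPass_dblock ρ (by omega), dblock_lineDeriv]
  rw [h1]
  refine (l1_mult_le _ _).trans (mul_le_mul_of_nonneg_right ?_ (l1_nonneg _))
  rw [l1_fourier_derivCut, zpow_add₀ (by norm_num), zpow_natCast, zpow_one]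
  have := mul_le_mul_of_nonneg_right (le_bernsteinConst (ρ := ρ) i)
    (by positivity : (0 : ℝ) ≤ 2 ^ n)
  linarith

lemma dnorm_lineDeriv_le (i : Fin (δ 0)) (θ : ℝ) (φ : 𝓢(Space δ, ℂ)) :
    dnorm ρ θ (∂_{vUnit i} φ) ≤ bernsteinConst ρ * dnorm ρ (θ + 1) φ := by
  unfold dnorm
  rw [← tsum_mul_left]
  refine (summable_dnorm ρ θ _).tsum_le_tsum (fun n => ?_)
    ((summable_dnorm ρ (θ + 1) φ).mul_left _)
  refine (mul_le_mul_of_nonneg_left (l1_dblock_lineDeriv_le i n φ) (by positivity)).trans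
    (le_of_eq ?_)
  rw [mul_add, mul_one, Real.rpow_add (by norm_num), Real.rpow_natCast]
  ring

lemma vDeriv_apply (i : Fin (δ 0)) (f : 𝓢'(Space δ, ℂ)) (φ : 𝓢(Space δ, ℂ)) :
    vDeriv i f φ = -f (∂_{vUnit i} φ) := by
  rw [vDeriv, TemperedDistribution.lineDerivOp_apply_apply, map_neg]

lemma vDeriv_sub (i : Fin (δ 0)) (f g : 𝓢'(Space δ, ℂ)) :
    vDeriv i (f - g) = vDeriv i f - vDeriv i g := by
  ext φ
  change vDeriv i (f - g) φ = vDeriv i f φ - vDeriv i g φ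
  simp only [vDeriv_apply]
  change -(f _ - g _) = _
  ring

variable (ρ) in
/-- The norm of `∂_{v_i}` between Besov spaces. -/
def derivConst (γ : ℝ) : ℝ :=
  dualConst ρ (γ - 1) * (3 * (2 : ℝ) ^ |γ| * bernsteinConst ρ)

lemma derivConst_nonneg (γ : ℝ) : 0 ≤ derivConst ρ γ :=
  mul_nonneg (dualConst_nonneg _)
    (mul_nonneg (mul_nonneg (by norm_num) (Real.rpow_nonneg (by norm_num) _)) bernsteinConst_nonneg)

/-- By duality: the derivative falls on the test function and raises the dual exponent from -γ to
1-γ. -/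
lemma BesovBound.vDeriv {γ C : ℝ} {f : 𝓢'(Space δ, ℂ)} (hf : BesovBound ρ γ f C) (i : Fin (δ 0)) :
    BesovBound ρ (γ - 1) (vDeriv i f) (derivConst ρ γ * C) := by
  have hC := hf.nonneg
  have hb := bernsteinConst_nonneg (ρ := ρ)
  have h : BesovBound ρ (γ - 1) (Kolmogorov.vDeriv i f)
      (dualConst ρ (γ - 1) * (3 * (2 : ℝ) ^ |γ| * C * bernsteinConst ρ)) :=
    besovBound_of_dnorm (by positivity) fun φ => by
      rw [vDeriv_apply, norm_neg]
      refine (norm_apply_le_dnorm hf _).trans ?_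
      have := dnorm_lineDeriv_le (ρ := ρ) i (-γ) φ
      rw [show -γ + 1 = -(γ - 1) by ring] at this
      exact (mul_le_mul_of_nonneg_left this (by positivity :
        0 ≤ 3 * (2 : ℝ) ^ |γ| * C)).trans_eq (by ring)
  refine h.mono (le_of_eq ?_)
  rw [derivConst]
  ring

end

section

/-! ### Products of distributions with separated spectra -/

section Spectrum

variable {E : Type*} [NormedAddCommGroup E] [InnerProductSpace ℝ E] [FiniteDimensional ℝ E]
  [MeasurableSpace E] [BorelSpace E]

lemma fourier_translate (ψ : 𝓢(E, ℂ)) (v w : E) :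
    (𝓕 (translate v ψ)) w = (Real.fourierChar (-inner ℝ v w) : ℂ) * (𝓕 ψ) w := by
  rw [SchwartzMap.fourier_coe, SchwartzMap.fourier_coe, Real.fourier_eq, Real.fourier_eq,
    ← integral_const_mul, ← integral_add_right_eq_self _ v]
  refine integral_congr_ae (Eventually.of_forall fun x => ?_)
  simp only [SchwartzMap.compSubConstCLM_apply, Circle.smul_def, smul_eq_mul]
  rw [add_sub_cancel_right, inner_add_left, neg_add, AddChar.map_add_eq_mul, Circle.coe_mul]
  ring

lemma fourierInv_mul_reflect (m ψ θ : 𝓢(E, ℂ)) (y ξ : E)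
    (hθ : ∀ x, θ x = ψ x * (𝓕 m) (y - x)) :
    (𝓕⁻ θ) ξ = mult m (𝓕 (translate (-ξ) (𝓕⁻ ψ))) y := by
  rw [mult_apply_eq_integral, SchwartzMap.fourierInv_coe, Real.fourierInv_eq]
  refine integral_congr_ae (Eventually.of_forall fun x => ?_)
  simp only [fourier_translate, hθ, Circle.smul_def, smul_eq_mul, inner_neg_left, neg_neg,
    FourierTransform.fourier_fourierInv_eq]
  rw [real_inner_comm]
  ring

lemma mult_reflect_eq_zero (m₁ m₂ m₃ φ θ : 𝓢(E, ℂ)) (y : E)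
    (h : ∀ ξ η, m₁ η * (m₂ ξ * m₃ (η + ξ)) = 0)
    (hθ : ∀ x, θ x = mult m₃ φ x * (𝓕 m₁) (y - x)) : mult m₂ θ = 0 := by
  have h0 : ∀ ξ, (𝓕⁻ (0 : 𝓢(E, ℂ))) ξ = 0 := fun ξ => by
    have : 𝓕⁻ (0 : 𝓢(E, ℂ)) = 0 := map_zero (FourierTransform.fourierInvCLM ℂ 𝓢(E, ℂ))
    rw [this]; rfl
  refine eq_of_fourierInv fun ξ => ?_
  rw [h0, fourierInv_mult m₂.hasTemperateGrowth, fourierInv_mul_reflect m₁ _ θ y ξ hθ]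
  rcases eq_or_ne (m₂ ξ) 0 with hξ | hξ
  · rw [hξ, zero_mul]
  have h1 : mult m₁ (𝓕 (translate (-ξ) (𝓕⁻ (mult m₃ φ)))) = 0 := by
    refine eq_of_fourierInv fun η => ?_
    rw [h0, fourierInv_mult m₁.hasTemperateGrowth, FourierTransform.fourierInv_fourier_eq,
      SchwartzMap.compSubConstCLM_apply, sub_neg_eq_add, fourierInv_mult m₃.hasTemperateGrowth]
    have := h ξ η
    rw [mul_left_comm] at this
    rw [← mul_assoc, (mul_eq_zero.1 this).resolve_left hξ, zero_mul]
  rw [h1]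
  simp

/-- Spectral localization of a product of three factors. -/
theorem integral_mul_eq_zero_of_spectrum (b w : 𝓢'(E, ℂ)) (m₁ m₂ m₃ φ : 𝓢(E, ℂ)) {C : ℝ}
    (hC : ∀ x, ‖w (translate x (𝓕 m₂))‖ ≤ C)
    (h : ∀ ξ η, m₁ η * (m₂ ξ * m₃ (η + ξ)) = 0) :
    ∫ x, b (translate x (𝓕 m₁)) * w (translate x (𝓕 m₂)) * mult m₃ φ x = 0 := by
  set ψ := mult m₃ φ with hψ
  have hθ : HasMoments fun x => w (translate x (𝓕 m₂)) * ψ x :=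
    (SchwartzMap_hasMoments ψ).bdd_mul
      (continuous_apply_translate w (𝓕 m₂)).aestronglyMeasurable hC
  -- The distribution `b` is pulled out of the integral, and it remains to see that it is applied to
  -- the zero function. At a point y that function is `w` tested against the m₂-multiplier of x ↦
  -- ψ(x)·(𝓕 m₁)(y - x), which vanishes by the support condition on the three symbols.
  have h1 := apply_integral_translate b (𝓕 m₁) hθ 0 fun y => ?_
  · rw [map_zero] at h1
    rw [h1]
    refine integral_congr_ae (Eventually.of_forall fun x => ?_)
    simp only
    ring
  · set R : 𝓢(E, ℂ) := translate y (compL (ContinuousLinearEquiv.neg ℝ) (𝓕 m₁)) with hR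
    have hRx : ∀ x, R x = (𝓕 m₁) (y - x) := fun x => by
      rw [hR, SchwartzMap.compSubConstCLM_apply]
      change (𝓕 m₁) (-(x - y)) = _
      rw [neg_sub]
    set θ : 𝓢(E, ℂ) := SchwartzMap.smulLeftCLM ℂ ψ R with hθ'
    have hθx : ∀ x, θ x = ψ x * (𝓕 m₁) (y - x) := fun x => by
      rw [hθ', SchwartzMap.smulLeftCLM_apply_apply ψ.hasTemperateGrowth, hRx, smul_eq_mul]
    have h2 := apply_integral_translate w (𝓕 m₂) (SchwartzMap_hasMoments θ) (mult m₂ θ)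
      fun z => by
        rw [mult_apply_eq_integral]
        simp_rw [mul_comm]
    rw [mult_reflect_eq_zero m₁ m₂ m₃ φ θ y h hθx, map_zero] at h2
    change (0 : ℂ) = _
    rw [h2]
    refine integral_congr_ae (Eventually.of_forall fun x => ?_)
    simp only [hθx]
    ring

end Spectrum

variable {r : ℕ} {δ : Fin (r + 1) → ℕ} {ρ : Generator δ}

lemma anisoNorm_neg (z : Space δ) : anisoNorm (-z) = anisoNorm z := by
  simp [anisoNorm]

lemma fsize_neg (z : Space δ) : fsize (-z) = fsize z := by
  rw [fsize, smul_neg, anisoNorm_neg, fsize]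

lemma symbol_eq_zero_of_fsize {n : ℕ} {ζ : Space δ} (h : fsize ζ ≤ 2 ^ n / 2) :
    symbol ρ (n + 1) ζ = 0 := by
  rw [symbol_succ, sub_apply, cut_eq_one ρ (k := n) (by rw [zpow_natCast]; exact h),
    cut_eq_one ρ (k := (n : ℤ) + 1), sub_self]
  rw [zpow_add₀ (by norm_num), zpow_natCast, zpow_one]
  have : (0 : ℝ) < 2 ^ n := by positivity
  linarith

/-- If ξ and η+ξ have size at most (2/3)2^n then η has size at most (4/3)2^n, whereas block n+3
vanishes up to 2^{n+1}. A gap of three scales therefore separates the spectra. -/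
lemma symbol_mul_cut_mul_cut (n : ℕ) (ξ η : Space δ) :
    symbol ρ (n + 3) η * (cut ρ n ξ * cut ρ n (η + ξ)) = 0 := by
  by_contra hne
  have h1 : symbol ρ (n + 3) η ≠ 0 := left_ne_zero_of_mul hne
  have h2 := fsize_le_of_cut_ne_zero ρ (left_ne_zero_of_mul (right_ne_zero_of_mul hne))
  have h3 := fsize_le_of_cut_ne_zero ρ (right_ne_zero_of_mul (right_ne_zero_of_mul hne))
  refine h1 (symbol_eq_zero_of_fsize ?_)
  have h4 := fsize_add_le (η + ξ) (-ξ)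
  rw [fsize_neg, add_neg_cancel_right] at h4
  rw [zpow_natCast] at h2 h3
  rw [pow_add]
  have : (0 : ℝ) < 2 ^ n := by positivity
  linarith

/-! ### Bounds on the low-frequency parts -/

lemma sum_rpow_neg_le {α : ℝ} (hα : 0 < α) (n : ℕ) :
    ∑ i ∈ Finset.range n, (2 : ℝ) ^ (-(i : ℝ) * α) ≤ (1 - (2 : ℝ) ^ (-α))⁻¹ := by
  have h1 : (2 : ℝ) ^ (-α) < 1 := Real.rpow_lt_one_of_one_lt_of_neg (by norm_num) (by linarith)
  have h2 : ∀ i : ℕ, (2 : ℝ) ^ (-(i : ℝ) * α) = ((2 : ℝ) ^ (-α)) ^ i := fun i => by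
    rw [← Real.rpow_natCast, ← Real.rpow_mul (by norm_num)]
    ring_nf
  simp_rw [h2]
  rw [← tsum_geometric_of_lt_one (by positivity) h1]
  exact (summable_geometric_of_lt_one (by positivity) h1).sum_le_tsum _ fun _ _ => by positivity

/-- The sum of the geometric series `∑ 2^{-iα}`. -/
def geoConst (α : ℝ) : ℝ := (1 - (2 : ℝ) ^ (-α))⁻¹

lemma geoConst_nonneg {α : ℝ} (hα : 0 < α) : 0 ≤ geoConst α :=
  (sum_rpow_neg_le hα 0).trans' (by simp)

lemma BesovBound.norm_lowPassFun_le {α C : ℝ} {f : 𝓢'(Space δ, ℂ)} (hf : BesovBound ρ α f C)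
    (hα : 0 < α) (n : ℕ) (x : Space δ) : ‖lowPassFun ρ n f x‖ ≤ C * geoConst α := by
  have hC := hf.nonneg
  rw [← sum_block]
  refine (norm_sum_le _ _).trans ((Finset.sum_le_sum fun i _ => hf i x).trans ?_)
  rw [← Finset.mul_sum]
  exact mul_le_mul_of_nonneg_left (sum_rpow_neg_le hα _) hC

lemma BesovBound.norm_lowPassFun_le_of_neg {β C : ℝ} {f : 𝓢'(Space δ, ℂ)}
    (hf : BesovBound ρ (-β) f C) (hβ : 0 < β) (n : ℕ) (x : Space δ) :
    ‖lowPassFun ρ n f x‖ ≤ C * geoConst β * 2 ^ ((n : ℝ) * β) := by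
  have hC := hf.nonneg
  rw [← sum_block]
  refine (norm_sum_le _ _).trans ((Finset.sum_le_sum fun i _ => hf i x).trans ?_)
  rw [← Finset.mul_sum, mul_assoc]
  refine mul_le_mul_of_nonneg_left ?_ hC
  -- The sum is dominated by its top scale; summed from there downwards it is a convergent geometric
  -- series.
  rw [← Finset.sum_range_reflect]
  have h : ∀ j ∈ Finset.range (n + 1), (2 : ℝ) ^ (-((n + 1 - 1 - j : ℕ) : ℝ) * -β) =
      (2 : ℝ) ^ (-(j : ℝ) * β) * 2 ^ ((n : ℝ) * β) := by
    intro j hj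
    rw [Finset.mem_range] at hj
    rw [← Real.rpow_add (by norm_num), Nat.add_sub_cancel, Nat.cast_sub (by omega)]
    ring_nf
  rw [Finset.sum_congr rfl h, ← Finset.sum_mul]
  exact mul_le_mul_of_nonneg_right (sum_rpow_neg_le hβ _) (by positivity)

lemma l1_sub_lowPass_le {θ : ℝ} (hθ : 0 ≤ θ) (k : ℕ) (φ : 𝓢(Space δ, ℂ)) :
    l1 (φ - lowPass ρ k φ) ≤ 2 ^ (-(k : ℝ) * θ) * dnorm ρ θ φ := by
  have h1 : Tendsto (fun n : ℕ => l1 (lowPass ρ ((n + k : ℕ) : ℤ) φ - lowPass ρ k φ)) atTop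
      (𝓝 (l1 (φ - lowPass ρ k φ))) :=
    (continuous_l1.tendsto _).comp
      (((tendsto_lowPass ρ φ).comp (tendsto_add_atTop_nat k)).sub tendsto_const_nhds)
  refine le_of_tendsto h1 (Eventually.of_forall fun n => ?_)
  have h2 : lowPass ρ ((n + k : ℕ) : ℤ) φ - lowPass ρ k φ =
      ∑ i ∈ Finset.range n, dblock ρ (k + 1 + i) φ := by
    rw [← sum_dblock, ← sum_dblock, show n + k + 1 = (k + 1) + n by ring,
      Finset.sum_range_add _ (k + 1) n, add_sub_cancel_left]
  rw [h2]
  refine (seminorm_map_sum_le l1 _ _).trans ?_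
  calc _ ≤ ∑ i ∈ Finset.range n, (2 : ℝ) ^ (-(k : ℝ) * θ) *
        ((2 : ℝ) ^ (((k + 1 + i : ℕ) : ℝ) * θ) * l1 (dblock ρ (k + 1 + i) φ)) := by
        refine Finset.sum_le_sum fun i _ => ?_
        rw [← mul_assoc, ← Real.rpow_add (by norm_num)]
        refine le_mul_of_one_le_left (l1_nonneg _) (Real.one_le_rpow (by norm_num) ?_)
        push_cast
        nlinarith [mul_nonneg (Nat.cast_nonneg (α := ℝ) i) hθ]
    _ ≤ _ := by
        rw [← Finset.mul_sum]
        refine mul_le_mul_of_nonneg_left ?_ (by positivity)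
        have h3 := (summable_dnorm ρ θ φ).sum_le_tsum
          ((Finset.range n).map (addLeftEmbedding (k + 1)))
          fun m _ => dnorm_term_nonneg ρ θ φ m
        rwa [Finset.sum_map] at h3

lemma l1_le_dnorm {θ : ℝ} (hθ : 0 ≤ θ) (φ : 𝓢(Space δ, ℂ)) : l1 φ ≤ dnorm ρ θ φ := by
  have h1 : Tendsto (fun n : ℕ => l1 (lowPass ρ n φ)) atTop (𝓝 (l1 φ)) :=
    (continuous_l1.tendsto _).comp (tendsto_lowPass ρ φ)
  refine le_of_tendsto h1 (Eventually.of_forall fun n => ?_)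
  rw [← sum_dblock]
  refine (seminorm_map_sum_le l1 _ _).trans (le_trans ?_
    ((summable_dnorm ρ θ φ).sum_le_tsum (Finset.range (n + 1))
      fun m _ => dnorm_term_nonneg ρ θ φ m))
  refine Finset.sum_le_sum fun i _ => le_mul_of_one_le_left (l1_nonneg _)
    (Real.one_le_rpow (by norm_num) (by positivity))

lemma norm_integral_mul_le {F : Space δ → ℂ} {C : ℝ} (hF : ∀ x, ‖F x‖ ≤ C) (φ : 𝓢(Space δ, ℂ)) :
    ‖∫ x, F x * φ x‖ ≤ C * l1 φ := by
  rw [l1_eq, ← integral_const_mul]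
  refine norm_integral_le_of_norm_le (φ.integrable.norm.const_mul _)
    (Eventually.of_forall fun x => ?_)
  rw [norm_mul]
  exact mul_le_mul_of_nonneg_right (hF x) (norm_nonneg _)

lemma integrable_bdd_mul {F : Space δ → ℂ} {C : ℝ} (hc : Continuous F) (hF : ∀ x, ‖F x‖ ≤ C)
    (φ : 𝓢(Space δ, ℂ)) : Integrable fun x => F x * φ x :=
  φ.integrable.bdd_mul hc.aestronglyMeasurable (Eventually.of_forall hF)

end

section

variable {r : ℕ} {δ : Fin (r + 1) → ℕ} {ρ : Generator δ}

/-! ### Bony products -/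

section Bony

variable {β α κ Cb Cw : ℝ} {b w : 𝓢'(Space δ, ℂ)}

variable (ρ) in
/-- The product of the low-frequency parts. -/
def lowProd (b w : 𝓢'(Space δ, ℂ)) (n : ℕ) (x : Space δ) : ℂ :=
  lowPassFun ρ n b x * lowPassFun ρ n w x

lemma continuous_lowProd (b w : 𝓢'(Space δ, ℂ)) (n : ℕ) : Continuous (lowProd ρ b w n) :=
  (continuous_lowPassFun ρ n b).mul (continuous_lowPassFun ρ n w)

lemma lowProd_succ_sub (b w : 𝓢'(Space δ, ℂ)) (n : ℕ) (x : Space δ) :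
    lowProd ρ b w (n + 1) x - lowProd ρ b w n x =
      block ρ (n + 1) b x * lowPassFun ρ (n + 1 : ℕ) w x +
        lowPassFun ρ n b x * block ρ (n + 1) w x := by
  rw [lowProd, lowProd, ← lowPassFun_succ_sub, ← lowPassFun_succ_sub]
  push_cast
  ring

lemma norm_lowProd_le (hβ : 0 < β) (hα : 0 < α) (hb : BesovBound ρ (-β) b Cb)
    (hw : BesovBound ρ α w Cw) (n : ℕ) (x : Space δ) :
    ‖lowProd ρ b w n x‖ ≤ Cb * geoConst β * 2 ^ ((n : ℝ) * β) * (Cw * geoConst α) := by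
  rw [lowProd, norm_mul]
  have := hb.nonneg
  have := geoConst_nonneg hβ
  exact mul_le_mul (hb.norm_lowPassFun_le_of_neg hβ n x) (hw.norm_lowPassFun_le hα n x)
    (norm_nonneg _) (by positivity)

/-- The growth 2^{kβ} of the block of `b` is not compensated by `w`. It is compensated by the test
function: the product has no low frequencies, so `φ` may be replaced by `φ - lowPass ρ k φ`, whose
L¹ norm gains 2^{-k(β+κ)}. -/
lemma norm_integral_high_low_le (hβ : 0 < β) (hκ : 0 < κ) (hα : 0 < α)
    (hb : BesovBound ρ (-β) b Cb) (hw : BesovBound ρ α w Cw) (k : ℕ) (φ : 𝓢(Space δ, ℂ)) :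
    ‖∫ x, block ρ (k + 3) b x * lowPassFun ρ k w x * φ x‖ ≤
      Cb * Cw * geoConst α * 2 ^ (3 * β - (k : ℝ) * κ) * dnorm ρ (β + κ) φ := by
  have hCb := hb.nonneg
  have hCw := hw.nonneg
  have hg := geoConst_nonneg hα
  have hF : ∀ x, ‖block ρ (k + 3) b x * lowPassFun ρ k w x‖ ≤
      Cb * 2 ^ (((k : ℝ) + 3) * β) * (Cw * geoConst α) := fun x => by
    rw [norm_mul]
    refine mul_le_mul ?_ (hw.norm_lowPassFun_le hα k x) (norm_nonneg _) (by positivity)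
    have := hb (k + 3) x
    push_cast at this
    rwa [neg_mul_neg] at this
  have hcont : Continuous fun x => block ρ (k + 3) b x * lowPassFun ρ k w x :=
    (continuous_block ρ _ b).mul (continuous_lowPassFun ρ k w)
  have h1 : ∫ x, block ρ (k + 3) b x * lowPassFun ρ k w x * φ x =
      ∫ x, block ρ (k + 3) b x * lowPassFun ρ k w x * (φ - lowPass ρ k φ) x := by
    have h2 := integral_mul_eq_zero_of_spectrum b w (symbol ρ (k + 3)) (cut ρ k) (cut ρ k) φ
      (fun x => hw.norm_lowPassFun_le hα k x) (symbol_mul_cut_mul_cut k)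
    have h3 : ∫ x, block ρ (k + 3) b x * lowPassFun ρ k w x * (lowPass ρ k φ) x = 0 := h2
    have h4 := integral_sub (integrable_bdd_mul hcont hF φ)
      (integrable_bdd_mul hcont hF (lowPass ρ k φ))
    rw [h3, sub_zero] at h4
    rw [← h4]
    refine integral_congr_ae (Eventually.of_forall fun x => ?_)
    simp only [sub_apply]
    ring
  rw [h1]
  refine (norm_integral_mul_le hF _).trans ?_
  refine (mul_le_mul_of_nonneg_left (l1_sub_lowPass_le (θ := β + κ) (by positivity) k φ)
    (by positivity)).trans (le_of_eq ?_)
  rw [show 3 * β - (k : ℝ) * κ = ((k : ℝ) + 3) * β + -(k : ℝ) * (β + κ) by ring,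
    Real.rpow_add (by norm_num)]
  ring

lemma norm_integral_block_lowPass_le (hβ : 0 < β) (hκ : 0 < κ) (hα : β + κ ≤ α)
    (hb : BesovBound ρ (-β) b Cb) (hw : BesovBound ρ α w Cw) (n : ℕ) (φ : 𝓢(Space δ, ℂ)) :
    ‖∫ x, block ρ (n + 1) b x * lowPassFun ρ (n + 1 : ℕ) w x * φ x‖ ≤
      Cb * Cw * (2 ^ (3 * (β + κ)) * (geoConst α + 3)) * 2 ^ (-(n : ℝ) * κ) *
        dnorm ρ (β + κ) φ := by
  have hα0 : 0 < α := by linarith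
  have hCb := hb.nonneg
  have hCw := hw.nonneg
  have hg := geoConst_nonneg hα0
  have hl := l1_le_dnorm (ρ := ρ) (θ := β + κ) (by positivity) φ
  have hd := dnorm_nonneg ρ (β + κ) φ
  have hbn : ∀ m : ℕ, ∀ x, ‖block ρ m b x‖ ≤ Cb * 2 ^ ((m : ℝ) * β) := fun m x => by
    have := hb m x
    rwa [neg_mul_neg] at this
  -- The high-low argument needs a gap of three scales below block n+1. For n = 0, 1 a crude bound
  -- suffices; otherwise n+1 = k+3 and the low-frequency part of `w` splits at scale k, leaving
  -- three resonant blocks of size 2^{-kα} with α ≥ β+κ.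
  by_cases hn : n < 2
  · have hn' : (n : ℝ) ≤ 1 := by exact_mod_cast (by omega : n ≤ 1)
    have hF : ∀ x, ‖block ρ (n + 1) b x * lowPassFun ρ (n + 1 : ℕ) w x‖ ≤
        Cb * 2 ^ (((n + 1 : ℕ) : ℝ) * β) * (Cw * geoConst α) := fun x => by
      rw [norm_mul]
      exact mul_le_mul (hbn _ x) (hw.norm_lowPassFun_le hα0 _ x) (norm_nonneg _) (by positivity)
    refine (norm_integral_mul_le hF φ).trans ?_
    have h2 : (2 : ℝ) ^ (((n + 1 : ℕ) : ℝ) * β) ≤ 2 ^ (3 * (β + κ)) * 2 ^ (-(n : ℝ) * κ) := by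
      rw [← Real.rpow_add (by norm_num)]
      refine Real.rpow_le_rpow_of_exponent_le (by norm_num) ?_
      push_cast
      nlinarith
    calc _ ≤ Cb * (2 ^ (3 * (β + κ)) * 2 ^ (-(n : ℝ) * κ)) * (Cw * (geoConst α + 3)) *
          dnorm ρ (β + κ) φ := by
            have := l1_nonneg φ
            gcongr
            linarith
      _ = _ := by ring
  · obtain ⟨k, rfl⟩ := Nat.exists_eq_add_of_le (not_lt.1 hn)
    rw [show 2 + k + 1 = k + 3 by ring]
    have hsub : ∀ x, lowPassFun ρ (k + 3 : ℕ) w x = lowPassFun ρ k w x +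
        (block ρ (k + 1) w x + block ρ (k + 2) w x + block ρ (k + 3) w x) := fun x => by
      rw [← sum_block, ← sum_block, Finset.sum_range_succ, Finset.sum_range_succ,
        Finset.sum_range_succ]
      ring
    have hwn : ∀ m : ℕ, k + 1 ≤ m → ∀ x, ‖block ρ m w x‖ ≤ Cw * 2 ^ (-((k : ℝ) + 1) * α) :=
      fun m hm x => by
        refine (hw m x).trans (mul_le_mul_of_nonneg_left
          (Real.rpow_le_rpow_of_exponent_le (by norm_num) ?_) hCw)
        have : (k : ℝ) + 1 ≤ m := by exact_mod_cast hm
        nlinarith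
    have hG : ∀ x, ‖block ρ (k + 3) b x *
        (block ρ (k + 1) w x + block ρ (k + 2) w x + block ρ (k + 3) w x)‖ ≤
        Cb * 2 ^ (((k + 3 : ℕ) : ℝ) * β) * (3 * (Cw * 2 ^ (-((k : ℝ) + 1) * α))) := fun x => by
      rw [norm_mul]
      refine mul_le_mul (hbn _ x) ?_ (norm_nonneg _) (by positivity)
      refine (norm_add₃_le).trans ?_
      linarith [hwn (k + 1) le_rfl x, hwn (k + 2) (by omega) x, hwn (k + 3) (by omega) x]
    have hF : ∀ x, ‖block ρ (k + 3) b x * lowPassFun ρ k w x‖ ≤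
        Cb * 2 ^ (((k + 3 : ℕ) : ℝ) * β) * (Cw * geoConst α) := fun x => by
      rw [norm_mul]
      exact mul_le_mul (hbn _ x) (hw.norm_lowPassFun_le hα0 _ x) (norm_nonneg _) (by positivity)
    have hFc : Continuous fun x => block ρ (k + 3) b x * lowPassFun ρ k w x :=
      (continuous_block ρ _ b).mul (continuous_lowPassFun ρ k w)
    have hGc : Continuous fun x => block ρ (k + 3) b x *
        (block ρ (k + 1) w x + block ρ (k + 2) w x + block ρ (k + 3) w x) :=
      (continuous_block ρ _ b).mul (((continuous_block ρ _ w).add (continuous_block ρ _ w)).add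
        (continuous_block ρ _ w))
    have hsplit : ∫ x, block ρ (k + 3) b x * lowPassFun ρ (k + 3 : ℕ) w x * φ x =
        (∫ x, block ρ (k + 3) b x * lowPassFun ρ k w x * φ x) + ∫ x, block ρ (k + 3) b x *
        (block ρ (k + 1) w x + block ρ (k + 2) w x + block ρ (k + 3) w x) * φ x := by
      rw [← integral_add (integrable_bdd_mul hFc hF φ) (integrable_bdd_mul hGc hG φ)]
      refine integral_congr_ae (Eventually.of_forall fun x => ?_)
      simp only [hsub x]
      ring
    rw [hsplit]
    refine (norm_add_le _ _).trans ?_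
    have hA := norm_integral_high_low_le hβ hκ hα0 hb hw k φ
    have hB := norm_integral_mul_le hG φ
    have e1 : (2 : ℝ) ^ (3 * β - (k : ℝ) * κ) ≤
        2 ^ (3 * (β + κ)) * 2 ^ (-((2 + k : ℕ) : ℝ) * κ) := by
      rw [← Real.rpow_add (by norm_num)]
      refine Real.rpow_le_rpow_of_exponent_le (by norm_num) ?_
      push_cast
      nlinarith
    have e2 : (2 : ℝ) ^ (((k + 3 : ℕ) : ℝ) * β) * 2 ^ (-((k : ℝ) + 1) * α) ≤
        2 ^ (3 * (β + κ)) * 2 ^ (-((2 + k : ℕ) : ℝ) * κ) := by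
      rw [← Real.rpow_add (by norm_num), ← Real.rpow_add (by norm_num)]
      refine Real.rpow_le_rpow_of_exponent_le (by norm_num) ?_
      push_cast
      nlinarith [mul_le_mul_of_nonneg_left hα (by positivity : (0 : ℝ) ≤ (k : ℝ) + 1)]
    set Y := (2 : ℝ) ^ (3 * (β + κ)) * 2 ^ (-((2 + k : ℕ) : ℝ) * κ) with hY
    have hY0 : 0 ≤ Y := by positivity
    calc _ ≤ Cb * Cw * geoConst α * Y * dnorm ρ (β + κ) φ +
          3 * (Cb * Cw) * Y * dnorm ρ (β + κ) φ := by
          refine add_le_add (hA.trans (by gcongr)) (hB.trans ?_)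
          calc _ = 3 * (Cb * Cw) * ((2 : ℝ) ^ (((k + 3 : ℕ) : ℝ) * β) *
                2 ^ (-((k : ℝ) + 1) * α)) * l1 φ := by ring
            _ ≤ _ := by
              have := l1_nonneg φ
              gcongr
      _ = _ := by rw [hY]; ring

/-- The constant in the estimate of the increments of a Bony product. -/
def incrConst (β α κ : ℝ) : ℝ := 2 ^ (3 * (β + κ)) * (geoConst α + 3) + geoConst β

lemma incrConst_nonneg (hβ : 0 < β) (hα : 0 < α) : 0 ≤ incrConst β α κ := by
  have := geoConst_nonneg hβ
  have := geoConst_nonneg hα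
  unfold incrConst
  positivity

/-- The increment has a part with `b` at the top scale, estimated above, and a part with `w` at the
top scale, where 2^{nβ}2^{-nα} ≤ 2^{-nκ} directly. The increments are summable precisely because κ >
0. -/
lemma norm_integral_lowProd_sub_le (hβ : 0 < β) (hκ : 0 < κ) (hα : β + κ ≤ α)
    (hb : BesovBound ρ (-β) b Cb) (hw : BesovBound ρ α w Cw) (n : ℕ) (φ : 𝓢(Space δ, ℂ)) :
    ‖(∫ x, lowProd ρ b w (n + 1) x * φ x) - ∫ x, lowProd ρ b w n x * φ x‖ ≤
      incrConst β α κ * (Cb * Cw) * dnorm ρ (β + κ) φ * (2 ^ (-(n : ℝ) * κ)) := by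
  have hα0 : 0 < α := by linarith
  have hCb := hb.nonneg
  have hCw := hw.nonneg
  have hg := geoConst_nonneg hβ
  have hl := l1_le_dnorm (ρ := ρ) (θ := β + κ) (by positivity) φ
  have hd := dnorm_nonneg ρ (β + κ) φ
  have hG : ∀ x, ‖lowPassFun ρ n b x * block ρ (n + 1) w x‖ ≤
      Cb * Cw * geoConst β * 2 ^ (-(n : ℝ) * κ) := fun x => by
    rw [norm_mul]
    refine (mul_le_mul (hb.norm_lowPassFun_le_of_neg hβ n x) (hw (n + 1) x) (norm_nonneg _)
      (by positivity)).trans ?_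
    have e : (2 : ℝ) ^ ((n : ℝ) * β) * 2 ^ (-((n + 1 : ℕ) : ℝ) * α) ≤ 2 ^ (-(n : ℝ) * κ) := by
      rw [← Real.rpow_add (by norm_num)]
      refine Real.rpow_le_rpow_of_exponent_le (by norm_num) ?_
      push_cast
      nlinarith [mul_le_mul_of_nonneg_left hα (Nat.cast_nonneg (α := ℝ) n)]
    calc _ = Cb * Cw * geoConst β * ((2 : ℝ) ^ ((n : ℝ) * β) * 2 ^ (-((n + 1 : ℕ) : ℝ) * α)) := by
          ring
      _ ≤ _ := by gcongr
  have hF : ∀ x, ‖block ρ (n + 1) b x * lowPassFun ρ (n + 1 : ℕ) w x‖ ≤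
      Cb * 2 ^ (-((n + 1 : ℕ) : ℝ) * -β) * (Cw * geoConst α) := fun x => by
    rw [norm_mul]
    exact mul_le_mul (hb _ x) (hw.norm_lowPassFun_le hα0 _ x) (norm_nonneg _) (by positivity)
  have h1 := integral_sub
    (integrable_bdd_mul (continuous_lowProd (ρ := ρ) b w (n + 1))
      (norm_lowProd_le hβ hα0 hb hw (n + 1)) φ)
    (integrable_bdd_mul (continuous_lowProd (ρ := ρ) b w n) (norm_lowProd_le hβ hα0 hb hw n) φ)
  have h2 := integral_add
    (integrable_bdd_mul ((continuous_block ρ (n + 1) b).mul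
      (continuous_lowPassFun ρ (n + 1 : ℕ) w)) hF φ)
    (integrable_bdd_mul ((continuous_lowPassFun ρ n b).mul (continuous_block ρ (n + 1) w)) hG φ)
  simp only [Pi.mul_apply] at h2
  rw [← h1]
  have h3 : ∫ x, (lowProd ρ b w (n + 1) x * φ x - lowProd ρ b w n x * φ x) =
      ∫ x, (block ρ (n + 1) b x * lowPassFun ρ (n + 1 : ℕ) w x * φ x +
        lowPassFun ρ n b x * block ρ (n + 1) w x * φ x) := by
    refine integral_congr_ae (Eventually.of_forall fun x => ?_)
    simp only
    rw [← sub_mul, lowProd_succ_sub, add_mul]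
  rw [h3, h2]
  refine (norm_add_le _ _).trans ((add_le_add
    (norm_integral_block_lowPass_le hβ hκ hα hb hw n φ) (norm_integral_mul_le hG φ)).trans ?_)
  have : Cb * Cw * geoConst β * 2 ^ (-(n : ℝ) * κ) * l1 φ ≤
      Cb * Cw * geoConst β * 2 ^ (-(n : ℝ) * κ) * dnorm ρ (β + κ) φ := by gcongr
  refine (add_le_add_right this _).trans (le_of_eq ?_)
  rw [incrConst]
  ring

lemma integrable_block_mul_block (hb : BesovBound ρ (-β) b Cb) (hw : BesovBound ρ α w Cw)
    (i j : ℕ) (φ : 𝓢(Space δ, ℂ)) : Integrable fun x => block ρ i b x * block ρ j w x * φ x :=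
  integrable_bdd_mul ((continuous_block ρ i b).mul (continuous_block ρ j w))
    (fun x => by
      rw [Pi.mul_apply, norm_mul]
      have := hb.nonneg
      exact mul_le_mul (hb i x) (hw j x) (norm_nonneg _) (by positivity)) φ

lemma sum_sum_block (b w : 𝓢'(Space δ, ℂ)) (hb : BesovBound ρ (-β) b Cb) (hw : BesovBound ρ α w Cw) (n : ℕ) (φ : 𝓢(Space δ, ℂ)) :
    ∑ i ∈ Finset.range (n + 1), ∑ j ∈ Finset.range (n + 1),
      ∫ x, block ρ i b x * block ρ j w x * φ x = ∫ x, lowProd ρ b w n x * φ x := by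
  have hint := fun i j => integrable_block_mul_block hb hw i j φ
  simp_rw [← integral_finsetSum _ fun j _ => hint _ j]
  rw [← integral_finsetSum _ fun i _ => integrable_finsetSum _ fun j _ => hint i j]
  refine integral_congr_ae (Eventually.of_forall fun x => ?_)
  simp only [lowProd, ← sum_block, ← Finset.sum_mul, ← Finset.mul_sum]

variable (ρ) in
/-- The norm of Bony's product. -/
def bonyConst (β α κ : ℝ) : ℝ :=
  dualConst ρ (-(β + κ)) * (incrConst β α κ * geoConst κ + geoConst β * geoConst α)

lemma bonyConst_nonneg (hβ : 0 < β) (hα : 0 < α) (hκ : 0 < κ) : 0 ≤ bonyConst ρ β α κ := by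
  have := geoConst_nonneg hβ
  have := geoConst_nonneg hα
  have := geoConst_nonneg hκ
  have := incrConst_nonneg (κ := κ) hβ hα
  have := dualConst_nonneg (ρ := ρ) (-(β + κ))
  unfold bonyConst
  positivity

/-- Existence of Bony's product of a distribution of regularity `-β` and of one of regularity
`α ≥ β + κ`, as a distribution of regularity `-β-κ`. -/
theorem exists_isBonyProduct (hβ : 0 < β) (hκ : 0 < κ) (hα : β + κ ≤ α)
    (hb : BesovBound ρ (-β) b Cb) (hw : BesovBound ρ α w Cw) :
    ∃ p, IsBonyProduct ρ b w p ∧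
      BesovBound ρ (-(β + κ)) p (bonyConst ρ β α κ * (Cb * Cw)) := by
  have hα0 : 0 < α := by linarith
  have hCb := hb.nonneg
  have hCw := hw.nonneg
  have hgβ := geoConst_nonneg hβ
  have hgα := geoConst_nonneg hα0
  have hgκ := geoConst_nonneg hκ
  have hI := incrConst_nonneg (κ := κ) hβ hα0
  set T : ℕ → 𝓢(Space δ, ℂ) →ₗ[ℂ] ℂ := fun n =>
    { toFun := fun φ => ∫ x, lowProd ρ b w n x * φ x
      map_add' := fun φ ψ => by
        rw [← integral_add (integrable_bdd_mul (continuous_lowProd b w n)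
          (norm_lowProd_le hβ hα0 hb hw n) φ) (integrable_bdd_mul (continuous_lowProd b w n)
          (norm_lowProd_le hβ hα0 hb hw n) ψ)]
        simp_rw [add_apply, mul_add]
      map_smul' := fun c φ => by
        rw [RingHom.id_apply, smul_eq_mul, ← integral_const_mul]
        simp_rw [smul_apply, smul_eq_mul, mul_left_comm] } with hT
  have hTd : ∀ n φ, ‖T (n + 1) φ - T n φ‖ ≤
      incrConst β α κ * (Cb * Cw) * dnorm ρ (β + κ) φ * (2 ^ (-(n : ℝ) * κ)) := fun n φ =>
    norm_integral_lowProd_sub_le hβ hκ hα hb hw n φ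
  have hT0 : ∀ φ, ‖T 0 φ‖ ≤ geoConst β * geoConst α * (Cb * Cw) * dnorm ρ (β + κ) φ := fun φ => by
    refine (norm_integral_mul_le (norm_lowProd_le hβ hα0 hb hw 0) φ).trans ?_
    have hl := l1_le_dnorm (ρ := ρ) (θ := β + κ) (by positivity) φ
    simp only [Nat.cast_zero, zero_mul, Real.rpow_zero, mul_one]
    calc _ = geoConst β * geoConst α * (Cb * Cw) * l1 φ := by ring
      _ ≤ _ := by gcongr
  have hTn : ∀ n φ, ‖T n φ‖ ≤ (incrConst β α κ * geoConst κ + geoConst β * geoConst α) *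
      (Cb * Cw) * dnorm ρ (β + κ) φ := fun n φ => by
    have h1 : T n φ = T 0 φ + ∑ i ∈ Finset.range n, (T (i + 1) φ - T i φ) := by
      rw [Finset.sum_range_sub fun i => T i φ]
      ring
    have hd := dnorm_nonneg ρ (β + κ) φ
    have h2 : ‖∑ i ∈ Finset.range n, (T (i + 1) φ - T i φ)‖ ≤
        incrConst β α κ * (Cb * Cw) * dnorm ρ (β + κ) φ * geoConst κ := by
      refine (norm_sum_le _ _).trans ((Finset.sum_le_sum fun i _ => hTd i φ).trans ?_)
      rw [← Finset.mul_sum]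
      exact mul_le_mul_of_nonneg_left (sum_rpow_neg_le hκ n) (by positivity)
    rw [h1]
    refine (norm_add_le _ _).trans ((add_le_add (hT0 φ) h2).trans (le_of_eq ?_))
    ring
  have hlim : ∀ φ, ∃ z, Tendsto (fun n => T n φ) atTop (𝓝 z) := fun φ => by
    refine cauchySeq_tendsto_of_complete (cauchySeq_of_summable_dist ?_)
    have hs : Summable fun n : ℕ => (2 : ℝ) ^ (-(n : ℝ) * κ) := by
      have h1 : (2 : ℝ) ^ (-κ) < 1 :=
        Real.rpow_lt_one_of_one_lt_of_neg (by norm_num) (by linarith)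
      refine (summable_geometric_of_lt_one (by positivity) h1).congr fun i => ?_
      rw [← Real.rpow_natCast, ← Real.rpow_mul (by norm_num)]
      ring_nf
    refine Summable.of_nonneg_of_le (fun _ => dist_nonneg) (fun n => ?_)
      (hs.mul_left (incrConst β α κ * (Cb * Cw) * dnorm ρ (β + κ) φ))
    rw [dist_comm, dist_eq_norm]
    exact hTd n φ
  choose P hP using hlim
  set p₀ : 𝓢(Space δ, ℂ) →ₗ[ℂ] ℂ := linearMapOfTendsto P T (tendsto_pi_nhds.2 hP) with hp₀
  have hp : ∀ φ, ‖p₀ φ‖ ≤ (incrConst β α κ * geoConst κ + geoConst β * geoConst α) *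
      (Cb * Cw) * dnorm ρ (β + κ) φ := fun φ =>
    le_of_tendsto (hP φ).norm (Eventually.of_forall fun n => hTn n φ)
  have hC : 0 ≤ (incrConst β α κ * geoConst κ + geoConst β * geoConst α) * (Cb * Cw) := by
    positivity
  refine ⟨ofDual p₀ hC hp, fun φ => ?_, ?_⟩
  -- The partial sum over i, j < n+1 is the product of the cut-offs at scale 2^n, so the sequence in
  -- the definition is shifted by one.
  · rw [← tendsto_add_atTop_iff_nat 1]
    refine (hP φ).congr fun n => ?_
    rw [sum_sum_block b w hb hw]
    rfl
  · have := besovBound_of_dnorm (γ := -(β + κ)) hC (f := ofDual p₀ hC hp) fun φ => by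
      rw [neg_neg]; exact hp φ
    refine this.mono (le_of_eq ?_)
    rw [bonyConst]
    ring

lemma isBonyProduct_bonyProduct (hβ : 0 < β) (hκ : 0 < κ) (hα : β + κ ≤ α)
    (hb : BesovBound ρ (-β) b Cb) (hw : BesovBound ρ α w Cw) :
    IsBonyProduct ρ b w (bonyProduct ρ b w) := by
  obtain ⟨p, hp, -⟩ := exists_isBonyProduct hβ hκ hα hb hw
  rwa [bonyProduct_eq hp]

lemma besovBound_bonyProduct (hβ : 0 < β) (hκ : 0 < κ) (hα : β + κ ≤ α)
    (hb : BesovBound ρ (-β) b Cb) (hw : BesovBound ρ α w Cw) :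
    BesovBound ρ (-(β + κ)) (bonyProduct ρ b w) (bonyConst ρ β α κ * (Cb * Cw)) := by
  obtain ⟨p, hp, h⟩ := exists_isBonyProduct hβ hκ hα hb hw
  rwa [bonyProduct_eq hp]

/-- The product takes a default value when its series diverges, so additivity is available only
under bounds that make both series converge. -/
lemma bonyProduct_sub_right {w' : 𝓢'(Space δ, ℂ)} {Cw' : ℝ} (hβ : 0 < β) (hκ : 0 < κ)
    (hα : β + κ ≤ α) (hb : BesovBound ρ (-β) b Cb) (hw : BesovBound ρ α w Cw)
    (hw' : BesovBound ρ α w' Cw') :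
    bonyProduct ρ b (w - w') = bonyProduct ρ b w - bonyProduct ρ b w' := by
  refine bonyProduct_eq fun φ => ?_
  refine ((isBonyProduct_bonyProduct hβ hκ hα hb hw φ).sub
    (isBonyProduct_bonyProduct hβ hκ hα hb hw' φ)).congr fun n => ?_
  simp_rw [← Finset.sum_sub_distrib]
  refine Finset.sum_congr rfl fun i _ => Finset.sum_congr rfl fun j _ => ?_
  rw [← integral_sub (integrable_block_mul_block hb hw i j φ)
    (integrable_block_mul_block hb hw' i j φ)]
  refine integral_congr_ae (Eventually.of_forall fun x => ?_)
  simp only [block_sub]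
  ring

lemma bonyProduct_sub_left {b' : 𝓢'(Space δ, ℂ)} {Cb' : ℝ} (hβ : 0 < β) (hκ : 0 < κ)
    (hα : β + κ ≤ α) (hb : BesovBound ρ (-β) b Cb) (hb' : BesovBound ρ (-β) b' Cb')
    (hw : BesovBound ρ α w Cw) :
    bonyProduct ρ (b - b') w = bonyProduct ρ b w - bonyProduct ρ b' w := by
  refine bonyProduct_eq fun φ => ?_
  refine ((isBonyProduct_bonyProduct hβ hκ hα hb hw φ).sub
    (isBonyProduct_bonyProduct hβ hκ hα hb' hw φ)).congr fun n => ?_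
  simp_rw [← Finset.sum_sub_distrib]
  refine Finset.sum_congr rfl fun i _ => Finset.sum_congr rfl fun j _ => ?_
  rw [← integral_sub (integrable_block_mul_block hb hw i j φ)
    (integrable_block_mul_block hb' hw i j φ)]
  refine integral_congr_ae (Eventually.of_forall fun x => ?_)
  simp only [block_sub]
  ring

end Bony

end

section

/-! ### Matrix exponentials -/

section MatrixExp

variable {n : Type*} [Fintype n] [DecidableEq n]

open scoped Matrix.Norms.Operator in
lemma continuous_matrix_exp : Continuous (fun M : Matrix n n ℝ => NormedSpace.exp M) :=
  NormedSpace.exp_continuous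

open scoped Matrix.Norms.Operator in
lemma hasDerivAt_exp_mulVec (M : Matrix n n ℝ) (t : ℝ) (y : n → ℝ) (k : n) :
    HasDerivAt (fun s : ℝ => (NormedSpace.exp (s • M) *ᵥ y) k)
      ((M *ᵥ (NormedSpace.exp (t • M) *ᵥ y)) k) t := by
  have h := hasDerivAt_exp_smul_const' (𝕂 := ℝ) M t
  let L : Matrix n n ℝ →ₗ[ℝ] ℝ :=
    { toFun := fun N => (N *ᵥ y) k
      map_add' := fun a b => by simp [Matrix.add_mulVec]
      map_smul' := fun a b => by simp [Matrix.smul_mulVec] }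
  refine ((LinearMap.toContinuousLinearMap L).hasFDerivAt.comp_hasDerivAt t h).congr_deriv ?_
  rw [Matrix.mulVec_mulVec]
  rfl

lemma exp_add_smul (M : Matrix n n ℝ) (s t : ℝ) :
    NormedSpace.exp ((s + t) • M) = NormedSpace.exp (s • M) * NormedSpace.exp (t • M) := by
  rw [add_smul]
  exact Matrix.exp_add_of_commute _ _ (((Commute.refl M).smul_left s).smul_right t)

lemma exp_neg_mul_exp (M : Matrix n n ℝ) (t : ℝ) :
    NormedSpace.exp (t • -M) * NormedSpace.exp (t • M) = 1 := by
  rw [smul_neg, ← neg_smul, ← exp_add_smul, neg_add_cancel, zero_smul, NormedSpace.exp_zero]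

lemma exp_mul_exp_neg (M : Matrix n n ℝ) (t : ℝ) :
    NormedSpace.exp (t • M) * NormedSpace.exp (t • -M) = 1 := by
  rw [smul_neg, ← neg_smul, ← exp_add_smul, add_neg_cancel, zero_smul, NormedSpace.exp_zero]

end MatrixExp

/-! ### The quadratic form of the covariance -/

variable {r : ℕ} {δ : Fin (r + 1) → ℕ}

/-- The squared norm of the `v`-component. -/
def vSq (y : Coord δ → ℝ) : ℝ := ∑ k : Coord δ, if k.1 = 0 then y k ^ 2 else 0

lemma vSq_nonneg (y : Coord δ → ℝ) : 0 ≤ vSq y :=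
  Finset.sum_nonneg fun k _ => by split_ifs <;> positivity

lemma continuous_vSq : Continuous (vSq : (Coord δ → ℝ) → ℝ) := by
  refine continuous_finsetSum _ fun k _ => ?_
  split_ifs <;> fun_prop

lemma vSq_congr {y z : Coord δ → ℝ} (h : ∀ k : Coord δ, k.1 = 0 → y k = z k) : vSq y = vSq z :=
  Finset.sum_congr rfl fun k _ => by
    split_ifs with hk
    · rw [h k hk]
    · rfl

lemma vSq_smul (c : ℝ) (y : Coord δ → ℝ) : vSq (c • y) = c ^ 2 * vSq y := by
  rw [vSq, vSq, Finset.mul_sum]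
  refine Finset.sum_congr rfl fun k _ => ?_
  split_ifs
  · rw [Pi.smul_apply, smul_eq_mul, mul_pow]
  · rw [mul_zero]

lemma eq_zero_of_vSq_eq_zero {y : Coord δ → ℝ} (h : vSq y = 0) (k : Coord δ) (hk : k.1 = 0) :
    y k = 0 := by
  have h1 := (Finset.sum_eq_zero_iff_of_nonneg fun (k : Coord δ) _ => by
    split_ifs <;> positivity).1 h k (Finset.mem_univ k)
  rw [if_pos hk] at h1
  exact pow_eq_zero_iff two_ne_zero |>.1 h1

/-- The quadratic form `⟨C(t) x, x⟩ = ∫_0^t |A e^{τ Bᵀ} x|² dτ`. -/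
def covForm (B : Matrix (Coord δ) (Coord δ) ℝ) (t : ℝ) (x : Coord δ → ℝ) : ℝ :=
  ∫ τ in (0 : ℝ)..t, vSq (NormedSpace.exp (τ • Bᵀ) *ᵥ x)

lemma continuous_exp_mulVec {n : Type*} [Fintype n] [DecidableEq n] (M : Matrix n n ℝ)
    (x : n → ℝ) : Continuous fun τ : ℝ => NormedSpace.exp (τ • M) *ᵥ x :=
  (continuous_matrix_exp.comp (continuous_id.smul continuous_const)).matrix_mulVec
    continuous_const

lemma continuous_vSq_exp (M : Matrix (Coord δ) (Coord δ) ℝ) (x : Coord δ → ℝ) :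
    Continuous fun τ : ℝ => vSq (NormedSpace.exp (τ • M) *ᵥ x) :=
  continuous_vSq.comp (continuous_exp_mulVec M x)

lemma dotProduct_covMatrix (B : Matrix (Coord δ) (Coord δ) ℝ) (t : ℝ) (x : Coord δ → ℝ) :
    x ⬝ᵥ (covMatrix B t *ᵥ x) = covForm B t x := by
  have hc : ∀ k l, Continuous fun τ : ℝ =>
      (NormedSpace.exp (τ • B) * projMatrix δ * (NormedSpace.exp (τ • B))ᵀ) k l := fun k l => by
    have h1 : Continuous fun τ : ℝ => NormedSpace.exp (τ • B) :=
      continuous_matrix_exp.comp (continuous_id.smul continuous_const)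
    exact ((h1.matrix_mul continuous_const).matrix_mul h1.matrix_transpose).matrix_elem k l
  have h1 : ∀ τ : ℝ, vSq (NormedSpace.exp (τ • Bᵀ) *ᵥ x) = ∑ k, ∑ l, x k *
      ((NormedSpace.exp (τ • B) * projMatrix δ * (NormedSpace.exp (τ • B))ᵀ) k l * x l) := by
    intro τ
    have h2 : ∀ y : Coord δ → ℝ, vSq y = y ⬝ᵥ (projMatrix δ *ᵥ y) := fun y => by
      rw [vSq, dotProduct]
      refine Finset.sum_congr rfl fun k _ => ?_
      rw [projMatrix, Matrix.mulVec_diagonal]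
      split_ifs <;> ring
    rw [h2, ← Matrix.transpose_smul, Matrix.exp_transpose, Matrix.mulVec_transpose,
      ← Matrix.dotProduct_mulVec, Matrix.mulVec_mulVec, ← Matrix.mulVec_transpose,
      Matrix.mulVec_mulVec, dotProduct]
    refine Finset.sum_congr rfl fun k _ => ?_
    rw [Matrix.mulVec, dotProduct, Finset.mul_sum]
  have hint : ∀ k l, IntervalIntegrable (fun τ : ℝ => x k * ((NormedSpace.exp (τ • B) *
      projMatrix δ * (NormedSpace.exp (τ • B))ᵀ) k l * x l)) volume 0 t := fun k l =>
    Continuous.intervalIntegrable (continuous_const.mul ((hc k l).mul continuous_const)) _ _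
  have hint2 : ∀ k, IntervalIntegrable (fun τ : ℝ => ∑ l, x k * ((NormedSpace.exp (τ • B) *
      projMatrix δ * (NormedSpace.exp (τ • B))ᵀ) k l * x l)) volume 0 t := fun k =>
    Continuous.intervalIntegrable (continuous_finsetSum _ fun l _ =>
      continuous_const.mul ((hc k l).mul continuous_const)) _ _
  rw [covForm]
  simp_rw [h1]
  rw [intervalIntegral.integral_finsetSum fun k _ => hint2 k, dotProduct]
  refine Finset.sum_congr rfl fun k _ => ?_
  rw [intervalIntegral.integral_finsetSum fun l _ => hint k l,
    Matrix.mulVec, dotProduct, Finset.mul_sum]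
  refine Finset.sum_congr rfl fun l _ => ?_
  rw [intervalIntegral.integral_const_mul, intervalIntegral.integral_mul_const]
  rfl

lemma covMatrix_isSymm (B : Matrix (Coord δ) (Coord δ) ℝ) (t : ℝ) : (covMatrix B t).IsSymm := by
  refine Matrix.IsSymm.ext fun k l => ?_
  simp only [covMatrix, Matrix.of_apply]
  refine intervalIntegral.integral_congr fun τ _ => ?_
  have : (NormedSpace.exp (τ • B) * projMatrix δ * (NormedSpace.exp (τ • B))ᵀ).IsSymm := by
    rw [Matrix.IsSymm, Matrix.transpose_mul, Matrix.transpose_mul, Matrix.transpose_transpose,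
      projMatrix, Matrix.diagonal_transpose, Matrix.mul_assoc]
  exact this.apply k l

/-- The cocycle identity behind the semigroup law of the Gaussian multipliers transported by the
flow. -/
lemma covForm_add (B : Matrix (Coord δ) (Coord δ) ℝ) (s t : ℝ) (x : Coord δ → ℝ) :
    covForm B (s + t) x = covForm B s x + covForm B t (NormedSpace.exp (s • Bᵀ) *ᵥ x) := by
  have hc := continuous_vSq_exp Bᵀ x
  have h1 := intervalIntegral.integral_add_adjacent_intervals (μ := volume) (a := 0) (b := s)
    (c := s + t) (hc.intervalIntegrable 0 s) (hc.intervalIntegrable s (s + t))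
  rw [covForm, covForm, covForm, ← h1]
  congr 1
  have h2 := intervalIntegral.integral_comp_add_right (a := 0) (b := t)
    (fun τ => vSq (NormedSpace.exp (τ • Bᵀ) *ᵥ x)) s
  rw [zero_add, add_comm t s] at h2
  rw [← h2]
  simp_rw [exp_add_smul, Matrix.mulVec_mulVec]

/-- Reversing time in the integral; this allows the Gaussian multiplier to be applied before the
push-forward instead of after it. -/
lemma covForm_neg (B : Matrix (Coord δ) (Coord δ) ℝ) (t : ℝ) (x : Coord δ → ℝ) :
    covForm (-B) t (NormedSpace.exp (t • Bᵀ) *ᵥ x) = covForm B t x := by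
  have h2 := intervalIntegral.integral_comp_sub_left (a := 0) (b := t)
    (fun τ => vSq (NormedSpace.exp (τ • Bᵀ) *ᵥ x)) t
  rw [sub_self, sub_zero] at h2
  rw [covForm, covForm, ← h2]
  refine intervalIntegral.integral_congr fun τ _ => ?_
  rw [Matrix.mulVec_mulVec, Matrix.transpose_neg, smul_neg, ← neg_smul, ← exp_add_smul,
    neg_add_eq_sub]

lemma covForm_nonneg (B : Matrix (Coord δ) (Coord δ) ℝ) {t : ℝ} (ht : 0 ≤ t) (x : Coord δ → ℝ) :
    0 ≤ covForm B t x :=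
  intervalIntegral.integral_nonneg ht fun _ _ => vSq_nonneg _

/-! ### Coercivity of the covariance under the rank condition -/

lemma IsKolmogorovMatrix.neg {B : Matrix (Coord δ) (Coord δ) ℝ} (hB : IsKolmogorovMatrix B) :
    IsKolmogorovMatrix (-B) where
  one_le := hB.one_le
  dim_anti := hB.dim_anti
  dim_pos := hB.dim_pos
  rank_block j := by
    have : (Matrix.of fun (k : Fin (δ j.succ)) (l : Fin (δ j.castSucc)) =>
        (-B) ⟨j.succ, k⟩ ⟨j.castSucc, l⟩) = -Matrix.of fun (k : Fin (δ j.succ))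
        (l : Fin (δ j.castSucc)) => B ⟨j.succ, k⟩ ⟨j.castSucc, l⟩ := rfl
    have h2 : ∀ N : Matrix (Fin (δ j.succ)) (Fin (δ j.castSucc)) ℝ, (-N).rank = N.rank :=
      fun N => by
        have : (-N).mulVecLin = -N.mulVecLin := by ext; simp
        rw [Matrix.rank, this, LinearMap.range_neg, Matrix.rank]
    rw [this, h2]
    exact hB.rank_block j
  zero_block i j h k l := by rw [Matrix.neg_apply, hB.zero_block i j h k l, neg_zero]

/-- The matrix `tBᵀ` conjugated by the scaling `diag(t^i)`. -/
def scaledDrift (B : Matrix (Coord δ) (Coord δ) ℝ) (t : ℝ) : Matrix (Coord δ) (Coord δ) ℝ :=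
  Matrix.of fun k l => t ^ ((k.1 : ℕ) + 1 - (l.1 : ℕ)) * B l k

/-- Full row rank of the subdiagonal block means that its transpose is injective. -/
lemma eq_zero_of_transpose_mul {B : Matrix (Coord δ) (Coord δ) ℝ} (hB : IsKolmogorovMatrix B)
    (j : Fin r) (z : Coord δ → ℝ)
    (h : ∀ k : Fin (δ j.castSucc), ∑ l : Fin (δ j.succ), B ⟨j.succ, l⟩ ⟨j.castSucc, k⟩ *
      z ⟨j.succ, l⟩ = 0) (l : Fin (δ j.succ)) : z ⟨j.succ, l⟩ = 0 := by
  set N : Matrix (Fin (δ j.succ)) (Fin (δ j.castSucc)) ℝ :=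
    Matrix.of fun k l => B ⟨j.succ, k⟩ ⟨j.castSucc, l⟩ with hN
  have h1 : LinearIndependent ℝ N.row := by
    rw [linearIndependent_iff_card_eq_finrank_span, Set.finrank, ← Matrix.rank_eq_finrank_span_row,
      hB.rank_block j, Fintype.card_fin]
  have h2 : Function.Injective N.vecMul := Matrix.vecMul_injective_iff.2 h1
  have h3 : (fun l => z ⟨j.succ, l⟩) ᵥ* N = 0 ᵥ* N := by
    rw [Matrix.zero_vecMul]
    ext k
    rw [Matrix.vecMul, dotProduct, Pi.zero_apply, ← h k]
    exact Finset.sum_congr rfl fun l _ => mul_comm _ _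
  exact congrFun (h2 h3) l

/-- The Kalman argument. If the blocks up to n vanish along the trajectory on an open time interval,
so does the derivative of block n, and this derivative is the transposed subdiagonal block applied
to block n+1. Injectivity propagates the vanishing upwards, and invertibility of the flow returns to
the initial point. -/
lemma eq_zero_of_vSq_flow {B : Matrix (Coord δ) (Coord δ) ℝ} (hB : IsKolmogorovMatrix B) (t : ℝ)
    (y : Coord δ → ℝ)
    (h : ∀ σ ∈ Ioo (0 : ℝ) 1, vSq (NormedSpace.exp (σ • scaledDrift B t) *ᵥ y) = 0) : y = 0 := by
  set z : ℝ → Coord δ → ℝ := fun σ => NormedSpace.exp (σ • scaledDrift B t) *ᵥ y with hz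
  have key : ∀ n : ℕ, ∀ k : Coord δ, (k.1 : ℕ) ≤ n → ∀ σ ∈ Ioo (0 : ℝ) 1, z σ k = 0 := by
    intro n
    induction n with
    | zero =>
      intro k hk σ hσ
      exact eq_zero_of_vSq_eq_zero (h σ hσ) k (Fin.ext (by simpa using hk))
    | succ n ih =>
      rintro ⟨i, l⟩ hk σ hσ
      rcases Nat.lt_or_ge (i : ℕ) (n + 1) with hi | hi
      · exact ih ⟨i, l⟩ (by simpa using Nat.lt_succ_iff.1 hi) σ hσ
      have hin : (i : ℕ) = n + 1 := le_antisymm hk hi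
      obtain ⟨j, rfl⟩ : ∃ j : Fin r, i = j.succ :=
        ⟨⟨n, by have := i.2; omega⟩, Fin.ext (by simp [hin])⟩
      have hjn : (j : ℕ) = n := by simpa using hin
      refine eq_zero_of_transpose_mul hB j (z σ) (fun k => ?_) l
      have h1 := hasDerivAt_exp_mulVec (scaledDrift B t) σ y ⟨j.castSucc, k⟩
      have h2 : (fun s => (NormedSpace.exp (s • scaledDrift B t) *ᵥ y) ⟨j.castSucc, k⟩) =ᶠ[𝓝 σ]
          fun _ => 0 := by
        filter_upwards [isOpen_Ioo.mem_nhds hσ] with s hs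
        exact ih ⟨j.castSucc, k⟩ (by simp [hjn]) s hs
      have h3 := (h1.congr_of_eventuallyEq h2.symm).unique (hasDerivAt_const σ (0 : ℝ))
      rw [← h3, Matrix.mulVec, dotProduct, Fintype.sum_sigma,
        Finset.sum_eq_single j.succ]
      · refine Finset.sum_congr rfl fun l _ => ?_
        rw [show scaledDrift B t ⟨j.castSucc, k⟩ ⟨j.succ, l⟩ = B ⟨j.succ, l⟩ ⟨j.castSucc, k⟩ by
          simp [scaledDrift]]
      -- Blocks below n+1 vanish by induction; blocks above it are not seen by row n of the scaled
      -- drift.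
      · intro i _ hij
        refine Finset.sum_eq_zero fun l _ => ?_
        rcases Nat.lt_or_ge (i : ℕ) (n + 1) with hi | hi
        · rw [show (NormedSpace.exp (σ • scaledDrift B t) *ᵥ y) ⟨i, l⟩ = 0 from
            ih ⟨i, l⟩ (by simpa using Nat.lt_succ_iff.1 hi) σ hσ, mul_zero]
        · have hlt : (j.castSucc : ℕ) + 1 < i := by
            have : (i : ℕ) ≠ n + 1 := fun hh => hij (Fin.ext (by simp [hh, hjn]))
            simp only [Fin.val_castSucc]
            omega
          simp [scaledDrift, hB.zero_block i j.castSucc hlt l k]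
      · simp
  have h0 : z (1 / 2) = 0 := by
    ext k
    exact key k.1 k le_rfl _ (by norm_num)
  have h1 : NormedSpace.exp ((1 / 2 : ℝ) • -scaledDrift B t) *ᵥ z (1 / 2) = y := by
    rw [hz]
    simp only
    rw [Matrix.mulVec_mulVec, exp_neg_mul_exp, Matrix.one_mulVec]
  rw [← h1, h0, Matrix.mulVec_zero]

lemma continuous_scaledDrift (B : Matrix (Coord δ) (Coord δ) ℝ) : Continuous (scaledDrift B) :=
  continuous_matrix fun k l => by
    simp only [scaledDrift, Matrix.of_apply]
    fun_prop

/-- Uniform coercivity of the rescaled covariance. -/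
lemma exists_pos_le_scaled_integral {B : Matrix (Coord δ) (Coord δ) ℝ} (hB : IsKolmogorovMatrix B)
    (T : ℝ) : ∃ c > 0, ∀ t ∈ Icc 0 T, ∀ y : Coord δ → ℝ, c * ∑ k, y k ^ 2 ≤
      ∫ σ in (0 : ℝ)..1, vSq (NormedSpace.exp (σ • scaledDrift B t) *ᵥ y) := by
  set F : ℝ × Space δ → ℝ := fun p =>
    ∫ σ in (0 : ℝ)..1, vSq (NormedSpace.exp (σ • scaledDrift B p.1) *ᵥ p.2.ofLp) with hF
  have hjoint : Continuous (Function.uncurry fun (p : ℝ × Space δ) (σ : ℝ) =>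
      vSq (NormedSpace.exp (σ • scaledDrift B p.1) *ᵥ p.2.ofLp)) := by
    refine continuous_vSq.comp (Continuous.matrix_mulVec (continuous_matrix_exp.comp
      (continuous_snd.smul ((continuous_scaledDrift B).comp
        (continuous_fst.comp continuous_fst)))) ?_)
    exact (PiLp.continuous_ofLp 2 _).comp (continuous_snd.comp continuous_fst)
  have hFc : Continuous F :=
    intervalIntegral.continuous_parametric_intervalIntegral_of_continuous' hjoint 0 1
  -- Time 0 belongs to the compact set: there the scaled drift keeps only the subdiagonal blocks,
  -- and these already make the form nondegenerate. This is why the lower bound does not deteriorate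
  -- as t → 0.
  have hcomp : IsCompact (Icc (0 : ℝ) T ×ˢ Metric.sphere (0 : Space δ) 1) :=
    isCompact_Icc.prod (isCompact_sphere 0 1)
  have hpos : ∀ p ∈ Icc (0 : ℝ) T ×ˢ Metric.sphere (0 : Space δ) 1, 0 < F p := by
    rintro ⟨t, y⟩ ⟨-, hy⟩
    have hcont := continuous_vSq_exp (scaledDrift B t) y.ofLp
    refine lt_of_le_of_ne (intervalIntegral.integral_nonneg zero_le_one fun _ _ => vSq_nonneg _)
      fun h0 => ?_
    have h1 := (intervalIntegral.integral_eq_zero_iff_of_le_of_nonneg_ae zero_le_one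
      (Eventually.of_forall fun σ => vSq_nonneg _) (hcont.intervalIntegrable 0 1)).1 h0.symm
    have h2 : ∀ σ ∈ Ioo (0 : ℝ) 1,
        vSq (NormedSpace.exp (σ • scaledDrift B t) *ᵥ y.ofLp) = 0 := by
      have h3 := Measure.eqOn_open_of_ae_eq (μ := volume) (U := Ioo (0 : ℝ) 1)
        (f := fun σ : ℝ => vSq (NormedSpace.exp (σ • scaledDrift B t) *ᵥ y.ofLp))
        (g := fun _ => 0)
        (ae_restrict_of_ae_restrict_of_subset Ioo_subset_Ioc_self h1) isOpen_Ioo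
        hcont.continuousOn continuousOn_const
      exact fun σ hσ => h3 hσ
    have h4 := eq_zero_of_vSq_flow hB t y.ofLp h2
    have h5 : y = 0 := by ext k; exact congrFun h4 k
    rw [h5] at hy
    simp at hy
  obtain ⟨c, hc, hcF⟩ : ∃ c > 0, ∀ p ∈ Icc (0 : ℝ) T ×ˢ Metric.sphere (0 : Space δ) 1, c ≤ F p := by
    -- `T` is an arbitrary real here, so the compact set may be empty.
    rcases (Icc (0 : ℝ) T ×ˢ Metric.sphere (0 : Space δ) 1).eq_empty_or_nonempty with he | hne
    · exact ⟨1, one_pos, fun p hp => by rw [he] at hp; exact hp.elim⟩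
    · obtain ⟨p₀, hp₀, hmin⟩ := hcomp.exists_isMinOn hne hFc.continuousOn
      exact ⟨F p₀, hpos p₀ hp₀, fun p hp => hmin hp⟩
  refine ⟨c, hc, fun t ht y => ?_⟩
  rcases eq_or_ne y 0 with rfl | hy
  · simp only [Pi.zero_apply, ne_eq, OfNat.ofNat_ne_zero, not_false_eq_true, zero_pow,
      Finset.sum_const_zero, mul_zero]
    exact intervalIntegral.integral_nonneg zero_le_one fun _ _ => vSq_nonneg _
  set y' : Space δ := WithLp.toLp 2 y with hy'
  have hn : ‖y'‖ ^ 2 = ∑ k, y k ^ 2 := by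
    rw [EuclideanSpace.norm_sq_eq]
    simp [hy']
  have hn0 : ‖y'‖ ≠ 0 := by
    rw [norm_ne_zero_iff]
    intro h0
    exact hy (by ext k; simpa [hy'] using congrArg (fun v : Space δ => v k) h0)
  have h1 := hcF (t, ‖y'‖⁻¹ • y') ⟨ht, by
    rw [mem_sphere_zero_iff_norm, norm_smul, norm_inv, norm_norm, inv_mul_cancel₀ hn0]⟩
  have h2 : F (t, ‖y'‖⁻¹ • y') = (‖y'‖ ^ 2)⁻¹ *
      ∫ σ in (0 : ℝ)..1, vSq (NormedSpace.exp (σ • scaledDrift B t) *ᵥ y) := by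
    rw [hF, ← intervalIntegral.integral_const_mul]
    refine intervalIntegral.integral_congr fun σ _ => ?_
    simp only [WithLp.ofLp_smul]
    rw [Matrix.mulVec_smul, vSq_smul, inv_pow]
  rw [h2, ← div_eq_inv_mul, le_div_iff₀ (by positivity), hn] at h1
  exact h1

/-- The covariance is bounded from below by the anisotropic scaling. -/
theorem exists_pos_le_covForm {B : Matrix (Coord δ) (Coord δ) ℝ} (hB : IsKolmogorovMatrix B)
    (T : ℝ) : ∃ c > 0, ∀ t ∈ Ioc 0 T, ∀ x : Coord δ → ℝ,
      c * ∑ k : Coord δ, t ^ (2 * (k.1 : ℕ) + 1) * x k ^ 2 ≤ covForm B t x := by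
  obtain ⟨c, hc, h⟩ := exists_pos_le_scaled_integral hB T
  refine ⟨c, hc, fun t ht x => ?_⟩
  have ht0 : t ≠ 0 := ht.1.ne'
  -- Conjugation by diag(t^i) turns the time-t problem into a problem on the unit interval whose
  -- matrix extends continuously to t = 0. On block 0 it is the identity, so the integrand is
  -- unchanged.
  set S : Matrix (Coord δ) (Coord δ) ℝ := Matrix.diagonal fun k => t ^ (k.1 : ℕ) with hS
  have hSu : IsUnit S := by
    rw [Matrix.isUnit_iff_isUnit_det, hS, Matrix.det_diagonal, isUnit_iff_ne_zero]
    exact Finset.prod_ne_zero_iff.2 fun k _ => pow_ne_zero _ ht0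
  have hconj : S * (t • Bᵀ) = scaledDrift B t * S := by
    ext k l
    rw [hS, Matrix.diagonal_mul, Matrix.mul_diagonal, scaledDrift, Matrix.of_apply,
      Matrix.smul_apply, Matrix.transpose_apply, smul_eq_mul]
    -- The exponent in `scaledDrift` is a truncated subtraction; it truncates only where the
    -- corresponding entry of `B` is zero.
    by_cases hkl : (k.1 : ℕ) + 1 < l.1
    · obtain ⟨i, k⟩ := k
      obtain ⟨j, l⟩ := l
      rw [hB.zero_block j i hkl l k]
      ring
    · have : t ^ ((k.1 : ℕ) + 1 - (l.1 : ℕ)) * t ^ (l.1 : ℕ) = t ^ (k.1 : ℕ) * t := by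
        rw [← pow_add, Nat.sub_add_cancel (not_lt.1 hkl), pow_succ]
      linear_combination (-(B l k)) * this
  have hexp : ∀ σ : ℝ, NormedSpace.exp (σ • scaledDrift B t) * S =
      S * NormedSpace.exp ((σ * t) • Bᵀ) := fun σ => by
    have h1 : σ • scaledDrift B t = S * ((σ * t) • Bᵀ) * S⁻¹ := by
      rw [mul_smul, Matrix.mul_smul, hconj, Matrix.smul_mul, Matrix.mul_assoc,
        Matrix.mul_nonsing_inv _ ((Matrix.isUnit_iff_isUnit_det S).1 hSu), Matrix.mul_one]
    rw [h1, Matrix.exp_conj S _ hSu, Matrix.mul_assoc,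
      Matrix.nonsing_inv_mul _ ((Matrix.isUnit_iff_isUnit_det S).1 hSu), Matrix.mul_one]
  have h1 := h t ⟨ht.1.le, ht.2⟩ (S *ᵥ x)
  have h2 : ∫ σ in (0 : ℝ)..1, vSq (NormedSpace.exp (σ • scaledDrift B t) *ᵥ (S *ᵥ x)) =
      t⁻¹ * covForm B t x := by
    have h3 := intervalIntegral.integral_comp_mul_right (a := 0) (b := 1)
      (fun τ => vSq (NormedSpace.exp (τ • Bᵀ) *ᵥ x)) ht0
    rw [zero_mul, one_mul, smul_eq_mul] at h3
    rw [covForm, ← h3]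
    refine intervalIntegral.integral_congr fun σ _ => ?_
    rw [Matrix.mulVec_mulVec, hexp, ← Matrix.mulVec_mulVec]
    refine vSq_congr fun k hk => ?_
    rw [hS, Matrix.mulVec_diagonal, hk]
    simp
  rw [h2, ← div_eq_inv_mul, le_div_iff₀ ht.1] at h1
  refine le_trans (le_of_eq ?_) h1
  rw [mul_assoc, Finset.sum_mul]
  congr 1
  refine Finset.sum_congr rfl fun k _ => ?_
  rw [hS, Matrix.mulVec_diagonal]
  ring

end

section

/-! ### Gaussian functions as Schwartz functions -/

lemma exists_bound_polynomial_mul_gaussian (p : Polynomial ℝ) :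
    ∃ C, ∀ x : ℝ, |p.eval x * Real.exp (-(x ^ 2 / 2))| ≤ C := by
  induction p using Polynomial.induction_on' with
  | add p q hp hq =>
    obtain ⟨C, hC⟩ := hp
    obtain ⟨D, hD⟩ := hq
    refine ⟨C + D, fun x => ?_⟩
    rw [Polynomial.eval_add, add_mul]
    exact (abs_add_le _ _).trans (add_le_add (hC x) (hD x))
  | monomial n a =>
    refine ⟨|a| * (n.factorial * Real.exp (1 / 2)), fun x => ?_⟩
    rw [Polynomial.eval_monomial, mul_assoc, abs_mul]
    refine mul_le_mul_of_nonneg_left ?_ (abs_nonneg a)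
    rw [abs_mul, abs_pow, Real.abs_exp]
    have h1 : |x| ^ n ≤ n.factorial * Real.exp |x| := by
      have := Real.pow_div_factorial_le_exp |x| (abs_nonneg x) n
      rwa [div_le_iff₀ (by positivity), mul_comm] at this
    calc _ ≤ n.factorial * Real.exp |x| * Real.exp (-(x ^ 2 / 2)) := by gcongr
      _ = n.factorial * Real.exp (|x| - x ^ 2 / 2) := by
        rw [mul_assoc, ← Real.exp_add, sub_eq_add_neg]
      _ ≤ _ := by
        gcongr
        nlinarith [sq_nonneg (|x| - 1), sq_abs x]

/-- The one-dimensional Gaussian `e^{-x²/2}`. -/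
def gaussLine : 𝓢(ℝ, ℝ) where
  toFun x := Real.exp (-(x ^ 2 / 2))
  smooth' := by fun_prop
  decay' k n := by
    -- The derivatives of the Gaussian are, up to sign, Hermite polynomials times the Gaussian.
    obtain ⟨C, hC⟩ := exists_bound_polynomial_mul_gaussian
      (Polynomial.X ^ k * (Polynomial.hermite n).map (Int.castRingHom ℝ))
    refine ⟨C, fun x => (hC x).trans' (le_of_eq ?_)⟩
    rw [norm_iteratedFDeriv_eq_norm_iteratedDeriv, iteratedDeriv_eq_iterate,
      Polynomial.deriv_gaussian_eq_hermite_mul_gaussian, Polynomial.eval_mul, Polynomial.eval_pow,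
      Polynomial.eval_X, Polynomial.eval_map, Polynomial.aeval_def, ← Real.norm_eq_abs]
    simp [mul_assoc]

section Gauss

variable {E : Type*} [NormedAddCommGroup E] [InnerProductSpace ℝ E] [FiniteDimensional ℝ E]
  [MeasurableSpace E] [BorelSpace E]

/-- The homothety of ratio `c`. -/
def homothety (c : ℝ) (hc : c ≠ 0) : E ≃L[ℝ] E := ContinuousLinearEquiv.smulLeft (Units.mk0 c hc)

lemma homothety_apply (c : ℝ) (hc : c ≠ 0) (x : E) : homothety c hc x = c • x := rfl

variable (E) in
/-- The Gaussian `e^{-2π²‖x‖²}`. -/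
def stdGauss : 𝓢(E, ℂ) :=
  compL (homothety (2 * Real.pi) (by positivity))
    -- The one-dimensional Gaussian is evaluated at √(1+‖x‖²), which unlike ‖x‖ is smooth at the
    -- origin; the prefactor cancels the resulting e^{-1/2}.
    ((Real.exp (1 / 2) : ℂ) • SchwartzMap.postcompCLM (𝕜 := ℝ) Complex.ofRealCLM
      (SchwartzMap.compCLM ℝ (Function.hasTemperateGrowth_one_add_norm_sq_rpow E (1 / 2))
        ⟨1, 1, fun x => by
          rw [one_mul, pow_one, ← Real.sqrt_eq_rpow, Real.norm_of_nonneg (Real.sqrt_nonneg _)]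
          have : ‖x‖ ≤ Real.sqrt (1 + ‖x‖ ^ 2) := Real.le_sqrt_of_sq_le (by linarith)
          linarith⟩ gaussLine))

lemma stdGauss_apply (x : E) :
    stdGauss E x = ((Real.exp (-(2 * Real.pi ^ 2) * ‖x‖ ^ 2) : ℝ) : ℂ) := by
  change (Real.exp (1 / 2) : ℂ) •
    ((Real.exp (-(((1 + ‖(2 * Real.pi) • x‖ ^ 2) ^ (1 / 2 : ℝ)) ^ 2 / 2)) : ℝ) : ℂ) = _
  rw [← Real.sqrt_eq_rpow, Real.sq_sqrt (by positivity), smul_eq_mul, ← Complex.ofReal_mul,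
    ← Real.exp_add, norm_smul, Real.norm_of_nonneg (by positivity)]
  congr 2
  ring

lemma fourier_stdGauss (w : E) : (𝓕 (stdGauss E)) w =
    (((2 * Real.pi) ^ (-(Module.finrank ℝ E : ℝ) / 2) * Real.exp (-(1 / 2) * ‖w‖ ^ 2) : ℝ) : ℂ) := by
  have h1 : (stdGauss E : E → ℂ) =
      fun v => Complex.exp (-((2 * Real.pi ^ 2 : ℝ) : ℂ) * ‖v‖ ^ 2) := by
    ext v
    rw [stdGauss_apply]
    push_cast
    rfl
  have hpi : (Real.pi : ℝ) ≠ 0 := Real.pi_ne_zero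
  have h2 : ((Real.pi : ℂ) / ((2 * Real.pi ^ 2 : ℝ) : ℂ)) = (((2 * Real.pi)⁻¹ : ℝ) : ℂ) := by
    rw [← Complex.ofReal_div]
    congr 1
    field_simp
  rw [SchwartzMap.fourier_coe, h1, fourier_gaussian_innerProductSpace (by
    rw [Complex.ofReal_re]; positivity), h2]
  rw [show ((Module.finrank ℝ E : ℂ) / 2) = (((Module.finrank ℝ E : ℝ) / 2 : ℝ) : ℂ) by push_cast; rfl,
    ← Complex.ofReal_cpow (by positivity), Complex.ofReal_mul ((2 * Real.pi) ^ (_ : ℝ)), Complex.ofReal_exp,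
    Real.inv_rpow (by positivity), ← Real.rpow_neg (by positivity), neg_div]
  congr 2
  have : (Real.pi : ℂ) ≠ 0 := by exact_mod_cast hpi
  push_cast
  field_simp

/-- The transform is positive, so its L¹ norm is its integral, that is, the value of the Gaussian at
0. By invariance under linear maps every Gaussian multiplier is an L¹ contraction. -/
lemma l1_fourier_stdGauss : l1 (𝓕 (stdGauss E)) = 1 := by
  have h1 : ∀ w, ((‖(𝓕 (stdGauss E)) w‖ : ℝ) : ℂ) = (𝓕 (stdGauss E)) w := fun w => by
    rw [fourier_stdGauss, Complex.norm_real, Real.norm_of_nonneg (by positivity)]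
  have h2 : (𝓕⁻ (𝓕 (stdGauss E))) (0 : E) = 1 := by
    rw [FourierTransform.fourierInv_fourier_eq, stdGauss_apply]
    simp
  rw [SchwartzMap.fourierInv_coe, Real.fourierInv_eq] at h2
  simp only [inner_zero_right, AddChar.map_zero_eq_one, one_smul] at h2
  rw [l1_eq]
  have h3 : ((∫ x, ‖(𝓕 (stdGauss E)) x‖ : ℝ) : ℂ) = 1 := by
    rw [← integral_complex_ofReal, ← h2]
    exact integral_congr_ae (Eventually.of_forall h1)
  exact_mod_cast h3

/-- The Gaussian `e^{-2π²‖Lx‖²}`. -/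
def gauss (L : E ≃L[ℝ] E) : 𝓢(E, ℂ) := compL L (stdGauss E)

lemma gauss_apply (L : E ≃L[ℝ] E) (x : E) :
    gauss L x = ((Real.exp (-(2 * Real.pi ^ 2) * ‖L x‖ ^ 2) : ℝ) : ℂ) := by
  rw [gauss, SchwartzMap.compCLMOfContinuousLinearEquiv_apply, Function.comp_apply, stdGauss_apply]

lemma l1_fourier_gauss (L : E ≃L[ℝ] E) : l1 (𝓕 (gauss L)) = 1 := by
  rw [gauss, l1_fourier_compL, l1_fourier_stdGauss]

lemma l1_mult_gauss_le (L : E ≃L[ℝ] E) (φ : 𝓢(E, ℂ)) : l1 (mult (gauss L) φ) ≤ l1 φ := by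
  have := l1_mult_le (gauss L) φ
  rwa [l1_fourier_gauss, one_mul] at this

end Gauss

/-! ### Positive definite quadratic forms as squared norms of linear images -/

section MatEquiv

variable {n : Type*} [Fintype n] [DecidableEq n]

/-- The linear equivalence given by an invertible matrix. -/
def matEquiv (M M' : Matrix n n ℝ) (h : M * M' = 1) (h' : M' * M = 1) :
    EuclideanSpace ℝ n ≃L[ℝ] EuclideanSpace ℝ n :=
  (LinearEquiv.ofLinearMap (Matrix.toLpLin 2 2 M) (Matrix.toLpLin 2 2 M')
    (by ext x k; simp [Matrix.mulVec_mulVec, h])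
    (by ext x k; simp [Matrix.mulVec_mulVec, h'])).toContinuousLinearEquiv

lemma matEquiv_apply (M M' : Matrix n n ℝ) (h : M * M' = 1) (h' : M' * M = 1)
    (x : EuclideanSpace ℝ n) : matEquiv M M' h h' x = WithLp.toLp 2 (M *ᵥ x.ofLp) := rfl

lemma det_matEquiv (M M' : Matrix n n ℝ) (h : M * M' = 1) (h' : M' * M = 1) :
    LinearMap.det (matEquiv M M' h h' : EuclideanSpace ℝ n →ₗ[ℝ] EuclideanSpace ℝ n) = M.det :=
  LinearMap.det_toLpLin 2 M

open scoped MatrixOrder Matrix.Norms.L2Operator in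
lemma exists_eq_transpose_mul {C : Matrix n n ℝ} (hC : C.PosDef) :
    ∃ R : Matrix n n ℝ, C = Rᵀ * R := by
  obtain ⟨y, rfl⟩ := CStarAlgebra.nonneg_iff_eq_star_mul_self.mp hC.posSemidef.nonneg
  exact ⟨y, rfl⟩

lemma inner_eq_dotProduct (x y : EuclideanSpace ℝ n) : inner ℝ x y = x.ofLp ⬝ᵥ y.ofLp := by
  rw [EuclideanSpace.inner_eq_star_dotProduct, dotProduct_comm]
  simp

/-- A positive definite quadratic form is the square of the norm of a linear equivalence. -/
lemma exists_equiv_of_posDef {C : Matrix n n ℝ} (hC : C.PosDef) :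
    ∃ L : EuclideanSpace ℝ n ≃L[ℝ] EuclideanSpace ℝ n,
      (∀ x, ‖L x‖ ^ 2 = x.ofLp ⬝ᵥ (C *ᵥ x.ofLp)) ∧
      |(LinearMap.det (L : EuclideanSpace ℝ n →ₗ[ℝ] EuclideanSpace ℝ n))⁻¹| =
        (Real.sqrt C.det)⁻¹ ∧
      ∀ z, ‖(adjEquiv L).symm z‖ ^ 2 = (C⁻¹ *ᵥ z.ofLp) ⬝ᵥ z.ofLp := by
  obtain ⟨R, hR⟩ := exists_eq_transpose_mul hC
  have hdet : C.det = R.det ^ 2 := by rw [hR, Matrix.det_mul, Matrix.det_transpose, sq]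
  have hCu : IsUnit C.det := hC.det_pos.ne'.isUnit
  have hRu : IsUnit R.det := by
    rw [isUnit_iff_ne_zero]
    intro h0
    rw [hdet, h0] at hCu
    simp at hCu
  set L := matEquiv R R⁻¹ (Matrix.mul_nonsing_inv R hRu) (Matrix.nonsing_inv_mul R hRu) with hL
  have hinner : ∀ x y, inner ℝ (L x) (L y) = x.ofLp ⬝ᵥ (C *ᵥ y.ofLp) := fun x y => by
    rw [inner_eq_dotProduct, hL, matEquiv_apply, matEquiv_apply, hR, ← Matrix.mulVec_mulVec,
      Matrix.dotProduct_mulVec x.ofLp, Matrix.vecMul_transpose]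
  refine ⟨L, fun x => ?_, ?_, fun z => ?_⟩
  · rw [← real_inner_self_eq_norm_sq, hinner]
  · rw [hL, det_matEquiv, abs_inv, hdet, Real.sqrt_sq_eq_abs]
  · set w := (adjEquiv L).symm z with hw
    -- With C = LᵀL and w = L^{-T}z one has L^{-1}w = C^{-1}z, whence ‖w‖² = ⟨C^{-1}z, z⟩.
    have h1 : C *ᵥ (L.symm w).ofLp = z.ofLp := by
      refine dotProduct_eq _ _ fun x => ?_
      have h2 := hinner (WithLp.toLp 2 x) (L.symm w)
      rw [L.apply_symm_apply, hw, inner_adjEquiv_symm, inner_eq_dotProduct] at h2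
      rw [dotProduct_comm, ← h2, dotProduct_comm]
    have h3 : (L.symm w).ofLp = C⁻¹ *ᵥ z.ofLp := by
      rw [← h1, Matrix.mulVec_mulVec, Matrix.nonsing_inv_mul C hCu, Matrix.one_mulVec]
    have h4 := inner_adjEquiv_symm L (L.symm w) z
    rw [L.apply_symm_apply, ← hw, real_inner_self_eq_norm_sq] at h4
    rw [h4, inner_eq_dotProduct, h3]

end MatEquiv

end

section

variable {r : ℕ} {δ : Fin (r + 1) → ℕ}

/-! ### The adjoint semigroup as a Fourier multiplier along the linear flow -/

/-- The linear flow `e^{tM}`. -/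
def flow (M : Matrix (Coord δ) (Coord δ) ℝ) (t : ℝ) : Space δ ≃L[ℝ] Space δ :=
  matEquiv (NormedSpace.exp (t • M)) (NormedSpace.exp (t • -M)) (exp_mul_exp_neg M t)
    (exp_neg_mul_exp M t)

variable (M : Matrix (Coord δ) (Coord δ) ℝ)

lemma flow_ofLp (t : ℝ) (x : Space δ) :
    (flow M t x).ofLp = NormedSpace.exp (t • M) *ᵥ x.ofLp := rfl

lemma flow_flow (s t : ℝ) (x : Space δ) : flow M s (flow M t x) = flow M (s + t) x := by
  refine WithLp.ofLp_injective 2 ?_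
  rw [flow_ofLp, flow_ofLp, flow_ofLp, Matrix.mulVec_mulVec, exp_add_smul]

lemma flow_zero (x : Space δ) : flow M 0 x = x := by
  refine WithLp.ofLp_injective 2 ?_
  rw [flow_ofLp, zero_smul, NormedSpace.exp_zero, Matrix.one_mulVec]

lemma inner_flow (t : ℝ) (x y : Space δ) :
    inner ℝ (flow M t x) y = inner ℝ x (flow Mᵀ t y) := by
  rw [inner_eq_dotProduct, inner_eq_dotProduct, flow_ofLp, flow_ofLp, ← Matrix.transpose_smul,
    Matrix.exp_transpose, Matrix.dotProduct_mulVec x.ofLp, Matrix.vecMul_transpose]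

/-- The push-forward of a Schwartz density by the linear flow. -/
def push (t : ℝ) : 𝓢(Space δ, ℂ) →L[ℂ] 𝓢(Space δ, ℂ) :=
  ((|(LinearMap.det (flow M t : Space δ →ₗ[ℝ] Space δ))⁻¹| : ℝ) : ℂ) • compL (flow M t).symm

lemma push_apply (t : ℝ) (φ : 𝓢(Space δ, ℂ)) (x : Space δ) : push M t φ x =
    ((|(LinearMap.det (flow M t : Space δ →ₗ[ℝ] Space δ))⁻¹| : ℝ) : ℂ) *
      φ ((flow M t).symm x) := rfl

lemma integral_mul_push (t : ℝ) (F : Space δ → ℂ) (φ : 𝓢(Space δ, ℂ)) :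
    ∫ x, F x * push M t φ x = ∫ y, F (flow M t y) * φ y := by
  have h := integral_comp_equiv (flow M t) fun x => F x * φ ((flow M t).symm x)
  simp only [ContinuousLinearEquiv.symm_apply_apply] at h
  rw [h, ← integral_smul]
  refine integral_congr_ae (Eventually.of_forall fun x => ?_)
  simp only [push_apply, Complex.real_smul]
  ring

lemma l1_push (t : ℝ) (φ : 𝓢(Space δ, ℂ)) : l1 (push M t φ) = l1 φ := by
  have h := integral_comp_equiv (flow M t) fun x => ‖φ ((flow M t).symm x)‖
  simp only [ContinuousLinearEquiv.symm_apply_apply] at h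
  rw [l1_eq, l1_eq, h, ← integral_smul]
  refine integral_congr_ae (Eventually.of_forall fun x => ?_)
  simp only [push_apply, norm_mul, Complex.norm_real, smul_eq_mul, Real.norm_eq_abs, abs_abs]

lemma fourierInv_push (t : ℝ) (φ : 𝓢(Space δ, ℂ)) (ξ : Space δ) :
    (𝓕⁻ (push M t φ)) ξ = (𝓕⁻ φ) (flow Mᵀ t ξ) := by
  have h := integral_mul_push M t (fun x => (Real.fourierChar (inner ℝ x ξ) : ℂ)) φ
  rw [SchwartzMap.fourierInv_coe, SchwartzMap.fourierInv_coe, Real.fourierInv_eq,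
    Real.fourierInv_eq]
  simp only [Circle.smul_def, smul_eq_mul]
  rw [h]
  simp only [inner_flow]

variable (B : Matrix (Coord δ) (Coord δ) ℝ)

/-- The Fourier multiplier `e^{-2π²⟨C(t)ξ, ξ⟩}`. -/
def gaussSymbol (t : ℝ) (ξ : Space δ) : ℂ :=
  ((Real.exp (-(2 * Real.pi ^ 2) * covForm B t ξ.ofLp) : ℝ) : ℂ)

lemma gaussSymbol_zero : gaussSymbol B 0 = fun _ => 1 := by
  ext ξ
  simp [gaussSymbol, covForm]

/-- The adjoint semigroup as a continuous linear map. -/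
def evol (t : ℝ) : 𝓢(Space δ, ℂ) →L[ℂ] 𝓢(Space δ, ℂ) := (mult (gaussSymbol B t)).comp (push B t)

variable {B}

lemma posDef_covMatrix (hB : IsKolmogorovMatrix B) {t : ℝ} (ht : 0 < t) :
    (covMatrix B t).PosDef := by
  obtain ⟨c, hc, h⟩ := exists_pos_le_covForm hB t
  refine Matrix.PosDef.of_dotProduct_mulVec_pos ?_ fun x hx => ?_
  · rw [Matrix.IsHermitian, Matrix.conjTranspose_eq_transpose_of_trivial]
    exact covMatrix_isSymm B t
  · rw [star_trivial, dotProduct_covMatrix]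
    refine lt_of_lt_of_le ?_ (h t ⟨ht, le_rfl⟩ x)
    obtain ⟨k, hk⟩ := Function.ne_iff.1 hx
    refine mul_pos hc (Finset.sum_pos' (fun k _ => by positivity) ⟨k, Finset.mem_univ k, ?_⟩)
    have : x k ≠ 0 := hk
    positivity

lemma exists_gaussSymbol_eq (hB : IsKolmogorovMatrix B) {t : ℝ} (ht : 0 < t) :
    ∃ L : Space δ ≃L[ℝ] Space δ, gaussSymbol B t = gauss L ∧
      (∀ x, ‖L x‖ ^ 2 = covForm B t x.ofLp) ∧
      ∀ z, (𝓕 (gauss L)) z = (gaussianKernel B t z.ofLp : ℂ) := by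
  obtain ⟨L, h1, h2, h3⟩ := exists_equiv_of_posDef (posDef_covMatrix hB ht)
  have h1' : ∀ x, ‖L x‖ ^ 2 = covForm B t x.ofLp := fun x => by rw [h1, dotProduct_covMatrix]
  refine ⟨L, ?_, h1', fun z => ?_⟩
  · ext ξ
    rw [gauss_apply, h1']
    rfl
  · rw [gauss, fourier_compL, h2, fourier_stdGauss, h3, Complex.real_smul, ← Complex.ofReal_mul,
      gaussianKernel, finrank_euclideanSpace]
    congr 1
    ring

lemma hasTemperateGrowth_gaussSymbol (hB : IsKolmogorovMatrix B) {t : ℝ} (ht : 0 ≤ t) :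
    (gaussSymbol B t).HasTemperateGrowth := by
  rcases ht.eq_or_lt with rfl | ht
  · rw [gaussSymbol_zero]
    fun_prop
  · obtain ⟨L, h, -⟩ := exists_gaussSymbol_eq hB ht
    rw [h]
    exact (gauss L).hasTemperateGrowth

lemma fourierInv_evol (hB : IsKolmogorovMatrix B) {t : ℝ} (ht : 0 ≤ t) (φ : 𝓢(Space δ, ℂ))
    (ξ : Space δ) :
    (𝓕⁻ (evol B t φ)) ξ = gaussSymbol B t ξ * (𝓕⁻ φ) (flow Bᵀ t ξ) := by
  rw [evol, ContinuousLinearMap.comp_apply, fourierInv_mult (hasTemperateGrowth_gaussSymbol hB ht),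
    fourierInv_push]

lemma evol_zero (hB : IsKolmogorovMatrix B) (φ : 𝓢(Space δ, ℂ)) : evol B 0 φ = φ := by
  refine eq_of_fourierInv fun ξ => ?_
  rw [fourierInv_evol hB le_rfl, gaussSymbol_zero, one_mul, flow_zero]

lemma evol_evol (hB : IsKolmogorovMatrix B) {s t : ℝ} (hs : 0 ≤ s) (ht : 0 ≤ t)
    (φ : 𝓢(Space δ, ℂ)) : evol B s (evol B t φ) = evol B (s + t) φ := by
  refine eq_of_fourierInv fun ξ => ?_
  rw [fourierInv_evol hB hs, fourierInv_evol hB ht, fourierInv_evol hB (add_nonneg hs ht),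
    flow_flow, add_comm t s, ← mul_assoc]
  congr 1
  simp only [gaussSymbol]
  rw [← Complex.ofReal_mul, ← Real.exp_add, covForm_add, flow_ofLp]
  congr 2
  ring

lemma l1_evol_le (hB : IsKolmogorovMatrix B) {t : ℝ} (ht : 0 ≤ t) (φ : 𝓢(Space δ, ℂ)) :
    l1 (evol B t φ) ≤ l1 φ := by
  rcases ht.eq_or_lt with rfl | ht
  · rw [evol_zero hB]
  · obtain ⟨L, h, -⟩ := exists_gaussSymbol_eq hB ht
    rw [evol, ContinuousLinearMap.comp_apply, h]
    exact (l1_mult_gauss_le L _).trans_eq (l1_push B t φ)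

lemma evol_eq_integral (hB : IsKolmogorovMatrix B) {t : ℝ} (ht : 0 < t) (φ : 𝓢(Space δ, ℂ))
    (z : Space δ) : evol B t φ z = ∫ y, (fundSol B t y z : ℂ) * φ y := by
  obtain ⟨L, h, -, h2⟩ := exists_gaussSymbol_eq hB ht
  rw [evol, ContinuousLinearMap.comp_apply, h, mult_apply_eq_integral]
  refine (integral_mul_push B t (fun y => (𝓕 (gauss L)) (z - y)) φ).trans ?_
  simp only [h2]
  rfl

/-- For a Kolmogorov matrix, `adjointSemigroup` is given by `evol`. -/
theorem adjointSemigroup_eq (hB : IsKolmogorovMatrix B) {t : ℝ} (ht : 0 ≤ t)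
    (φ : 𝓢(Space δ, ℂ)) : adjointSemigroup B t φ = evol B t φ := by
  rcases ht.eq_or_lt with rfl | ht
  · rw [evol_zero hB, adjointSemigroup, if_pos rfl]
  · have hex : ∃ ψ : 𝓢(Space δ, ℂ), ∀ z, ψ z = ∫ y, (fundSol B t y z : ℂ) * φ y :=
      ⟨evol B t φ, evol_eq_integral hB ht φ⟩
    rw [adjointSemigroup, if_neg ht.ne', dif_pos hex]
    ext z
    rw [hex.choose_spec, evol_eq_integral hB ht]

end

section

/-! ### Decay of Gaussian multipliers on annuli -/

section Decay

variable {E : Type*} [NormedAddCommGroup E] [InnerProductSpace ℝ E] [FiniteDimensional ℝ E]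
  [MeasurableSpace E] [BorelSpace E]

lemma l1_fourier_smulLeft_le (f g : 𝓢(E, ℂ)) :
    l1 (𝓕 (SchwartzMap.smulLeftCLM ℂ f g)) ≤ l1 (𝓕 f) * l1 (𝓕 g) := by
  have h := l1_mult_le f (𝓕 g)
  rwa [mult_apply, FourierTransform.fourierInv_fourier_eq] at h

lemma IsAnnular.exists_div_pow (M : ℕ) : ∀ {χ : 𝓢(E, ℂ)}, IsAnnular χ →
    ∃ χ' : 𝓢(E, ℂ), ∀ ξ, χ ξ = (((‖ξ‖ ^ 2) ^ M : ℝ) : ℂ) * χ' ξ := by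
  induction M with
  | zero => exact fun {χ} _ => ⟨χ, fun ξ => by simp⟩
  | succ M ih =>
    intro χ hχ
    obtain ⟨χ₁, h₁, he₁⟩ := hχ.exists_div
    obtain ⟨χ₂, he₂⟩ := ih h₁
    refine ⟨χ₂, fun ξ => ?_⟩
    rw [he₁, he₂, pow_succ]
    push_cast
    ring

lemma hasTemperateGrowth_norm_sq_pow (M : ℕ) :
    (fun ξ : E => (((‖ξ‖ ^ 2) ^ M : ℝ) : ℂ)).HasTemperateGrowth := by
  have h : (fun ξ : E => (‖ξ‖ ^ 2) ^ M).HasTemperateGrowth := by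
    have h2 : (fun ξ : E => ‖ξ‖ ^ 2).HasTemperateGrowth := by
      exact Function.hasTemperateGrowth_norm_sq E
    induction M with
    | zero => simp
    | succ M ih =>
      simp_rw [pow_succ _ M]
      exact ih.mul h2
  exact Complex.ofRealCLM.hasTemperateGrowth.comp h

/-- A Gaussian which dominates an isotropic Gaussian of size `s` is of order `s^{-M}` on annuli. -/
theorem exists_l1_fourier_gauss_annulus_le {c : ℝ} (hc : 0 < c) (M : ℕ) {χ : 𝓢(E, ℂ)}
    (hχ : IsAnnular χ) : ∃ C, 0 ≤ C ∧ ∀ (s : ℝ) (_ : 0 < s) (L L' : E ≃L[ℝ] E),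
      (∀ ξ, ‖L ξ‖ ^ 2 = ‖L' ξ‖ ^ 2 + c * s * ‖ξ‖ ^ 2) →
      s ^ M * l1 (𝓕 (SchwartzMap.smulLeftCLM ℂ (gauss L) χ)) ≤ C := by
  obtain ⟨χ', hχ'⟩ := hχ.exists_div_pow M
  -- This is ‖x‖^{2M} e^{-2π²c‖x‖²}. Composing it with the homothety of ratio √s produces
  -- s^M‖ξ‖^{2M} times the isotropic Gaussian of size s.
  set Ψ : 𝓢(E, ℂ) := SchwartzMap.smulLeftCLM ℂ (fun ξ : E => (((‖ξ‖ ^ 2) ^ M : ℝ) : ℂ))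
    (gauss (homothety (Real.sqrt c) (Real.sqrt_pos.2 hc).ne')) with hΨ
  have hΨx : ∀ x, Ψ x = (((‖x‖ ^ 2) ^ M * Real.exp (-(2 * Real.pi ^ 2) * (c * ‖x‖ ^ 2)) : ℝ) : ℂ) :=
    fun x => by
      rw [hΨ, SchwartzMap.smulLeftCLM_apply_apply (hasTemperateGrowth_norm_sq_pow M), gauss_apply,
        homothety_apply, norm_smul, mul_pow, Real.norm_eq_abs, sq_abs, Real.sq_sqrt hc.le,
        smul_eq_mul, ← Complex.ofReal_mul]
  refine ⟨l1 (𝓕 Ψ) * l1 (𝓕 χ'), mul_nonneg (l1_nonneg _) (l1_nonneg _), fun s hs L L' hL => ?_⟩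
  set H : E ≃L[ℝ] E := homothety (Real.sqrt s) (Real.sqrt_pos.2 hs).ne' with hH
  -- The powers of ‖ξ‖ divided out of χ combine with the isotropic Gaussian into the dilate of Ψ,
  -- and s^{-M} comes out. The three factors left have kernels with L¹ norms independent of s, L and
  -- L'.
  have hkey : SchwartzMap.smulLeftCLM ℂ (gauss L) χ = (((s ^ M)⁻¹ : ℝ) : ℂ) •
      SchwartzMap.smulLeftCLM ℂ (gauss L') (SchwartzMap.smulLeftCLM ℂ (compL H Ψ) χ') := by
    ext ξ
    rw [smul_apply, SchwartzMap.smulLeftCLM_apply_apply (gauss L).hasTemperateGrowth,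
      SchwartzMap.smulLeftCLM_apply_apply (gauss L').hasTemperateGrowth,
      SchwartzMap.smulLeftCLM_apply_apply (compL H Ψ).hasTemperateGrowth,
      SchwartzMap.compCLMOfContinuousLinearEquiv_apply, Function.comp_apply, hΨx, gauss_apply,
      gauss_apply, hχ', hL, hH, homothety_apply, norm_smul, mul_pow, Real.norm_eq_abs, sq_abs,
      Real.sq_sqrt hs.le]
    simp only [smul_eq_mul, ← mul_assoc, ← Complex.ofReal_mul]
    congr 2
    have h1 : Real.exp (-(2 * Real.pi ^ 2) * (‖L' ξ‖ ^ 2 + c * s * ‖ξ‖ ^ 2)) =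
        Real.exp (-(2 * Real.pi ^ 2) * ‖L' ξ‖ ^ 2) *
          Real.exp (-(2 * Real.pi ^ 2) * (c * (s * ‖ξ‖ ^ 2))) := by
      rw [← Real.exp_add]
      ring_nf
    rw [h1, mul_pow]
    have : s ^ M ≠ 0 := by positivity
    field_simp
  have hsm : 𝓕 ((((s ^ M)⁻¹ : ℝ) : ℂ) • SchwartzMap.smulLeftCLM ℂ (gauss L')
      (SchwartzMap.smulLeftCLM ℂ (compL H Ψ) χ')) = (((s ^ M)⁻¹ : ℝ) : ℂ) •
      𝓕 (SchwartzMap.smulLeftCLM ℂ (gauss L') (SchwartzMap.smulLeftCLM ℂ (compL H Ψ) χ')) :=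
    map_smul (FourierTransform.fourierCLM ℂ 𝓢(E, ℂ)) _ _
  rw [hkey, hsm, map_smul_eq_mul, Complex.norm_real, Real.norm_of_nonneg (by positivity),
    ← mul_assoc, mul_inv_cancel₀ (by positivity), one_mul]
  refine (l1_fourier_smulLeft_le _ _).trans ?_
  rw [l1_fourier_gauss, one_mul]
  refine (l1_fourier_smulLeft_le _ _).trans_eq ?_
  rw [l1_fourier_compL]

end Decay

variable {r : ℕ} {δ : Fin (r + 1) → ℕ} (ρ : Generator δ)

/-- A multiplier equal to one on the support of `annulus`. -/
def fatAnnulus : 𝓢(Space δ, ℂ) := cut ρ 1 - cut ρ (-2)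

lemma isAnnular_fatAnnulus : IsAnnular (fatAnnulus ρ) := by
  refine ⟨?_, ?_⟩
  · have : (fatAnnulus ρ : Space δ → ℂ) = (cut ρ 1 : Space δ → ℂ) - cut ρ (-2) := rfl
    rw [this, sub_eq_add_neg]
    exact (hasCompactSupport_cut ρ 1).add (hasCompactSupport_cut ρ (-2)).neg
  · obtain ⟨s, hs, h⟩ := exists_fsize_lt (δ := δ) (c := 1 / 8) (by norm_num)
    refine ⟨s, hs, fun ξ hξ => ?_⟩
    have := h ξ hξ
    rw [fatAnnulus, sub_apply, cut_eq_one ρ (by norm_num; linarith),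
      cut_eq_one ρ (by norm_num; linarith), sub_self]

lemma fatAnnulus_mul_annulus (ξ : Space δ) : fatAnnulus ρ ξ * annulus ρ ξ = annulus ρ ξ := by
  rw [fatAnnulus, annulus, sub_apply, sub_apply, sub_mul, mul_sub, mul_sub,
    mul_comm (cut ρ 1 ξ), mul_comm (cut ρ 1 ξ), cut_mul_cut ρ (by norm_num),
    cut_mul_cut ρ (by norm_num), cut_mul_cut ρ (by norm_num), cut_mul_cut ρ (by norm_num)]
  ring

variable {B : Matrix (Coord δ) (Coord δ) ℝ}

/-- The Gaussian now acts directly on a frequency-localized function, and the push-forward that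
follows preserves L¹ norms. -/
lemma evol_eq_push_mult (hB : IsKolmogorovMatrix B) {t : ℝ} (ht : 0 ≤ t) (φ : 𝓢(Space δ, ℂ)) :
    evol B t φ = push B t (mult (gaussSymbol (-B) t) φ) := by
  refine eq_of_fourierInv fun ξ => ?_
  rw [fourierInv_evol hB ht, fourierInv_push,
    fourierInv_mult (hasTemperateGrowth_gaussSymbol hB.neg ht)]
  congr 1
  simp only [gaussSymbol]
  rw [flow_ofLp, covForm_neg]

/-- The rescaled Gaussian multiplier splits off an isotropic Gaussian. -/
lemma exists_split_gaussSymbol (hB : IsKolmogorovMatrix B) (T : ℝ) : ∃ c > 0,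
    ∀ t ∈ Ioc 0 T, ∀ n : ℕ, 1 ≤ t * 4 ^ n → ∃ L L' : Space δ ≃L[ℝ] Space δ,
      (∀ ξ, gaussSymbol B t ξ = gauss L (dil (-(n : ℤ)) ξ)) ∧
      ∀ ξ, ‖L ξ‖ ^ 2 = ‖L' ξ‖ ^ 2 + c * (t * 4 ^ n) * ‖ξ‖ ^ 2 := by
  obtain ⟨c, hc, h⟩ := exists_pos_le_covForm hB T
  -- Only half of the coercivity goes into the isotropic Gaussian, so that the remaining form stays
  -- positive definite and is the square of a linear equivalence.
  refine ⟨c / 2, half_pos hc, fun t ht n hn => ?_⟩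
  obtain ⟨L₀, hL₀, hL₀', -⟩ := exists_gaussSymbol_eq hB ht.1
  set L : Space δ ≃L[ℝ] Space δ := (dil (n : ℤ)).trans L₀ with hL
  set D : Matrix (Coord δ) (Coord δ) ℝ :=
    Matrix.diagonal fun k => ((2 : ℝ) ^ n) ^ (2 * (k.1 : ℕ) + 1) with hD
  set C : Matrix (Coord δ) (Coord δ) ℝ :=
    D * covMatrix B t * D - (c / 2 * (t * 4 ^ n)) • (1 : Matrix (Coord δ) (Coord δ) ℝ) with hC
  have hDx : ∀ x : Space δ, (dil (n : ℤ) x).ofLp = D *ᵥ x.ofLp := fun x => by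
    ext k
    rw [hD, Matrix.mulVec_diagonal, dil_apply, dilation_apply, zpow_natCast]
  have hDs : Dᵀ = D := Matrix.diagonal_transpose _
  have hLx : ∀ x : Space δ, ‖L x‖ ^ 2 = covForm B t (D *ᵥ x.ofLp) := fun x => by
    rw [hL, ContinuousLinearEquiv.trans_apply, hL₀', hDx]
  have hCx : ∀ x : Coord δ → ℝ, x ⬝ᵥ (C *ᵥ x) =
      covForm B t (D *ᵥ x) - c / 2 * (t * 4 ^ n) * (x ⬝ᵥ x) := fun x => by
    rw [hC, Matrix.sub_mulVec, dotProduct_sub, Matrix.smul_mulVec, Matrix.one_mulVec,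
      dotProduct_smul, smul_eq_mul, ← dotProduct_covMatrix, Matrix.mul_assoc,
      ← Matrix.mulVec_mulVec, ← Matrix.mulVec_mulVec, Matrix.dotProduct_mulVec x D,
      ← Matrix.mulVec_transpose, hDs]
  have hlow : ∀ x : Coord δ → ℝ, c * (t * 4 ^ n) * (x ⬝ᵥ x) ≤ covForm B t (D *ᵥ x) := fun x => by
    refine le_trans ?_ (h t ht (D *ᵥ x))
    rw [mul_assoc]
    refine mul_le_mul_of_nonneg_left ?_ hc.le
    rw [dotProduct, Finset.mul_sum]
    refine Finset.sum_le_sum fun k _ => ?_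
    have h4 : (4 : ℝ) ^ n = (2 ^ n) ^ 2 := by
      rw [← pow_mul, mul_comm, pow_mul]
      norm_num
    have e : t ^ (2 * (k.1 : ℕ) + 1) * (((2 : ℝ) ^ n) ^ (2 * (k.1 : ℕ) + 1) * x k) ^ 2 =
        (t * 4 ^ n) ^ (2 * (k.1 : ℕ) + 1) * (x k * x k) := by
      rw [h4, mul_pow, mul_pow, ← pow_mul _ 2, mul_comm 2 (2 * (k.1 : ℕ) + 1), pow_mul _ _ 2]
      ring
    rw [hD, Matrix.mulVec_diagonal, e]
    -- After dilation by 2^n the coercivity on block i is (t4^n)^{2i+1}, which dominates t4^n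
    -- exactly because t4^n ≥ 1.
    refine mul_le_mul_of_nonneg_right (le_self_pow₀ hn (by omega)) (mul_self_nonneg _)
  have hpos : C.PosDef := by
    refine Matrix.PosDef.of_dotProduct_mulVec_pos ?_ fun x hx => ?_
    · rw [Matrix.IsHermitian, Matrix.conjTranspose_eq_transpose_of_trivial, hC,
        Matrix.transpose_sub, Matrix.transpose_mul, Matrix.transpose_mul, hDs,
        (covMatrix_isSymm B t).eq, Matrix.mul_assoc, Matrix.transpose_smul, Matrix.transpose_one]
    · rw [star_trivial, hCx]
      have h1 := hlow x
      have h2 : 0 < x ⬝ᵥ x := by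
        have := Matrix.dotProduct_star_self_pos_iff.2 hx
        rwa [star_trivial] at this
      have h3 : 0 < c * (t * 4 ^ n) * (x ⬝ᵥ x) := by
        have := ht.1
        positivity
      nlinarith
  obtain ⟨L', hL', -⟩ := exists_equiv_of_posDef hpos
  refine ⟨L, L', fun ξ => ?_, fun ξ => ?_⟩
  · rw [hL₀, gauss_apply, gauss_apply, hL, ContinuousLinearEquiv.trans_apply, dil_dil,
      add_neg_cancel, dil_zero]
  · rw [hL', hLx, hCx, ← inner_eq_dotProduct, real_inner_self_eq_norm_sq]
    ring

/-- The size of a frequency `2^m` relative to the time `t`. -/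
def relSize (t : ℝ) (m : ℕ) : ℝ := max 1 (Real.sqrt t * 2 ^ m)

lemma one_le_relSize (t : ℝ) (m : ℕ) : 1 ≤ relSize t m := le_max_left _ _

lemma relSize_sq (t : ℝ) (ht : 0 ≤ t) (m : ℕ) : relSize t m ^ 2 = max 1 (t * 4 ^ m) := by
  have h1 : (Real.sqrt t * 2 ^ m) ^ 2 = t * 4 ^ m := by
    rw [mul_pow, Real.sq_sqrt ht, ← pow_mul, mul_comm m 2, pow_mul]
    norm_num
  have h0 : 0 ≤ Real.sqrt t * 2 ^ m := by positivity
  rw [relSize, ← h1]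
  rcases le_total (Real.sqrt t * 2 ^ m) 1 with h | h
  · rw [max_eq_left h, max_eq_left (pow_le_one₀ h0 h), one_pow]
  · rw [max_eq_right h, max_eq_right (one_le_pow₀ h)]

/-- Smoothing of the adjoint semigroup on a Paley-Littlewood block. -/
theorem exists_relSize_mul_l1_evol_le (hB : IsKolmogorovMatrix B) (T : ℝ) (M : ℕ) :
    ∃ C, 0 ≤ C ∧ ∀ t ∈ Ioc 0 T, ∀ (m : ℕ) (φ : 𝓢(Space δ, ℂ)),
      (relSize t m ^ 2) ^ M * l1 (evol B t (dblock ρ m φ)) ≤ C * l1 (dblock ρ m φ) := by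
  obtain ⟨c, hc, h⟩ := exists_split_gaussSymbol hB.neg T
  obtain ⟨C, hC, hCs⟩ := exists_l1_fourier_gauss_annulus_le hc M (isAnnular_fatAnnulus ρ)
  refine ⟨(max 1 T) ^ M + C, add_nonneg (by positivity) hC, fun t ht m φ => ?_⟩
  have hT : 1 ≤ max 1 T := le_max_left _ _
  have hcon := l1_evol_le hB ht.1.le (dblock ρ m φ)
  have hl := l1_nonneg (dblock ρ m φ)
  rw [relSize_sq t ht.1.le, add_mul]
  rcases le_or_gt (t * 4 ^ m) 1 with h1 | h1
  · rw [max_eq_left h1, one_pow, one_mul]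
    have h2 : 1 ≤ (max 1 T) ^ M := one_le_pow₀ hT
    nlinarith [mul_nonneg hC hl]
  rw [max_eq_right h1.le]
  -- Block 0 has no annular support, but there the relative size is bounded in terms of `T` and
  -- contraction suffices.
  cases m with
  | zero =>
    rw [pow_zero, mul_one]
    have h2 : t ^ M ≤ (max 1 T) ^ M := pow_le_pow_left₀ ht.1.le (ht.2.trans (le_max_right _ _)) M
    have h3 := mul_le_mul h2 hcon (l1_nonneg _) (by positivity)
    nlinarith [mul_nonneg hC hl]
  | succ n =>
    obtain ⟨L, L', hL, hLL⟩ := h t ht (n + 1) h1.le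
    have h2 := hCs (t * 4 ^ (n + 1)) (by linarith) L L' hLL
    -- Inserting the fat annulus, which is 1 on the block, replaces the Gaussian by an annular
    -- multiplier; up to dilation this is the one estimated above with s = t4^{n+1}.
    have h3 : mult (gaussSymbol (-B) t) (dblock ρ (n + 1) φ) =
        mult (compL (dil (-((n + 1 : ℕ) : ℤ)))
          (SchwartzMap.smulLeftCLM ℂ (gauss L) (fatAnnulus ρ))) (dblock ρ (n + 1) φ) := by
      refine eq_of_fourierInv fun ξ => ?_
      rw [fourierInv_mult (hasTemperateGrowth_gaussSymbol hB.neg ht.1.le),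
        fourierInv_mult (SchwartzMap.hasTemperateGrowth _), dblock,
        fourierInv_mult (SchwartzMap.hasTemperateGrowth _), symbol_succ_eq, hL,
        SchwartzMap.compCLMOfContinuousLinearEquiv_apply,
        SchwartzMap.compCLMOfContinuousLinearEquiv_apply, Function.comp_apply, Function.comp_apply,
        SchwartzMap.smulLeftCLM_apply_apply (gauss L).hasTemperateGrowth, smul_eq_mul]
      have := fatAnnulus_mul_annulus ρ (dil (-((n + 1 : ℕ) : ℤ)) ξ)
      linear_combination (-(gauss L (dil (-((n + 1 : ℕ) : ℤ)) ξ) * (𝓕⁻ φ) ξ)) * this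
    rw [evol_eq_push_mult hB ht.1.le, l1_push, h3]
    have h4 := l1_mult_le (compL (dil (-((n + 1 : ℕ) : ℤ)))
      (SchwartzMap.smulLeftCLM ℂ (gauss L) (fatAnnulus ρ))) (dblock ρ (n + 1) φ)
    rw [l1_fourier_compL] at h4
    have h5 : (0 : ℝ) ≤ (t * 4 ^ (n + 1)) ^ M := by
      have := ht.1
      positivity
    have h6 := mul_le_mul_of_nonneg_left h4 h5
    rw [← mul_assoc] at h6
    have h7 := mul_le_mul_of_nonneg_right h2 hl
    have h8 : 0 ≤ (max 1 T) ^ M * l1 (dblock ρ (n + 1) φ) := by positivity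
    linarith

end

section

/-! ### Anisotropic size along the linear flow -/

variable {r : ℕ} {δ : Fin (r + 1) → ℕ}

lemma abs_coord_le_pow {s : ℝ} (hs : 1 ≤ s) {z : Space δ} (h : anisoNorm z ≤ s) (k : Coord δ) :
    |z k| ≤ s ^ (2 * r + 1) := by
  set a : ℝ := Real.sqrt (∑ l : Fin (δ k.1), z ⟨k.1, l⟩ ^ 2) with ha
  have ha0 : 0 ≤ a := Real.sqrt_nonneg _
  have h1 : |z k| ≤ a := by
    rw [ha]
    refine Real.abs_le_sqrt ?_
    exact Finset.single_le_sum (f := fun l : Fin (δ k.1) => z ⟨k.1, l⟩ ^ 2)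
      (fun l _ => sq_nonneg _) (Finset.mem_univ k.2)
  have h2 : a ^ (1 / (2 * ((k.1 : ℕ) : ℝ) + 1)) ≤ s := by
    refine le_trans ?_ h
    unfold anisoNorm
    exact Finset.single_le_sum
      (f := fun i : Fin (r + 1) =>
        (Real.sqrt (∑ l : Fin (δ i), z ⟨i, l⟩ ^ 2)) ^ (1 / (2 * (i : ℝ) + 1)))
      (fun i _ => Real.rpow_nonneg (Real.sqrt_nonneg _) _) (Finset.mem_univ k.1)
  have h3 : a ≤ s ^ (2 * (k.1 : ℕ) + 1) := by
    have h4 := pow_le_pow_left₀ (Real.rpow_nonneg ha0 _) h2 (2 * (k.1 : ℕ) + 1)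
    rwa [← Real.rpow_natCast, ← Real.rpow_mul ha0, show
      1 / (2 * ((k.1 : ℕ) : ℝ) + 1) * ((2 * (k.1 : ℕ) + 1 : ℕ) : ℝ) = 1 by
        push_cast; field_simp, Real.rpow_one] at h4
  refine h1.trans (h3.trans (pow_le_pow_right₀ hs ?_))
  have := k.1.2
  omega

lemma anisoNorm_le_of_abs_coord_le {R : ℝ} (hR : 1 ≤ R) {z : Space δ} (h : ∀ k, |z k| ≤ R) :
    anisoNorm z ≤ ((r + 1) * (Fintype.card (Coord δ) + 1)) * R := by
  have key : ∀ i : Fin (r + 1), (Real.sqrt (∑ l : Fin (δ i), z ⟨i, l⟩ ^ 2)) ^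
      (1 / (2 * (i : ℝ) + 1)) ≤ (Fintype.card (Coord δ) + 1) * R := fun i => by
    have h1 : Real.sqrt (∑ l : Fin (δ i), z ⟨i, l⟩ ^ 2) ≤ (Fintype.card (Coord δ) + 1) * R := by
      refine Real.sqrt_le_iff.2 ⟨by positivity, ?_⟩
      calc ∑ l : Fin (δ i), z ⟨i, l⟩ ^ 2 ≤ ∑ k : Coord δ, z k ^ 2 := by
            rw [Fintype.sum_sigma]
            exact Finset.single_le_sum (f := fun i => ∑ l : Fin (δ i), z ⟨i, l⟩ ^ 2)
              (fun i _ => Finset.sum_nonneg fun l _ => sq_nonneg _) (Finset.mem_univ i)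
        _ ≤ ∑ _k : Coord δ, R ^ 2 := Finset.sum_le_sum fun k _ => by
            rw [← sq_abs]
            exact pow_le_pow_left₀ (abs_nonneg _) (h k) 2
        _ = Fintype.card (Coord δ) * R ^ 2 := by
            rw [Finset.sum_const, nsmul_eq_mul, Finset.card_univ]
        _ ≤ ((Fintype.card (Coord δ) + 1) * R) ^ 2 := by
            rw [mul_pow]
            refine mul_le_mul_of_nonneg_right ?_ (sq_nonneg _)
            have : (0 : ℝ) ≤ Fintype.card (Coord δ) := Nat.cast_nonneg _
            nlinarith
    have hX : 1 ≤ (Fintype.card (Coord δ) + 1) * R := by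
      have : (0 : ℝ) ≤ Fintype.card (Coord δ) := Nat.cast_nonneg _
      nlinarith
    refine (Real.rpow_le_rpow (Real.sqrt_nonneg _) h1 (by positivity)).trans ?_
    refine (Real.rpow_le_rpow_of_exponent_le hX (y := _) (z := 1) ?_).trans_eq (Real.rpow_one _)
    rw [div_le_one (by positivity)]
    have : (0 : ℝ) ≤ (i : ℕ) := Nat.cast_nonneg _
    linarith
  refine (Finset.sum_le_sum fun i _ => key i).trans_eq ?_
  rw [Finset.sum_const, nsmul_eq_mul, Finset.card_univ, Fintype.card_fin]
  push_cast
  ring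

/-- Matrices with bounded entries form a compact set, on which the exponential is bounded by
continuity. -/
lemma exists_abs_exp_entry_le {n : Type*} [Fintype n] [DecidableEq n] (R : n → n → ℝ) :
    ∃ K, 1 ≤ K ∧ ∀ N : Matrix n n ℝ, (∀ k l, |N k l| ≤ R k l) →
      ∀ y : n → ℝ, ∀ a, 0 ≤ a → (∀ k, |y k| ≤ a) → ∀ k, |(NormedSpace.exp N *ᵥ y) k| ≤ K * a := by
  have hc : IsCompact (Set.pi univ fun k => Set.pi univ fun l => Icc (-R k l) (R k l)) :=
    isCompact_univ_pi fun k => isCompact_univ_pi fun l => isCompact_Icc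
  have hf : Continuous fun N : n → n → ℝ => ∑ k, ∑ l, |NormedSpace.exp (Matrix.of N) k l| := by
    refine continuous_finsetSum _ fun k _ => continuous_finsetSum _ fun l _ => ?_
    exact ((continuous_matrix_exp (n := n)).matrix_elem k l).abs
  obtain ⟨K, hK⟩ := hc.bddAbove_image hf.continuousOn
  refine ⟨max 1 K, le_max_left _ _, fun N hN y a ha hy k => ?_⟩
  have h1 : ∑ k, ∑ l, |NormedSpace.exp N k l| ≤ K :=
    hK ⟨N, fun k _ l _ => abs_le.1 (hN k l), rfl⟩
  have h2 : ∑ l, |NormedSpace.exp N k l| ≤ K :=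
    (Finset.single_le_sum (f := fun k => ∑ l, |NormedSpace.exp N k l|)
      (fun k _ => Finset.sum_nonneg fun l _ => abs_nonneg _) (Finset.mem_univ k)).trans h1
  rw [Matrix.mulVec, dotProduct]
  refine (Finset.abs_sum_le_sum_abs _ _).trans ?_
  calc ∑ l, |NormedSpace.exp N k l * y l| ≤ ∑ l, |NormedSpace.exp N k l| * a :=
        Finset.sum_le_sum fun l _ => by
          rw [abs_mul]
          exact mul_le_mul_of_nonneg_left (hy l) (abs_nonneg _)
    _ = (∑ l, |NormedSpace.exp N k l|) * a := by rw [Finset.sum_mul]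
    _ ≤ max 1 K * a := mul_le_mul_of_nonneg_right (h2.trans (le_max_right _ _)) ha

/-- Frequencies of size at most `s b` remain of size `O(s^q b)` along the flow, for times of
order `b⁻²`. -/
theorem exists_fsize_flow_le {M : Matrix (Coord δ) (Coord δ) ℝ}
    (hM : ∀ k l : Coord δ, (k.1 : ℕ) + 1 < (l.1 : ℕ) → M k l = 0) (Λ : ℝ) :
    ∃ C, 1 ≤ C ∧ ∀ b t : ℝ, 1 ≤ b → 0 ≤ t → t * b ^ 2 ≤ Λ → ∀ s, 1 ≤ s → ∀ ξ : Space δ,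
      fsize ξ ≤ s * b → fsize (flow M t ξ) ≤ C * s ^ (2 * r + 1) * b := by
  obtain ⟨K, hK1, hK⟩ := exists_abs_exp_entry_le fun k l : Coord δ => Λ * |M k l|
  set c : ℝ := (r + 1) * (Fintype.card (Coord δ) + 1) with hc
  have hc1 : 1 ≤ c := by
    have h1 : (0 : ℝ) ≤ Fintype.card (Coord δ) := Nat.cast_nonneg _
    have h2 : (0 : ℝ) ≤ r := Nat.cast_nonneg _
    rw [hc]
    nlinarith [mul_nonneg h1 h2]
  refine ⟨c * K, by nlinarith, fun b t hb ht hΛ s hs ξ hξ => ?_⟩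
  have hb0 : 0 < b := by linarith
  -- Conjugating tM by the anisotropic dilation of ratio b multiplies its (k,l) entry by b^{2(l-k)},
  -- with k and l the block indices. Entries with l > k+1 vanish, so all are bounded by tb²|M| and
  -- the exponential stays in a compact set.
  set D : (Matrix (Coord δ) (Coord δ) ℝ)ˣ :=
    ⟨Matrix.diagonal fun k => b ^ (2 * (k.1 : ℕ) + 1),
      Matrix.diagonal fun k => (b ^ (2 * (k.1 : ℕ) + 1))⁻¹, by
        rw [Matrix.diagonal_mul_diagonal, ← Matrix.diagonal_one]
        congr 1; ext k; exact mul_inv_cancel₀ (by positivity), by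
        rw [Matrix.diagonal_mul_diagonal, ← Matrix.diagonal_one]
        congr 1; ext k; exact inv_mul_cancel₀ (by positivity)⟩ with hD
  set N : Matrix (Coord δ) (Coord δ) ℝ := D⁻¹.1 * (t • M) * D.1 with hN
  have hNM : t • M = D.1 * N * D⁻¹.1 := by
    rw [hN, ← Matrix.mul_assoc, ← Matrix.mul_assoc, ← Units.val_mul, mul_inv_cancel,
      Units.val_one, Matrix.one_mul, Matrix.mul_assoc, ← Units.val_mul, mul_inv_cancel,
      Units.val_one, Matrix.mul_one]
  have hNkl : ∀ k l, |N k l| ≤ Λ * |M k l| := fun k l => by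
    have h1 : N k l = (b ^ (2 * (k.1 : ℕ) + 1))⁻¹ * (t * M k l) * b ^ (2 * (l.1 : ℕ) + 1) := by
      have : N = Matrix.diagonal (fun k => (b ^ (2 * (k.1 : ℕ) + 1))⁻¹) * (t • M) *
        Matrix.diagonal fun k => b ^ (2 * (k.1 : ℕ) + 1) := rfl
      rw [this, Matrix.mul_diagonal, Matrix.diagonal_mul, Matrix.smul_apply, smul_eq_mul]
    rcases lt_or_ge ((k.1 : ℕ) + 1) (l.1 : ℕ) with h2 | h2
    · rw [h1, hM k l h2]
      simp
    · have h3 : (b ^ (2 * (k.1 : ℕ) + 1))⁻¹ * b ^ (2 * (l.1 : ℕ) + 1) ≤ b ^ 2 := by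
        rw [inv_mul_le_iff₀ (by positivity), ← pow_add]
        exact pow_le_pow_right₀ hb (by omega)
      have h4 : N k l = t * ((b ^ (2 * (k.1 : ℕ) + 1))⁻¹ * b ^ (2 * (l.1 : ℕ) + 1)) * M k l := by
        rw [h1]; ring
      rw [h4, abs_mul, abs_of_nonneg (by positivity)]
      exact mul_le_mul_of_nonneg_right ((mul_le_mul_of_nonneg_left h3 ht).trans hΛ) (abs_nonneg _)
  set η : Space δ := (2 * Real.pi) • dilation b⁻¹ ξ with hη
  have hη1 : anisoNorm η ≤ s := by
    have h1 : anisoNorm η = b⁻¹ * fsize ξ := fsize_dilation (by positivity) ξ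
    rw [h1, inv_mul_le_iff₀ hb0, mul_comm]
    exact hξ
  have h1 : (2 * Real.pi) • flow M t ξ =
      dilation b (WithLp.toLp 2 (NormedSpace.exp N *ᵥ η.ofLp)) := by
    have e1 : η.ofLp = (2 * Real.pi) • (D⁻¹.1 *ᵥ ξ.ofLp) := by
      ext k
      have : (D⁻¹.1 *ᵥ ξ.ofLp) k = (b ^ (2 * (k.1 : ℕ) + 1))⁻¹ * ξ k := Matrix.mulVec_diagonal _ _ _
      rw [Pi.smul_apply, this, hη, PiLp.smul_apply, dilation_apply, inv_pow]
    have e2 : (flow M t ξ).ofLp = D.1 *ᵥ (NormedSpace.exp N *ᵥ (D⁻¹.1 *ᵥ ξ.ofLp)) := by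
      rw [flow_ofLp, hNM, Matrix.exp_units_conj, Matrix.mulVec_mulVec, Matrix.mulVec_mulVec]
    ext k
    rw [PiLp.smul_apply, dilation_apply, e1, Matrix.mulVec_smul, e2]
    change _ * (Matrix.diagonal (fun k : Coord δ => b ^ (2 * (k.1 : ℕ) + 1)) *ᵥ _) k = _
    rw [Matrix.mulVec_diagonal]
    simp only [Pi.smul_apply, smul_eq_mul]
    ring
  rw [fsize, h1, anisoNorm_dilation hb0.le]
  have hs1 : 1 ≤ s ^ (2 * r + 1) := one_le_pow₀ hs
  have h2 := anisoNorm_le_of_abs_coord_le (z := WithLp.toLp 2 (NormedSpace.exp N *ᵥ η.ofLp))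
    (R := K * s ^ (2 * r + 1)) (by nlinarith)
    (hK N hNkl η.ofLp _ (by positivity) (abs_coord_le_pow hs hη1))
  rw [← hc] at h2
  nlinarith

lemma relSize_mono (t : ℝ) {m n : ℕ} (h : m ≤ n) : relSize t m ≤ relSize t n :=
  max_le_max le_rfl (mul_le_mul_of_nonneg_left (pow_le_pow_right₀ (by norm_num) h)
    (Real.sqrt_nonneg _))

/-- Comparison of the sizes of frequencies transported by the flow. -/
theorem exists_fsize_flow_le_relSize {M : Matrix (Coord δ) (Coord δ) ℝ}
    (hM : ∀ k l : Coord δ, (k.1 : ℕ) + 1 < (l.1 : ℕ) → M k l = 0) (T : ℝ) :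
    ∃ C, 1 ≤ C ∧ ∀ t ∈ Icc 0 T, ∀ (m : ℕ) (ξ : Space δ), fsize ξ ≤ 2 ^ m →
      fsize (flow M t ξ) ≤ C * relSize t m ^ (2 * r + 1) * 2 ^ m := by
  obtain ⟨C, hC1, hC⟩ := exists_fsize_flow_le hM (max 1 T)
  refine ⟨C, hC1, fun t ht m ξ hξ => ?_⟩
  have hm : (1 : ℝ) ≤ 2 ^ m := one_le_pow₀ (by norm_num)
  have hm4 : ((2 : ℝ) ^ m) ^ 2 = 4 ^ m := by
    rw [← pow_mul, mul_comm, pow_mul]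
    norm_num
  rcases le_or_gt (t * 4 ^ m) 1 with h | h
  · have h1 := hC (2 ^ m) t hm ht.1 (by rw [hm4]; exact h.trans (le_max_left _ _)) 1 le_rfl ξ
      (by rwa [one_mul])
    rw [one_pow, mul_one] at h1
    refine h1.trans (mul_le_mul_of_nonneg_right ?_ (by positivity))
    exact le_mul_of_one_le_right (by linarith) (one_le_pow₀ (one_le_relSize t m))
  · have ht0 : 0 < t := by
      rcases ht.1.eq_or_lt with h0 | h0
      · rw [← h0, zero_mul] at h
        linarith
      · exact h0
    have hst : 0 < Real.sqrt t := Real.sqrt_pos.2 ht0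
    have hb1 : max 1 (Real.sqrt t)⁻¹ ≤ 2 ^ m := by
      refine max_le hm ?_
      rw [inv_le_iff_one_le_mul₀ hst]
      refine (sq_le_sq₀ zero_le_one (by positivity)).1 ?_
      rw [mul_pow, Real.sq_sqrt ht0.le, hm4, one_pow, mul_comm]
      exact h.le
    -- The natural frequency at time t is t^{-1/2}. Relative to it, 2^m is larger by a factor at
    -- most `relSize t m`, and only this factor enters with a power.
    set b : ℝ := max 1 (Real.sqrt t)⁻¹ with hb
    have hb0 : 0 < b := lt_of_lt_of_le one_pos (le_max_left _ _)
    have hbt : t * b ^ 2 ≤ max 1 T := by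
      rcases le_total 1 (Real.sqrt t)⁻¹ with h1 | h1
      · rw [hb, max_eq_right h1, inv_pow, Real.sq_sqrt ht0.le, mul_inv_cancel₀ ht0.ne']
        exact le_max_left _ _
      · rw [hb, max_eq_left h1, one_pow, mul_one]
        exact ht.2.trans (le_max_right _ _)
    have hs : 2 ^ m / b ≤ relSize t m := by
      rw [div_le_iff₀ hb0]
      calc (2 : ℝ) ^ m = Real.sqrt t * 2 ^ m * (Real.sqrt t)⁻¹ := by field_simp
        _ ≤ relSize t m * b := mul_le_mul (le_max_right _ _) (le_max_right _ _) (by positivity)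
            (zero_le_one.trans (one_le_relSize t m))
    have h1 := hC b t (le_max_left _ _) ht.1 hbt (2 ^ m / b) (by rwa [le_div_iff₀ hb0, one_mul]) ξ
      (by rwa [div_mul_cancel₀ _ hb0.ne'])
    refine h1.trans ?_
    refine mul_le_mul (mul_le_mul_of_nonneg_left (pow_le_pow_left₀ (by positivity) hs _)
      (by linarith)) hb1 hb0.le ?_
    have := one_le_relSize t m
    positivity

end

section

/-! ### Schauder estimates for the adjoint semigroup -/

/-- With truncated subtraction, the summand is 2^{-|n-m|}. -/
lemma sum_half_pow_dist_le (m N : ℕ) :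
    ∑ n ∈ Finset.range N, ((1 : ℝ) / 2) ^ (n - m) * (1 / 2) ^ (m - n) ≤ 3 := by
  have key : ∑ n ∈ Finset.range N, ((1 : ℝ) / 2) ^ (n - m) * (1 / 2) ^ (m - n) ≤
      if N ≤ m then (1 / 2) ^ (m - N) else 3 - 2 * (1 / 2) ^ (N - m) := by
    induction N with
    | zero => simp
    | succ N ih =>
      rw [Finset.sum_range_succ]
      rcases lt_trichotomy N m with h | rfl | h
      · rw [if_pos h.le] at ih
        rw [if_pos (Nat.succ_le_of_lt h), Nat.sub_eq_zero_of_le h.le, pow_zero, one_mul]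
        have : m - N = m - (N + 1) + 1 := by omega
        rw [this, pow_succ] at ih ⊢
        linarith
      · rw [if_pos le_rfl, Nat.sub_self, pow_zero] at ih
        rw [if_neg (by omega), Nat.sub_self, pow_zero, show N + 1 - N = 1 by omega]
        linarith
      · rw [if_neg (by omega)] at ih
        rw [if_neg (by omega), Nat.sub_eq_zero_of_le h.le, pow_zero, mul_one]
        have : N + 1 - m = N - m + 1 := by omega
        rw [this, pow_succ]
        linarith
  refine key.trans ?_
  split_ifs
  · exact (pow_le_one₀ (by norm_num) (by norm_num)).trans (by norm_num)
  · have : (0 : ℝ) < (1 / 2) ^ (N - m) := by positivity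
    linarith

variable {r : ℕ} {δ : Fin (r + 1) → ℕ} (ρ : Generator δ)
variable {B : Matrix (Coord δ) (Coord δ) ℝ}

lemma fsize_le_of_symbol_ne_zero {n : ℕ} {ζ : Space δ} (h : symbol ρ n ζ ≠ 0) :
    fsize ζ ≤ 2 ^ n := by
  by_contra hlt
  rw [not_le] at hlt
  have h2 : (0 : ℝ) < 2 ^ n := by positivity
  cases n with
  | zero =>
    refine h ?_
    rw [symbol_zero]
    exact cut_eq_zero ρ (by rw [zpow_zero]; rw [pow_zero] at hlt; linarith)
  | succ n =>
    refine h ?_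
    rw [symbol_succ, sub_apply, cut_eq_zero ρ (k := (n : ℤ) + 1), cut_eq_zero ρ (k := n), sub_self]
    · rw [zpow_natCast]
      rw [pow_succ] at hlt h2
      linarith
    · rw [zpow_add₀ (by norm_num), zpow_natCast, zpow_one]
      rw [pow_succ] at hlt h2
      linarith

lemma pow_le_of_symbol_ne_zero {n : ℕ} {ζ : Space δ} (h : symbol ρ n ζ ≠ 0) :
    n = 0 ∨ (2 : ℝ) ^ n ≤ 4 * fsize ζ := by
  cases n with
  | zero => exact Or.inl rfl
  | succ n =>
    refine Or.inr ?_
    by_contra hlt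
    rw [not_le, pow_succ] at hlt
    exact h (symbol_eq_zero_of_fsize (by linarith))

/-- The semigroup moves frequencies of size `2^m` to comparable ones. -/
theorem exists_dblock_evol_dblock_eq_zero (hB : IsKolmogorovMatrix B) (T : ℝ) :
    ∃ C, 1 ≤ C ∧ ∀ t ∈ Icc 0 T, ∀ (m n : ℕ) (φ : 𝓢(Space δ, ℂ)),
      dblock ρ n (evol B t (dblock ρ m φ)) ≠ 0 →
        (2 : ℝ) ^ n ≤ C * relSize t m ^ (2 * r + 1) * 2 ^ m ∧
        (2 : ℝ) ^ m ≤ C * relSize t m ^ (2 * r + 1) * 2 ^ n := by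
  obtain ⟨C₁, hC₁, h₁⟩ := exists_fsize_flow_le_relSize (M := Bᵀ)
    (fun k l h => hB.zero_block _ _ h _ _) T
  obtain ⟨C₂, hC₂, h₂⟩ := exists_fsize_flow_le_relSize (M := -Bᵀ)
    (fun k l h => by
      rw [Matrix.neg_apply, Matrix.transpose_apply, hB.zero_block _ _ h, neg_zero]) T
  have hmax : 1 ≤ max C₁ C₂ := hC₁.trans (le_max_left _ _)
  refine ⟨4 * max C₁ C₂, by linarith, fun t ht m n φ hne => ?_⟩
  -- A nonzero composition forces some ξ in the spectrum of block n to be carried by the flow into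
  -- that of block m. The flow and its inverse then compare the two scales in both directions.
  have hex : ∃ ξ, symbol ρ n ξ ≠ 0 ∧ symbol ρ m (flow Bᵀ t ξ) ≠ 0 := by
    by_contra hcon
    push Not at hcon
    refine hne (eq_of_fourierInv fun ξ => ?_)
    rw [dblock, fourierInv_mult (SchwartzMap.hasTemperateGrowth _), fourierInv_evol hB ht.1, dblock,
      fourierInv_mult (SchwartzMap.hasTemperateGrowth _)]
    have h0 : (𝓕⁻ (0 : 𝓢(Space δ, ℂ))) ξ = 0 := by
      have : 𝓕⁻ (0 : 𝓢(Space δ, ℂ)) = 0 := map_zero (FourierTransform.fourierInvCLM ℂ 𝓢(Space δ, ℂ))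
      rw [this]
      rfl
    rw [h0]
    by_cases h : symbol ρ n ξ = 0
    · rw [h, zero_mul]
    · rw [hcon ξ h, zero_mul, mul_zero, mul_zero]
  obtain ⟨ξ, hn, hm⟩ := hex
  have hrel : ∀ m : ℕ, 1 ≤ relSize t m ^ (2 * r + 1) := fun m => one_le_pow₀ (one_le_relSize t m)
  have hback : flow (-Bᵀ) t (flow Bᵀ t ξ) = ξ := by
    ext k
    rw [flow_ofLp, flow_ofLp, Matrix.mulVec_mulVec, exp_neg_mul_exp, Matrix.one_mulVec]
  have h3 := h₂ t ht m _ (fsize_le_of_symbol_ne_zero ρ hm)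
  rw [hback] at h3
  have h4 := h₁ t ht n _ (fsize_le_of_symbol_ne_zero ρ hn)
  have h2m : (1 : ℝ) ≤ 2 ^ m := one_le_pow₀ (by norm_num)
  have h2n : (1 : ℝ) ≤ 2 ^ n := one_le_pow₀ (by norm_num)
  have hX : 1 ≤ max C₁ C₂ * relSize t m ^ (2 * r + 1) := one_le_mul_of_one_le_of_one_le hmax (hrel m)
  constructor
  · rcases pow_le_of_symbol_ne_zero ρ hn with h | h
    · rw [h, pow_zero]
      nlinarith
    · refine h.trans ?_
      have : C₂ * relSize t m ^ (2 * r + 1) * 2 ^ m ≤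
          max C₁ C₂ * relSize t m ^ (2 * r + 1) * 2 ^ m := by
        have := hrel m
        have := le_max_right C₁ C₂
        gcongr
      linarith
  -- The forward flow gives a bound with the relative size at scale n. For n ≤ m it is dominated by
  -- the one at scale m, and for m ≤ n the claim is trivial.
  · rcases le_total m n with hmn | hmn
    · have : (2 : ℝ) ^ m ≤ 2 ^ n := pow_le_pow_right₀ (by norm_num) hmn
      nlinarith
    · rcases pow_le_of_symbol_ne_zero ρ hm with h | h
      · subst h
        rw [pow_zero]
        nlinarith
      · refine h.trans ?_
        have : C₁ * relSize t n ^ (2 * r + 1) * 2 ^ n ≤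
            max C₁ C₂ * relSize t m ^ (2 * r + 1) * 2 ^ n := by
          have := hrel m
          have := relSize_mono t hmn
          have := le_max_left C₁ C₂
          have := one_le_relSize t n
          gcongr
        linarith

lemma rpow_mul_le_of_comparable {X θ : ℝ} (hX : 1 ≤ X) {m n : ℕ} (h₁ : (2 : ℝ) ^ n ≤ X * 2 ^ m)
    (h₂ : (2 : ℝ) ^ m ≤ X * 2 ^ n) :
    (2 : ℝ) ^ ((n : ℝ) * θ) ≤ X ^ |θ| * 2 ^ ((m : ℝ) * θ) := by
  have hX0 : 0 ≤ X := by linarith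
  rw [Real.rpow_mul (by norm_num), Real.rpow_mul (by norm_num), Real.rpow_natCast,
    Real.rpow_natCast]
  rcases le_total 0 θ with h | h
  · rw [abs_of_nonneg h, ← Real.mul_rpow hX0 (by positivity)]
    exact Real.rpow_le_rpow (by positivity) h₁ h
  · rw [abs_of_nonpos h, Real.rpow_neg hX0, ← Real.inv_rpow hX0,
      ← Real.mul_rpow (by positivity) (by positivity)]
    refine Real.rpow_le_rpow_of_nonpos (by positivity) ?_ h
    rw [inv_mul_le_iff₀ (by linarith)]
    exact h₂

lemma one_le_mul_half_pow_dist {X : ℝ} {m n : ℕ} (h₁ : (2 : ℝ) ^ n ≤ X * 2 ^ m)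
    (h₂ : (2 : ℝ) ^ m ≤ X * 2 ^ n) : 1 ≤ X * ((1 / 2) ^ (n - m) * (1 / 2) ^ (m - n)) := by
  have h2m : (0 : ℝ) < 2 ^ m := by positivity
  have h2n : (0 : ℝ) < 2 ^ n := by positivity
  rcases le_total m n with h | h
  · rw [Nat.sub_eq_zero_of_le h, pow_zero, mul_one, one_div, inv_pow, ← div_eq_mul_inv,
      one_le_div (by positivity)]
    rw [← Nat.sub_add_cancel h, pow_add] at h₁
    exact le_of_mul_le_mul_right h₁ h2m
  · rw [Nat.sub_eq_zero_of_le h, pow_zero, one_mul, one_div, inv_pow, ← div_eq_mul_inv,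
      one_le_div (by positivity)]
    rw [← Nat.sub_add_cancel h, pow_add] at h₂
    exact le_of_mul_le_mul_right h₂ h2n

/-- Only output scales with 2^|n-m| ≤ X contribute, where X is polynomial in the relative size R.
The factors X^{|θ|} from the change of weight and X 2^{-|n-m|} from counting scales are paid by the
Gaussian decay R^{-2M}, which leaves R^{-a} ≤ t^{-a/2}2^{-ma}. -/
lemma exists_sum_dblock_evol_le (hB : IsKolmogorovMatrix B) (T θ : ℝ) {a : ℝ} (ha : 0 ≤ a) :
    ∃ C, 0 ≤ C ∧ ∀ t ∈ Ioc 0 T, ∀ (m N : ℕ) (φ : 𝓢(Space δ, ℂ)),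
      ∑ n ∈ Finset.range N, (2 : ℝ) ^ ((n : ℝ) * θ) * l1 (dblock ρ n (evol B t (dblock ρ m φ))) ≤
        C * t ^ (-(a / 2)) * ((2 : ℝ) ^ ((m : ℝ) * (θ - a)) * l1 (dblock ρ m φ)) := by
  obtain ⟨C₁, hC₁, h₁⟩ := exists_dblock_evol_dblock_eq_zero ρ hB T
  -- X grows like R^{2r+1} and enters with the power |θ|+1; a further R^a is kept for the gain.
  obtain ⟨M, hM⟩ := exists_nat_ge (((2 * r + 1 : ℕ) : ℝ) * (|θ| + 1) + a)
  obtain ⟨C₂, hC₂, h₂⟩ := exists_relSize_mul_l1_evol_le ρ hB T M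
  have hcc := cutConst_nonneg ρ
  refine ⟨3 * (2 * cutConst ρ) * (C₁ ^ (|θ| + 1) * C₂), by positivity, fun t ht m N φ => ?_⟩
  have ht0 := ht.1
  set R : ℝ := relSize t m with hR
  have hR1 : 1 ≤ R := one_le_relSize t m
  have hR0 : 0 < R := by linarith
  set X : ℝ := C₁ * R ^ (2 * r + 1) with hX
  have hX1 : 1 ≤ X := one_le_mul_of_one_le_of_one_le hC₁ (one_le_pow₀ hR1)
  have hX0 : 0 < X := by linarith
  set e := l1 (evol B t (dblock ρ m φ)) with he
  have he0 : 0 ≤ e := l1_nonneg _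
  have hterm : ∀ n : ℕ, (2 : ℝ) ^ ((n : ℝ) * θ) * l1 (dblock ρ n (evol B t (dblock ρ m φ))) ≤
      (2 * cutConst ρ) * (X ^ (|θ| + 1) * 2 ^ ((m : ℝ) * θ) * e) *
        ((1 / 2) ^ (n - m) * (1 / 2) ^ (m - n)) := fun n => by
    by_cases h0 : dblock ρ n (evol B t (dblock ρ m φ)) = 0
    · rw [h0, map_zero, mul_zero]
      positivity
    · obtain ⟨g₁, g₂⟩ := h₁ t ⟨ht0.le, ht.2⟩ m n φ h0
      have g₃ := rpow_mul_le_of_comparable (θ := θ) hX1 g₁ g₂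
      have g₄ := one_le_mul_half_pow_dist g₁ g₂
      have g₅ := l1_dblock_le ρ n (evol B t (dblock ρ m φ))
      rw [← he] at g₅
      calc _ ≤ (X ^ |θ| * 2 ^ ((m : ℝ) * θ)) * (2 * cutConst ρ * e) :=
            mul_le_mul g₃ g₅ (l1_nonneg _) (by positivity)
        _ ≤ (X ^ |θ| * 2 ^ ((m : ℝ) * θ)) * (2 * cutConst ρ * e) *
            (X * ((1 / 2) ^ (n - m) * (1 / 2) ^ (m - n))) :=
            le_mul_of_one_le_right (by positivity) g₄
        _ = _ := by
            rw [Real.rpow_add hX0, Real.rpow_one]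
            ring
  have hsum : ∑ n ∈ Finset.range N, (2 : ℝ) ^ ((n : ℝ) * θ) *
      l1 (dblock ρ n (evol B t (dblock ρ m φ))) ≤
      (2 * cutConst ρ) * (X ^ (|θ| + 1) * 2 ^ ((m : ℝ) * θ) * e) * 3 := by
    refine (Finset.sum_le_sum fun n _ => hterm n).trans ?_
    rw [← Finset.mul_sum]
    exact mul_le_mul_of_nonneg_left (sum_half_pow_dist_le m N) (by positivity)
  have hXR : X ^ (|θ| + 1) * R ^ a ≤ C₁ ^ (|θ| + 1) * (R ^ 2) ^ M := by
    rw [hX, Real.mul_rpow (by linarith) (by positivity), mul_assoc]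
    refine mul_le_mul_of_nonneg_left ?_ (by positivity)
    rw [← Real.rpow_natCast R, ← Real.rpow_mul hR0.le, ← Real.rpow_add hR0, ← pow_mul,
      ← Real.rpow_natCast]
    refine Real.rpow_le_rpow_of_exponent_le hR1 (hM.trans ?_)
    push_cast
    have : (0 : ℝ) ≤ M := Nat.cast_nonneg _
    linarith
  have hRa : t ^ (a / 2) * 2 ^ ((m : ℝ) * a) ≤ R ^ a := by
    have : t ^ (a / 2) * 2 ^ ((m : ℝ) * a) = (Real.sqrt t * 2 ^ m) ^ a := by
      rw [Real.mul_rpow (Real.sqrt_nonneg _) (by positivity), Real.sqrt_eq_rpow,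
        ← Real.rpow_mul ht0.le, Real.rpow_mul (by norm_num), Real.rpow_natCast]
      congr 2
      ring
    rw [this]
    exact Real.rpow_le_rpow (by positivity) (le_max_right _ _) ha
  have h3 := h₂ t ht m φ
  rw [← he, ← hR] at h3
  set L := l1 (dblock ρ m φ) with hL
  have hmain : X ^ (|θ| + 1) * e ≤ C₁ ^ (|θ| + 1) * C₂ * t ^ (-(a / 2)) * 2 ^ (-((m : ℝ) * a)) * L := by
    have h4 : X ^ (|θ| + 1) * e * (t ^ (a / 2) * 2 ^ ((m : ℝ) * a)) ≤
        C₁ ^ (|θ| + 1) * C₂ * L := by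
      calc _ ≤ X ^ (|θ| + 1) * e * R ^ a := mul_le_mul_of_nonneg_left hRa (by positivity)
        _ = (X ^ (|θ| + 1) * R ^ a) * e := by ring
        _ ≤ (C₁ ^ (|θ| + 1) * (R ^ 2) ^ M) * e := mul_le_mul_of_nonneg_right hXR he0
        _ = C₁ ^ (|θ| + 1) * ((R ^ 2) ^ M * e) := by ring
        _ ≤ C₁ ^ (|θ| + 1) * (C₂ * L) := mul_le_mul_of_nonneg_left h3 (by positivity)
        _ = _ := by ring
    have h5 : 0 < t ^ (a / 2) * 2 ^ ((m : ℝ) * a) := by positivity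
    rw [← le_div_iff₀ h5] at h4
    refine h4.trans_eq ?_
    rw [Real.rpow_neg ht0.le, Real.rpow_neg (by norm_num)]
    field_simp
  refine hsum.trans ?_
  have h6 : (2 : ℝ) ^ ((m : ℝ) * (θ - a)) = 2 ^ ((m : ℝ) * θ) * 2 ^ (-((m : ℝ) * a)) := by
    rw [← Real.rpow_add (by norm_num)]
    congr 1
    ring
  rw [h6]
  have h7 := mul_le_mul_of_nonneg_left hmain
    (show 0 ≤ 3 * (2 * cutConst ρ) * (2 : ℝ) ^ ((m : ℝ) * θ) by positivity)
  calc _ = 3 * (2 * cutConst ρ) * (2 : ℝ) ^ ((m : ℝ) * θ) * (X ^ (|θ| + 1) * e) := by ring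
    _ ≤ _ := h7
    _ = _ := by ring

/-- Schauder estimate in the dual norms. -/
theorem exists_dnorm_evol_le (hB : IsKolmogorovMatrix B) (T θ : ℝ) {a : ℝ} (ha : 0 ≤ a) :
    ∃ C, 0 ≤ C ∧ ∀ t ∈ Ioc 0 T, ∀ φ : 𝓢(Space δ, ℂ),
      dnorm ρ θ (evol B t φ) ≤ C * t ^ (-(a / 2)) * dnorm ρ (θ - a) φ := by
  obtain ⟨C, hC, h⟩ := exists_sum_dblock_evol_le ρ hB T θ ha
  refine ⟨C, hC, fun t ht φ => ?_⟩
  have ht0 := ht.1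
  refine Real.tsum_le_of_sum_range_le (dnorm_term_nonneg ρ θ _) fun N => ?_
  -- The semigroup does not commute with the blocks, so a truncation of `φ` is split into finitely
  -- many input blocks, with finitely many output blocks fixed, and the truncation is removed at the
  -- end.
  have hlim : Tendsto (fun K : ℕ => ∑ n ∈ Finset.range N, (2 : ℝ) ^ ((n : ℝ) * θ) *
      l1 (dblock ρ n (evol B t (lowPass ρ K φ)))) atTop (𝓝 (∑ n ∈ Finset.range N,
        (2 : ℝ) ^ ((n : ℝ) * θ) * l1 (dblock ρ n (evol B t φ)))) := by
    refine tendsto_finsetSum _ fun n _ => Tendsto.const_mul _ ?_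
    exact ((continuous_l1.comp ((dblock ρ n).continuous.comp (evol B t).continuous)).tendsto φ).comp
      (tendsto_lowPass ρ φ)
  refine le_of_tendsto' hlim fun K => ?_
  calc _ ≤ ∑ n ∈ Finset.range N, ∑ m ∈ Finset.range (K + 1), (2 : ℝ) ^ ((n : ℝ) * θ) *
        l1 (dblock ρ n (evol B t (dblock ρ m φ))) := Finset.sum_le_sum fun n _ => by
          rw [← Finset.mul_sum, ← sum_dblock, map_sum, map_sum]
          exact mul_le_mul_of_nonneg_left (seminorm_map_sum_le _ _ _) (by positivity)
    _ ≤ ∑ m ∈ Finset.range (K + 1), C * t ^ (-(a / 2)) *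
        ((2 : ℝ) ^ ((m : ℝ) * (θ - a)) * l1 (dblock ρ m φ)) := by
          rw [Finset.sum_comm]
          exact Finset.sum_le_sum fun m _ => h t ht m N φ
    _ ≤ _ := by
          rw [← Finset.mul_sum]
          exact mul_le_mul_of_nonneg_left ((summable_dnorm ρ (θ - a) φ).sum_le_tsum _
            fun m _ => dnorm_term_nonneg ρ _ φ m) (by positivity)

lemma exists_dnorm_evol_le_dnorm (hB : IsKolmogorovMatrix B) (T θ : ℝ) :
    ∃ C, 1 ≤ C ∧ ∀ t ∈ Icc 0 T, ∀ φ : 𝓢(Space δ, ℂ),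
      dnorm ρ θ (evol B t φ) ≤ C * dnorm ρ θ φ := by
  obtain ⟨C, hC, h⟩ := exists_dnorm_evol_le ρ hB T θ le_rfl
  refine ⟨max 1 C, le_max_left _ _, fun t ht φ => ?_⟩
  have h0 := dnorm_nonneg ρ θ φ
  rcases ht.1.eq_or_lt with rfl | h1
  · rw [evol_zero hB]
    exact le_mul_of_one_le_left h0 (le_max_left _ _)
  · have := h t ⟨h1, ht.2⟩ φ
    rw [zero_div, neg_zero, Real.rpow_zero, mul_one, sub_zero] at this
    exact this.trans (mul_le_mul_of_nonneg_right (le_max_right _ _) h0)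

end

section

/-! ### Strong continuity of the adjoint semigroup in the dual norms -/

variable {r : ℕ} {δ : Fin (r + 1) → ℕ} (ρ : Generator δ)
variable {B : Matrix (Coord δ) (Coord δ) ℝ}

lemma exists_norm_flow_symm_le (M : Matrix (Coord δ) (Coord δ) ℝ) :
    ∃ K, 1 ≤ K ∧ ∀ h ∈ Icc (0 : ℝ) 1, ∀ ξ : Space δ, ‖ξ‖ ≤ K * ‖flow M h ξ‖ := by
  obtain ⟨K, hK1, hK⟩ := exists_abs_exp_entry_le fun k l : Coord δ => |M k l|
  refine ⟨(Fintype.card (Coord δ) + 1) * K, ?_, fun h hh ξ => ?_⟩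
  · have : (0 : ℝ) ≤ Fintype.card (Coord δ) := Nat.cast_nonneg _
    nlinarith
  have h1 : ∀ k, |ξ k| ≤ K * ‖flow M h ξ‖ := fun k => by
    have h2 := hK (h • -M) (fun k l => by
      rw [Matrix.smul_apply, Matrix.neg_apply, smul_eq_mul, abs_mul, abs_neg, abs_of_nonneg hh.1]
      exact mul_le_of_le_one_left (abs_nonneg _) hh.2) (flow M h ξ).ofLp _ (norm_nonneg (flow M h ξ))
      (fun l => PiLp.norm_apply_le (flow M h ξ) l) k
    rwa [flow_ofLp, Matrix.mulVec_mulVec, exp_neg_mul_exp, Matrix.one_mulVec] at h2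
  rw [EuclideanSpace.norm_eq]
  refine Real.sqrt_le_iff.2 ⟨by positivity, ?_⟩
  calc ∑ k, ‖ξ k‖ ^ 2 ≤ ∑ _k : Coord δ, (K * ‖flow M h ξ‖) ^ 2 :=
        Finset.sum_le_sum fun k _ => pow_le_pow_left₀ (norm_nonneg _) (h1 k) 2
    _ = Fintype.card (Coord δ) * (K * ‖flow M h ξ‖) ^ 2 := by
        rw [Finset.sum_const, nsmul_eq_mul, Finset.card_univ]
    _ ≤ ((Fintype.card (Coord δ) + 1) * K * ‖flow M h ξ‖) ^ 2 := by
        rw [mul_assoc, mul_pow (_ + 1)]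
        refine mul_le_mul_of_nonneg_right ?_ (sq_nonneg _)
        have : (0 : ℝ) ≤ Fintype.card (Coord δ) := Nat.cast_nonneg _
        nlinarith

lemma continuous_covForm (x : Coord δ → ℝ) : Continuous fun t => covForm B t x :=
  intervalIntegral.continuous_primitive
    (fun a b => (continuous_vSq_exp Bᵀ x).intervalIntegrable a b) 0

lemma norm_gaussSymbol_le {t : ℝ} (ht : 0 ≤ t) (ξ : Space δ) : ‖gaussSymbol B t ξ‖ ≤ 1 := by
  rw [gaussSymbol, Complex.norm_real, Real.norm_of_nonneg (Real.exp_pos _).le, Real.exp_le_one_iff]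
  have h1 := covForm_nonneg B ht ξ.ofLp
  have h2 : 0 ≤ Real.pi ^ 2 * covForm B t ξ.ofLp := by positivity
  linarith

lemma continuous_flow_apply (M : Matrix (Coord δ) (Coord δ) ℝ) (ξ : Space δ) :
    Continuous fun t => flow M t ξ :=
  (PiLp.continuous_toLp 2 _).comp (continuous_exp_mulVec M ξ.ofLp)

lemma apply_eq_integral_fourierInv (φ : 𝓢(Space δ, ℂ)) (x : Space δ) :
    φ x = ∫ ξ, Real.fourierChar (-inner ℝ ξ x) • (𝓕⁻ φ) ξ := by
  have h : 𝓕 (𝓕⁻ φ) = φ := FourierTransform.fourier_fourierInv_eq φ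
  calc φ x = (𝓕 (𝓕⁻ φ)) x := by rw [h]
    _ = _ := by rw [SchwartzMap.fourier_coe, Real.fourier_eq]

/-- Dominated convergence on the Fourier side: for times at most 1 the flow distorts ‖ξ‖ by a
bounded factor, so the transported transform keeps a uniform integrable decay. -/
lemma tendsto_evol_apply (hB : IsKolmogorovMatrix B) (φ : 𝓢(Space δ, ℂ)) (x : Space δ) :
    Tendsto (fun h => evol B h φ x) (𝓝[Ici 0] 0) (𝓝 (φ x)) := by
  obtain ⟨K, hK1, hK⟩ := exists_norm_flow_symm_le (δ := δ) Bᵀ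
  set n : ℕ := Module.finrank ℝ (Space δ) + 1 with hn
  set S : ℝ := 2 ^ n * (Finset.Iic (n, 0)).sup (fun m => SchwartzMap.seminorm ℂ m.1 m.2) (𝓕⁻ φ)
  have hS : ∀ ξ : Space δ, (1 + ‖ξ‖) ^ n * ‖(𝓕⁻ φ) ξ‖ ≤ S := fun ξ => by
    simpa using SchwartzMap.one_add_le_sup_seminorm_apply (𝕜 := ℂ) (m := (n, 0)) le_rfl le_rfl
      (𝓕⁻ φ) ξ
  simp_rw [apply_eq_integral_fourierInv _ x]
  have hmem : Icc (0 : ℝ) 1 ∈ 𝓝[Ici 0] (0 : ℝ) := Icc_mem_nhdsGE one_pos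
  refine tendsto_integral_filter_of_dominated_convergence
    (fun ξ => K ^ n * S * (1 + ‖ξ‖) ^ (-(n : ℝ))) ?_ ?_ ?_ ?_
  · refine Eventually.of_forall fun h => Continuous.aestronglyMeasurable ?_
    have : Continuous fun ξ => (𝓕⁻ (evol B h φ)) ξ := (𝓕⁻ (evol B h φ)).continuous
    fun_prop
  · filter_upwards [hmem] with h hh
    refine Eventually.of_forall fun ξ => ?_
    rw [Circle.norm_smul, fourierInv_evol hB hh.1, norm_mul]
    refine (mul_le_of_le_one_left (norm_nonneg _) (norm_gaussSymbol_le hh.1 ξ)).trans ?_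
    have h1 : 0 < (1 + ‖ξ‖) ^ n := by positivity
    rw [Real.rpow_neg (by positivity), Real.rpow_natCast, ← div_eq_mul_inv, le_div_iff₀ h1]
    have h2 : (1 + ‖ξ‖) ^ n ≤ K ^ n * (1 + ‖flow Bᵀ h ξ‖) ^ n := by
      rw [← mul_pow]
      refine pow_le_pow_left₀ (by positivity) ?_ n
      have := hK h hh ξ
      nlinarith
    calc _ ≤ ‖(𝓕⁻ φ) (flow Bᵀ h ξ)‖ * (K ^ n * (1 + ‖flow Bᵀ h ξ‖) ^ n) :=
          mul_le_mul_of_nonneg_left h2 (norm_nonneg _)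
      _ = K ^ n * ((1 + ‖flow Bᵀ h ξ‖) ^ n * ‖(𝓕⁻ φ) (flow Bᵀ h ξ)‖) := by ring
      _ ≤ _ := mul_le_mul_of_nonneg_left (hS _) (by positivity)
  · exact (integrable_one_add_norm (by rw [hn]; push_cast; linarith)).const_mul _
  · refine Eventually.of_forall fun ξ => Tendsto.const_smul ?_ _
    have h1 : Continuous fun h : ℝ => gaussSymbol B h ξ * (𝓕⁻ φ) (flow Bᵀ h ξ) := by
      refine Continuous.mul ?_ ((𝓕⁻ φ).continuous.comp (continuous_flow_apply _ ξ))
      exact Complex.continuous_ofReal.comp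
        (Real.continuous_exp.comp (continuous_const.mul (continuous_covForm _)))
    have h2 := (h1.tendsto 0).mono_left (nhdsWithin_le_nhds (s := Ici 0))
    rw [gaussSymbol_zero, one_mul, flow_zero] at h2
    refine h2.congr' ?_
    filter_upwards [self_mem_nhdsWithin] with h hh
    rw [fourierInv_evol hB hh]

/-- A Scheffé-type argument: |P_hφ - φ| - |P_hφ| is dominated by |φ| and tends pointwise to -|φ|,
where P_h stands for `evol B h`. As the L¹ norm of P_hφ is at most that of φ, the difference tends
to 0 in L¹. -/
lemma tendsto_l1_evol_sub (hB : IsKolmogorovMatrix B) (φ : 𝓢(Space δ, ℂ)) :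
    Tendsto (fun h => l1 (evol B h φ - φ)) (𝓝[Ici 0] 0) (𝓝 0) := by
  have hint : ∀ ψ : 𝓢(Space δ, ℂ), Integrable (fun x => ‖ψ x‖) := fun ψ => ψ.integrable.norm
  have h1 : Tendsto (fun h => ∫ x, (‖(evol B h φ - φ) x‖ - ‖evol B h φ x‖)) (𝓝[Ici 0] 0)
      (𝓝 (∫ x, (‖φ x - φ x‖ - ‖φ x‖))) := by
    refine tendsto_integral_filter_of_dominated_convergence (fun x => ‖φ x‖) ?_ ?_ (hint φ) ?_
    · exact Eventually.of_forall fun h =>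
        ((hint (evol B h φ - φ)).sub (hint (evol B h φ))).aestronglyMeasurable
    · refine Eventually.of_forall fun h => Eventually.of_forall fun x => ?_
      have h2 := abs_norm_sub_norm_le (evol B h φ x - φ x) (evol B h φ x)
      rw [sub_sub_cancel_left, norm_neg] at h2
      exact h2
    · refine Eventually.of_forall fun x => ?_
      have h2 := tendsto_evol_apply hB φ x
      exact (h2.sub_const _).norm.sub h2.norm
  have h2 : ∫ x, (‖φ x - φ x‖ - ‖φ x‖) = -l1 φ := by
    rw [l1_eq, ← integral_neg]
    simp
  rw [h2] at h1
  have h3 := h1.add_const (l1 φ)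
  rw [neg_add_cancel] at h3
  refine tendsto_of_tendsto_of_tendsto_of_le_of_le' tendsto_const_nhds h3
    (Eventually.of_forall fun h => l1_nonneg _) ?_
  filter_upwards [self_mem_nhdsWithin] with h hh
  rw [integral_sub (hint _) (hint _), ← l1_eq, ← l1_eq]
  have := l1_evol_le hB hh φ
  linarith

lemma dnorm_neg (θ : ℝ) (φ : 𝓢(Space δ, ℂ)) : dnorm ρ θ (-φ) = dnorm ρ θ φ := by
  unfold dnorm
  simp only [map_neg, map_neg_eq_map]

lemma dnorm_sub_comm (θ : ℝ) (φ ψ : 𝓢(Space δ, ℂ)) : dnorm ρ θ (φ - ψ) = dnorm ρ θ (ψ - φ) := by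
  rw [← dnorm_neg, neg_sub]

lemma dnorm_sub_le (θ : ℝ) (φ ψ : 𝓢(Space δ, ℂ)) :
    dnorm ρ θ (φ - ψ) ≤ dnorm ρ θ φ + dnorm ρ θ ψ := by
  rw [sub_eq_add_neg, ← dnorm_neg ρ θ ψ]
  exact dnorm_add_le ρ θ _ _

/-- Each block converges by the L¹ statement. The uniform bound at exponent θ+1 gives the summable
majorant 2^{-n}. -/
theorem tendsto_dnorm_evol_sub (hB : IsKolmogorovMatrix B) (θ : ℝ) (φ : 𝓢(Space δ, ℂ)) :
    Tendsto (fun h => dnorm ρ θ (evol B h φ - φ)) (𝓝[Ici 0] 0) (𝓝 0) := by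
  obtain ⟨C, hC1, hC⟩ := exists_dnorm_evol_le_dnorm ρ hB 1 (θ + 1)
  have hmem : Icc (0 : ℝ) 1 ∈ 𝓝[Ici 0] (0 : ℝ) := Icc_mem_nhdsGE one_pos
  rw [show 𝓝 (0 : ℝ) = 𝓝 (∑' _n : ℕ, (0 : ℝ)) by rw [tsum_zero]]
  refine tendsto_tsum_of_dominated_convergence
    (bound := fun n : ℕ => ((1 : ℝ) / 2) ^ n * ((C + 1) * dnorm ρ (θ + 1) φ))
    (summable_geometric_two.mul_right _) (fun n => ?_) ?_
  · have h1 : Tendsto (fun h => (2 : ℝ) ^ ((n : ℝ) * θ) * (2 * cutConst ρ * l1 (evol B h φ - φ)))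
        (𝓝[Ici 0] 0) (𝓝 0) := by
      simpa using ((tendsto_l1_evol_sub hB φ).const_mul (2 * cutConst ρ)).const_mul
        ((2 : ℝ) ^ ((n : ℝ) * θ))
    refine tendsto_of_tendsto_of_tendsto_of_le_of_le tendsto_const_nhds h1
      (fun h => dnorm_term_nonneg ρ θ _ n) (fun h => ?_)
    exact mul_le_mul_of_nonneg_left (l1_dblock_le ρ n _) (by positivity)
  · filter_upwards [hmem] with h hh n
    rw [Real.norm_of_nonneg (dnorm_term_nonneg ρ θ _ n)]
    have h1 := le_dnorm ρ (θ + 1) (evol B h φ - φ) n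
    have h2 : dnorm ρ (θ + 1) (evol B h φ - φ) ≤ (C + 1) * dnorm ρ (θ + 1) φ := by
      refine (dnorm_sub_le ρ _ _ _).trans ?_
      rw [add_mul, one_mul]
      exact add_le_add_left (hC h hh φ) _
    have h3 : (2 : ℝ) ^ ((n : ℝ) * θ) = (1 / 2) ^ n * 2 ^ ((n : ℝ) * (θ + 1)) := by
      rw [mul_add, mul_one, Real.rpow_add (by norm_num), Real.rpow_natCast, one_div, inv_pow]
      field_simp
    rw [h3, mul_assoc]
    exact mul_le_mul_of_nonneg_left (h1.trans h2) (by positivity)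

theorem tendsto_dnorm_evol_sub_evol (hB : IsKolmogorovMatrix B) (θ : ℝ) (φ : 𝓢(Space δ, ℂ))
    {T s : ℝ} (hs : s ∈ Icc 0 T) :
    Tendsto (fun t => dnorm ρ θ (evol B t φ - evol B s φ)) (𝓝[Icc 0 T] s) (𝓝 0) := by
  obtain ⟨C, hC1, hC⟩ := exists_dnorm_evol_le_dnorm ρ hB T θ
  have h1 : Tendsto (fun t => |t - s|) (𝓝[Icc 0 T] s) (𝓝[Ici 0] 0) := by
    refine tendsto_nhdsWithin_iff.2 ⟨?_, Eventually.of_forall fun t => mem_Ici.2 (abs_nonneg _)⟩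
    have : Continuous fun t : ℝ => |t - s| := by fun_prop
    have h := (this.tendsto s).mono_left (nhdsWithin_le_nhds (s := Icc 0 T))
    rwa [sub_self, abs_zero] at h
  have h2 := ((tendsto_dnorm_evol_sub ρ hB θ φ).comp h1).const_mul C
  rw [mul_zero] at h2
  refine tendsto_of_tendsto_of_tendsto_of_le_of_le' tendsto_const_nhds h2
    (Eventually.of_forall fun t => dnorm_nonneg ρ θ _) ?_
  have key : ∀ a b : ℝ, a ∈ Icc 0 T → a ≤ b →
      dnorm ρ θ (evol B b φ - evol B a φ) ≤ C * dnorm ρ θ (evol B (b - a) φ - φ) := by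
    intro a b ha hab
    have h3 := hC a ha (evol B (b - a) φ - φ)
    rwa [map_sub, evol_evol hB ha.1 (sub_nonneg.2 hab), add_sub_cancel] at h3
  filter_upwards [self_mem_nhdsWithin] with t ht
  rcases le_total s t with h | h
  · rw [Function.comp_apply, abs_of_nonneg (sub_nonneg.2 h)]
    exact key s t hs h
  · rw [Function.comp_apply, abs_sub_comm, abs_of_nonneg (sub_nonneg.2 h), dnorm_sub_comm]
    exact key t s ht h

end

section

/-! ### Measurability in time -/

section Caratheodory

variable {X : Type*} [TopologicalSpace X] [TopologicalSpace.MetrizableSpace X]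
  [SecondCountableTopology X] [MeasurableSpace X] [BorelSpace X] [Nonempty X]
variable {μ : Measure ℝ}

/-- A function which is almost everywhere measurable in one variable and continuous in the other
has a jointly measurable version. -/
lemma exists_stronglyMeasurable_uncurry {f : ℝ → X → ℂ}
    (hf : ∀ x, AEMeasurable (fun s => f s x) μ) (hc : ∀ᵐ s ∂μ, Continuous (f s)) :
    ∃ F : ℝ × X → ℂ, StronglyMeasurable F ∧ ∀ᵐ s ∂μ, ∀ x, f s x = F (s, x) := by
  classical
  set d : ℕ → X := TopologicalSpace.denseSeq X with hd
  have h1 : ∀ᵐ s ∂μ, Continuous (f s) ∧ ∀ k, f s (d k) = (hf (d k)).mk _ s := by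
    filter_upwards [hc, ae_all_iff.2 fun k => (hf (d k)).ae_eq_mk] with s h2 h3 using ⟨h2, h3⟩
  -- On a measurable set of full measure the sections in x are continuous and agree, along a dense
  -- sequence, with measurable versions. After extension by zero, measurability in time passes from
  -- the dense sequence to every x by limits.
  obtain ⟨S, hSae, hS, hSp⟩ := h1.exists_measurable_mem
  set F : X → ℝ → ℂ := fun x => S.indicator fun s => f s x with hF
  have hFd : ∀ k, Measurable (F (d k)) := fun k => by
    have : F (d k) = S.indicator ((hf (d k)).mk _) :=
      Set.indicator_congr fun s hs => (hSp s hs).2 k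
    rw [this]
    exact (hf (d k)).measurable_mk.indicator hS
  have hFc : ∀ s, Continuous fun x => F x s := fun s => by
    by_cases hs : s ∈ S
    · simp only [hF, Set.indicator_of_mem hs]
      exact (hSp s hs).1
    · simp only [hF, Set.indicator_of_notMem hs]
      exact continuous_const
  have hFm : ∀ x, Measurable (F x) := fun x => by
    obtain ⟨y, hy, hyx⟩ := mem_closure_iff_seq_limit.1
      ((TopologicalSpace.denseRange_denseSeq X).closure_range ▸ mem_univ x :
        x ∈ closure (range d))
    choose k hk using hy
    refine measurable_of_tendsto_metrizable (f := fun n => F (y n)) (fun n => ?_) ?_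
    · rw [← hk n]
      exact hFd (k n)
    · exact tendsto_pi_nhds.2 fun s => ((hFc s).tendsto x).comp hyx
  have hjoint := stronglyMeasurable_uncurry_of_continuous_of_stronglyMeasurable hFc
    fun x => (hFm x).stronglyMeasurable
  refine ⟨fun p => F p.2 p.1, hjoint.comp_measurable measurable_swap, ?_⟩
  filter_upwards [hSae] with s hs x
  exact (Set.indicator_of_mem hs fun s => f s x).symm

end Caratheodory

variable {r : ℕ} {δ : Fin (r + 1) → ℕ} {ρ : Generator δ}
variable {B : Matrix (Coord δ) (Coord δ) ℝ} {μ : Measure ℝ}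

lemma aemeasurable_integral_block_mul {b w : ℝ → 𝓢'(Space δ, ℂ)}
    (hb : ∀ φ, AEMeasurable (fun s => b s φ) μ) (hw : ∀ φ, AEMeasurable (fun s => w s φ) μ)
    (i j : ℕ) (φ : 𝓢(Space δ, ℂ)) :
    AEMeasurable (fun s => ∫ x, block ρ i (b s) x * block ρ j (w s) x * φ x) μ := by
  obtain ⟨F, hF, hFe⟩ := exists_stronglyMeasurable_uncurry
    (f := fun s x => block ρ i (b s) x * block ρ j (w s) x * φ x) (μ := μ)
    (fun x => ((hb _).mul (hw _)).mul_const _)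
    (Eventually.of_forall fun s =>
      ((continuous_block ρ i (b s)).mul (continuous_block ρ j (w s))).mul φ.continuous)
  refine ⟨_, (hF.integral_prod_right' (ν := volume)).measurable, ?_⟩
  filter_upwards [hFe] with s hs
  simp only [hs]

lemma aemeasurable_bonyProduct {β α σ : ℝ} (hβ : 0 < β) (hσ : 0 < σ) (hα : β + σ ≤ α)
    {b w : ℝ → 𝓢'(Space δ, ℂ)}
    (hb : ∀ φ, AEMeasurable (fun s => b s φ) μ) (hw : ∀ φ, AEMeasurable (fun s => w s φ) μ)
    (hbB : ∀ᵐ s ∂μ, ∃ C, BesovBound ρ (-β) (b s) C) (hwB : ∀ᵐ s ∂μ, ∃ C, BesovBound ρ α (w s) C)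
    (φ : 𝓢(Space δ, ℂ)) : AEMeasurable (fun s => bonyProduct ρ (b s) (w s) φ) μ := by
  refine aemeasurable_of_tendsto_metrizable_ae atTop (f := fun (n : ℕ) s =>
    ∑ i ∈ Finset.range n, ∑ j ∈ Finset.range n,
      ∫ x, block ρ i (b s) x * block ρ j (w s) x * φ x) (fun n => ?_) ?_
  · exact Finset.aemeasurable_fun_sum _ fun i _ => Finset.aemeasurable_fun_sum _ fun j _ =>
      aemeasurable_integral_block_mul hb hw i j φ
  · filter_upwards [hbB, hwB] with s ⟨Cb, hCb⟩ ⟨Cw, hCw⟩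
    exact isBonyProduct_bonyProduct hβ hσ hα hCb hCw φ

lemma BesovBound.continuousOn_apply_evol (hB : IsKolmogorovMatrix B) {θ C : ℝ}
    {f : 𝓢'(Space δ, ℂ)} (hf : BesovBound ρ θ f C) (φ : 𝓢(Space δ, ℂ)) (T : ℝ) :
    ContinuousOn (fun t => f (evol B t φ)) (Icc 0 T) := by
  intro s hs
  have h1 := (tendsto_dnorm_evol_sub_evol ρ hB (-θ) φ hs).const_mul (3 * (2 : ℝ) ^ |θ| * C)
  rw [mul_zero] at h1
  refine tendsto_iff_norm_sub_tendsto_zero.2 ?_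
  refine tendsto_of_tendsto_of_tendsto_of_le_of_le tendsto_const_nhds h1
    (fun t => norm_nonneg _) fun t => ?_
  have := norm_apply_le_dnorm hf (evol B t φ - evol B s φ)
  rwa [map_sub] at this

/-- The projection of the line to `[0, T]`. -/
def clampTime (T x : ℝ) : ℝ := max 0 (min x T)

lemma continuous_clampTime (T : ℝ) : Continuous (clampTime T) := by
  unfold clampTime
  fun_prop

lemma clampTime_mem {T : ℝ} (hT : 0 ≤ T) (x : ℝ) : clampTime T x ∈ Icc 0 T :=
  ⟨le_max_left _ _, max_le hT (min_le_right _ _)⟩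

lemma clampTime_of_mem {T x : ℝ} (hx : x ∈ Icc 0 T) : clampTime T x = x := by
  rw [clampTime, min_eq_left hx.2, max_eq_right hx.1]

/-- The time s occurs both in `k` and in the semigroup. Separating the two occurrences gives a
Carathéodory function, whose jointly measurable version is restricted to the line x = s - t;
clamping makes it continuous in x on all of ℝ. -/
lemma aemeasurable_apply_evol (hB : IsKolmogorovMatrix B) {T θ : ℝ} (hT : 0 ≤ T)
    {k : ℝ → 𝓢'(Space δ, ℂ)} (hk : ∀ φ, AEMeasurable (fun s => k s φ) (volume.restrict (Icc 0 T)))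
    (hkB : ∀ᵐ s ∂volume.restrict (Icc 0 T), ∃ C, BesovBound ρ θ (k s) C)
    {t : ℝ} (ht : 0 ≤ t) (φ : 𝓢(Space δ, ℂ)) :
    AEMeasurable (fun s => k s (evol B (s - t) φ)) (volume.restrict (Icc t T)) := by
  have hle : volume.restrict (Icc t T) ≤ volume.restrict (Icc 0 T) :=
    Measure.restrict_mono (Icc_subset_Icc_left ht) le_rfl
  obtain ⟨F, hF, hFe⟩ := exists_stronglyMeasurable_uncurry
    (f := fun s x => k s (evol B (clampTime T x) φ)) (μ := volume.restrict (Icc 0 T))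
    (fun x => hk _) (by
      filter_upwards [hkB] with s ⟨C, hC⟩
      exact (hC.continuousOn_apply_evol hB φ T).comp_continuous (continuous_clampTime T)
        (clampTime_mem hT))
  refine ⟨fun s => F (s, s - t), (hF.measurable.comp (by fun_prop)), ?_⟩
  filter_upwards [ae_mono hle hFe, ae_restrict_mem measurableSet_Icc] with s hs hst
  rw [← hs (s - t), clampTime_of_mem ⟨sub_nonneg.2 hst.1, by linarith [hst.2]⟩]

end

section

/-! ### Time integrals against the adjoint semigroup -/

/-- The integral `∫_0^∞ τ^{-a/2} e^{-ντ} dτ`. -/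
def volterraConst (a ν : ℝ) : ℝ := (1 / ν) ^ (1 - a / 2) * Real.Gamma (1 - a / 2)

lemma volterraConst_nonneg {a ν : ℝ} (ha : a < 2) (hν : 0 < ν) : 0 ≤ volterraConst a ν :=
  mul_nonneg (by positivity) (Real.Gamma_pos_of_pos (by linarith)).le

/-- Since a < 2 the power of 1/ν is positive. This decay is the source both of the contraction
(large time weight) and of the smallness in part (b) (large λ). -/
lemma tendsto_volterraConst {a : ℝ} (ha : a < 2) :
    Tendsto (volterraConst a) atTop (𝓝 0) := by
  have h1 : Tendsto (fun ν : ℝ => (1 / ν) ^ (1 - a / 2)) atTop (𝓝 0) := by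
    have h2 := tendsto_rpow_neg_atTop (y := 1 - a / 2) (by linarith)
    refine h2.congr' ?_
    filter_upwards [eventually_gt_atTop 0] with ν hν
    rw [one_div, Real.inv_rpow hν.le, Real.rpow_neg hν.le]
  have h3 := h1.mul_const (Real.Gamma (1 - a / 2))
  rwa [zero_mul] at h3

lemma integrableOn_rpow_mul_exp {a ν : ℝ} (ha : a < 2) (hν : 0 < ν) :
    IntegrableOn (fun τ : ℝ => τ ^ (-(a / 2)) * Real.exp (-ν * τ)) (Ioi 0) := by
  have := integrableOn_rpow_mul_exp_neg_mul_rpow (s := -(a / 2)) (p := 1) (b := ν) (by linarith)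
    zero_lt_one hν
  simpa using this

lemma intervalIntegrable_volterra {a ν t T : ℝ} (ha : a < 2) (hν : 0 < ν) (htT : t ≤ T) :
    IntervalIntegrable (fun s => (s - t) ^ (-(a / 2)) * Real.exp (-ν * (s - t))) volume t T := by
  have h1 : IntervalIntegrable (fun τ : ℝ => τ ^ (-(a / 2)) * Real.exp (-ν * τ)) volume 0 (T - t) :=
    (intervalIntegrable_iff_integrableOn_Ioc_of_le (by linarith)).2
      ((integrableOn_rpow_mul_exp ha hν).mono_set Ioc_subset_Ioi_self)
  have h2 := h1.comp_sub_right t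
  rwa [zero_add, sub_add_cancel] at h2

lemma integral_volterra_le {a ν t T : ℝ} (ha : a < 2) (hν : 0 < ν) (htT : t ≤ T) :
    ∫ s in t..T, (s - t) ^ (-(a / 2)) * Real.exp (-ν * (s - t)) ≤ volterraConst a ν := by
  have h1 := intervalIntegral.integral_comp_sub_right (a := t) (b := T)
    (fun τ : ℝ => τ ^ (-(a / 2)) * Real.exp (-ν * τ)) t
  rw [h1, sub_self, intervalIntegral.integral_of_le (by linarith)]
  have h2 := Real.integral_rpow_mul_exp_neg_mul_Ioi (a := 1 - a / 2) (by linarith) hν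
  rw [volterraConst, ← h2]
  have h3 : ∀ τ : ℝ, τ ^ (1 - a / 2 - 1) * Real.exp (-(ν * τ)) =
      τ ^ (-(a / 2)) * Real.exp (-ν * τ) := fun τ => by
    rw [neg_mul]
    congr 2
    ring
  simp_rw [h3]
  refine setIntegral_mono_set (integrableOn_rpow_mul_exp ha hν) ?_
    (LE.le.eventuallyLE Ioc_subset_Ioi_self)
  filter_upwards [ae_restrict_mem measurableSet_Ioi] with τ hτ
  have : (0 : ℝ) < τ := hτ
  positivity

variable {r : ℕ} {δ : Fin (r + 1) → ℕ} (ρ : Generator δ)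
variable {B : Matrix (Coord δ) (Coord δ) ℝ}

lemma ae_Ioc_of_ae_Icc {T t : ℝ} (ht : 0 ≤ t) {p : ℝ → Prop}
    (h : ∀ᵐ s ∂volume.restrict (Icc 0 T), p s) : ∀ᵐ s, s ∈ Ioc t T → p s := by
  have := (ae_restrict_iff' measurableSet_Icc).1 h
  filter_upwards [this] with s hs hst
  exact hs ⟨ht.trans hst.1.le, hst.2⟩

/-- Gain of `a < 2` derivatives for time integrals against the semigroup, with weights in time. -/
theorem exists_norm_integral_evol_le (hB : IsKolmogorovMatrix B) (T : ℝ) {γ β' : ℝ}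
    (h0 : 0 ≤ γ + β') (h2 : γ + β' < 2) :
    ∃ C, 0 ≤ C ∧ ∀ κ μ H t : ℝ, 0 < κ + μ → 0 ≤ H → t ∈ Icc 0 T → ∀ k : ℝ → 𝓢'(Space δ, ℂ),
      (∀ᵐ s ∂volume.restrict (Icc 0 T), BesovBound ρ (-β') (k s) (H * Real.exp (κ * (T - s)))) →
      ∀ φ : 𝓢(Space δ, ℂ),
        ‖∫ s in t..T, ((Real.exp (-μ * (s - t)) : ℝ) : ℂ) * k s (evol B (s - t) φ)‖ ≤
          C * volterraConst (γ + β') (κ + μ) * H * Real.exp (κ * (T - t)) * dnorm ρ (-γ) φ := by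
  obtain ⟨C, hC, hS⟩ := exists_dnorm_evol_le ρ hB T β' h0
  refine ⟨3 * (2 : ℝ) ^ |β'| * C, by positivity, fun κ μ H t hν hH ht k hk φ => ?_⟩
  set A : ℝ := 3 * (2 : ℝ) ^ |β'| * C * H * Real.exp (κ * (T - t)) * dnorm ρ (-γ) φ with hA
  have hA0 : 0 ≤ A := by
    have := dnorm_nonneg ρ (-γ) φ
    positivity
  have hint := (intervalIntegrable_volterra h2 hν ht.2).const_mul A
  -- Since e^{κ(T-s)} = e^{κ(T-t)}e^{-κ(s-t)}, the time weight acts as additional damping, and κ and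
  -- μ enter only through their sum.
  refine (intervalIntegral.norm_integral_le_of_norm_le (g := fun s => A *
    ((s - t) ^ (-((γ + β') / 2)) * Real.exp (-(κ + μ) * (s - t)))) ht.2 ?_ hint).trans ?_
  · filter_upwards [ae_Ioc_of_ae_Icc ht.1 hk] with s hs hst
    have hst0 : 0 < s - t := sub_pos.2 hst.1
    have h3 := norm_apply_le_dnorm (hs hst) (evol B (s - t) φ)
    rw [abs_neg, neg_neg] at h3
    have h4 := hS (s - t) ⟨hst0, by linarith [ht.1, hst.2]⟩ φ
    rw [show β' - (γ + β') = -γ by ring] at h4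
    rw [norm_mul, Complex.norm_real, Real.norm_of_nonneg (Real.exp_pos _).le]
    calc _ ≤ Real.exp (-μ * (s - t)) * (3 * (2 : ℝ) ^ |β'| * (H * Real.exp (κ * (T - s))) *
          (C * (s - t) ^ (-((γ + β') / 2)) * dnorm ρ (-γ) φ)) := by
            gcongr
            refine h3.trans ?_
            gcongr
      _ = A * ((s - t) ^ (-((γ + β') / 2)) *
          (Real.exp (-μ * (s - t)) * Real.exp (κ * (T - s)) * Real.exp (-(κ * (T - t))))) := by
            rw [hA, Real.exp_neg]
            have := Real.exp_ne_zero (κ * (T - t))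
            field_simp
      _ = _ := by
            rw [← Real.exp_add, ← Real.exp_add]
            congr 3
            ring
  · rw [intervalIntegral.integral_const_mul]
    refine (mul_le_mul_of_nonneg_left (integral_volterra_le h2 hν ht.2) hA0).trans_eq ?_
    rw [hA]
    ring

/-- The solution formula of a first-order linear equation in integrated form. -/
lemma eq_integral_exp_of_volterra {t T lam : ℝ} (htT : t ≤ T) {y F : ℝ → ℝ}
    (hy : IntervalIntegrable (fun s => lam * y s + F s) volume t T)
    (hF : IntervalIntegrable F volume t T)
    (h : ∀ τ ∈ Icc t T, y τ = -∫ s in τ..T, lam * y s + F s) :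
    y t = -∫ s in t..T, Real.exp (-lam * (s - t)) * F s := by
  set k : ℝ → ℝ := fun s => lam * y s + F s with hk
  set e : ℝ → ℝ := fun τ => Real.exp (-lam * (τ - t)) with he
  have hec : Continuous e := by fun_prop
  have heF : IntervalIntegrable (fun s => e s * F s) volume t T :=
    hF.continuousOn_mul hec.continuousOn
  -- `Y` is an absolutely continuous function on the whole line which coincides with `y` on [t, T].
  set Y : ℝ → ℝ := fun τ => (∫ s in t..τ, k s) - ∫ s in t..T, k s with hY
  have hYy : ∀ τ ∈ Icc t T, Y τ = y τ := fun τ hτ => by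
    have h1 := intervalIntegral.integral_add_adjacent_intervals
      (hy.mono_set (by rw [uIcc_of_le hτ.1, uIcc_of_le htT]; exact Icc_subset_Icc_right hτ.2) :
        IntervalIntegrable k volume t τ)
      (hy.mono_set (by rw [uIcc_of_le hτ.2, uIcc_of_le htT]; exact Icc_subset_Icc_left hτ.1) :
        IntervalIntegrable k volume τ T)
    have h2 : y τ = -∫ s in τ..T, k s := h τ hτ
    simp only [hY]
    linarith
  have hYac : AbsolutelyContinuousOnInterval Y t T := by
    have h1 := hy.absolutelyContinuousOnInterval_intervalIntegral (c := t) left_mem_uIcc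
    have h2 : AbsolutelyContinuousOnInterval (fun _ : ℝ => ∫ s in t..T, k s) t T :=
      (LipschitzWith.const _).lipschitzOnWith.absolutelyContinuousOnInterval
    exact h1.sub h2
  have hed : ∀ τ, HasDerivAt e (-lam * e τ) τ := fun τ => by
    have h1 : HasDerivAt (fun τ : ℝ => -lam * (τ - t)) (-lam) τ := by
      simpa using ((hasDerivAt_id τ).sub_const t).const_mul (-lam)
    simpa [he, mul_comm] using h1.exp
  have heac : AbsolutelyContinuousOnInterval e t T := by
    have h1 : Continuous fun τ => -lam * e τ := by fun_prop
    have h2 := (h1.intervalIntegrable t T).absolutelyContinuousOnInterval_intervalIntegral (c := t)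
      left_mem_uIcc
    have h3 : AbsolutelyContinuousOnInterval (fun _ : ℝ => e t) t T :=
      (LipschitzWith.const _).lipschitzOnWith.absolutelyContinuousOnInterval
    have h4 : e = (fun τ => ∫ s in t..τ, -lam * e s) + fun _ => e t := by
      ext τ
      rw [Pi.add_apply, intervalIntegral.integral_eq_sub_of_hasDerivAt (fun s _ => hed s)
        (h1.intervalIntegrable t τ), sub_add_cancel]
    rw [h4]
    exact h2.add h3
  have hIac := heF.absolutelyContinuousOnInterval_intervalIntegral (c := t) left_mem_uIcc
  -- The data are merely integrable, so the integrating factor is used almost everywhere: e·Y minus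
  -- the primitive of e·F is absolutely continuous with zero derivative, hence constant.
  obtain ⟨C, hC⟩ := ((heac.mul hYac).sub hIac).const_of_ae_hasDerivAt_zero (by
    filter_upwards [hy.ae_hasDerivAt_integral, heF.ae_hasDerivAt_integral] with τ h1 h2 hτ
    have h3 := (h1 hτ t left_mem_uIcc).sub_const (∫ s in t..T, k s)
    have h4 := ((hed τ).mul h3).sub (h2 hτ t left_mem_uIcc)
    convert! h4 using 1
    have h5 := hYy τ (by rwa [uIcc_of_le htT] at hτ)
    simp only [hY] at h5
    rw [h5]
    simp only [hk]
    ring)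
  have h1 := (hC t left_mem_uIcc).trans (hC T right_mem_uIcc).symm
  simp only [Pi.sub_apply, Pi.mul_apply, intervalIntegral.integral_same, sub_zero] at h1
  rw [hYy t ⟨le_rfl, htT⟩, show e t = 1 by simp [he], show Y T = 0 by simp [hY], one_mul, mul_zero,
    zero_sub] at h1
  exact h1

lemma eq_integral_exp_of_volterra_complex {t T lam : ℝ} (htT : t ≤ T) {y F : ℝ → ℂ}
    (hy : IntervalIntegrable (fun s => (lam : ℂ) * y s + F s) volume t T)
    (hF : IntervalIntegrable F volume t T)
    (h : ∀ τ ∈ Icc t T, y τ = -∫ s in τ..T, (lam : ℂ) * y s + F s) :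
    y t = -∫ s in t..T, ((Real.exp (-lam * (s - t)) : ℝ) : ℂ) * F s := by
  have key : ∀ L : ℂ →L[ℝ] ℝ, L (y t) =
      L (-∫ s in t..T, ((Real.exp (-lam * (s - t)) : ℝ) : ℂ) * F s) := by
    intro L
    have hL : ∀ (c : ℝ) (z : ℂ), L ((c : ℂ) * z) = c * L z := fun c z => by
      rw [← Complex.real_smul, map_smul, smul_eq_mul]
    have hsub : ∀ τ ∈ Icc t T, IntervalIntegrable (fun s => (lam : ℂ) * y s + F s) volume τ T :=
      fun τ hτ => hy.mono_set
        (by rw [uIcc_of_le hτ.2, uIcc_of_le htT]; exact Icc_subset_Icc_left hτ.1)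
    have hint : ∀ {G : ℝ → ℂ}, IntervalIntegrable G volume t T →
        IntervalIntegrable (fun s => L (G s)) volume t T := fun hG =>
      ⟨L.integrable_comp hG.1, L.integrable_comp hG.2⟩
    have hmap : ∀ s, L ((lam : ℂ) * y s + F s) = lam * L (y s) + L (F s) := fun s => by
      rw [map_add, hL]
    have heF : IntervalIntegrable (fun s => ((Real.exp (-lam * (s - t)) : ℝ) : ℂ) * F s)
        volume t T := by
      have : Continuous fun s => ((Real.exp (-lam * (s - t)) : ℝ) : ℂ) := by fun_prop
      exact hF.continuousOn_mul this.continuousOn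
    have h1 := eq_integral_exp_of_volterra (lam := lam) (y := fun s => L (y s))
      (F := fun s => L (F s)) htT (by simpa only [hmap] using hint hy) (hint hF) (fun τ hτ => by
        have h2 := L.intervalIntegral_comp_comm (hsub τ hτ)
        simp only [hmap] at h2
        rw [h2, h τ hτ, map_neg])
    have h3 := L.intervalIntegral_comp_comm heF
    simp only [hL] at h3
    rw [map_neg, ← h3]
    exact h1
  exact Complex.ext (key Complex.reCLM) (key Complex.imCLM)

end

section

/-! ### Estimates for the mild formulation -/

variable {r : ℕ} {δ : Fin (r + 1) → ℕ} (ρ : Generator δ)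
variable {B : Matrix (Coord δ) (Coord δ) ℝ}

/-- Regularities for which the mild formulation is well posed: the data have regularity `-β`, the
products regularity `-(β+σ)`, the solutions regularity `γ`. -/
structure Exponents (β σ γ : ℝ) : Prop where
  pos : 0 < β
  loss_pos : 0 < σ
  le : 1 + (β + σ) ≤ γ
  lt_two : γ + (β + σ) < 2

/-- The constant in the estimate of the drift term. -/
def driftConst (β σ γ : ℝ) : ℝ :=
  δ 0 * (bonyConst ρ β (γ - 1) σ * derivConst ρ γ)

variable {ρ} {β σ γ : ℝ}

lemma driftConst_nonneg (he : Exponents β σ γ) : 0 ≤ driftConst ρ β σ γ := by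
  have := bonyConst_nonneg (ρ := ρ) he.pos
    (by linarith [he.pos, he.loss_pos, he.le] : 0 < γ - 1) he.loss_pos
  have := derivConst_nonneg (ρ := ρ) γ
  unfold driftConst
  positivity

lemma BesovBound.sum {ι : Type*} (s : Finset ι) {f : ι → 𝓢'(Space δ, ℂ)} {C : ι → ℝ} {θ : ℝ}
    (h : ∀ i ∈ s, BesovBound ρ θ (f i) (C i)) : BesovBound ρ θ (∑ i ∈ s, f i) (∑ i ∈ s, C i) := by
  classical
  induction s using Finset.induction_on with
  | empty => simpa using besovBound_zero θ
  | insert a s ha ih =>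
    rw [Finset.sum_insert ha, Finset.sum_insert ha]
    exact (h a (Finset.mem_insert_self a s)).add
      (ih fun i hi => h i (Finset.mem_insert_of_mem hi))

lemma BesovBound.of_tendsto {θ c : ℝ} {C : ℕ → ℝ} {f : 𝓢'(Space δ, ℂ)}
    (h : ∀ n, BesovBound ρ θ f (C n)) (hC : Tendsto C atTop (𝓝 c)) : BesovBound ρ θ f c :=
  fun n x => ge_of_tendsto' (hC.mul_const _) fun m => h m n x

lemma besovBound_drift (he : Exponents β σ γ) {b : Fin (δ 0) → 𝓢'(Space δ, ℂ)}
    {u : 𝓢'(Space δ, ℂ)} {Cb R : ℝ} (hb : ∀ i, BesovBound ρ (-β) (b i) Cb)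
    (hu : BesovBound ρ γ u R) : BesovBound ρ (-(β + σ)) (∑ i, bonyProduct ρ (b i) (vDeriv i u))
      (driftConst ρ β σ γ * (Cb * R)) := by
  have h1 := BesovBound.sum Finset.univ fun i _ =>
    besovBound_bonyProduct he.pos he.loss_pos (by linarith [he.le]) (hb i) (hu.vDeriv i)
  refine h1.mono (le_of_eq ?_)
  rw [Finset.sum_const, nsmul_eq_mul, Finset.card_univ, Fintype.card_fin, driftConst]
  ring

lemma besovBound_source (he : Exponents β σ γ) {lam : ℝ} (hlam : 0 ≤ lam)
    {b : Fin (δ 0) → 𝓢'(Space δ, ℂ)} {g u : 𝓢'(Space δ, ℂ)} {Cb Cg R : ℝ}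
    (hb : ∀ i, BesovBound ρ (-β) (b i) Cb) (hg : BesovBound ρ (-(β + σ)) g Cg)
    (hu : BesovBound ρ γ u R) : BesovBound ρ (-(β + σ)) (source ρ lam b g u)
      (lam * R + Cg + driftConst ρ β σ γ * (Cb * R)) := by
  have h1 := (hu.mono_exponent (γ' := -(β + σ))
    (by linarith [he.pos, he.loss_pos, he.le])).smul (lam : ℂ)
  rw [Complex.norm_real, Real.norm_of_nonneg hlam] at h1
  exact (h1.add hg).sub (besovBound_drift he hb hu)

variable (ρ) in
/-- One step of the mild formulation, with weights in time. -/
theorem exists_besovBound_step (hB : IsKolmogorovMatrix B) (T : ℝ) (he : Exponents β σ γ) :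
    ∃ C, 0 ≤ C ∧ ∃ K : ℝ → ℝ, (∀ ν > 0, 0 ≤ K ν) ∧ Tendsto K atTop (𝓝 0) ∧
      ∀ lam μ κ Cb Cl Ch R : ℝ, 0 ≤ lam → 0 ≤ μ → 0 ≤ κ → 0 < κ + μ → 0 ≤ Cb → 0 ≤ Ch → 0 ≤ R →
      K (κ + μ) * (lam + Cb) ≤ 1 / 2 → ∀ (b : ℝ → Fin (δ 0) → 𝓢'(Space δ, ℂ))
      (h w : ℝ → 𝓢'(Space δ, ℂ)) (ℓ : 𝓢'(Space δ, ℂ)), BesovBound ρ γ ℓ Cl →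
      (∀ᵐ s ∂volume.restrict (Icc 0 T), ∀ i, BesovBound ρ (-β) (b s i) Cb) →
      (∀ᵐ s ∂volume.restrict (Icc 0 T), BesovBound ρ (-(β + σ)) (h s) Ch) →
      (∀ᵐ s ∂volume.restrict (Icc 0 T), BesovBound ρ γ (w s) (R * Real.exp (κ * (T - s)))) →
      ∀ t ∈ Icc 0 T, ∀ v : 𝓢'(Space δ, ℂ),
      (∀ φ, v φ = ((Real.exp (-μ * (T - t)) : ℝ) : ℂ) * ℓ (evol B (T - t) φ) -
        ∫ s in t..T, ((Real.exp (-μ * (s - t)) : ℝ) : ℂ) *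
          source ρ lam (b s) (h s) (w s) (evol B (s - t) φ)) →
      BesovBound ρ γ v ((C * Cl + K (κ + μ) * Ch + R / 2) * Real.exp (κ * (T - t))) := by
  obtain ⟨C₀, hC₀, h₀⟩ := exists_norm_integral_evol_le ρ hB T (γ := γ) (β' := β + σ)
    (by linarith [he.pos, he.loss_pos, he.le]) he.lt_two
  obtain ⟨C₁, hC₁, h₁⟩ := exists_dnorm_evol_le_dnorm ρ hB T (-γ)
  have hD := driftConst_nonneg (ρ := ρ) he
  have hd := dualConst_nonneg (ρ := ρ) γ
  set D := driftConst ρ β σ γ with hDdef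
  refine ⟨dualConst ρ γ * (3 * (2 : ℝ) ^ |γ| * C₁), by positivity,
    -- The factor 1 + D lets a single function K dominate the coefficients of the λ-term, the drift
    -- term and the forcing.
    fun ν => dualConst ρ γ * C₀ * (1 + D) * volterraConst (γ + (β + σ)) ν, fun ν hν => ?_, ?_, ?_⟩
  · have := volterraConst_nonneg he.lt_two hν
    positivity
  · simpa using (tendsto_volterraConst he.lt_two).const_mul (dualConst ρ γ * C₀ * (1 + D))
  intro lam μ κ Cb Cl Ch R hlam hμ hκ hν hCb hCh hR hK b h w ℓ hℓ hb hh hw t ht v hv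
  have hV := volterraConst_nonneg he.lt_two hν
  set V := volterraConst (γ + (β + σ)) (κ + μ) with hVdef
  set H : ℝ := lam * R + Ch + D * (Cb * R) with hH
  have hH0 : 0 ≤ H := by positivity
  have hCl := hℓ.nonneg
  have hsrc : ∀ᵐ s ∂volume.restrict (Icc 0 T), BesovBound ρ (-(β + σ))
      (source ρ lam (b s) (h s) (w s)) (H * Real.exp (κ * (T - s))) := by
    filter_upwards [hb, hh, hw, ae_restrict_mem measurableSet_Icc] with s h1 h2 h3 hs
    have h4 : 1 ≤ Real.exp (κ * (T - s)) :=
      Real.one_le_exp (mul_nonneg hκ (by linarith [hs.2]))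
    refine (besovBound_source he hlam h1 h2 h3).mono ?_
    rw [hH, add_mul, add_mul]
    have h5 : Ch ≤ Ch * Real.exp (κ * (T - s)) := le_mul_of_one_le_right hCh h4
    have h6 : lam * (R * Real.exp (κ * (T - s))) = lam * R * Real.exp (κ * (T - s)) := by ring
    have h7 : D * (Cb * (R * Real.exp (κ * (T - s)))) = D * (Cb * R) * Real.exp (κ * (T - s)) := by
      ring
    rw [h6, h7]
    linarith
  have hE : 1 ≤ Real.exp (κ * (T - t)) := Real.one_le_exp (mul_nonneg hκ (by linarith [ht.2]))
  have hdual : ∀ φ, ‖v φ‖ ≤ (3 * (2 : ℝ) ^ |γ| * C₁ * Cl + C₀ * V * H) *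
      Real.exp (κ * (T - t)) * dnorm ρ (-γ) φ := fun φ => by
    have hφ := dnorm_nonneg ρ (-γ) φ
    have h3 := h₀ κ μ H t hν hH0 ht _ hsrc φ
    have h4 : ‖((Real.exp (-μ * (T - t)) : ℝ) : ℂ) * ℓ (evol B (T - t) φ)‖ ≤
        3 * (2 : ℝ) ^ |γ| * C₁ * Cl * dnorm ρ (-γ) φ := by
      rw [norm_mul, Complex.norm_real, Real.norm_of_nonneg (Real.exp_pos _).le]
      have h5 : Real.exp (-μ * (T - t)) ≤ 1 := by
        rw [Real.exp_le_one_iff, neg_mul]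
        exact neg_nonpos.2 (mul_nonneg hμ (by linarith [ht.2]))
      refine (mul_le_of_le_one_left (norm_nonneg _) h5).trans ?_
      refine (norm_apply_le_dnorm hℓ _).trans ?_
      have h6 := h₁ (T - t) ⟨by linarith [ht.2], by linarith [ht.1]⟩ φ
      calc _ ≤ 3 * (2 : ℝ) ^ |γ| * Cl * (C₁ * dnorm ρ (-γ) φ) := by gcongr
        _ = _ := by ring
    rw [hv φ]
    refine (norm_sub_le _ _).trans ((add_le_add h4 h3).trans ?_)
    have h7 : 3 * (2 : ℝ) ^ |γ| * C₁ * Cl * dnorm ρ (-γ) φ ≤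
        3 * (2 : ℝ) ^ |γ| * C₁ * Cl * dnorm ρ (-γ) φ * Real.exp (κ * (T - t)) :=
      le_mul_of_one_le_right (by positivity) hE
    refine (add_le_add_left h7 _).trans_eq ?_
    ring
  refine (besovBound_of_dnorm (by positivity) hdual).mono ?_
  rw [← mul_assoc]
  refine mul_le_mul_of_nonneg_right ?_ (Real.exp_pos _).le
  have h8 : dualConst ρ γ * C₀ * V * (lam * R + D * (Cb * R)) ≤
      dualConst ρ γ * C₀ * (1 + D) * V * (lam + Cb) * R := by
    have : lam * R + D * (Cb * R) ≤ (1 + D) * (lam + Cb) * R := by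
      have := mul_nonneg hD (mul_nonneg hlam hR)
      have := mul_nonneg hCb hR
      nlinarith
    calc _ ≤ dualConst ρ γ * C₀ * V * ((1 + D) * (lam + Cb) * R) :=
          mul_le_mul_of_nonneg_left this (by positivity)
      _ = _ := by ring
  have h9 : dualConst ρ γ * C₀ * (1 + D) * V * (lam + Cb) * R ≤ 1 / 2 * R :=
    mul_le_mul_of_nonneg_right hK hR
  have h10 : dualConst ρ γ * C₀ * V * Ch ≤ dualConst ρ γ * C₀ * (1 + D) * V * Ch := by
    have : 0 ≤ dualConst ρ γ * C₀ * V * Ch * D := by positivity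
    nlinarith
  rw [hH]
  nlinarith

variable (ρ) in
/-- A priori estimate for solutions of the (possibly damped) mild formulation. -/
theorem exists_besovBound_of_mild (hB : IsKolmogorovMatrix B) (T : ℝ) (he : Exponents β σ γ) :
    ∃ C, 0 ≤ C ∧ ∃ K : ℝ → ℝ, (∀ ν > 0, 0 ≤ K ν) ∧ Tendsto K atTop (𝓝 0) ∧
      ∀ lam μ κ Cb Cl Ch : ℝ, 0 ≤ lam → 0 ≤ μ → 0 ≤ κ → 0 < κ + μ → 0 ≤ Cb → 0 ≤ Ch →
      K (κ + μ) * (lam + Cb) ≤ 1 / 2 → ∀ (b : ℝ → Fin (δ 0) → 𝓢'(Space δ, ℂ))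
      (h w : ℝ → 𝓢'(Space δ, ℂ)) (ℓ : 𝓢'(Space δ, ℂ)), BesovBound ρ γ ℓ Cl →
      (∀ᵐ s ∂volume.restrict (Icc 0 T), ∀ i, BesovBound ρ (-β) (b s i) Cb) →
      (∀ᵐ s ∂volume.restrict (Icc 0 T), BesovBound ρ (-(β + σ)) (h s) Ch) →
      (∃ R, ∀ᵐ s ∂volume.restrict (Icc 0 T), BesovBound ρ γ (w s) R) →
      (∀ t ∈ Icc 0 T, ∀ φ, w t φ = ((Real.exp (-μ * (T - t)) : ℝ) : ℂ) * ℓ (evol B (T - t) φ) -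
        ∫ s in t..T, ((Real.exp (-μ * (s - t)) : ℝ) : ℂ) *
          source ρ lam (b s) (h s) (w s) (evol B (s - t) φ)) →
      ∀ t ∈ Icc 0 T, BesovBound ρ γ (w t)
        (2 * (C * Cl + K (κ + μ) * Ch) * Real.exp (κ * (T - t))) := by
  obtain ⟨C, hC, K, hK0, hK, hstep⟩ := exists_besovBound_step ρ hB T he
  refine ⟨C, hC, K, hK0, hK, ?_⟩
  intro lam μ κ Cb Cl Ch hlam hμ hκ hν hCb hCh hKl b h w ℓ hℓ hb hh ⟨R, hR⟩ hw t ht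
  have hCl := hℓ.nonneg
  set A : ℝ := C * Cl + K (κ + μ) * Ch with hA
  have hA0 : 0 ≤ A := by
    have := hK0 _ hν
    positivity
  -- One step turns a bound R into A + R/2. As some finite bound is known beforehand, iteration
  -- brings it down to the fixed point 2A, whatever its initial size.
  have key : ∀ n : ℕ, ∀ᵐ s ∂volume.restrict (Icc 0 T),
      BesovBound ρ γ (w s) ((2 * A + max R 0 / 2 ^ n) * Real.exp (κ * (T - s))) := by
    intro n
    induction n with
    | zero =>
      filter_upwards [hR, ae_restrict_mem measurableSet_Icc] with s hs hsT
      have h4 : 1 ≤ Real.exp (κ * (T - s)) :=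
        Real.one_le_exp (mul_nonneg hκ (by linarith [hsT.2]))
      refine hs.mono ?_
      rw [pow_zero, div_one]
      have := le_max_left R 0
      have := le_max_right R 0
      nlinarith
    | succ n ih =>
      filter_upwards [ae_restrict_mem measurableSet_Icc] with s hsT
      refine (hstep lam μ κ Cb Cl Ch _ hlam hμ hκ hν hCb hCh (by positivity) hKl b h w ℓ hℓ hb hh
        ih s hsT (w s) (hw s hsT)).mono (le_of_eq ?_)
      rw [← hA, pow_succ]
      field_simp
      ring
  have h2 : ∀ n : ℕ, BesovBound ρ γ (w t)
      ((2 * A + max R 0 / 2 ^ (n + 1)) * Real.exp (κ * (T - t))) := fun n => by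
    refine (hstep lam μ κ Cb Cl Ch _ hlam hμ hκ hν hCb hCh (by positivity) hKl b h w ℓ hℓ hb hh
      (key n) t ht (w t) (hw t ht)).mono (le_of_eq ?_)
    rw [← hA, pow_succ]
    field_simp
    ring
  refine BesovBound.of_tendsto h2 ?_
  have h3 : Tendsto (fun n : ℕ => max R 0 / 2 ^ (n + 1)) atTop (𝓝 0) :=
    (tendsto_const_nhds.div_atTop
      (tendsto_pow_atTop_atTop_of_one_lt (one_lt_two (α := ℝ)))).comp (tendsto_add_atTop_nat 1)
  simpa using (h3.const_add (2 * A)).mul_const (Real.exp (κ * (T - t)))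

end

section

/-! ### Bounds and measurability of the data -/

variable {r : ℕ} {δ : Fin (r + 1) → ℕ} {ρ : Generator δ}
variable {B : Matrix (Coord δ) (Coord δ) ℝ} {β σ γ T lam : ℝ}

lemma ae_besovBound_of_timeNorm_le {θ M : ℝ} (hM : 0 ≤ M) {f : ℝ → 𝓢'(Space δ, ℂ)}
    (h : timeNorm ρ T θ f ≤ ENNReal.ofReal M) :
    ∀ᵐ s ∂volume.restrict (Icc 0 T), BesovBound ρ θ (f s) (2 ^ θ * M) := by
  filter_upwards [ENNReal.ae_le_essSup fun t => besovNorm ρ θ (f t)] with s hs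
  exact besovBound_of_besovNorm_le hM (hs.trans h)

lemma timeNorm_le_of_besovBound {θ C : ℝ} {f : ℝ → 𝓢'(Space δ, ℂ)}
    (h : ∀ t ∈ Icc 0 T, BesovBound ρ θ (f t) C) :
    timeNorm ρ T θ f ≤ ENNReal.ofReal (2 ^ (-θ) * C) := by
  refine essSup_le_of_ae_le _ ?_
  filter_upwards [ae_restrict_mem measurableSet_Icc] with s hs
  exact (h s hs).besovNorm_le

lemma ae_besovBound_of_vecTimeNorm_le {θ M : ℝ} (hM : 0 ≤ M)
    {b : ℝ → Fin (δ 0) → 𝓢'(Space δ, ℂ)} (h : vecTimeNorm ρ T θ b ≤ ENNReal.ofReal M) :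
    ∀ᵐ s ∂volume.restrict (Icc 0 T), ∀ i, BesovBound ρ θ (b s i) (2 ^ θ * M) :=
  ae_all_iff.2 fun i => ae_besovBound_of_timeNorm_le hM ((le_iSup _ i).trans h)

lemma MemLinf.exists_ae_besovBound {θ : ℝ} {f : ℝ → 𝓢'(Space δ, ℂ)} (h : MemLinf ρ T θ f) :
    ∃ C, 0 ≤ C ∧ ∀ᵐ s ∂volume.restrict (Icc 0 T), BesovBound ρ θ (f s) C :=
  ⟨_, by positivity, ae_besovBound_of_timeNorm_le ENNReal.toReal_nonneg
    (ENNReal.ofReal_toReal h.bdd.ne).ge⟩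

lemma VecMemLinf.exists_ae_besovBound {θ : ℝ} {b : ℝ → Fin (δ 0) → 𝓢'(Space δ, ℂ)}
    (h : VecMemLinf ρ T θ b) :
    ∃ C, 0 ≤ C ∧ ∀ᵐ s ∂volume.restrict (Icc 0 T), ∀ i, BesovBound ρ θ (b s i) C := by
  choose C hC hCb using fun i => (h i).exists_ae_besovBound
  refine ⟨∑ i, C i, Finset.sum_nonneg fun i _ => hC i, ?_⟩
  filter_upwards [ae_all_iff.2 hCb] with s hs i
  exact (hs i).mono (Finset.single_le_sum (fun i _ => hC i) (Finset.mem_univ i))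

lemma source_apply (b : Fin (δ 0) → 𝓢'(Space δ, ℂ)) (g u : 𝓢'(Space δ, ℂ)) (φ : 𝓢(Space δ, ℂ)) :
    source ρ lam b g u φ = (lam : ℂ) * u φ + g φ - ∑ i, bonyProduct ρ (b i) (vDeriv i u) φ := by
  have h : (∑ i, bonyProduct ρ (b i) (vDeriv i u)) φ =
      ∑ i, bonyProduct ρ (b i) (vDeriv i u) φ := by
    classical
    induction (Finset.univ : Finset (Fin (δ 0))) using Finset.induction_on with
    | empty => simp
    | insert a t ha ih =>
      rw [Finset.sum_insert ha, Finset.sum_insert ha, ← ih]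
      rfl
  rw [← h]
  rfl

lemma aemeasurable_source (he : Exponents β σ γ) {b : ℝ → Fin (δ 0) → 𝓢'(Space δ, ℂ)}
    {g u : ℝ → 𝓢'(Space δ, ℂ)} {Cb R : ℝ} {μ : Measure ℝ}
    (hb : ∀ i φ, AEMeasurable (fun s => b s i φ) μ) (hg : ∀ φ, AEMeasurable (fun s => g s φ) μ)
    (hu : ∀ φ, AEMeasurable (fun s => u s φ) μ)
    (hbB : ∀ᵐ s ∂μ, ∀ i, BesovBound ρ (-β) (b s i) Cb) (huB : ∀ᵐ s ∂μ, BesovBound ρ γ (u s) R)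
    (φ : 𝓢(Space δ, ℂ)) :
    AEMeasurable (fun s => source ρ lam (b s) (g s) (u s) φ) μ := by
  simp only [source_apply]
  refine (((hu φ).const_mul _).add (hg φ)).sub (Finset.aemeasurable_fun_sum _ fun i _ => ?_)
  refine aemeasurable_bonyProduct (β := β) (σ := σ) (α := γ - 1) he.pos he.loss_pos
    (by linarith [he.le]) (hb i) (fun φ => ?_) ?_ ?_ φ
  · simp only [vDeriv_apply]
    exact (hu _).neg
  · filter_upwards [hbB] with s hs using ⟨_, hs i⟩
  · filter_upwards [huB] with s hs using ⟨_, hs.vDeriv i⟩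

lemma exists_norm_apply_evol_le (hB : IsKolmogorovMatrix B) (T θ : ℝ) :
    ∃ C, 0 ≤ C ∧ ∀ (f : 𝓢'(Space δ, ℂ)) (H : ℝ), BesovBound ρ θ f H → ∀ t ∈ Icc 0 T,
      ∀ φ : 𝓢(Space δ, ℂ), ‖f (evol B t φ)‖ ≤ C * H * dnorm ρ (-θ) φ := by
  obtain ⟨C, hC, h⟩ := exists_dnorm_evol_le_dnorm ρ hB T (-θ)
  refine ⟨3 * (2 : ℝ) ^ |θ| * C, by positivity, fun f H hf t ht φ => ?_⟩
  have := hf.nonneg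
  refine (norm_apply_le_dnorm hf _).trans ?_
  calc _ ≤ 3 * (2 : ℝ) ^ |θ| * H * (C * dnorm ρ (-θ) φ) :=
        mul_le_mul_of_nonneg_left (h t ht φ) (by positivity)
    _ = _ := by ring

lemma intervalIntegrable_apply_evol (hB : IsKolmogorovMatrix B) (hT : 0 ≤ T) {θ H : ℝ}
    {k : ℝ → 𝓢'(Space δ, ℂ)} (hk : ∀ φ, AEMeasurable (fun s => k s φ) (volume.restrict (Icc 0 T)))
    (hkB : ∀ᵐ s ∂volume.restrict (Icc 0 T), BesovBound ρ θ (k s) H) {t : ℝ} (ht : t ∈ Icc 0 T)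
    (φ : 𝓢(Space δ, ℂ)) :
    IntervalIntegrable (fun s => k s (evol B (s - t) φ)) volume t T := by
  obtain ⟨C, hC, h⟩ := exists_norm_apply_evol_le (ρ := ρ) hB T θ
  rw [intervalIntegrable_iff_integrableOn_Icc_of_le ht.2]
  have hm := aemeasurable_apply_evol hB hT hk (hkB.mono fun s hs => ⟨_, hs⟩) ht.1 φ
  refine Integrable.of_bound hm.aestronglyMeasurable (C * H * dnorm ρ (-θ) φ) ?_
  have hle : volume.restrict (Icc t T) ≤ volume.restrict (Icc 0 T) :=
    Measure.restrict_mono (Icc_subset_Icc_left ht.1) le_rfl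
  filter_upwards [ae_mono hle hkB, ae_restrict_mem measurableSet_Icc] with s hs hst
  exact h (k s) H hs (s - t) ⟨sub_nonneg.2 hst.1, by linarith [hst.2, ht.1]⟩ φ

/-! ### The mild equation, the difference of two solutions, and damping -/

/-- `v` is the image of `u` under the map whose fixed points are the mild solutions. -/
def MildMap (ρ : Generator δ) (B : Matrix (Coord δ) (Coord δ) ℝ) (T lam : ℝ)
    (b : ℝ → Fin (δ 0) → 𝓢'(Space δ, ℂ)) (g : ℝ → 𝓢'(Space δ, ℂ)) (ℓ : 𝓢'(Space δ, ℂ))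
    (u v : ℝ → 𝓢'(Space δ, ℂ)) : Prop :=
  ∀ t ∈ Icc 0 T, ∀ φ, v t φ = ℓ (evol B (T - t) φ) -
    ∫ s in t..T, source ρ lam (b s) (g s) (u s) (evol B (s - t) φ)

lemma integral_semigroupPairing (hB : IsKolmogorovMatrix B) {t : ℝ} (ht : t ≤ T)
    (k : ℝ → 𝓢'(Space δ, ℂ)) (φ : 𝓢(Space δ, ℂ)) :
    ∫ s in t..T, semigroupPairing B (s - t) (k s) φ = ∫ s in t..T, k s (evol B (s - t) φ) := by
  refine intervalIntegral.integral_congr fun s hs => ?_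
  rw [uIcc_of_le ht] at hs
  change k s (adjointSemigroup B (s - t) φ) = _
  rw [adjointSemigroup_eq hB (sub_nonneg.2 hs.1)]

lemma IsMildSolution.mildMap (hB : IsKolmogorovMatrix B)
    {b : ℝ → Fin (δ 0) → 𝓢'(Space δ, ℂ)} {g u : ℝ → 𝓢'(Space δ, ℂ)} {ℓ : 𝓢'(Space δ, ℂ)}
    (h : IsMildSolution ρ B T γ lam b g ℓ u) : MildMap ρ B T lam b g ℓ u u := by
  intro t ht φ
  rw [h.eq t ht φ, integral_semigroupPairing hB ht.2, semigroupPairing,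
    adjointSemigroup_eq hB (sub_nonneg.2 ht.2)]

/-- Bounds and measurability for the coefficients and a candidate solution. -/
structure Controlled (ρ : Generator δ) (T β γ Cb Cg R : ℝ)
    (b : ℝ → Fin (δ 0) → 𝓢'(Space δ, ℂ)) (g u : ℝ → 𝓢'(Space δ, ℂ)) : Prop where
  drift_meas : ∀ i φ, AEMeasurable (fun s => b s i φ) (volume.restrict (Icc 0 T))
  forcing_meas : ∀ φ, AEMeasurable (fun s => g s φ) (volume.restrict (Icc 0 T))
  sol_meas : ∀ φ, AEMeasurable (fun s => u s φ) (volume.restrict (Icc 0 T))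
  drift_bound : ∀ᵐ s ∂volume.restrict (Icc 0 T), ∀ i, BesovBound ρ (-β) (b s i) Cb
  forcing_bound : ∀ᵐ s ∂volume.restrict (Icc 0 T), BesovBound ρ (-β) (g s) Cg
  sol_bound : ∀ᵐ s ∂volume.restrict (Icc 0 T), BesovBound ρ γ (u s) R

variable {b b' : ℝ → Fin (δ 0) → 𝓢'(Space δ, ℂ)} {g g' u u' v v' : ℝ → 𝓢'(Space δ, ℂ)}
  {ℓ ℓ' : 𝓢'(Space δ, ℂ)} {Cb Cg R Cb' Cg' R' : ℝ}

lemma Controlled.source_meas (h : Controlled ρ T β γ Cb Cg R b g u) (he : Exponents β σ γ)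
    (lam : ℝ) (φ : 𝓢(Space δ, ℂ)) :
    AEMeasurable (fun s => source ρ lam (b s) (g s) (u s) φ) (volume.restrict (Icc 0 T)) :=
  aemeasurable_source he h.drift_meas h.forcing_meas h.sol_meas h.drift_bound h.sol_bound φ

lemma Controlled.source_bound (h : Controlled ρ T β γ Cb Cg R b g u) (he : Exponents β σ γ)
    (hlam : 0 ≤ lam) : ∀ᵐ s ∂volume.restrict (Icc 0 T), BesovBound ρ (-(β + σ))
      (source ρ lam (b s) (g s) (u s)) (lam * R + Cg + driftConst ρ β σ γ * (Cb * R)) := by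
  filter_upwards [h.drift_bound, h.forcing_bound, h.sol_bound] with s h1 h2 h3
  exact besovBound_source he hlam h1 (h2.mono_exponent (by linarith [he.loss_pos])) h3

lemma Controlled.intervalIntegrable (h : Controlled ρ T β γ Cb Cg R b g u)
    (he : Exponents β σ γ) (hB : IsKolmogorovMatrix B) (hT : 0 ≤ T) (hlam : 0 ≤ lam) {t : ℝ}
    (ht : t ∈ Icc 0 T) (φ : 𝓢(Space δ, ℂ)) :
    IntervalIntegrable (fun s => source ρ lam (b s) (g s) (u s) (evol B (s - t) φ)) volume t T :=
  intervalIntegrable_apply_evol hB hT (h.source_meas he lam) (h.source_bound he hlam) ht φ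

/-- b·∇u - b'·∇u' = b·∇(u-u') + (b-b')·∇u', so the difference solves the equation with drift `b` and
the error in the drift becomes a forcing. -/
lemma source_sub_source (he : Exponents β σ γ) {b b' : Fin (δ 0) → 𝓢'(Space δ, ℂ)}
    {g g' u u' : 𝓢'(Space δ, ℂ)} (hb : ∀ i, BesovBound ρ (-β) (b i) Cb)
    (hb' : ∀ i, BesovBound ρ (-β) (b' i) Cb') (hu : BesovBound ρ γ u R)
    (hu' : BesovBound ρ γ u' R') :
    source ρ lam b g u - source ρ lam b' g' u' =
      source ρ lam b (g - g' - ∑ i, bonyProduct ρ (b i - b' i) (vDeriv i u')) (u - u') := by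
  have hα : β + σ ≤ γ - 1 := by linarith [he.le]
  have h1 : ∑ i, bonyProduct ρ (b i - b' i) (vDeriv i u') =
      ∑ i, bonyProduct ρ (b i) (vDeriv i u') - ∑ i, bonyProduct ρ (b' i) (vDeriv i u') := by
    rw [← Finset.sum_sub_distrib]
    exact Finset.sum_congr rfl fun i _ =>
      bonyProduct_sub_left he.pos he.loss_pos hα (hb i) (hb' i) (hu'.vDeriv i)
  have h2 : ∑ i, bonyProduct ρ (b i) (vDeriv i (u - u')) =
      ∑ i, bonyProduct ρ (b i) (vDeriv i u) - ∑ i, bonyProduct ρ (b i) (vDeriv i u') := by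
    rw [← Finset.sum_sub_distrib]
    refine Finset.sum_congr rfl fun i _ => ?_
    rw [vDeriv_sub]
    exact bonyProduct_sub_right he.pos he.loss_pos hα (hb i) (hu.vDeriv i) (hu'.vDeriv i)
  simp only [source]
  rw [h1, h2, smul_sub]
  abel

/-- The equation solved by the difference of two images. -/
theorem MildMap.sub (hB : IsKolmogorovMatrix B) (he : Exponents β σ γ) (hT : 0 ≤ T)
    (hlam : 0 ≤ lam) (h : Controlled ρ T β γ Cb Cg R b g u)
    (h' : Controlled ρ T β γ Cb' Cg' R' b' g' u') (hu : MildMap ρ B T lam b g ℓ u v)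
    (hu' : MildMap ρ B T lam b' g' ℓ' u' v') :
    MildMap ρ B T lam b
      (fun s => g s - g' s - ∑ i, bonyProduct ρ (b s i - b' s i) (vDeriv i (u' s))) (ℓ - ℓ')
      (fun s => u s - u' s) (fun s => v s - v' s) := by
  intro t ht φ
  change v t φ - v' t φ = ℓ (evol B (T - t) φ) - ℓ' (evol B (T - t) φ) - _
  rw [hu t ht φ, hu' t ht φ]
  have h1 := intervalIntegral.integral_sub (h.intervalIntegrable he hB hT hlam ht φ)
    (h'.intervalIntegrable he hB hT hlam ht φ)
  have h2 : ∫ s in t..T, (source ρ lam (b s) (g s) (u s) (evol B (s - t) φ) -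
      source ρ lam (b' s) (g' s) (u' s) (evol B (s - t) φ)) =
      ∫ s in t..T, source ρ lam (b s)
        (g s - g' s - ∑ i, bonyProduct ρ (b s i - b' s i) (vDeriv i (u' s))) (u s - u' s)
        (evol B (s - t) φ) := by
    refine intervalIntegral.integral_congr_ae ?_
    rw [uIoc_of_le ht.2]
    refine ae_Ioc_of_ae_Icc ht.1 ?_
    filter_upwards [h.drift_bound, h'.drift_bound, h.sol_bound, h'.sol_bound] with s h1 h2 h3 h4
    rw [← source_sub_source he h1 h2 h3 h4]
    rfl
  rw [← h2, h1]
  ring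

/-- A mild solution with vanishing terminal datum, written with the damped semigroup. -/
theorem MildMap.damped (hB : IsKolmogorovMatrix B) (he : Exponents β σ γ) (hT : 0 ≤ T)
    (hlam : 0 ≤ lam) (h : Controlled ρ T β γ Cb Cg R b g u) (hu : MildMap ρ B T lam b g 0 u u)
    {t : ℝ} (ht : t ∈ Icc 0 T) (φ : 𝓢(Space δ, ℂ)) :
    u t φ = -∫ s in t..T, ((Real.exp (-lam * (s - t)) : ℝ) : ℂ) *
      source ρ 0 (b s) (g s) (u s) (evol B (s - t) φ) := by
  have hsrc : ∀ s, source ρ lam (b s) (g s) (u s) (evol B (s - t) φ) =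
      (lam : ℂ) * u s (evol B (s - t) φ) + source ρ 0 (b s) (g s) (u s) (evol B (s - t) φ) :=
    fun s => by
      rw [source_apply, source_apply]
      push_cast
      ring
  have h1 := h.intervalIntegrable he hB hT hlam ht φ
  simp only [hsrc] at h1
  -- Variation of constants is applied to y(τ) = u_τ(evol (τ-t) φ). By the semigroup law the mild
  -- equation at time τ, tested against evol (τ-t) φ, has an integrand independent of τ.
  have h2 := eq_integral_exp_of_volterra_complex (lam := lam) ht.2 h1
    (h.intervalIntegrable he hB hT le_rfl ht φ) (fun τ hτ => by
      have hτ' : τ ∈ Icc 0 T := ⟨ht.1.trans hτ.1, hτ.2⟩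
      rw [hu τ hτ' (evol B (τ - t) φ)]
      change 0 - _ = _
      rw [zero_sub]
      congr 1
      refine intervalIntegral.integral_congr fun s hs => ?_
      rw [uIcc_of_le hτ.2] at hs
      rw [← hsrc, evol_evol hB (sub_nonneg.2 hs.1) (sub_nonneg.2 hτ.1), sub_add_sub_cancel])
  rw [sub_self, evol_zero hB] at h2
  exact h2

end

section

/-! ### Continuity in time and bounded continuous representatives -/

variable {r : ℕ} {δ : Fin (r + 1) → ℕ} {ρ : Generator δ}
variable {B : Matrix (Coord δ) (Coord δ) ℝ} {β σ γ T lam : ℝ}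

/-- The moving endpoint is put into an indicator, so that dominated convergence applies on a fixed
interval; the jump at s = t₀ is a null set. -/
lemma continuousOn_integral_apply_evol (hB : IsKolmogorovMatrix B) (hT : 0 ≤ T) {θ H : ℝ}
    {k : ℝ → 𝓢'(Space δ, ℂ)} (hk : ∀ φ, AEMeasurable (fun s => k s φ) (volume.restrict (Icc 0 T)))
    (hkB : ∀ᵐ s ∂volume.restrict (Icc 0 T), BesovBound ρ θ (k s) H) (φ : 𝓢(Space δ, ℂ)) :
    ContinuousOn (fun t => ∫ s in t..T, k s (evol B (s - t) φ)) (Icc 0 T) := by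
  obtain ⟨C, hC, h⟩ := exists_norm_apply_evol_le (ρ := ρ) hB T θ
  set F : ℝ → ℝ → ℂ := fun t => (Ioc t T).indicator fun s => k s (evol B (clampTime T (s - t)) φ)
  have hsub : ∀ t ∈ Icc 0 T, Ioc t T ⊆ Icc 0 T := fun t ht s hs => ⟨ht.1.trans hs.1.le, hs.2⟩
  have hcl : ∀ t ∈ Icc 0 T, ∀ s ∈ Ioc t T, clampTime T (s - t) = s - t := fun t ht s hs =>
    clampTime_of_mem ⟨sub_nonneg.2 hs.1.le, by linarith [hs.2, ht.1]⟩
  have hrestr : ∀ t ∈ Icc 0 T, (volume.restrict (Icc 0 T)).restrict (Ioc t T) =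
      volume.restrict (Ioc t T) := fun t ht => by
    rw [Measure.restrict_restrict measurableSet_Ioc, inter_eq_left.2 (hsub t ht)]
  have heq : ∀ t ∈ Icc 0 T, ∫ s in t..T, k s (evol B (s - t) φ) = ∫ s in Icc 0 T, F t s :=
    fun t ht => by
      rw [integral_indicator measurableSet_Ioc, hrestr t ht,
        intervalIntegral.integral_of_le ht.2]
      exact setIntegral_congr_fun measurableSet_Ioc fun s hs => by
        rw [hcl t ht s hs]
  refine ContinuousOn.congr (f := fun t => ∫ s in Icc 0 T, F t s) (fun t₀ ht₀ => ?_) heq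
  refine continuousWithinAt_of_dominated (bound := fun _ => |C * H * dnorm ρ (-θ) φ|) ?_ ?_
    (integrable_const _) ?_
  · filter_upwards [self_mem_nhdsWithin] with t ht
    refine AEMeasurable.aestronglyMeasurable ?_
    rw [aemeasurable_indicator_iff measurableSet_Ioc, hrestr t ht]
    have h1 := (aemeasurable_apply_evol hB hT hk (hkB.mono fun s hs => ⟨_, hs⟩) ht.1 φ).mono_measure
      (Measure.restrict_mono (Ioc_subset_Icc_self (a := t) (b := T)) le_rfl)
    refine h1.congr ?_
    filter_upwards [ae_restrict_mem measurableSet_Ioc] with s hs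
    rw [hcl t ht s hs]
  · filter_upwards [self_mem_nhdsWithin] with t ht
    filter_upwards [hkB] with s hs
    refine (norm_indicator_le_norm_self _ s).trans ?_
    exact (h (k s) H hs _ (clampTime_mem hT _) φ).trans (le_abs_self _)
  · have hne : ∀ᵐ s ∂volume.restrict (Icc 0 T), s ≠ t₀ :=
      ae_restrict_of_ae (Measure.ae_ne volume t₀)
    filter_upwards [hkB, hne, ae_restrict_mem measurableSet_Icc] with s hs hst hsT
    rcases lt_or_gt_of_ne hst with h1 | h1
    · have h2 : (fun t => F t s) =ᶠ[𝓝 t₀] fun _ => 0 := by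
        filter_upwards [lt_mem_nhds h1] with t ht
        exact Set.indicator_of_notMem (fun hs => lt_asymm ht hs.1) _
      exact (continuousAt_const.congr h2.symm).continuousWithinAt
    · have h2 : (fun t => F t s) =ᶠ[𝓝 t₀] fun t => k s (evol B (clampTime T (s - t)) φ) := by
        filter_upwards [gt_mem_nhds h1] with t ht
        exact Set.indicator_of_mem (show s ∈ Ioc t T from ⟨ht, hsT.2⟩) _
      have h3 : Continuous fun t => k s (evol B (clampTime T (s - t)) φ) :=
        (hs.continuousOn_apply_evol hB φ T).comp_continuous
          ((continuous_clampTime T).comp (by fun_prop)) fun t => clampTime_mem hT _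
      exact (h3.continuousAt.congr h2.symm).continuousWithinAt

variable {b : ℝ → Fin (δ 0) → 𝓢'(Space δ, ℂ)} {g u v : ℝ → 𝓢'(Space δ, ℂ)}
  {ℓ : 𝓢'(Space δ, ℂ)} {Cb Cg R Cl : ℝ}

/-- Images of the mild map are weakly continuous in time. -/
lemma MildMap.continuousOn_apply (hB : IsKolmogorovMatrix B) (he : Exponents β σ γ) (hT : 0 ≤ T)
    (hlam : 0 ≤ lam) (h : Controlled ρ T β γ Cb Cg R b g u) (hℓ : BesovBound ρ γ ℓ Cl)
    (hv : MildMap ρ B T lam b g ℓ u v) (φ : 𝓢(Space δ, ℂ)) :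
    ContinuousOn (fun t => v t φ) (Icc 0 T) := by
  have h1 : ContinuousOn (fun t => ℓ (evol B (T - t) φ)) (Icc 0 T) :=
    (hℓ.continuousOn_apply_evol hB φ T).comp (by fun_prop)
      fun t ht => ⟨by linarith [ht.2], by linarith [ht.1]⟩
  exact (h1.sub (continuousOn_integral_apply_evol hB hT (h.source_meas he lam)
    (h.source_bound he hlam) φ)).congr fun t ht => hv t ht φ

/-- The Besov bound uniform in time makes the distributions equicontinuous, which upgrades separate
continuity in t and x to joint continuity. -/
lemma continuousOn_apply_translate {θ : ℝ} (hu : ∀ φ, ContinuousOn (fun t => u t φ) (Icc 0 T))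
    (huB : ∀ t ∈ Icc 0 T, BesovBound ρ θ (u t) R) (K : 𝓢(Space δ, ℂ)) :
    ContinuousOn (fun p : ℝ × Space δ => u p.1 (translate p.2 K)) (Icc 0 T ×ˢ univ) := by
  rintro ⟨t₀, x₀⟩ ⟨ht₀, -⟩
  obtain ⟨q, hq, hqb⟩ := exists_dnorm_le_seminorm ρ (-θ)
  set A : ℝ := 3 * (2 : ℝ) ^ |θ| * R with hA
  have hR := (huB t₀ ht₀).nonneg
  have h1 : Tendsto (fun p : ℝ × Space δ => A * (2 * q (translate p.2 K - translate x₀ K)) +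
      ‖u p.1 (translate x₀ K) - u t₀ (translate x₀ K)‖) (𝓝[Icc 0 T ×ˢ univ] (t₀, x₀)) (𝓝 0) := by
    have h2 : Tendsto (fun p : ℝ × Space δ => A * (2 * q (translate p.2 K - translate x₀ K)))
        (𝓝 (t₀, x₀)) (𝓝 0) := by
      have : Continuous fun p : ℝ × Space δ =>
          A * (2 * q (translate p.2 K - translate x₀ K)) :=
        continuous_const.mul (continuous_const.mul (hq.comp
          (((continuous_translate K).comp continuous_snd).sub continuous_const)))
      have h3 := this.tendsto (t₀, x₀)
      simpa using h3
    have h3 : Tendsto (fun p : ℝ × Space δ => ‖u p.1 (translate x₀ K) - u t₀ (translate x₀ K)‖)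
        (𝓝[Icc 0 T ×ˢ univ] (t₀, x₀)) (𝓝 0) := by
      have h4 := tendsto_iff_norm_sub_tendsto_zero.1 (hu (translate x₀ K) t₀ ht₀)
      refine h4.comp ?_
      rw [nhdsWithin_prod_eq]
      exact tendsto_fst
    simpa using (h2.mono_left nhdsWithin_le_nhds).add h3
  refine tendsto_iff_norm_sub_tendsto_zero.2 ?_
  refine tendsto_of_tendsto_of_tendsto_of_le_of_le' tendsto_const_nhds h1
    (Eventually.of_forall fun p => norm_nonneg _) ?_
  filter_upwards [self_mem_nhdsWithin] with p hp
  have h2 : u p.1 (translate p.2 K) - u t₀ (translate x₀ K) =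
      u p.1 (translate p.2 K - translate x₀ K) +
        (u p.1 (translate x₀ K) - u t₀ (translate x₀ K)) := by
    rw [map_sub]
    ring
  rw [h2]
  refine (norm_add_le _ _).trans (add_le_add_left ?_ _)
  refine (norm_apply_le_dnorm (huB p.1 hp.1) _).trans ?_
  exact mul_le_mul_of_nonneg_left (hqb _) (by positivity)

/-- Bounded families of positive regularity which are weakly continuous in time are given by bounded
continuous functions. -/
theorem isBoundedContinuous_of_besovBound {θ : ℝ} (hθ : 0 < θ) (hT : 0 ≤ T)
    (hu : ∀ φ, ContinuousOn (fun t => u t φ) (Icc 0 T))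
    (huB : ∀ t ∈ Icc 0 T, BesovBound ρ θ (u t) R) : IsBoundedContinuous T u := by
  have hR := (huB 0 ⟨le_rfl, hT⟩).nonneg
  have hs : Summable fun n : ℕ => R * (2 : ℝ) ^ (-(n : ℝ) * θ) := by
    refine Summable.mul_left R ?_
    have h1 : (2 : ℝ) ^ (-θ) < 1 := Real.rpow_lt_one_of_one_lt_of_neg one_lt_two (by linarith)
    refine (summable_geometric_of_lt_one (by positivity) h1).congr fun n => ?_
    rw [← Real.rpow_natCast, ← Real.rpow_mul (by norm_num)]
    congr 1
    ring
  have hbd : ∀ t ∈ Icc 0 T, ∀ n x, ‖block ρ n (u t) x‖ ≤ R * (2 : ℝ) ^ (-(n : ℝ) * θ) :=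
    fun t ht n x => huB t ht n x
  refine ⟨fun p => ∑' n, block ρ n (u p.1) p.2, ?_, ⟨∑' n : ℕ, R * (2 : ℝ) ^ (-(n : ℝ) * θ),
    fun t ht x => ?_⟩, fun t ht φ => ?_⟩
  · exact continuousOn_tsum (fun n => continuousOn_apply_translate hu huB (𝓕 (symbol ρ n))) hs
      fun n p hp => hbd p.1 hp.1 n p.2
  · exact tsum_of_norm_bounded hs.hasSum fun n => hbd t ht n x
  · have hint : ∀ n, Integrable fun x => block ρ n (u t) x * φ x := fun n =>
      integrable_bdd_mul (continuous_block ρ n (u t)) (hbd t ht n) φ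
    have hle : ∀ n : ℕ, ∫ x, ‖block ρ n (u t) x * φ x‖ ≤ R * (2 : ℝ) ^ (-(n : ℝ) * θ) * l1 φ :=
      fun n => by
        rw [l1_eq, ← integral_const_mul]
        refine integral_mono (hint n).norm (φ.integrable.norm.const_mul _) fun x => ?_
        simp only [norm_mul]
        exact mul_le_mul_of_nonneg_right (hbd t ht n x) (norm_nonneg _)
    have h1 := hasSum_integral_of_summable_integral_norm hint
      (Summable.of_nonneg_of_le (fun n => integral_nonneg fun x => norm_nonneg _) hle
        (hs.mul_right _))
    simp only [← apply_dblock] at h1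
    rw [← hasSum_dblock (ρ := ρ) (u t) φ h1.summable, h1.tsum_eq]
    simp only [tsum_mul_right]

end

section

/-! ### Existence of mild solutions -/

variable {r : ℕ} {δ : Fin (r + 1) → ℕ} {ρ : Generator δ}
variable {B : Matrix (Coord δ) (Coord δ) ℝ} {β σ γ T lam : ℝ}
variable {b : ℝ → Fin (δ 0) → 𝓢'(Space δ, ℂ)} {g u v : ℝ → 𝓢'(Space δ, ℂ)}
  {ℓ : 𝓢'(Space δ, ℂ)} {Cb Cg R Cl : ℝ}

/-- A crude bound with dual exponent β+σ is enough to define a tempered distribution at each time;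
its true regularity γ comes afterwards from the weighted step. -/
lemma exists_mildMap (hB : IsKolmogorovMatrix B) (he : Exponents β σ γ) (hT : 0 ≤ T)
    (hlam : 0 ≤ lam) (h : Controlled ρ T β γ Cb Cg R b g u) (hℓ : BesovBound ρ γ ℓ Cl) :
    ∃ v, MildMap ρ B T lam b g ℓ u v := by
  obtain ⟨C₁, hC₁, h₁⟩ := exists_norm_apply_evol_le (ρ := ρ) hB T γ
  obtain ⟨C₂, hC₂, h₂⟩ := exists_norm_apply_evol_le (ρ := ρ) hB T (-(β + σ))
  have hCl := hℓ.nonneg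
  set H := lam * R + Cg + driftConst ρ β σ γ * (Cb * R)
  have key : ∀ t, t ∈ Icc 0 T → ∃ f : 𝓢'(Space δ, ℂ), ∀ φ, f φ = ℓ (evol B (T - t) φ) -
      ∫ s in t..T, source ρ lam (b s) (g s) (u s) (evol B (s - t) φ) := by
    intro t ht
    have hint := fun φ => h.intervalIntegrable he hB hT hlam ht φ
    let L : 𝓢(Space δ, ℂ) →ₗ[ℂ] ℂ :=
      { toFun := fun φ => ℓ (evol B (T - t) φ) -
          ∫ s in t..T, source ρ lam (b s) (g s) (u s) (evol B (s - t) φ)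
        map_add' := fun φ ψ => by
          simp only [map_add]
          rw [intervalIntegral.integral_add (hint φ) (hint ψ)]
          ring
        map_smul' := fun c φ => by
          simp only [map_smul, smul_eq_mul, RingHom.id_apply]
          rw [intervalIntegral.integral_const_mul]
          ring }
    have hL : ∀ φ, ‖L φ‖ ≤ (C₁ * Cl + C₂ * |H| * T) * dnorm ρ (β + σ) φ := fun φ => by
      have hφ := dnorm_nonneg ρ (β + σ) φ
      have h3 : ‖ℓ (evol B (T - t) φ)‖ ≤ C₁ * Cl * dnorm ρ (β + σ) φ :=
        (h₁ ℓ Cl hℓ _ ⟨by linarith [ht.2], by linarith [ht.1]⟩ φ).trans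
          (mul_le_mul_of_nonneg_left
            (dnorm_mono ρ (by linarith [he.pos, he.loss_pos, he.le]) φ) (by positivity))
      have h4 : ‖∫ s in t..T, source ρ lam (b s) (g s) (u s) (evol B (s - t) φ)‖ ≤
          C₂ * |H| * dnorm ρ (β + σ) φ * |T - t| := by
        refine intervalIntegral.norm_integral_le_of_norm_le_const_ae ?_
        rw [uIoc_of_le ht.2]
        filter_upwards [ae_Ioc_of_ae_Icc ht.1 (h.source_bound he hlam)] with s hs hst
        have h5 := h₂ _ _ ((hs hst).mono (le_abs_self H)) (s - t)
          ⟨sub_nonneg.2 hst.1.le, by linarith [hst.2, ht.1]⟩ φ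
        rwa [neg_neg] at h5
      have h5 : |T - t| ≤ T := by
        rw [abs_of_nonneg (sub_nonneg.2 ht.2)]
        linarith [ht.1]
      refine (norm_sub_le _ _).trans ((add_le_add h3 h4).trans ?_)
      have h6 : C₂ * |H| * dnorm ρ (β + σ) φ * |T - t| ≤ C₂ * |H| * dnorm ρ (β + σ) φ * T :=
        mul_le_mul_of_nonneg_left h5 (by positivity)
      linarith
    exact ⟨ofDual L (by positivity) hL, fun φ => rfl⟩
  choose! v hv using key
  exact ⟨v, hv⟩

lemma MildMap.undamped (h : MildMap ρ B T lam b g ℓ u v) {t : ℝ} (ht : t ∈ Icc 0 T)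
    (φ : 𝓢(Space δ, ℂ)) :
    v t φ = ((Real.exp (-(0 : ℝ) * (T - t)) : ℝ) : ℂ) * ℓ (evol B (T - t) φ) -
      ∫ s in t..T, ((Real.exp (-(0 : ℝ) * (s - t)) : ℝ) : ℂ) *
        source ρ lam (b s) (g s) (u s) (evol B (s - t) φ) := by
  simp only [neg_zero, zero_mul, Real.exp_zero, Complex.ofReal_one, one_mul]
  exact h t ht φ

lemma exists_mul_le_half {K : ℝ → ℝ} (hK : Tendsto K atTop (𝓝 0)) (c : ℝ) :
    ∃ ν₀ > 0, ∀ ν ≥ ν₀, K ν * c ≤ 1 / 2 := by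
  have h1 := hK.mul_const c
  rw [zero_mul] at h1
  obtain ⟨a, ha⟩ := eventually_atTop.1 (h1.eventually_le_const (show (0 : ℝ) < 1 / 2 by norm_num))
  exact ⟨max a 1, lt_of_lt_of_le one_pos (le_max_right _ _),
    fun ν hν => ha ν ((le_max_left _ _).trans hν)⟩

lemma Controlled.mono_sol {R' : ℝ} (h : Controlled ρ T β γ Cb Cg R b g u)
    (hv : ∀ φ, AEMeasurable (fun s => v s φ) (volume.restrict (Icc 0 T)))
    (hvB : ∀ t ∈ Icc 0 T, BesovBound ρ γ (v t) R') : Controlled ρ T β γ Cb Cg R' b g v :=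
  { h with
    sol_meas := hv
    sol_bound := by
      filter_upwards [ae_restrict_mem measurableSet_Icc] with s hs using hvB s hs }

/-- Existence of fixed points of the mild map. -/
theorem exists_mildMap_fixed (hB : IsKolmogorovMatrix B) (he : Exponents β σ γ) (hT : 0 ≤ T)
    (hlam : 0 ≤ lam) (hCb : 0 ≤ Cb) (hℓ : BesovBound ρ γ ℓ Cl)
    (hctrl : ∃ R, Controlled ρ T β γ Cb Cg R b g fun _ => 0) :
    ∃ u, MildMap ρ B T lam b g ℓ u u ∧
      (∀ φ, AEMeasurable (fun s => u s φ) (volume.restrict (Icc 0 T))) ∧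
      ∃ R, ∀ t ∈ Icc 0 T, BesovBound ρ γ (u t) R := by
  classical
  obtain ⟨Rz, hz⟩ := hctrl
  obtain ⟨C, hC, K, hK0, hK, hstep⟩ := exists_besovBound_step ρ hB T he
  -- A large weight replaces a short time interval: the map contracts on all of [0, T] at once.
  obtain ⟨κ, hκ, hκK⟩ := exists_mul_le_half hK (lam + Cb)
  have hκK' : K (κ + 0) * (lam + Cb) ≤ 1 / 2 := by
    rw [add_zero]
    exact hκK κ le_rfl
  let S := {w : ℝ → 𝓢'(Space δ, ℂ) //
    (∀ φ, AEMeasurable (fun s => w s φ) (volume.restrict (Icc 0 T))) ∧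
      ∃ R, ∀ t ∈ Icc 0 T, BesovBound ρ γ (w t) R}
  have hexp : ∀ t ∈ Icc 0 T, 1 ≤ Real.exp (κ * (T - t)) := fun t ht =>
    Real.one_le_exp (mul_nonneg hκ.le (by linarith [ht.2]))
  have hexpT : ∀ t ∈ Icc 0 T, Real.exp (κ * (T - t)) ≤ Real.exp (κ * T) := fun t ht =>
    Real.exp_le_exp.2 (mul_le_mul_of_nonneg_left (by linarith [ht.1]) hκ.le)
  have hctr : ∀ w : S, ∃ R, 0 ≤ R ∧ (∀ t ∈ Icc 0 T, BesovBound ρ γ (w.1 t) R) ∧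
      Controlled ρ T β γ Cb Cg R b g w.1 := fun w => by
    obtain ⟨R, hR⟩ := w.2.2
    have hR' : ∀ t ∈ Icc 0 T, BesovBound ρ γ (w.1 t) (max R 0) := fun t ht =>
      (hR t ht).mono (le_max_left _ _)
    exact ⟨max R 0, le_max_right _ _, hR', hz.mono_sol w.2.1 hR'⟩
  have hnext : ∀ w : S, ∃ w' : S, MildMap ρ B T lam b g ℓ w.1 w'.1 := fun w => by
    obtain ⟨R, hR0, hR, hwc⟩ := hctr w
    obtain ⟨v, hv⟩ := exists_mildMap hB he hT hlam hwc hℓ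
    refine ⟨⟨v, fun φ => (hv.continuousOn_apply hB he hT hlam hwc hℓ φ).aemeasurable
      measurableSet_Icc, _, fun t ht => hstep lam 0 κ Cb Cl (max Cg 0) R hlam le_rfl hκ.le
        (by linarith) hCb (le_max_right _ _) hR0 hκK' b g w.1 ℓ hℓ hwc.drift_bound ?_ ?_ t ht _
        (fun φ => hv.undamped ht φ) |>.mono (mul_le_mul_of_nonneg_left (hexpT t ht) ?_)⟩, hv⟩
    · filter_upwards [hwc.forcing_bound] with s hs
      exact (hs.mono_exponent (by linarith [he.loss_pos])).mono (le_max_left _ _)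
    · filter_upwards [ae_restrict_mem measurableSet_Icc] with s hs
      exact (hR s hs).mono (le_mul_of_one_le_right hR0 (hexp s hs))
    · have := hK0 (κ + 0) (by linarith)
      have := hℓ.nonneg
      positivity
  choose N hN using hnext
  have hcontr : ∀ w w' : S, ∀ R, 0 ≤ R →
      (∀ t ∈ Icc 0 T, BesovBound ρ γ (w.1 t - w'.1 t) (R * Real.exp (κ * (T - t)))) →
      ∀ t ∈ Icc 0 T, BesovBound ρ γ ((N w).1 t - (N w').1 t)
        (R / 2 * Real.exp (κ * (T - t))) := fun w w' R hR hww t ht => by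
    obtain ⟨R₁, -, -, hwc⟩ := hctr w
    obtain ⟨R₂, -, -, hwc'⟩ := hctr w'
    have hsub := MildMap.sub hB he hT hlam hwc hwc' (hN w) (hN w')
    refine (hstep lam 0 κ Cb 0 0 R hlam le_rfl hκ.le (by linarith) hCb le_rfl hR hκK' b _ _ (ℓ - ℓ)
      (by rw [sub_self]; exact besovBound_zero γ) hwc.drift_bound ?_ ?_ t ht _
      (fun φ => hsub.undamped ht φ)).mono (le_of_eq (by ring))
    -- The forcing of the difference contains the product with the drift b - b; applying the drift
    -- bound with constant 0 shows that it contributes nothing.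
    · filter_upwards [hwc'.sol_bound] with s hs
      have h1 := besovBound_drift (b := fun i => b s i - b s i) (Cb := 0) he
        (fun i => by rw [sub_self]; exact besovBound_zero _) hs
      rw [zero_mul, mul_zero] at h1
      have h2 := (besovBound_zero (ρ := ρ) (-(β + σ))).sub h1
      rw [add_zero] at h2
      rw [sub_self]
      exact h2
    · filter_upwards [ae_restrict_mem measurableSet_Icc] with s hs using hww s hs
  let w₀ : S := ⟨fun _ => 0, hz.sol_meas, 0, fun t _ => besovBound_zero γ⟩
  let seq : ℕ → S := fun n => N^[n] w₀
  have hseq : ∀ n, seq (n + 1) = N (seq n) := fun n => Function.iterate_succ_apply' N n w₀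
  obtain ⟨R₀, hR₀, hR₀', -⟩ := hctr (seq 1)
  have hdiff : ∀ n, ∀ t ∈ Icc 0 T, BesovBound ρ γ ((seq (n + 1)).1 t - (seq n).1 t)
      (R₀ / 2 ^ n * Real.exp (κ * (T - t))) := by
    intro n
    induction n with
    | zero =>
      intro t ht
      have h1 : (seq (0 + 1)).1 t - (seq 0).1 t = (seq 1).1 t := sub_zero _
      rw [h1, pow_zero, div_one]
      exact (hR₀' t ht).mono (le_mul_of_one_le_right hR₀ (hexp t ht))
    | succ n ih =>
      intro t ht
      have h1 := hcontr (seq (n + 1)) (seq n) _ (by positivity) ih t ht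
      rw [← hseq, ← hseq] at h1
      refine h1.mono (le_of_eq ?_)
      rw [pow_succ]
      field_simp
  set A : ℝ := 3 * (2 : ℝ) ^ |γ| * (R₀ * Real.exp (κ * T)) with hA
  have hA0 : 0 ≤ A := by positivity
  have hdist : ∀ t ∈ Icc 0 T, ∀ φ n, dist ((seq n).1 t φ) ((seq (n + 1)).1 t φ) ≤
      A * dnorm ρ (-γ) φ * (1 / 2) ^ n := fun t ht φ n => by
    have hφ := dnorm_nonneg ρ (-γ) φ
    have h1 := norm_apply_le_dnorm (hdiff n t ht) φ
    rw [dist_comm, dist_eq_norm]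
    refine h1.trans ?_
    calc _ ≤ 3 * (2 : ℝ) ^ |γ| * (R₀ / 2 ^ n * Real.exp (κ * T)) * dnorm ρ (-γ) φ := by
          have := hexpT t ht
          gcongr
      _ = _ := by
          rw [hA, one_div, inv_pow]
          ring
  have hlim : ∀ t, t ∈ Icc 0 T → ∃ f : 𝓢'(Space δ, ℂ), ∀ φ,
      Tendsto (fun n => (seq n).1 t φ) atTop (𝓝 (f φ)) := by
    intro t ht
    have h1 : ∀ φ, ∃ z, Tendsto (fun n => (seq n).1 t φ) atTop (𝓝 z) := fun φ =>
      cauchySeq_tendsto_of_complete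
        (cauchySeq_of_le_geometric (1 / 2) _ (by norm_num) (hdist t ht φ))
    choose z hz using h1
    let L : 𝓢(Space δ, ℂ) →ₗ[ℂ] ℂ :=
      { toFun := z
        map_add' := fun φ ψ => tendsto_nhds_unique (hz (φ + ψ))
          (by simpa only [map_add] using (hz φ).add (hz ψ))
        map_smul' := fun c φ => tendsto_nhds_unique (hz (c • φ))
          (by simpa only [map_smul, RingHom.id_apply] using (hz φ).const_smul c) }
    have hL : ∀ φ, ‖L φ‖ ≤ 2 * A * dnorm ρ (-γ) φ := fun φ => by
      have h2 := dist_le_of_le_geometric_of_tendsto₀ (1 / 2) _ (by norm_num) (hdist t ht φ) (hz φ)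
      have h3 : (seq 0).1 t φ = 0 := rfl
      rw [h3, dist_zero_left] at h2
      refine h2.trans (le_of_eq ?_)
      ring
    exact ⟨ofDual L (by positivity) hL, hz⟩
  choose! u hu using hlim
  have hclose : ∀ n, ∀ t ∈ Icc 0 T, BesovBound ρ γ ((seq n).1 t - u t)
      (dualConst ρ γ * (2 * A * (1 / 2) ^ n)) := fun n t ht => by
    refine besovBound_of_dnorm (by positivity) fun φ => ?_
    have h2 := dist_le_of_le_geometric_of_tendsto (1 / 2) _ (by norm_num) (hdist t ht φ) (hu t ht φ) n
    rw [dist_eq_norm] at h2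
    exact h2.trans (le_of_eq (by ring))
  have huS : (∀ φ, AEMeasurable (fun s => u s φ) (volume.restrict (Icc 0 T))) ∧
      ∃ R, ∀ t ∈ Icc 0 T, BesovBound ρ γ (u t) R := by
    refine ⟨fun φ => aemeasurable_of_tendsto_metrizable_ae atTop
      (f := fun n s => (seq n).1 s φ) (fun n => (seq n).2.1 φ) ?_,
      0 + dualConst ρ γ * (2 * A * (1 / 2) ^ 0), fun t ht => ?_⟩
    · filter_upwards [ae_restrict_mem measurableSet_Icc] with s hs using hu s hs φ
    · have h1 := (besovBound_zero (ρ := ρ) γ).sub (hclose 0 t ht)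
      have h2 : (0 : 𝓢'(Space δ, ℂ)) - ((seq 0).1 t - u t) = u t := by
        have : (seq 0).1 t = 0 := rfl
        rw [this, zero_sub, zero_sub, neg_neg]
      rwa [h2] at h1
  let U : S := ⟨u, huS⟩
  have hd := dualConst_nonneg (ρ := ρ) γ
  -- The iterates tend to `u`, and by the contraction property also to the image of `u`. Times
  -- outside [0, T] play no role.
  have hfix : ∀ t ∈ Icc 0 T, ∀ φ, (N U).1 t φ = u t φ := fun t ht φ => by
    have h1 : ∀ n, ‖(seq (n + 1)).1 t φ - (N U).1 t φ‖ ≤ 3 * (2 : ℝ) ^ |γ| *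
        (dualConst ρ γ * (2 * A * (1 / 2) ^ n) / 2 * Real.exp (κ * (T - t))) *
          dnorm ρ (-γ) φ := fun n => by
      have h2 := hcontr (seq n) U (dualConst ρ γ * (2 * A * (1 / 2) ^ n)) (by positivity)
        (fun s hs => (hclose n s hs).mono (le_mul_of_one_le_right (by positivity) (hexp s hs))) t ht
      rw [← hseq] at h2
      exact norm_apply_le_dnorm h2 φ
    have h2 : Tendsto (fun n : ℕ => 3 * (2 : ℝ) ^ |γ| *
        (dualConst ρ γ * (2 * A * (1 / 2) ^ n) / 2 * Real.exp (κ * (T - t))) *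
          dnorm ρ (-γ) φ) atTop (𝓝 0) := by
      have h3 := tendsto_pow_atTop_nhds_zero_of_lt_one (r := (1 : ℝ) / 2) (by norm_num) (by norm_num)
      have h4 := h3.const_mul (3 * (2 : ℝ) ^ |γ| * dualConst ρ γ * A * Real.exp (κ * (T - t)) *
        dnorm ρ (-γ) φ)
      rw [mul_zero] at h4
      exact h4.congr fun n => by ring
    have h3 : Tendsto (fun n => (seq (n + 1)).1 t φ) atTop (𝓝 ((N U).1 t φ)) :=
      tendsto_iff_norm_sub_tendsto_zero.2 (squeeze_zero (fun n => norm_nonneg _) h1 h2)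
    exact tendsto_nhds_unique h3 ((hu t ht φ).comp (tendsto_add_atTop_nat 1))
  refine ⟨u, fun t ht φ => ?_, huS⟩
  rw [← hfix t ht φ]
  exact hN U t ht φ

end

section

/-! ### Well-posedness, stability and smallness of mild solutions -/

variable {r : ℕ} {δ : Fin (r + 1) → ℕ} {ρ : Generator δ}
variable {B : Matrix (Coord δ) (Coord δ) ℝ} {β σ γ T lam : ℝ}
variable {b : ℝ → Fin (δ 0) → 𝓢'(Space δ, ℂ)} {g u v : ℝ → 𝓢'(Space δ, ℂ)}
  {ℓ : 𝓢'(Space δ, ℂ)} {Cb Cg R Cl : ℝ}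

lemma BesovBound.sub_rev {θ C : ℝ} {f g : 𝓢'(Space δ, ℂ)} (h : BesovBound ρ θ (f - g) C) :
    BesovBound ρ θ (g - f) C := fun n x => by
  have h1 := h n x
  change ‖f (blockKernel ρ n x) - g (blockKernel ρ n x)‖ ≤ _ at h1
  change ‖g (blockKernel ρ n x) - f (blockKernel ρ n x)‖ ≤ _
  rwa [norm_sub_rev]

lemma exists_controlled (hb : VecMemLinf ρ T (-β) b) (hg : MemLinf ρ T (-β) g)
    (hu : MemLinf ρ T γ u) :
    ∃ Cb Cg R, 0 ≤ Cb ∧ 0 ≤ R ∧ Controlled ρ T β γ Cb Cg R b g u := by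
  obtain ⟨Cb, hCb, hbB⟩ := hb.exists_ae_besovBound
  obtain ⟨Cg, -, hgB⟩ := hg.exists_ae_besovBound
  obtain ⟨R, hR, huB⟩ := hu.exists_ae_besovBound
  exact ⟨Cb, Cg, R, hCb, hR, fun i => (hb i).meas, hg.meas, hu.meas, hbB, hgB, huB⟩

lemma Controlled.mono_exponent {β' γ' : ℝ} (h : Controlled ρ T β γ Cb Cg R b g u) (hβ : β ≤ β')
    (hγ : γ' ≤ γ) : Controlled ρ T β' γ' Cb Cg R b g u where
  drift_meas := h.drift_meas
  forcing_meas := h.forcing_meas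
  sol_meas := h.sol_meas
  drift_bound := h.drift_bound.mono fun _ hs i => (hs i).mono_exponent (by linarith)
  forcing_bound := h.forcing_bound.mono fun _ hs => hs.mono_exponent (by linarith)
  sol_bound := h.sol_bound.mono fun _ hs => hs.mono_exponent hγ

lemma memLinf_zero : MemLinf ρ T γ fun _ => 0 where
  mem := fun _ _ => (besovBound_zero γ).besovNorm_lt_top
  meas := fun _ => aemeasurable_const
  bdd := (timeNorm_le_of_besovBound fun _ _ => besovBound_zero γ).trans_lt ENNReal.ofReal_lt_top

theorem exists_isMildSolution (hB : IsKolmogorovMatrix B) (he : Exponents β σ γ) (hT : 0 ≤ T)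
    (hlam : 0 ≤ lam) (hb : VecMemLinf ρ T (-β) b) (hg : MemLinf ρ T (-β) g)
    (hℓ : besovNorm ρ γ ℓ < ⊤) : ∃ u, IsMildSolution ρ B T γ lam b g ℓ u := by
  obtain ⟨Cb, Cg, R₀, hCb, -, h₀⟩ := exists_controlled hb hg (memLinf_zero (γ := γ))
  have hℓB := besovBound_toReal hℓ
  obtain ⟨u, hu, hum, R, huB⟩ := exists_mildMap_fixed hB he hT hlam hCb hℓB ⟨R₀, h₀⟩
  have h := h₀.mono_sol hum huB
  have hγ : 0 < γ := by linarith [he.pos, he.loss_pos, he.le]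
  refine ⟨u, ?_, ?_, fun t ht φ => ?_, fun t ht φ => ?_⟩
  · exact isBoundedContinuous_of_besovBound hγ hT
      (hu.continuousOn_apply hB he hT hlam h hℓB) huB
  · exact ⟨fun t ht => (huB t ht).besovNorm_lt_top, hum,
      (timeNorm_le_of_besovBound huB).trans_lt ENNReal.ofReal_lt_top⟩
  · refine (h.intervalIntegrable he hB hT hlam ht φ).congr fun s hs => ?_
    rw [uIoc_of_le ht.2] at hs
    change _ = source ρ lam (b s) (g s) (u s) (adjointSemigroup B (s - t) φ)
    rw [adjointSemigroup_eq hB (sub_nonneg.2 hs.1.le)]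
  · rw [hu t ht φ, integral_semigroupPairing hB ht.2, semigroupPairing,
      adjointSemigroup_eq hB (sub_nonneg.2 ht.2)]

/-- The difference of two solutions is controlled by the differences of the data. -/
theorem exists_besovBound_sub (ρ : Generator δ) (hB : IsKolmogorovMatrix B) (he : Exponents β σ γ)
    (hT : 0 ≤ T) (hlam : 0 ≤ lam) (hCb : 0 ≤ Cb) : ∃ D, 0 ≤ D ∧
      ∀ {b b' : ℝ → Fin (δ 0) → 𝓢'(Space δ, ℂ)} {g g' u u' : ℝ → 𝓢'(Space δ, ℂ)}
      {ℓ ℓ' : 𝓢'(Space δ, ℂ)} {Cg R Cb' Cg' R' Db Dg Dl : ℝ},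
      Controlled ρ T β γ Cb Cg R b g u → Controlled ρ T β γ Cb' Cg' R' b' g' u' →
      MildMap ρ B T lam b g ℓ u u → MildMap ρ B T lam b' g' ℓ' u' u' → 0 ≤ Db → 0 ≤ R' →
      (∀ᵐ s ∂volume.restrict (Icc 0 T), ∀ i, BesovBound ρ (-β) (b s i - b' s i) Db) →
      (∀ᵐ s ∂volume.restrict (Icc 0 T), BesovBound ρ (-β) (g s - g' s) Dg) → 0 ≤ Dg →
      BesovBound ρ γ (ℓ - ℓ') Dl →
      ∀ t ∈ Icc 0 T, BesovBound ρ γ (u t - u' t) (D * (Dl + Dg + Db * R')) := by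
  obtain ⟨C, hC, K, hK0, hK, hmild⟩ := exists_besovBound_of_mild ρ hB T he
  obtain ⟨κ, hκ, hκK⟩ := exists_mul_le_half hK (lam + Cb)
  have hdc := driftConst_nonneg (ρ := ρ) he
  have hKκ := hK0 κ hκ
  refine ⟨2 * (C + K κ * (1 + driftConst ρ β σ γ)) * Real.exp (κ * T), by positivity, ?_⟩
  intro b b' g g' u u' ℓ ℓ' Cg R Cb' Cg' R' Db Dg Dl h h' hu hu' hDb hR' hbb hgg hDg hll t ht
  have hDl := hll.nonneg
  -- The constant sees only the bound `Cb` of the first drift, and the estimate only the size `R'`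
  -- of the second solution. The size of the first solution merely has to be finite.
  have hsub := MildMap.sub hB he hT hlam h h' hu hu'
  have h1 := hmild lam 0 κ Cb Dl (Dg + driftConst ρ β σ γ * (Db * R')) hlam le_rfl hκ.le
    (by linarith) hCb (by positivity) (by rw [add_zero]; exact hκK κ le_rfl) b _ _ (ℓ - ℓ') hll
    h.drift_bound ?_ ?_ (fun t ht φ => hsub.undamped ht φ) t ht
  · refine h1.mono ?_
    rw [add_zero]
    have h2 : Real.exp (κ * (T - t)) ≤ Real.exp (κ * T) :=
      Real.exp_le_exp.2 (mul_le_mul_of_nonneg_left (by linarith [ht.1]) hκ.le)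
    have h3 : C * Dl + K κ * (Dg + driftConst ρ β σ γ * (Db * R')) ≤
        (C + K κ * (1 + driftConst ρ β σ γ)) * (Dl + Dg + Db * R') := by
      have e : (C + K κ * (1 + driftConst ρ β σ γ)) * (Dl + Dg + Db * R') -
          (C * Dl + K κ * (Dg + driftConst ρ β σ γ * (Db * R'))) =
          C * (Dg + Db * R') + K κ * (Dl + Db * R' + driftConst ρ β σ γ * (Dl + Dg)) := by ring
      have : 0 ≤ C * (Dg + Db * R') + K κ * (Dl + Db * R' + driftConst ρ β σ γ * (Dl + Dg)) := by
        positivity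
      linarith
    calc _ ≤ 2 * ((C + K κ * (1 + driftConst ρ β σ γ)) * (Dl + Dg + Db * R')) *
          Real.exp (κ * T) := by gcongr
      _ = _ := by ring
  · filter_upwards [hbb, hgg, h'.sol_bound] with s hs1 hs2 hs3
    exact (hs2.mono_exponent (by linarith [he.loss_pos])).sub (besovBound_drift he hs1 hs3)
  · refine ⟨R + R', ?_⟩
    filter_upwards [h.sol_bound, h'.sol_bound] with s hs1 hs2 using hs1.sub hs2

theorem IsMildSolution.eqOn (hB : IsKolmogorovMatrix B) (he : Exponents β σ γ) (hT : 0 ≤ T)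
    (hlam : 0 ≤ lam) (hb : VecMemLinf ρ T (-β) b) (hg : MemLinf ρ T (-β) g)
    (hu : IsMildSolution ρ B T γ lam b g ℓ u)
    (hv : IsMildSolution ρ B T γ lam b g ℓ v) : EqOn v u (Icc 0 T) := by
  obtain ⟨Cb, Cg, R, hCb, hR, h⟩ := exists_controlled hb hg hu.mem
  obtain ⟨Cb', Cg', R', hCb', hR', h'⟩ := exists_controlled hb hg hv.mem
  obtain ⟨D, hD, hsub⟩ := exists_besovBound_sub ρ hB he hT hlam hCb'
  intro t ht
  have h1 := hsub h' h (hv.mildMap hB) (hu.mildMap hB) le_rfl hR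
    (ae_of_all _ fun s i => by rw [sub_self]; exact besovBound_zero _)
    (ae_of_all _ fun s => by rw [sub_self]; exact besovBound_zero _) le_rfl
    (by rw [sub_self]; exact besovBound_zero γ) t ht
  rw [zero_mul, add_zero, add_zero, mul_zero] at h1
  ext φ
  have h2 := norm_apply_le_dnorm h1 φ
  rw [mul_zero, zero_mul] at h2
  exact sub_eq_zero.1 (norm_le_zero_iff.1 h2)

/-- The individual bounds of the approximations at exponent -β need not be uniform in n. Convergence
gives uniform bounds only at -β-η, and only eventually; hence the estimates are run with β enlarged.
-/
lemma Approximates.exists_eventually_besovBound {bₙ : ℕ → ℝ → Fin (δ 0) → 𝓢'(Space δ, ℂ)}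
    {gₙ : ℕ → ℝ → 𝓢'(Space δ, ℂ)} (h : Approximates ρ T β b g bₙ gₙ) (hβ : 0 < β) {η : ℝ}
    (hη : 0 < η) {M : ℝ}
    (hb : ∀ᵐ s ∂volume.restrict (Icc 0 T), ∀ i, BesovBound ρ (-β) (b s i) M)
    (hg : ∀ᵐ s ∂volume.restrict (Icc 0 T), BesovBound ρ (-β) (g s) M) :
    ∃ n₀ : ℕ, ∀ n ≥ n₀,
      (∀ᵐ s ∂volume.restrict (Icc 0 T), ∀ i, BesovBound ρ (-(β + η)) (bₙ n s i) (M + 1)) ∧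
      ∀ᵐ s ∂volume.restrict (Icc 0 T), BesovBound ρ (-(β + η)) (gₙ n s) (M + 1) := by
  have h2 : (2 : ℝ) ^ (-(β + η)) * 1 ≤ 1 := by
    rw [mul_one]
    exact Real.rpow_le_one_of_one_le_of_nonpos one_le_two (by linarith)
  have e : -β - η = -(β + η) := by ring
  have h3 := (h.drift_tendsto η hη).eventually_le_const (u := ENNReal.ofReal 1) (by simp)
  have h4 := (h.forcing_tendsto η hη).eventually_le_const (u := ENNReal.ofReal 1) (by simp)
  rw [e] at h3 h4
  refine eventually_atTop.1 ((h3.and h4).mono fun n hn => ⟨?_, ?_⟩)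
  · filter_upwards [hb, ae_besovBound_of_vecTimeNorm_le zero_le_one hn.1] with s hs1 hs2 i
    have h5 := ((hs1 i).mono_exponent (show -(β + η) ≤ -β by linarith)).sub ((hs2 i).mono h2)
    have h6 : b s i - (b - bₙ n) s i = bₙ n s i := sub_sub_cancel _ _
    rwa [h6] at h5
  · filter_upwards [hg, ae_besovBound_of_timeNorm_le zero_le_one hn.2] with s hs1 hs2
    have h5 := (hs1.mono_exponent (show -(β + η) ≤ -β by linarith)).sub (hs2.mono h2)
    have h6 : g s - (g - gₙ n) s = gₙ n s := sub_sub_cancel _ _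
    rwa [h6] at h5

/-- Stability of mild solutions with respect to the data. -/
theorem tendsto_timeNorm_sub (hB : IsKolmogorovMatrix B) (hβ : 0 < β) (hT : 0 ≤ T)
    (hlam : 0 ≤ lam) {η η' : ℝ} (hη : 0 < η) (hη' : η ≤ η')
    (he : Exponents (β + η) σ (γ - η)) {bₙ : ℕ → ℝ → Fin (δ 0) → 𝓢'(Space δ, ℂ)}
    {gₙ uₙ : ℕ → ℝ → 𝓢'(Space δ, ℂ)} {ℓₙ : ℕ → 𝓢'(Space δ, ℂ)}
    (h : Approximates ρ T β b g bₙ gₙ)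
    (hℓ : Tendsto (fun n => besovNorm ρ (γ - η) (ℓ - ℓₙ n)) atTop (𝓝 0))
    (hu : IsMildSolution ρ B T γ lam b g ℓ u)
    (huₙ : ∀ n, IsMildSolution ρ B T γ lam (bₙ n) (gₙ n) (ℓₙ n) (uₙ n)) :
    Tendsto (fun n => timeNorm ρ T (γ - η') (uₙ n - u)) atTop (𝓝 0) := by
  obtain ⟨Cb, Cg, R, hCb, hR, hc⟩ := exists_controlled h.drift_mem h.forcing_mem hu.mem
  set M := max Cb Cg with hM
  have hM0 : 0 ≤ M := hCb.trans (le_max_left _ _)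
  obtain ⟨n₀, hn₀⟩ := h.exists_eventually_besovBound hβ hη
    (hc.drift_bound.mono fun s hs i => (hs i).mono (le_max_left Cb Cg))
    (hc.forcing_bound.mono fun s hs => hs.mono (le_max_right Cb Cg))
  obtain ⟨D, hD, hsub⟩ := exists_besovBound_sub (T := T) (lam := lam) (Cb := M + 1) ρ hB he hT hlam
    (by linarith)
  have e : -β - η = -(β + η) := by ring
  have hbt := h.drift_tendsto η hη
  have hgt := h.forcing_tendsto η hη
  rw [e] at hbt hgt
  have hlim : Tendsto (fun n => ENNReal.ofReal (2 ^ (-(γ - η')) *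
      (D * (2 ^ (γ - η) * (besovNorm ρ (γ - η) (ℓ - ℓₙ n)).toReal +
        2 ^ (-(β + η)) * (timeNorm ρ T (-(β + η)) (g - gₙ n)).toReal +
        2 ^ (-(β + η)) * (vecTimeNorm ρ T (-(β + η)) (b - bₙ n)).toReal * R)))) atTop (𝓝 0) := by
    have hz := fun {f : ℕ → ℝ≥0∞} (hf : Tendsto f atTop (𝓝 0)) =>
      (ENNReal.tendsto_toReal ENNReal.zero_ne_top).comp hf
    have h1 := (((((hz hℓ).const_mul ((2 : ℝ) ^ (γ - η))).add
      ((hz hgt).const_mul ((2 : ℝ) ^ (-(β + η))))).add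
      (((hz hbt).const_mul ((2 : ℝ) ^ (-(β + η)))).mul_const R)).const_mul D).const_mul
      ((2 : ℝ) ^ (-(γ - η')))
    have h2 := ENNReal.tendsto_ofReal h1
    simpa using h2
  refine tendsto_of_tendsto_of_tendsto_of_le_of_le' tendsto_const_nhds hlim
    (Eventually.of_forall fun _ => zero_le) ?_
  filter_upwards [eventually_ge_atTop n₀, hℓ.eventually_lt_const ENNReal.zero_lt_top,
    hgt.eventually_lt_const ENNReal.zero_lt_top, hbt.eventually_lt_const ENNReal.zero_lt_top]
    with n hn hl hg hb
  obtain ⟨Cbn, Cgn, Rn, -, -, hcn⟩ :=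
    exists_controlled (h.drift_mem_n n) (h.forcing_mem_n n) (huₙ n).mem
  -- The approximating problem is put first: its drift bound M+1 is uniform in n, and the solution
  -- entering through its size is the fixed limit `u`. The bound `Rn` may depend on n without harm.
  have hcn' : Controlled ρ T (β + η) (γ - η) (M + 1) (M + 1) Rn (bₙ n) (gₙ n) (uₙ n) :=
    { hcn.mono_exponent (show β ≤ β + η by linarith) (show γ - η ≤ γ by linarith) with
      drift_bound := (hn₀ n hn).1
      forcing_bound := (hn₀ n hn).2 }
  have hc' := hc.mono_exponent (show β ≤ β + η by linarith) (show γ - η ≤ γ by linarith)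
  refine timeNorm_le_of_besovBound fun t ht => ((hsub hcn' hc' ((huₙ n).mildMap hB)
    (hu.mildMap hB) (by positivity) hR ?_ ?_ (by positivity)
    (besovBound_toReal hl).sub_rev t ht).mono_exponent (by linarith))
  · filter_upwards [ae_besovBound_of_vecTimeNorm_le ENNReal.toReal_nonneg
      (ENNReal.ofReal_toReal hb.ne).ge] with s hs i using (hs i).sub_rev
  · filter_upwards [ae_besovBound_of_timeNorm_le ENNReal.toReal_nonneg
      (ENNReal.ofReal_toReal hg.ne).ge] with s hs using hs.sub_rev

/-- For large `λ`, solutions with vanishing terminal datum are small, uniformly in bounded data. -/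
theorem exists_timeNorm_le_half (ρ : Generator δ) (hB : IsKolmogorovMatrix B) (hT : 0 ≤ T)
    (he : Exponents β σ γ) {M : ℝ} (hM : 0 ≤ M) : ∃ lamBar : ℝ, 0 < lamBar ∧ ∀ lam > lamBar,
      ∀ {b : ℝ → Fin (δ 0) → 𝓢'(Space δ, ℂ)} {g w : ℝ → 𝓢'(Space δ, ℂ)} {R : ℝ},
      Controlled ρ T β γ M M R b g w → IsMildSolution ρ B T γ lam b g 0 w →
      timeNorm ρ T γ w ≤ 1 / 2 := by
  obtain ⟨C, hC, K, hK0, hK, hmild⟩ := exists_besovBound_of_mild ρ hB T he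
  obtain ⟨ν₁, hν₁, h₁⟩ := exists_mul_le_half hK (0 + M)
  -- The a priori bound is 2K(λ)M, and returning from `BesovBound` to the norm costs 2^{-γ}.
  obtain ⟨ν₂, hν₂, h₂⟩ := exists_mul_le_half hK (2 ^ (-γ) * 2 * M)
  refine ⟨max ν₁ ν₂, lt_of_lt_of_le hν₁ (le_max_left _ _), fun lam hlam b g w R h hw => ?_⟩
  have hl₁ : ν₁ ≤ lam := (le_max_left _ _).trans hlam.le
  have hl₂ : ν₂ ≤ lam := (le_max_right _ _).trans hlam.le
  have hlam0 : 0 < lam := hν₁.trans_le hl₁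
  -- Here λ is spent entirely as damping μ, with no zeroth-order term and no time weight.
  have h3 := hmild 0 lam 0 M 0 M le_rfl hlam0.le le_rfl (by linarith) hM hM
    (by rw [zero_add]; exact h₁ lam hl₁) b g w 0 (besovBound_zero γ) h.drift_bound
    (h.forcing_bound.mono fun s hs => hs.mono_exponent (by linarith [he.loss_pos]))
    ⟨R, h.sol_bound⟩ (fun t ht φ => by
      rw [(hw.mildMap hB).damped hB he hT hlam0.le h ht φ]
      change _ = _ * (0 : ℂ) - _
      rw [mul_zero, zero_sub])
  refine (timeNorm_le_of_besovBound (C := 2 * (K lam * M)) fun t ht =>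
    (h3 t ht).mono (le_of_eq ?_)).trans (ENNReal.ofReal_le_of_le_toReal ?_)
  · rw [mul_zero, zero_add, zero_add, zero_mul, Real.exp_zero, mul_one]
  · have h4 := h₂ lam hl₂
    have h5 : (1 / 2 : ℝ≥0∞).toReal = 1 / 2 := by simp
    rw [h5]
    linarith

end

end Kolmogorov

end

/-! ### The main theorem -/

theorem theorem4 {r : ℕ} {δ : Fin (r + 1) → ℕ}
    (B : Matrix (Kolmogorov.Coord δ) (Kolmogorov.Coord δ) ℝ)
    (hB : Kolmogorov.IsKolmogorovMatrix B) (ρ : Kolmogorov.Generator δ)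
    (T β ε : ℝ) (hT : 0 < T) (hβ : β ∈ Ioo (0 : ℝ) (1 / 2)) (hε : ε ∈ Ioo (0 : ℝ) (1 - 2 * β)) :
    -- Part (a): the mild solutions exist, are unique, and converge
    (∀ (lam : ℝ), 0 ≤ lam →
      ∀ (b : ℝ → Fin (δ 0) → 𝓢'(Kolmogorov.Space δ, ℂ)) (g : ℝ → 𝓢'(Kolmogorov.Space δ, ℂ))
        (bₙ : ℕ → ℝ → Fin (δ 0) → 𝓢'(Kolmogorov.Space δ, ℂ))
        (gₙ : ℕ → ℝ → 𝓢'(Kolmogorov.Space δ, ℂ))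
        (ℓ : 𝓢'(Kolmogorov.Space δ, ℂ)) (ℓₙ : ℕ → 𝓢'(Kolmogorov.Space δ, ℂ)),
      Kolmogorov.Approximates ρ T β b g bₙ gₙ →
      Kolmogorov.besovNorm ρ (1 + β + ε) ℓ < ⊤ →
      (∀ n, Kolmogorov.besovNorm ρ (1 + β + ε) (ℓₙ n) < ⊤) →
      (∀ η > 0, Tendsto (fun n => Kolmogorov.besovNorm ρ (1 + β + ε - η) (ℓ - ℓₙ n))
        atTop (𝓝 0)) →
      ∃ (u : ℝ → 𝓢'(Kolmogorov.Space δ, ℂ)) (uₙ : ℕ → ℝ → 𝓢'(Kolmogorov.Space δ, ℂ)),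
        Kolmogorov.IsUniqueMildSolution ρ B T (1 + β + ε) lam b g ℓ u ∧
        (∀ n, Kolmogorov.IsUniqueMildSolution ρ B T (1 + β + ε) lam
          (bₙ n) (gₙ n) (ℓₙ n) (uₙ n)) ∧
        ∀ η > 0, Tendsto (fun n => Kolmogorov.timeNorm ρ T (1 + β + ε - η) (uₙ n - u))
          atTop (𝓝 0)) ∧
    -- Part (b): zero terminal data; for every approximating sequence there is a threshold
    (∀ (b : ℝ → Fin (δ 0) → 𝓢'(Kolmogorov.Space δ, ℂ)) (g : ℝ → 𝓢'(Kolmogorov.Space δ, ℂ))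
        (bₙ : ℕ → ℝ → Fin (δ 0) → 𝓢'(Kolmogorov.Space δ, ℂ))
        (gₙ : ℕ → ℝ → 𝓢'(Kolmogorov.Space δ, ℂ)),
      Kolmogorov.Approximates ρ T β b g bₙ gₙ →
      ∃ lamBar : ℝ, 0 < lamBar ∧ ∀ lam > lamBar, ∀ (n : ℕ) (w : ℝ → 𝓢'(Kolmogorov.Space δ, ℂ)),
        Kolmogorov.IsMildSolution ρ B T (1 + β + ε) lam (bₙ n) (gₙ n) 0 w →
        Kolmogorov.timeNorm ρ T (1 + β + ε) w ≤ 1 / 2) ∧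
    -- Part (b), dependence of the threshold: only the size of the data matters
    (∀ M : ℝ≥0, ∃ lamBar : ℝ, 0 < lamBar ∧
      ∀ (b : ℝ → Fin (δ 0) → 𝓢'(Kolmogorov.Space δ, ℂ)) (g : ℝ → 𝓢'(Kolmogorov.Space δ, ℂ))
        (bₙ : ℕ → ℝ → Fin (δ 0) → 𝓢'(Kolmogorov.Space δ, ℂ))
        (gₙ : ℕ → ℝ → 𝓢'(Kolmogorov.Space δ, ℂ)),
      Kolmogorov.Approximates ρ T β b g bₙ gₙ →
      Kolmogorov.vecTimeNorm ρ T (-β) b ≤ M → Kolmogorov.timeNorm ρ T (-β) g ≤ M →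
      (∃ n₀ : ℕ, ∀ lam > lamBar, ∀ n ≥ n₀, ∀ w : ℝ → 𝓢'(Kolmogorov.Space δ, ℂ),
        Kolmogorov.IsMildSolution ρ B T (1 + β + ε) lam (bₙ n) (gₙ n) 0 w →
        Kolmogorov.timeNorm ρ T (1 + β + ε) w ≤ 1 / 2) ∧
      ((∀ n, Kolmogorov.vecTimeNorm ρ T (-β) (bₙ n) ≤ M ∧
          Kolmogorov.timeNorm ρ T (-β) (gₙ n) ≤ M) →
        ∀ lam > lamBar, ∀ (n : ℕ) (w : ℝ → 𝓢'(Kolmogorov.Space δ, ℂ)),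
        Kolmogorov.IsMildSolution ρ B T (1 + β + ε) lam (bₙ n) (gₙ n) 0 w →
        Kolmogorov.timeNorm ρ T (1 + β + ε) w ≤ 1 / 2)) := by
  obtain ⟨hβ0, -⟩ := hβ
  obtain ⟨hε0, hε1⟩ := hε
  -- `m` is the room left by 0 < ε < 1-2β; it is shared between the loss of exponent of the data and
  -- the loss in the products.
  obtain ⟨m, hm, hmε, hm1⟩ : ∃ m > 0, 2 * m ≤ ε ∧ 2 * β + ε + 2 * m < 1 := by
    refine ⟨min ε (1 - 2 * β - ε) / 4, ?_, ?_, ?_⟩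
    · have : 0 < min ε (1 - 2 * β - ε) := lt_min hε0 (by linarith)
      linarith
    · linarith [min_le_left ε (1 - 2 * β - ε)]
    · linarith [min_le_right ε (1 - 2 * β - ε)]
  have he : Kolmogorov.Exponents β m (1 + β + ε) :=
    ⟨hβ0, hm, by linarith, by linarith⟩
  have he' : Kolmogorov.Exponents (β + m) (m / 2) (1 + β + ε) :=
    ⟨by linarith, by linarith, by linarith, by linarith⟩
  have hself : ∀ b g bₙ gₙ, Kolmogorov.Approximates ρ T β b g bₙ gₙ → ∀ n w lam (M : ℝ),
      Kolmogorov.IsMildSolution ρ B T (1 + β + ε) lam (bₙ n) (gₙ n) 0 w →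
      (∀ᵐ s ∂volume.restrict (Icc 0 T), ∀ i, Kolmogorov.BesovBound ρ (-(β + m)) (bₙ n s i) M) →
      (∀ᵐ s ∂volume.restrict (Icc 0 T), Kolmogorov.BesovBound ρ (-(β + m)) (gₙ n s) M) →
      ∃ R, Kolmogorov.Controlled ρ T (β + m) (1 + β + ε) M M R (bₙ n) (gₙ n) w := by
    intro b g bₙ gₙ h n w lam M hw hb hg
    obtain ⟨Cb, Cg, R, -, -, hc⟩ :=
      Kolmogorov.exists_controlled (h.drift_mem_n n) (h.forcing_mem_n n) hw.mem
    exact ⟨R, { hc.mono_exponent (show β ≤ β + m by linarith) le_rfl with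
      drift_bound := hb
      forcing_bound := hg }⟩
  have hdata : ∀ (M : ℝ≥0) b g, Kolmogorov.vecTimeNorm ρ T (-β) b ≤ M →
      Kolmogorov.timeNorm ρ T (-β) g ≤ M →
      (∀ᵐ s ∂volume.restrict (Icc 0 T), ∀ i, Kolmogorov.BesovBound ρ (-β) (b s i) M) ∧
      ∀ᵐ s ∂volume.restrict (Icc 0 T), Kolmogorov.BesovBound ρ (-β) (g s) M := by
    intro M b g hb hg
    rw [← ENNReal.ofReal_coe_nnreal] at hb hg
    have h1 : (2 : ℝ) ^ (-β) * M ≤ M := mul_le_of_le_one_left M.2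
      (Real.rpow_le_one_of_one_le_of_nonpos one_le_two (by linarith))
    refine ⟨?_, ?_⟩
    · filter_upwards [Kolmogorov.ae_besovBound_of_vecTimeNorm_le M.2 hb] with s hs i
      exact (hs i).mono h1
    · filter_upwards [Kolmogorov.ae_besovBound_of_timeNorm_le M.2 hg] with s hs
      exact hs.mono h1
  refine ⟨?_, ?_, ?_⟩
  · intro lam hlam b g bₙ gₙ ℓ ℓₙ h hℓ hℓₙ hlim
    obtain ⟨u, hu⟩ :=
      Kolmogorov.exists_isMildSolution hB he hT.le hlam h.drift_mem h.forcing_mem hℓ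
    choose uₙ huₙ using fun n => Kolmogorov.exists_isMildSolution hB he hT.le hlam
      (h.drift_mem_n n) (h.forcing_mem_n n) (hℓₙ n)
    refine ⟨u, uₙ, ⟨hu, fun w hw => hu.eqOn hB he hT.le hlam h.drift_mem h.forcing_mem hw⟩,
      fun n => ⟨huₙ n, fun w hw =>
        (huₙ n).eqOn hB he hT.le hlam (h.drift_mem_n n) (h.forcing_mem_n n) hw⟩, fun η hη => ?_⟩
    -- Convergence is proved at a loss of at most m/2, for which the shifted exponents remain
    -- admissible. It implies convergence for larger η.
    have hη₀ : 0 < min η (m / 2) := lt_min hη (by linarith)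
    have hηm := min_le_right η (m / 2)
    exact Kolmogorov.tendsto_timeNorm_sub (σ := m / 2) hB hβ0 hT.le hlam hη₀ (min_le_left _ _)
      ⟨by linarith, by linarith, by linarith, by linarith⟩ h (hlim _ hη₀) hu huₙ
  · intro b g bₙ gₙ h
    obtain ⟨Cb, hCb, hbB⟩ := h.drift_mem.exists_ae_besovBound
    obtain ⟨Cg, hCg, hgB⟩ := h.forcing_mem.exists_ae_besovBound
    obtain ⟨n₀, hn₀⟩ := h.exists_eventually_besovBound hβ0 hm
      (hbB.mono fun s hs i => (hs i).mono (le_max_left Cb Cg))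
      (hgB.mono fun s hs => hs.mono (le_max_right Cb Cg))
    choose Db hDb hDbB using fun n => (h.drift_mem_n n).exists_ae_besovBound
    choose Dg hDg hDgB using fun n => (h.forcing_mem_n n).exists_ae_besovBound
    -- The uniform bound holds only for n ≥ n₀; the finitely many earlier data are covered by adding
    -- their own bounds.
    set S : ℝ := ∑ n ∈ Finset.range n₀, (Db n + Dg n) with hS
    have hS0 : 0 ≤ S := Finset.sum_nonneg fun n _ => add_nonneg (hDb n) (hDg n)
    have hM : 0 ≤ max Cb Cg := hCb.trans (le_max_left _ _)
    obtain ⟨lamBar, hpos, hlb⟩ := Kolmogorov.exists_timeNorm_le_half ρ hB hT.le he'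
      (M := max Cb Cg + 1 + S) (by linarith)
    refine ⟨lamBar, hpos, fun lam hlam n w hw => ?_⟩
    have hbg : (∀ᵐ s ∂volume.restrict (Icc 0 T), ∀ i,
        Kolmogorov.BesovBound ρ (-(β + m)) (bₙ n s i) (max Cb Cg + 1 + S)) ∧
        ∀ᵐ s ∂volume.restrict (Icc 0 T),
          Kolmogorov.BesovBound ρ (-(β + m)) (gₙ n s) (max Cb Cg + 1 + S) := by
      rcases le_or_gt n₀ n with hn | hn
      · exact ⟨(hn₀ n hn).1.mono fun s hs i => (hs i).mono (by linarith),
          (hn₀ n hn).2.mono fun s hs => hs.mono (by linarith)⟩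
      · have h1 : Db n + Dg n ≤ S := Finset.single_le_sum (f := fun n => Db n + Dg n)
          (fun n _ => add_nonneg (hDb n) (hDg n)) (Finset.mem_range.2 hn)
        have h2 := hDb n
        have h3 := hDg n
        exact ⟨(hDbB n).mono fun s hs i =>
            ((hs i).mono_exponent (by linarith)).mono (by linarith),
          (hDgB n).mono fun s hs => (hs.mono_exponent (by linarith)).mono (by linarith)⟩
    obtain ⟨R, hc⟩ := hself b g bₙ gₙ h n w lam _ hw hbg.1 hbg.2
    exact hlb lam hlam hc hw
  · intro M
    have hM := M.2
    -- For n large the approximations exceed the bound of the limit by at most one at the exponent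
    -- -(β+m). The threshold is fixed here, before any sequence is chosen, and the index n₀ comes
    -- from the convergence of the data alone, hence does not involve λ.
    obtain ⟨lamBar, hpos, hlb⟩ := Kolmogorov.exists_timeNorm_le_half ρ hB hT.le he'
      (M := M + 1) (by positivity)
    refine ⟨lamBar, hpos, fun b g bₙ gₙ h hb hg => ⟨?_, fun hbg lam hlam n w hw => ?_⟩⟩
    · obtain ⟨hbB, hgB⟩ := hdata M b g hb hg
      obtain ⟨n₀, hn₀⟩ := h.exists_eventually_besovBound hβ0 hm hbB hgB
      refine ⟨n₀, fun lam hlam n hn w hw => ?_⟩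
      obtain ⟨R, hc⟩ := hself b g bₙ gₙ h n w lam _ hw (hn₀ n hn).1 (hn₀ n hn).2
      exact hlb lam hlam hc hw
    · obtain ⟨hbB, hgB⟩ := hdata M _ _ (hbg n).1 (hbg n).2
      obtain ⟨R, hc⟩ := hself b g bₙ gₙ h n w lam (M + 1) hw
        (hbB.mono fun s hs i => ((hs i).mono_exponent (by linarith)).mono (by linarith))
        (hgB.mono fun s hs => (hs.mono_exponent (by linarith)).mono (by linarith))
      exact hlb lam hlam hc hw
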